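/- Let $n\ge 1$ and let $W$ be a complex polynomial of degree $n+1$ with $W'$ monic. A \emph{curve with cuts} consists of the following. (a) A nonsingular curve $\Sigma:\ y^2=W'(x)^2+f_0(x)=\prod_{i=1}^n(x-a_i^-)(x-a_i^+)$ with $2n$ distinct branch points, where $f_0$ is a polynomial of degree $n-1$ with leading coefficient $-4t$, $t\neq0$. (b) A regular $C^1$ path $\lambda:\mathbb R\to\mathbb C$ without self-intersection, with $|\lambda(s)|\to\infty$ as $s\to\pm\infty$ and running along the positive real axis for all large $s$, which passes through $a_1^-,a_1^+,a_2^-,a_2^+,\dots,a_n^-,a_n^+$ in this order. The cut $\mathcal C_i$ is the piece of the path from $a_i^-$ to $a_i^+$, and $\mathcal C=\bigcup_i\mathcal C_i$. Let $y_0$ be the branch of $y$ on $\mathbb C\setminus\mathcal C$ with $y_0(x)\sim W'(x)$ at infinity. Then $y=y_0$ on the upper sheet and $y=-y_0$ on the lower one. Put $\zeta=y\,dx$, $\omega_0=(W'-y_0)/(2t)$ and $$\rho_0(s)=\dot\lambda(s)\lim_{\epsilon\to0^+}\tfrac1{2\pi i}\big[\omega_0(\lambda(s)-i\epsilon\dot\lambda(s))-\omega_0(\lambda(s)+i\epsilon\dot\lambda(s))\big],$$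 $$S_i=t\int_{\lambda^{-1}(\mathcal C_i)}\rho_0(s)\,ds,\qquad \tilde S_i=\sum_{j\le i}S_j\quad(1\le i\le n-1),$$ $$\mathcal F_0=t^2\,\mathcal P\!\!\int\!\!\int \ln(\lambda(s)-\lambda(s'))\,\rho_0(s)\rho_0(s')\,ds\,ds'-t\int W(\lambda(s))\rho_0(s)\,ds .$$ Here $\ln(x-\lambda(s'))$ is the branch cut along $\lambda((-\infty,s'])$ that is real for large positive real $x$ when continued along $\lambda$ (that is, it is asymptotic to $\ln x$ there), and $\mathcal P\ln(\lambda(s)-\lambda(s'))$ is the mean of its boundary values at $\lambda(s)$ from the two sides of the path. Then the following hold. 1. For every curve with cuts and every closed $C^1$ curve $\hat\alpha$ on the upper sheet (avoiding $\mathcal C$) that encircles all the cuts once clockwise, that is, has winding number $-1$ about every point of $\mathcal C$, $$\frac1{4\pi i}\int_{\hat\alpha}\zeta=t .$$ 2. Let a family of curves with cuts, with $W$ fixed, be parametrised by $(t,\tilde S)=(t,\tilde S_1,\dots,\tilde S_{n-1})$ in an open set $U\subset\mathbb C^n$, so that the member at $(t,\tilde S)$ has these values of $t$ and $\tilde S_i$.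 Suppose that the coefficients of $f_0$ depend holomorphically on $(t,\tilde S)$, that $\lambda$ is jointly $C^1$ in $(t,\tilde S)$ and $s$ and real for large $s$ locally uniformly in $(t,\tilde S)$, and that the parameter values at which $\lambda$ meets the points $a_i^\pm$ vary continuously. Then at every point of $U$ the function $\mathcal F_0(t,\tilde S)$ has a complex partial derivative in $t$ at fixed $\tilde S$, and $$\frac12\int_{\hat\beta}\zeta=\frac{\partial\mathcal F_0}{\partial t}(t,\tilde S)+W(\Lambda_0)-t\log\Lambda_0^2+O\!\left(\frac1{\Lambda_0}\right)\qquad(\Lambda_0\to+\infty).$$ Here $\hat\beta$ is the relative cycle cut off at $\Lambda_0$: it runs along $\lambda$ from the point above $\Lambda_0$ on the lower sheet to $a_n^+$ and from there back along $\lambda$ to the point above $\Lambda_0$ on the upper sheet. The implied constant and threshold may depend on the curve. -/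

import Mathlib

open Polynomial Filter Topology

noncomputable section

/-- The integral of the one-form `ζ = y dx` along a path `r ↦ (x(r), y(r))` in `ℂ²`, that is,
`∫ y(r) x'(r) dr` over `[a, b]`. -/
def zetaIntegral (c : ℝ → ℂ × ℂ) (a b : ℝ) : ℂ :=
  ∫ r in a..b, (c r).2 * deriv (fun u => (c u).1) r

/-- The continuous logarithm of `lam s - lam s'` for `s' < s`, continued along the path `lam` from
its positive real end `s = +∞`, where it is the real (principal) logarithm. -/
def pathLog (lam : ℝ → ℂ) (s s' : ℝ) : ℂ :=
  limUnder atTop fun R : ℝ =>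
    Complex.log (lam R - lam s') - ∫ u in s..R, deriv lam u / (lam u - lam s')

open Classical in
/-- The principal value `𝒫 ln(lam s - lam s')` along the path `lam`: half the sum of the
boundary values at `lam s`, from the two sides of the path, of the branch of
`x ↦ ln(x - lam s')` cut along the part of the path that precedes `lam s'`.
For `s' < s` both values are the continuous logarithm; for `s < s'` they are the two continuations
`ln(lam s' - lam s) ± π i`, past `lam s'` on either side. -/
def principalLog (lam : ℝ → ℂ) (s s' : ℝ) : ℂ :=
  if s' < s then pathLog lam s s'
  else ((pathLog lam s' s + Real.pi * Complex.I) + (pathLog lam s' s - Real.pi * Complex.I)) / 2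

/-- A nonsingular hyperelliptic curve `y² = W'(x)² + f₀(x) = ∏ᵢ (x - aᵢ⁻)(x - aᵢ⁺)`, `i = 0, …, m`
(there are `n = m + 1` cuts), together with a path `lam` without self-intersection, running from
infinity to infinity and ending along the positive real axis, that contains the branch cuts:
the `i`-th cut is the piece of the path between `aᵢ⁻ = lam (sMinus i)` and `aᵢ⁺ = lam (sPlus i)`.
The `2n` branch points are distinct because the path is injective. -/
structure CutCurve (m : ℕ) (W : ℂ[X]) where
  /-- the polynomial `f₀`, of degree `n - 1 = m` and leading coefficient `-4t ≠ 0` -/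
  f : ℂ[X]
  lam : ℝ → ℂ
  sMinus : Fin (m + 1) → ℝ
  sPlus : Fin (m + 1) → ℝ
  natDegree_f : f.natDegree ≤ m
  coeff_f_ne_zero : f.coeff m ≠ 0
  contDiff_lam : ContDiff ℝ 1 lam
  deriv_lam_ne_zero : ∀ s, deriv lam s ≠ 0
  injective_lam : Function.Injective lam
  tendsto_atBot : Tendsto (fun s => ‖lam s‖) atBot atTop
  tendsto_atTop : Tendsto (fun s => (lam s).re) atTop atTop
  eventually_real : ∃ T : ℝ, ∀ s ≥ T, (lam s).im = 0
  sMinus_lt_sPlus : ∀ i, sMinus i < sPlus i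
  sPlus_lt_sMinus : ∀ i j, i < j → sPlus i < sMinus j
  factorization : W.derivative ^ 2 + f =
    ∏ i, ((X - C (lam (sMinus i))) * (X - C (lam (sPlus i))))

namespace CutCurve

variable {m : ℕ} {W : ℂ[X]} (Γ : CutCurve m W)

/-- `t` is `-1/4` times the leading coefficient of `f₀`. -/
def t : ℂ := -Γ.f.coeff m / 4

/-- The union `𝒞` of the cuts. -/
def cuts : Set ℂ := ⋃ i, Γ.lam '' Set.Icc (Γ.sMinus i) (Γ.sPlus i)

/-- The Riemann surface `Σ` (without its two points at infinity), as an affine curve. -/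
def surface : Set (ℂ × ℂ) :=
  {q | q.2 ^ 2 = (W.derivative.eval q.1) ^ 2 + Γ.f.eval q.1}

/-- The branch `y₀` of `√(W'² + f₀)` on the upper sheet `ℂ ∖ 𝒞`, with `y₀(x) ∼ W'(x)` at infinity.
It is the product over the cuts of the branches of `√((x - aᵢ⁻)(x - aᵢ⁺))` with cut `𝒞ᵢ` and
asymptotic to `x`; since `∫_{𝒞ᵢ} dz/(z - x) = ln((x - aᵢ⁺)/(x - aᵢ⁻))`, such a branch is
`(x - aᵢ⁻) exp(½ ∫_{𝒞ᵢ} dz/(z - x))`. On the cuts the value is set to `0`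
(the correct value at the branch points). See `y₀_sq`, `continuousOn_y₀`, `tendsto_y₀_div`. -/
def y₀ : ℂ → ℂ :=
  Set.indicator Γ.cutsᶜ fun x =>
    ∏ i, (x - Γ.lam (Γ.sMinus i)) *
      Complex.exp ((∫ s in Γ.sMinus i..Γ.sPlus i, deriv Γ.lam s / (Γ.lam s - x)) / 2)

theorem lam_sub_ne_zero {x : ℂ} (hx : x ∉ Γ.cuts) (i : Fin (m + 1)) {s : ℝ}
    (hs : s ∈ Set.Icc (Γ.sMinus i) (Γ.sPlus i)) : Γ.lam s - x ≠ 0 := by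
  intro h
  exact hx (Set.mem_iUnion.2 ⟨i, s, hs, sub_eq_zero.1 h⟩)

theorem continuousOn_integrand {x : ℂ} (hx : x ∉ Γ.cuts) (i : Fin (m + 1)) :
    ContinuousOn (fun s => deriv Γ.lam s / (Γ.lam s - x)) (Set.Icc (Γ.sMinus i) (Γ.sPlus i)) :=
  ((Γ.contDiff_lam.continuous_deriv le_rfl).continuousOn).div
    ((Γ.contDiff_lam.continuous.sub continuous_const).continuousOn)
    (fun _ hs => Γ.lam_sub_ne_zero hx i hs)

theorem exp_integral {x : ℂ} (hx : x ∉ Γ.cuts) (i : Fin (m + 1)) :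
    Complex.exp (∫ s in Γ.sMinus i..Γ.sPlus i, deriv Γ.lam s / (Γ.lam s - x)) *
      (Γ.lam (Γ.sMinus i) - x) = Γ.lam (Γ.sPlus i) - x := by
  have hlt := Γ.sMinus_lt_sPlus i
  have hc := Γ.continuousOn_integrand hx i
  set a := Γ.sMinus i with ha
  set b := Γ.sPlus i with hb
  set h : ℝ → ℂ := fun s => deriv Γ.lam s / (Γ.lam s - x) with hh
  have hint : ∀ u ∈ Set.Icc a b, IntervalIntegrable h MeasureTheory.volume a u := fun u hu =>
    (hc.mono (by rw [Set.uIcc_of_le hu.1]; exact Set.Icc_subset_Icc_right hu.2)).intervalIntegrable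
  have key := constant_of_has_deriv_right_zero (a := a) (b := b)
    (f := fun u => Complex.exp (-∫ s in a..u, h s) * (Γ.lam u - x)) ?_ ?_ b
    (Set.right_mem_Icc.2 hlt.le)
  · simp only [intervalIntegral.integral_same, neg_zero, Complex.exp_zero, one_mul] at key
    rw [← key, ← mul_assoc, ← Complex.exp_add]
    simp
  · refine ContinuousOn.mul (Complex.continuous_exp.comp_continuousOn ?_)
      (Γ.contDiff_lam.continuous.sub continuous_const).continuousOn
    refine ContinuousOn.neg ?_
    have := intervalIntegral.continuousOn_primitive_interval (μ := MeasureTheory.volume) (f := h)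
      (a := a) (b := b) (by
        rw [Set.uIcc_of_le hlt.le]
        exact hc.integrableOn_Icc)
    rwa [Set.uIcc_of_le hlt.le] at this
  · intro u hu
    have hu' : u ∈ Set.Icc a b := ⟨hu.1, hu.2.le⟩
    have hne := Γ.lam_sub_ne_zero hx i hu'
    have h1 : HasDerivWithinAt (fun v => ∫ s in a..v, h s) (h u) (Set.Ici u) u := by
      refine intervalIntegral.integral_hasDerivWithinAt_right (t := Set.Ioi u) (hint u hu') ?_ ?_
      · refine ⟨Set.Icc a b, ?_, hc.aestronglyMeasurable measurableSet_Icc⟩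
        exact (Icc_mem_nhdsGT_of_mem hu)
      · exact (hc u hu').mono_of_mem_nhdsWithin ((Icc_mem_nhdsGT_of_mem hu))
    have h2 : HasDerivWithinAt (fun v => Γ.lam v - x) (deriv Γ.lam u) (Set.Ici u) u :=
      ((Γ.contDiff_lam.differentiable (by norm_num) u).hasDerivAt.sub_const x).hasDerivWithinAt
    have h3 := (h1.neg.cexp).mul h2
    have h4 : h u * (Γ.lam u - x) = deriv Γ.lam u := div_mul_cancel₀ _ hne
    refine HasDerivWithinAt.congr_deriv h3 ?_
    rw [← h4]
    ring

/-- `(x, y₀(x))` lies on the curve, for `x` off the cuts. -/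
theorem y₀_sq {x : ℂ} (hx : x ∉ Γ.cuts) :
    Γ.y₀ x ^ 2 = (W.derivative.eval x) ^ 2 + Γ.f.eval x := by
  have h := congrArg (Polynomial.eval x) Γ.factorization
  simp only [eval_add, eval_pow, eval_prod, eval_mul, eval_sub, eval_X, eval_C] at h
  rw [h, y₀, Set.indicator_of_mem (show x ∈ Γ.cutsᶜ from hx), ← Finset.prod_pow]
  refine Finset.prod_congr rfl fun i _ => ?_
  have e := Γ.exp_integral hx i
  rw [mul_pow, ← Complex.exp_nat_mul]
  push_cast
  rw [mul_div_cancel₀ _ (two_ne_zero)]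
  linear_combination (-(x - Γ.lam (Γ.sMinus i))) * e

theorem isClosed_cuts : IsClosed Γ.cuts :=
  isClosed_iUnion_of_finite fun _ =>
    (isCompact_Icc.image Γ.contDiff_lam.continuous).isClosed

theorem continuousOn_y₀ : ContinuousOn Γ.y₀ Γ.cutsᶜ := by
  have : ContinuousOn (fun x : ℂ => ∏ i, (x - Γ.lam (Γ.sMinus i)) *
      Complex.exp ((∫ s in Γ.sMinus i..Γ.sPlus i, deriv Γ.lam s / (Γ.lam s - x)) / 2))
      Γ.cutsᶜ := by
    refine continuousOn_finsetProd _ fun i _ => ?_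
    refine ContinuousOn.mul (by fun_prop) (Complex.continuous_exp.comp_continuousOn ?_)
    refine ContinuousOn.div_const ?_ 2
    have hle := (Γ.sMinus_lt_sPlus i).le
    set pr : ℝ → ℝ := fun s => (Set.projIcc _ _ hle s : ℝ) with hpr
    have hprc : Continuous pr := continuous_subtype_val.comp continuous_projIcc
    rw [continuousOn_iff_continuous_domRestrict]
    have hF : Continuous (fun x : ↥Γ.cutsᶜ => ∫ s in Γ.sMinus i..Γ.sPlus i,
        deriv Γ.lam (pr s) / (Γ.lam (pr s) - x)) := by
      refine intervalIntegral.continuous_parametric_intervalIntegral_of_continuous' ?_ _ _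
      refine Continuous.div ?_ ?_ ?_
      · exact (Γ.contDiff_lam.continuous_deriv le_rfl).comp (hprc.comp continuous_snd)
      · exact (Γ.contDiff_lam.continuous.comp (hprc.comp continuous_snd)).sub
          (continuous_subtype_val.comp continuous_fst)
      · rintro ⟨x, s⟩
        exact Γ.lam_sub_ne_zero x.2 i (Set.projIcc _ _ hle s).2
    convert hF using 2 with x
    refine intervalIntegral.integral_congr fun s hs => ?_
    rw [Set.uIcc_of_le hle] at hs
    simp only [hpr, Set.projIcc_of_mem hle hs]
  exact this.congr fun x hx => Set.indicator_of_mem hx _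

/-- `y₀(x) ∼ xⁿ` at infinity, which is the leading term of `W'(x)`. -/
theorem tendsto_y₀_div :
    Tendsto (fun x => Γ.y₀ x / x ^ (m + 1)) (Bornology.cobounded ℂ) (𝓝 1) := by
  have : (Bornology.cobounded ℂ).IsCountablyGenerated := by
    rw [← comap_norm_atTop]
    infer_instance
  have hno : Tendsto (fun x : ℂ => ‖x‖) (Bornology.cobounded ℂ) atTop := tendsto_norm_cobounded_atTop
  have hoff : ∀ᶠ x in Bornology.cobounded ℂ, x ∈ Γ.cutsᶜ := by
    have hb : Bornology.IsBounded Γ.cuts :=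
      (isCompact_iUnion fun _ => isCompact_Icc.image Γ.contDiff_lam.continuous).isBounded
    exact Bornology.isBounded_def.1 hb
  have hinv : Tendsto (fun x : ℂ => x⁻¹) (Bornology.cobounded ℂ) (𝓝 0) :=
    tendsto_inv₀_cobounded
  have hfac : ∀ i : Fin (m + 1), Tendsto (fun x : ℂ => (1 - Γ.lam (Γ.sMinus i) * x⁻¹) *
      Complex.exp ((∫ s in Γ.sMinus i..Γ.sPlus i, deriv Γ.lam s / (Γ.lam s - x)) / 2))
      (Bornology.cobounded ℂ) (𝓝 1) := by
    intro i
    have hle := (Γ.sMinus_lt_sPlus i).le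
    have h1 : Tendsto (fun x : ℂ => 1 - Γ.lam (Γ.sMinus i) * x⁻¹) (Bornology.cobounded ℂ)
        (𝓝 1) := by
      simpa using (hinv.const_mul (Γ.lam (Γ.sMinus i))).const_sub 1
    have hdc : Continuous (deriv Γ.lam) := Γ.contDiff_lam.continuous_deriv le_rfl
    obtain ⟨K, hK⟩ := (isCompact_Icc (a := Γ.sMinus i) (b := Γ.sPlus i)).exists_bound_of_continuousOn
      Γ.contDiff_lam.continuous.continuousOn
    have h2 : Tendsto (fun x : ℂ => ∫ s in Γ.sMinus i..Γ.sPlus i,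
        deriv Γ.lam s / (Γ.lam s - x)) (Bornology.cobounded ℂ)
        (𝓝 (∫ s in Γ.sMinus i..Γ.sPlus i, (0 : ℂ))) := by
      refine intervalIntegral.tendsto_integral_filter_of_dominated_convergence
        (fun s => ‖deriv Γ.lam s‖) ?_ ?_ (hdc.norm.intervalIntegrable _ _) ?_
      · filter_upwards [hoff] with x hx
        refine ((Γ.continuousOn_integrand hx i).mono ?_).aestronglyMeasurable measurableSet_uIoc
        rw [Set.uIoc_of_le hle]
        exact Set.Ioc_subset_Icc_self
      · filter_upwards [hno.eventually_ge_atTop (K + 1)] with x hx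
        refine Filter.Eventually.of_forall fun s hs => ?_
        rw [Set.uIoc_of_le hle] at hs
        have h3 := hK s (Set.Ioc_subset_Icc_self hs)
        have h4 : 1 ≤ ‖Γ.lam s - x‖ := by
          have := norm_sub_norm_le x (Γ.lam s)
          rw [norm_sub_rev] at this
          linarith
        rw [norm_div]
        exact div_le_self (norm_nonneg _) h4
      · refine Filter.Eventually.of_forall fun s _ => ?_
        have h5 : Tendsto (fun x : ℂ => Γ.lam s - x) (Bornology.cobounded ℂ)
            (Bornology.cobounded ℂ) := by
          rw [← tendsto_norm_atTop_iff_cobounded]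
          refine tendsto_atTop_mono (fun x => ?_)
            (tendsto_atTop_add_const_right _ (-‖Γ.lam s‖) hno)
          have := norm_sub_norm_le x (Γ.lam s)
          rw [norm_sub_rev] at this
          linarith
        simpa [div_eq_mul_inv] using (tendsto_inv₀_cobounded.comp h5).const_mul (deriv Γ.lam s)
    rw [intervalIntegral.integral_zero] at h2
    have h6 := (Complex.continuous_exp.tendsto _).comp (h2.div_const 2)
    have h7 := h1.mul h6
    simp only [zero_div, Complex.exp_zero, mul_one] at h7
    exact h7
  have hprod := tendsto_finsetProd Finset.univ fun i _ => hfac i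
  simp only [Finset.prod_const_one] at hprod
  refine hprod.congr' ?_
  filter_upwards [hoff, hno.eventually_gt_atTop 0] with x hx hx0
  have hx0' : x ≠ 0 := norm_pos_iff.1 hx0
  have hpow : x ^ (m + 1) = ∏ _i : Fin (m + 1), x := by simp
  rw [y₀, Set.indicator_of_mem hx, hpow, ← Finset.prod_div_distrib]
  refine Finset.prod_congr rfl fun i _ => ?_
  field_simp

/-- The planar resolvent `ω₀`, from `y₀ = W' - 2 t ω₀`. -/
def ω₀ (x : ℂ) : ℂ := (W.derivative.eval x - Γ.y₀ x) / (2 * Γ.t)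

/-- The (complex) planar spectral density: the discontinuity of `ω₀` across the path. -/
def ρ₀ (s : ℝ) : ℂ :=
  deriv Γ.lam s * limUnder (𝓝[>] (0 : ℝ)) fun ε : ℝ =>
    1 / (2 * Real.pi * Complex.I) *
      (Γ.ω₀ (Γ.lam s - Complex.I * ε * deriv Γ.lam s)
        - Γ.ω₀ (Γ.lam s + Complex.I * ε * deriv Γ.lam s))

/-- `Sᵢ = t ∫_{lam⁻¹(𝒞ᵢ)} ρ₀(s) ds`. -/
def S (i : Fin (m + 1)) : ℂ := Γ.t * ∫ s in Γ.sMinus i..Γ.sPlus i, Γ.ρ₀ s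

/-- `S̃ᵢ = ∑_{j ≤ i} Sⱼ`, for all cuts `i` but the last one. -/
def tildeS (i : Fin m) : ℂ := ∑ j ∈ Finset.Iic i.castSucc, Γ.S j

/-- The prepotential
`ℱ₀ = t² 𝒫∫∫ ln(lam s - lam s') ρ₀(s) ρ₀(s') ds ds' - t ∫ W(lam s) ρ₀(s) ds`. -/
def prepotential : ℂ :=
  Γ.t ^ 2 * (∫ s, ∫ s', principalLog Γ.lam s s' * Γ.ρ₀ s * Γ.ρ₀ s')
    - Γ.t * ∫ s, W.eval (Γ.lam s) * Γ.ρ₀ s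

/-- A representative of the cycle `α̂`: a closed curve `c : [0, 1] → ℂ ∖ 𝒞` on the upper sheet that
encircles all the cuts once, clockwise. -/
structure IsAlphaHat (c : ℝ → ℂ) : Prop where
  contDiffOn : ContDiffOn ℝ 1 c (Set.Icc 0 1)
  closed : c 0 = c 1
  notMem_cuts : ∀ r ∈ Set.Icc (0 : ℝ) 1, c r ∉ Γ.cuts
  winding : ∀ x ∈ Γ.cuts,
    1 / (2 * Real.pi * Complex.I) * ∫ r in (0 : ℝ)..1, deriv c r / (c r - x) = -1

/-- The lift of a curve in the `x`-plane to the upper sheet. -/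
def upperLift (c : ℝ → ℂ) (r : ℝ) : ℂ × ℂ := (c r, Γ.y₀ (c r))

/-- The cycle `β̂`, cut off. With `sₙ = s(aₙ⁺)` the parameter of the end of the last cut, the
path `betaHat` on `[-(s₁ - sₙ), s₁ - sₙ]` runs over `lam` from the point above `lam s₁` on the lower
sheet (where `y = -y₀`) to the branch point `aₙ⁺`, and back from there to the point
above `lam s₁` on the upper sheet. -/
def betaHat (r : ℝ) : ℂ × ℂ :=
  if r < 0 then
    (Γ.lam (Γ.sPlus (Fin.last m) - r), -Γ.y₀ (Γ.lam (Γ.sPlus (Fin.last m) - r)))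
  else
    (Γ.lam (Γ.sPlus (Fin.last m) + r), Γ.y₀ (Γ.lam (Γ.sPlus (Fin.last m) + r)))

theorem upperLift_mem_surface {c : ℝ → ℂ} (r : ℝ) (hr : c r ∉ Γ.cuts) :
    Γ.upperLift c r ∈ Γ.surface := Γ.y₀_sq hr

theorem lam_notMem_cuts {s : ℝ} (hs : Γ.sPlus (Fin.last m) < s) : Γ.lam s ∉ Γ.cuts := by
  intro h
  obtain ⟨i, u, hu, he⟩ := Set.mem_iUnion.1 h
  have := Γ.injective_lam he
  rcases (Fin.le_last i).eq_or_lt with h1 | h1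
  · subst h1
    linarith [hu.2]
  · linarith [hu.2, Γ.sPlus_lt_sMinus i _ h1, Γ.sMinus_lt_sPlus (Fin.last m)]

theorem betaHat_mem_surface (r : ℝ) : Γ.betaHat r ∈ Γ.surface := by
  rcases lt_trichotomy r 0 with h | h | h
  · simp only [betaHat, h, if_true, surface, Set.mem_ofPred_eq, neg_sq]
    exact Γ.y₀_sq (Γ.lam_notMem_cuts (by linarith))
  · subst h
    have hmem : Γ.lam (Γ.sPlus (Fin.last m)) ∈ Γ.cuts :=
      Set.mem_iUnion.2 ⟨Fin.last m, _, Set.right_mem_Icc.2 (Γ.sMinus_lt_sPlus _).le, rfl⟩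
    have h := congrArg (Polynomial.eval (Γ.lam (Γ.sPlus (Fin.last m)))) Γ.factorization
    simp only [eval_add, eval_pow, eval_prod, eval_mul, eval_sub, eval_X, eval_C] at h
    rw [Finset.prod_eq_zero (Finset.mem_univ (Fin.last m)) (by simp)] at h
    simp [betaHat, surface, h, y₀, hmem]
  · simp only [betaHat, not_lt.2 h.le, if_false, surface, Set.mem_ofPred_eq]
    exact Γ.y₀_sq (Γ.lam_notMem_cuts (by linarith))

/-- `∫_{β̂} ζ` with `β̂` cut off at the points above `lam s₁`. -/
def betaHatIntegral (s₁ : ℝ) : ℂ :=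
  zetaIntegral Γ.betaHat (-(s₁ - Γ.sPlus (Fin.last m))) (s₁ - Γ.sPlus (Fin.last m))

end CutCurve

/-- A family of curves with cuts that depends holomorphically on `p = (t, S̃₁, …, S̃ₙ₋₁)`, over an
open set `U` of values of these parameters, with a path that varies smoothly and stays real beyond
a locally uniform bound. Over `U` the prepotential is a function `ℱ₀(t, S̃)`. -/
structure IsCoordinateFamily {m : ℕ} {W : ℂ[X]} (U : Set (ℂ × (Fin m → ℂ)))
    (Γ : ℂ × (Fin m → ℂ) → CutCurve m W) : Prop where
  isOpen : IsOpen U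
  t_eq : ∀ p ∈ U, (Γ p).t = p.1
  tildeS_eq : ∀ p ∈ U, ∀ i, (Γ p).tildeS i = p.2 i
  differentiableOn_coeff : ∀ k, DifferentiableOn ℂ (fun p => (Γ p).f.coeff k) U
  contDiffOn_lam : ContDiffOn ℝ 1
    (fun q : (ℂ × (Fin m → ℂ)) × ℝ => (Γ q.1).lam q.2) (U ×ˢ Set.univ)
  continuousOn_sMinus : ∀ i, ContinuousOn (fun p => (Γ p).sMinus i) U
  continuousOn_sPlus : ∀ i, ContinuousOn (fun p => (Γ p).sPlus i) U
  locally_eventually_real : ∀ p ∈ U, ∃ T : ℝ, ∀ᶠ q in 𝓝 p, ∀ s ≥ T, ((Γ q).lam s).im = 0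

end

/-! ### Local geometry of a regular path: windows, sides, logarithms. -/

noncomputable section

/-! Write y₊ for the boundary value of y₀ on the left of the path, P = W'² + f₀, and V = W − (1/πi)
∫ 𝒫ln(· − z) y₊ dz for the effective potential, with the integral over the cuts.

Everything rests on the dispersion relation `div_y₀_eq`: if h and q are polynomials with h/y₀ − q →
0 at infinity, then h/y₀ = q + (1/πi) ∫ (h/y₊) dz/(z − x) off the cuts. The difference of the two
sides has no jump inside the cuts; at a branch point a it has at most polynomial growth and is
o(1/(x − a)) along one approach. It therefore extends to an entire function that vanishes at
infinity, and Liouville applies. For h = P and q = W', the 1/x terms give ∫ y₊ dz = 2πi t.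
Integrating over α̂, where W' dx is exact and each dx/(z − x) contributes a winding number, gives
part 1.

For part 2, the relation is integrated along the path pushed slightly to its left, which gives the
variation of logarithmic potentials along the path (`potential_sub`). Averaging the two boundary
values of the logarithm removes the contribution of the cuts. So V is constant on each cut, with
value V_i say, and varies off the cuts by ∫ y dz (`effPot_sub`). Half of the integral over β̂ is
then V(Λ₀) − V_n, and V(Λ₀) = W(Λ₀) − t log Λ₀² + O(1/Λ₀) because y₊ dz has total mass 2πi t. What
remains is ∂ℱ₀/∂t = −V_n.

Constancy of V on the cuts turns ℱ₀ into −(1/4πi) Σ_i (∫ W y₊ dz + V_i ∫ y₊ dz), with integrals over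
the i-th cut (`prepotential_eq`). The ingredients reduce to integrals of g(z) y dz between branch
points or fixed points. The derivative of such an integral is half the integral of g(z) ḟ dz/y
(`hasDerivAt_integral_branch`): displacing the path only adds boundary terms, and these vanish.
Hence dV_i/dt is −(1/2πi) times the value on the i-th cut of the logarithmic potential of ḟ dz/y₊,
which is constant on each cut because deg ḟ < n (`hasDerivAt_effPot`). As the S̃_i are fixed and ḟ
has leading coefficient −4, the integral of ḟ dz/y₊ is 4πi over the last cut and 0 over the others
(`integral_cut_dens_fdot`). The symmetry of the double logarithmic integral
(`integral_potential_mul_dens`) then cancels everything but −V_n. -/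

/-- On a window of radius `κ` about `s₀`, the velocity of the path is close to its value at `s₀`. -/
def IsWindow (lam : ℝ → ℂ) (s₀ κ : ℝ) : Prop :=
  0 < κ ∧ ∀ s ∈ Set.Icc (s₀ - κ) (s₀ + κ), ‖deriv lam s - deriv lam s₀‖ ≤ ‖deriv lam s₀‖ / 4

theorem exists_isWindow {lam : ℝ → ℂ} (hlam : ContDiff ℝ 1 lam) (hne : ∀ s, deriv lam s ≠ 0)
    (s₀ : ℝ) {κ₀ : ℝ} (hκ₀ : 0 < κ₀) : ∃ κ, 0 < κ ∧ κ ≤ κ₀ ∧ IsWindow lam s₀ κ := by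
  have hpos : 0 < ‖deriv lam s₀‖ / 4 := by have := norm_pos_iff.2 (hne s₀); positivity
  obtain ⟨δ, hδ, h⟩ := Metric.continuousAt_iff.1
    ((hlam.continuous_deriv le_rfl).continuousAt (x := s₀)) _ hpos
  refine ⟨min (δ / 2) κ₀, by positivity, min_le_right _ _, by positivity, fun s hs => ?_⟩
  have h1 : |s - s₀| ≤ δ / 2 := abs_le.2
    ⟨by linarith [hs.1, min_le_left (δ / 2) κ₀], by linarith [hs.2, min_le_left (δ / 2) κ₀]⟩
  have := h (x := s) (by rw [Real.dist_eq]; linarith)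
  rw [dist_eq_norm] at this
  exact this.le

theorem IsWindow.self_mem {lam : ℝ → ℂ} {s₀ κ : ℝ} (h : IsWindow lam s₀ κ) :
    s₀ ∈ Set.Icc (s₀ - κ) (s₀ + κ) := ⟨by linarith [h.1], by linarith [h.1]⟩

section window
variable {lam : ℝ → ℂ} {s₀ κ : ℝ}

theorem IsWindow.norm_sub_le (h : IsWindow lam s₀ κ) (hlam : ContDiff ℝ 1 lam) {s s' : ℝ}
    (hs : s ∈ Set.Icc (s₀ - κ) (s₀ + κ)) (hs' : s' ∈ Set.Icc (s₀ - κ) (s₀ + κ)) :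
    ‖lam s - lam s' - (s - s' : ℝ) * deriv lam s₀‖ ≤ ‖deriv lam s₀‖ / 4 * |s - s'| := by
  have hd : ∀ x ∈ Set.Icc (s₀ - κ) (s₀ + κ), HasDerivWithinAt
      (fun x : ℝ => lam x - (x : ℂ) * deriv lam s₀) (deriv lam x - deriv lam s₀)
      (Set.Icc (s₀ - κ) (s₀ + κ)) x := by
    intro x _
    have h1 := (hlam.differentiable (by norm_num) x).hasDerivAt
    have h2 : HasDerivAt (fun x : ℝ => (x : ℂ) * deriv lam s₀) (1 * deriv lam s₀) x :=
      (Complex.ofRealCLM.hasDerivAt (x := x)).mul_const _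
    rw [one_mul] at h2
    exact (h1.sub h2).hasDerivWithinAt
  have := (convex_Icc (s₀ - κ) (s₀ + κ)).norm_image_sub_le_of_norm_hasDerivWithin_le hd
    (fun x hx => h.2 x hx) hs' hs
  rw [Real.norm_eq_abs] at this
  refine le_trans (le_of_eq ?_) this
  congr 1
  push_cast
  ring

/-- Division by the tangent at `s₀` makes the piece of path nearly horizontal with nearly unit
speed. Real parts then measure the parameter, and signs of imaginary parts tell the sides of the
path apart. -/
theorem IsWindow.norm_div_sub_le (h : IsWindow lam s₀ κ) (hlam : ContDiff ℝ 1 lam)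
    (hne : deriv lam s₀ ≠ 0) {s s' : ℝ}
    (hs : s ∈ Set.Icc (s₀ - κ) (s₀ + κ)) (hs' : s' ∈ Set.Icc (s₀ - κ) (s₀ + κ)) :
    ‖(lam s - lam s') / deriv lam s₀ - ((s - s' : ℝ) : ℂ)‖ ≤ |s - s'| / 4 := by
  have hp := norm_pos_iff.2 hne
  have h1 := h.norm_sub_le hlam hs hs'
  have : (lam s - lam s') / deriv lam s₀ - ((s - s' : ℝ) : ℂ)
      = (lam s - lam s' - (s - s' : ℝ) * deriv lam s₀) / deriv lam s₀ := by
    field_simp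
  rw [this, norm_div, div_le_iff₀ hp]
  linarith

theorem IsWindow.abs_re_sub_le (h : IsWindow lam s₀ κ) (hlam : ContDiff ℝ 1 lam)
    (hne : deriv lam s₀ ≠ 0) {s s' : ℝ}
    (hs : s ∈ Set.Icc (s₀ - κ) (s₀ + κ)) (hs' : s' ∈ Set.Icc (s₀ - κ) (s₀ + κ)) :
    |((lam s - lam s') / deriv lam s₀).re - (s - s')| ≤ |s - s'| / 4 := by
  have := (Complex.abs_re_le_norm _).trans (h.norm_div_sub_le hlam hne hs hs')
  simpa using this

theorem IsWindow.abs_im_le (h : IsWindow lam s₀ κ) (hlam : ContDiff ℝ 1 lam)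
    (hne : deriv lam s₀ ≠ 0) {s s' : ℝ}
    (hs : s ∈ Set.Icc (s₀ - κ) (s₀ + κ)) (hs' : s' ∈ Set.Icc (s₀ - κ) (s₀ + κ)) :
    |((lam s - lam s') / deriv lam s₀).im| ≤ |s - s'| / 4 := by
  have := (Complex.abs_im_le_norm _).trans (h.norm_div_sub_le hlam hne hs hs')
  simpa using this

theorem IsWindow.re_pos (h : IsWindow lam s₀ κ) (hlam : ContDiff ℝ 1 lam)
    (hne : deriv lam s₀ ≠ 0) {s s' : ℝ}
    (hs : s ∈ Set.Icc (s₀ - κ) (s₀ + κ)) (hs' : s' ∈ Set.Icc (s₀ - κ) (s₀ + κ)) (hlt : s' < s) :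
    0 < ((lam s - lam s') / deriv lam s₀).re := by
  have := abs_le.1 (h.abs_re_sub_le hlam hne hs hs')
  rw [abs_of_pos (by linarith : 0 < s - s')] at this
  linarith [this.1]

theorem IsWindow.norm_ge (h : IsWindow lam s₀ κ) (hlam : ContDiff ℝ 1 lam)
    {s s' : ℝ}
    (hs : s ∈ Set.Icc (s₀ - κ) (s₀ + κ)) (hs' : s' ∈ Set.Icc (s₀ - κ) (s₀ + κ)) :
    ‖deriv lam s₀‖ / 2 * |s - s'| ≤ ‖lam s - lam s'‖ := by
  have h1 := h.norm_sub_le hlam hs hs'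
  have h2 := norm_sub_norm_le ((s - s' : ℝ) * deriv lam s₀ : ℂ) (lam s - lam s')
  rw [norm_sub_rev _ (lam s - lam s'), norm_mul, Complex.norm_real, Real.norm_eq_abs] at h2
  have := mul_nonneg (norm_nonneg (deriv lam s₀)) (abs_nonneg (s - s'))
  nlinarith

end window

/-- This encodes "to the left of the path". With `w = (lam s - x) / v`, the path is level with `x`
where `w.re = 0`, and it must pass below `x` there. -/
theorem I_mul_mem_slitPlane {w : ℂ} (h : w.re = 0 → w.im < 0) : Complex.I * w ∈ Complex.slitPlane := by
  rw [Complex.mem_slitPlane_iff]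
  simp only [Complex.mul_re, Complex.I_re, Complex.I_im, Complex.mul_im, zero_mul, one_mul,
    zero_sub, zero_add]
  by_cases hw : w.re = 0
  · left; linarith [h hw]
  · right; simpa using hw

theorem neg_I_mul_mem_slitPlane {w : ℂ} (h : w.re = 0 → 0 < w.im) :
    -Complex.I * w ∈ Complex.slitPlane := by
  have : -Complex.I * w = Complex.I * (-w) := by ring
  rw [this]
  apply I_mul_mem_slitPlane
  intro h'
  simp only [Complex.neg_re, neg_eq_zero, Complex.neg_im] at h' ⊢
  linarith [h h']

theorem log_I_mul {w : ℂ} (h : 0 < w.re) :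
    Complex.log (Complex.I * w) = Complex.log w + Real.pi / 2 * Complex.I := by
  have hw : w ≠ 0 := fun h0 => by simp [h0] at h
  have harg := abs_lt.1 (Complex.abs_arg_lt_pi_div_two_iff.2 (Or.inl h))
  have hpi := Real.pi_pos
  rw [Complex.log_mul (x := Complex.I) (y := w) Complex.I_ne_zero hw, Complex.log_I]
  · ring
  · rw [Complex.arg_I]
    exact ⟨by linarith [harg.1], by linarith [harg.2]⟩

theorem log_neg_I_mul {w : ℂ} (h : 0 < w.re) :
    Complex.log (-Complex.I * w) = Complex.log w - Real.pi / 2 * Complex.I := by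
  have hw : w ≠ 0 := fun h0 => by simp [h0] at h
  have harg := abs_lt.1 (Complex.abs_arg_lt_pi_div_two_iff.2 (Or.inl h))
  have hpi := Real.pi_pos
  rw [Complex.log_mul (x := -Complex.I) (y := w) (neg_ne_zero.2 Complex.I_ne_zero) hw,
    Complex.log_neg_I]
  · ring
  · rw [Complex.arg_neg_I]
    exact ⟨by linarith [harg.1], by linarith [harg.2]⟩

/-- `∫ dz / (z - x)` along a piece of path on which `c (z - x)` stays in the slit plane. -/
theorem integral_deriv_div_eq_log {lam : ℝ → ℂ} (hlam : ContDiff ℝ 1 lam) {c x : ℂ} {α β : ℝ}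
    (hαβ : α ≤ β) (h : ∀ s ∈ Set.Icc α β, c * (lam s - x) ∈ Complex.slitPlane) :
    ∫ s in α..β, deriv lam s / (lam s - x) =
      Complex.log (c * (lam β - x)) - Complex.log (c * (lam α - x)) := by
  have hne : ∀ s ∈ Set.Icc α β, lam s - x ≠ 0 := fun s hs h0 => by
    have := h s hs
    rw [h0, mul_zero] at this
    exact Complex.zero_notMem_slitPlane this
  have hc : c ≠ 0 := fun h0 => by
    have := h α ⟨le_rfl, hαβ⟩
    rw [h0, zero_mul] at this
    exact Complex.zero_notMem_slitPlane this
  refine intervalIntegral.integral_eq_sub_of_hasDerivAt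
    (f := fun s => Complex.log (c * (lam s - x))) ?_ ?_
  · intro s hs
    rw [Set.uIcc_of_le hαβ] at hs
    have h1 := (((hlam.differentiable (by norm_num) s).hasDerivAt.sub_const x).const_mul c)
    have h2 := h1.clog_real (h s hs)
    exact h2.congr_deriv (mul_div_mul_left _ _ hc)
  · refine ContinuousOn.intervalIntegrable ?_
    rw [Set.uIcc_of_le hαβ]
    exact ((hlam.continuous_deriv le_rfl).continuousOn).div
      ((hlam.continuous.sub continuous_const).continuousOn) hne

section window
variable {lam : ℝ → ℂ} {s₀ κ : ℝ}

/-- A point off a short piece of path lies on the left or on the right of it. -/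
theorem IsWindow.left_or_right (h : IsWindow lam s₀ κ) (hlam : ContDiff ℝ 1 lam)
    (hne : deriv lam s₀ ≠ 0) {A : Set ℝ} (hA : A ⊆ Set.Icc (s₀ - κ) (s₀ + κ)) {x : ℂ}
    (hx : x ∉ lam '' A) :
    (∀ s ∈ A, Complex.I / deriv lam s₀ * (lam s - x) ∈ Complex.slitPlane) ∨
      (∀ s ∈ A, -Complex.I / deriv lam s₀ * (lam s - x) ∈ Complex.slitPlane) := by
  have e1 : ∀ s, Complex.I / deriv lam s₀ * (lam s - x)
      = Complex.I * ((lam s - x) / deriv lam s₀) := fun s => by ring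
  have e2 : ∀ s, -Complex.I / deriv lam s₀ * (lam s - x)
      = -Complex.I * ((lam s - x) / deriv lam s₀) := fun s => by ring
  simp only [e1, e2]
  -- The real part increases strictly along the window, so the path is level with `x` at most once,
  -- and the sign of the imaginary part at that parameter decides the side. If the path is never
  -- level with `x`, both alternatives hold.
  by_cases hz : ∃ s ∈ A, ((lam s - x) / deriv lam s₀).re = 0
  · obtain ⟨s, hs, h0⟩ := hz
    have huniq : ∀ s' ∈ A, ((lam s' - x) / deriv lam s₀).re = 0 → s' = s := by
      intro s' hs' h0'
      by_contra hss
      rcases lt_or_gt_of_ne hss with hlt | hlt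
      · have := h.re_pos hlam hne (hA hs) (hA hs') hlt
        rw [show lam s - lam s' = (lam s - x) - (lam s' - x) by ring, sub_div, Complex.sub_re,
          h0, h0'] at this
        simp at this
      · have := h.re_pos hlam hne (hA hs') (hA hs) hlt
        rw [show lam s' - lam s = (lam s' - x) - (lam s - x) by ring, sub_div, Complex.sub_re,
          h0, h0'] at this
        simp at this
    have him : ((lam s - x) / deriv lam s₀).im ≠ 0 := by
      intro h1
      have h2 : (lam s - x) / deriv lam s₀ = 0 := Complex.ext h0 h1
      rcases div_eq_zero_iff.1 h2 with h3 | h3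
      · exact hx ⟨s, hs, sub_eq_zero.1 h3⟩
      · exact hne h3
    rcases lt_or_gt_of_ne him with h1 | h1
    · left
      intro s' hs'
      refine I_mul_mem_slitPlane fun h' => ?_
      rw [huniq s' hs' h']; exact h1
    · right
      intro s' hs'
      refine neg_I_mul_mem_slitPlane fun h' => ?_
      rw [huniq s' hs' h']; exact h1
  · push Not at hz
    left
    intro s hs
    exact I_mul_mem_slitPlane fun h' => absurd h' (hz s hs)

theorem IsWindow.re_im_of_offset (h : IsWindow lam s₀ κ) (hlam : ContDiff ℝ 1 lam)
    (hne : deriv lam s₀ ≠ 0) {s s' : ℝ}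
    (hs : s ∈ Set.Icc (s₀ - κ) (s₀ + κ)) (hs' : s' ∈ Set.Icc (s₀ - κ) (s₀ + κ)) {d : ℂ} {ε : ℝ}
    (hd : ‖d - deriv lam s₀‖ ≤ ‖deriv lam s₀‖ / 4) (hε : 0 < ε)
    (h0 : ((lam s' - (lam s + Complex.I * ε * d)) / deriv lam s₀).re = 0) :
    ((lam s' - (lam s + Complex.I * ε * d)) / deriv lam s₀).im < 0 := by
  have hp := norm_pos_iff.2 hne
  set v := deriv lam s₀
  have hz : ‖d / v - 1‖ ≤ 1 / 4 := by
    rw [show d / v - 1 = (d - v) / v by field_simp, norm_div, div_le_iff₀ hp]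
    linarith
  have hzr := abs_le.1 ((Complex.abs_re_le_norm _).trans hz)
  have hzi := abs_le.1 ((Complex.abs_im_le_norm _).trans hz)
  have h1 := abs_le.1 (h.abs_re_sub_le hlam hne hs' hs)
  have h2 := abs_le.1 (h.abs_im_le hlam hne hs' hs)
  have e : (lam s' - (lam s + Complex.I * ε * d)) / v
      = (lam s' - lam s) / v - (ε : ℂ) * (Complex.I * (d / v)) := by field_simp; ring
  rw [e] at h0 ⊢
  simp only [Complex.sub_re, Complex.sub_im, Complex.ofReal_re,
    Complex.ofReal_im, Complex.mul_re, Complex.mul_im, Complex.I_re, Complex.I_im, zero_mul, one_mul, zero_sub,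
    zero_add, Complex.one_re, Complex.one_im, sub_zero] at h0 hzr hzi ⊢
  -- The vanishing real part gives `3/4 * |s' - s| ≤ ε / 4`. The imaginary part is then at most `ε /
  -- 12 - 3 * ε / 4`.
  have k1 : |s' - s| ≤ ε / 3 := by
    rcases abs_cases (s' - s) with ⟨ha, _⟩ | ⟨ha, _⟩ <;> rw [ha] at h1 ⊢ <;> nlinarith
  nlinarith

/-- Points displaced to the left of the path see a short piece of it in the slit plane. -/
theorem IsWindow.left_of_offset (h : IsWindow lam s₀ κ) (hlam : ContDiff ℝ 1 lam)
    (hne : deriv lam s₀ ≠ 0) {s s' : ℝ}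
    (hs : s ∈ Set.Icc (s₀ - κ) (s₀ + κ)) (hs' : s' ∈ Set.Icc (s₀ - κ) (s₀ + κ)) {d : ℂ} {ε : ℝ}
    (hd : ‖d - deriv lam s₀‖ ≤ ‖deriv lam s₀‖ / 4) (hε : 0 < ε) :
    Complex.I / deriv lam s₀ * (lam s' - (lam s + Complex.I * ε * d)) ∈ Complex.slitPlane := by
  rw [div_mul_eq_mul_div, mul_div_assoc]
  exact I_mul_mem_slitPlane fun h0 => h.re_im_of_offset hlam hne hs hs' hd hε h0

theorem IsWindow.right_of_offset (h : IsWindow lam s₀ κ) (hlam : ContDiff ℝ 1 lam)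
    (hne : deriv lam s₀ ≠ 0) {s s' : ℝ}
    (hs : s ∈ Set.Icc (s₀ - κ) (s₀ + κ)) (hs' : s' ∈ Set.Icc (s₀ - κ) (s₀ + κ)) {d : ℂ} {ε : ℝ}
    (hd : ‖d - deriv lam s₀‖ ≤ ‖deriv lam s₀‖ / 4) (hε : 0 < ε) :
    -Complex.I / deriv lam s₀ * (lam s' - (lam s - Complex.I * ε * d)) ∈ Complex.slitPlane := by
  have hp := norm_pos_iff.2 hne
  have e : -Complex.I / deriv lam s₀ * (lam s' - (lam s - Complex.I * ε * d))
      = Complex.I * (-((lam s' - (lam s - Complex.I * ε * d)) / deriv lam s₀)) := by ring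
  rw [e]
  refine I_mul_mem_slitPlane fun h0 => ?_
  set v := deriv lam s₀
  have hz : ‖d / v - 1‖ ≤ 1 / 4 := by
    rw [show d / v - 1 = (d - v) / v by field_simp, norm_div, div_le_iff₀ hp]
    linarith
  have hzr := abs_le.1 ((Complex.abs_re_le_norm _).trans hz)
  have hzi := abs_le.1 ((Complex.abs_im_le_norm _).trans hz)
  have h1 := abs_le.1 (h.abs_re_sub_le hlam hne hs' hs)
  have h2 := abs_le.1 (h.abs_im_le hlam hne hs' hs)
  have e : -((lam s' - (lam s - Complex.I * ε * d)) / v)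
      = -((lam s' - lam s) / v) - (ε : ℂ) * (Complex.I * (d / v)) := by field_simp; ring
  rw [e] at h0 ⊢
  simp only [Complex.sub_re, Complex.sub_im, Complex.neg_re, Complex.neg_im, Complex.ofReal_re,
    Complex.ofReal_im, Complex.mul_re, Complex.mul_im, Complex.I_re, Complex.I_im, zero_mul, one_mul, zero_sub,
    zero_add, Complex.one_re, Complex.one_im, sub_zero] at h0 hzr hzi ⊢
  have k1 : |s' - s| ≤ ε / 3 := by
    rcases abs_cases (s' - s) with ⟨ha, _⟩ | ⟨ha, _⟩ <;> rw [ha] at h1 ⊢ <;> nlinarith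
  nlinarith

end window
end

/-! ### Square roots, Cauchy transforms, and `y₀` near the interior of a cut. -/

noncomputable section

/-- A continuous square root of a differentiable function is differentiable where it is nonzero. -/
theorem HasDerivAt.of_sq {𝕜 : Type*} [NontriviallyNormedField 𝕜] [NormedAlgebra 𝕜 ℂ]
    {y p : 𝕜 → ℂ} {p' : ℂ} {s : 𝕜}
    (hy : ContinuousAt y s) (hsq : ∀ᶠ u in 𝓝 s, y u ^ 2 = p u) (hp : HasDerivAt p p' s)
    (h0 : y s ≠ 0) : HasDerivAt y (p' / (2 * y s)) s := by
  rw [hasDerivAt_iff_tendsto_slope] at hp ⊢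
  have h2 : Tendsto (fun u => y u + y s) (𝓝[≠] s) (𝓝 (2 * y s)) := by
    rw [two_mul]
    exact (hy.tendsto.add tendsto_const_nhds).mono_left nhdsWithin_le_nhds
  have hne : (2 : ℂ) * y s ≠ 0 := mul_ne_zero two_ne_zero h0
  refine (hp.div h2 hne).congr' ?_
  filter_upwards [hsq.filter_mono nhdsWithin_le_nhds, h2.eventually_ne hne] with u hu hne'
  have hs := hsq.self_of_nhds
  rw [Pi.div_apply, slope_def_module, slope_def_module, ← hu, ← hs, show y u ^ 2 - y s ^ 2
    = (y u - y s) * (y u + y s) by ring, ← smul_mul_assoc, mul_div_cancel_right₀ _ hne']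

/-- Cauchy transforms are holomorphic off the path. -/
theorem hasDerivAt_integral_div_sub {lam φ : ℝ → ℂ} {A : Set ℝ} (hA : MeasurableSet A)
    (hlam : Continuous lam)
    (hφ : MeasureTheory.IntegrableOn φ A) {x : ℂ} {d : ℝ} (hd : 0 < d)
    (hx : ∀ s ∈ A, d ≤ ‖lam s - x‖) :
    HasDerivAt (fun z => ∫ s in A, φ s / (lam s - z)) (∫ s in A, φ s / (lam s - x) ^ 2) x := by
  have hfar : ∀ z ∈ Metric.ball x (d / 2), ∀ s ∈ A, d / 2 ≤ ‖lam s - z‖ := by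
    intro z hz s hs
    have h1 := hx s hs
    have h2 : ‖z - x‖ < d / 2 := by rwa [← dist_eq_norm]
    have h3 : ‖lam s - x‖ ≤ ‖lam s - z‖ + ‖z - x‖ := by
      simpa using norm_add_le (lam s - z) (z - x)
    linarith
  have hmeas : ∀ z, MeasureTheory.AEStronglyMeasurable (fun s => φ s / (lam s - z))
      (MeasureTheory.volume.restrict A) := fun z =>
    hφ.aestronglyMeasurable.div₀ (hlam.sub continuous_const).aestronglyMeasurable
  refine (hasDerivAt_integral_of_dominated_loc_of_deriv_le (μ := MeasureTheory.volume.restrict A)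
    (F := fun z s => φ s / (lam s - z)) (F' := fun z s => φ s / (lam s - z) ^ 2)
    (s := Metric.ball x (d / 2))
    (bound := fun s => ‖φ s‖ * (4 / d ^ 2)) (Metric.ball_mem_nhds x (by positivity))
    (Eventually.of_forall hmeas) ?_ ?_ ?_ ?_ ?_).2
  · refine MeasureTheory.Integrable.mono' (hφ.norm.mul_const (1 / d)) (hmeas x) ?_
    refine (MeasureTheory.ae_restrict_iff' hA).2 (Eventually.of_forall fun s hs => ?_)
    rw [norm_div, div_eq_mul_one_div]
    gcongr
    exact hx s hs
  · exact hφ.aestronglyMeasurable.div₀ ((hlam.sub continuous_const).pow 2).aestronglyMeasurable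
  · refine (MeasureTheory.ae_restrict_iff' hA).2 (Eventually.of_forall fun s hs z hz => ?_)
    rw [norm_div, norm_pow, div_eq_mul_inv]
    have h1 := hfar z hz s hs
    have h2 : (d / 2) ^ 2 ≤ ‖lam s - z‖ ^ 2 := by gcongr
    have h3 : (‖lam s - z‖ ^ 2)⁻¹ ≤ ((d / 2) ^ 2)⁻¹ := inv_anti₀ (by positivity) h2
    have h4 : ((d / 2) ^ 2)⁻¹ = 4 / d ^ 2 := by field_simp; norm_num
    rw [h4] at h3
    gcongr
  · exact hφ.norm.mul_const _
  · refine (MeasureTheory.ae_restrict_iff' hA).2 (Eventually.of_forall fun s hs z hz => ?_)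
    have h1 := hfar z hz s hs
    have hne : lam s - z ≠ 0 := fun h0 => by rw [h0, norm_zero] at h1; linarith
    have h2 := ((hasDerivAt_const z (φ s)).div ((hasDerivAt_id z).const_sub (lam s)) hne)
    refine h2.congr_deriv ?_
    simp

theorem differentiableAt_integral_div_sub {lam φ : ℝ → ℂ} (hlam : Continuous lam) {α β : ℝ}
    (hαβ : α ≤ β) (hφ : Continuous φ) {x : ℂ} (hx : x ∉ lam '' Set.Icc α β) :
    DifferentiableAt ℂ (fun z => ∫ s in α..β, φ s / (lam s - z)) x := by
  simp only [intervalIntegral.integral_of_le hαβ, ← MeasureTheory.integral_Icc_eq_integral_Ioc]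
  have hcl : IsClosed (lam '' Set.Icc α β) := (isCompact_Icc.image hlam).isClosed
  obtain ⟨d, hd, hball⟩ := Metric.isOpen_iff.1 hcl.isOpen_compl x hx
  refine (hasDerivAt_integral_div_sub measurableSet_Icc hlam hφ.continuousOn.integrableOn_Icc hd
    fun s hs => ?_).differentiableAt
  by_contra hlt
  exact hball (show lam s ∈ Metric.ball x d by
    rw [Metric.mem_ball, dist_eq_norm]; exact not_le.1 hlt) ⟨s, hs, rfl⟩

namespace CutCurve
variable {m : ℕ} {W : ℂ[X]} (Γ : CutCurve m W)

/-- The parameters of the branch points. -/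
def bp : Fin (m + 1) × Bool → ℝ
  | (i, false) => Γ.sMinus i
  | (i, true) => Γ.sPlus i

/-- The parameters of the points on the cuts. -/
def cutParams : Set ℝ := ⋃ i, Set.Icc (Γ.sMinus i) (Γ.sPlus i)

theorem bp_injective : Function.Injective Γ.bp := by
  have key : ∀ i j, i < j → ∀ b c, Γ.bp (i, b) < Γ.bp (j, c) := by
    intro i j hij b c
    have h1 := Γ.sPlus_lt_sMinus i j hij
    have h2 := Γ.sMinus_lt_sPlus i
    have h3 := Γ.sMinus_lt_sPlus j
    cases b <;> cases c <;> simp only [bp] <;> linarith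
  rintro ⟨i, b⟩ ⟨j, c⟩ h
  rcases lt_trichotomy i j with hij | hij | hij
  · exact absurd h (key i j hij b c).ne
  · subst hij
    have h2 := Γ.sMinus_lt_sPlus i
    cases b <;> cases c <;> simp only [bp] at h <;> first | rfl | (exfalso; linarith)
  · exact absurd h (key j i hij c b).ne'

theorem cuts_eq_image : Γ.cuts = Γ.lam '' Γ.cutParams := by
  rw [cuts, cutParams, Set.image_iUnion]

theorem isCompact_cutParams : IsCompact Γ.cutParams := isCompact_iUnion fun _ => isCompact_Icc

theorem isCompact_cuts : IsCompact Γ.cuts := by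
  rw [cuts_eq_image]; exact Γ.isCompact_cutParams.image Γ.contDiff_lam.continuous

theorem lam_mem_cuts_iff {s : ℝ} : Γ.lam s ∈ Γ.cuts ↔ s ∈ Γ.cutParams := by
  rw [cuts_eq_image, Γ.injective_lam.mem_set_image]

theorem eval_eq_prod (x : ℂ) : W.derivative.eval x ^ 2 + Γ.f.eval x =
    ∏ k, (x - Γ.lam (Γ.bp k)) := by
  have h := congrArg (Polynomial.eval x) Γ.factorization
  simp only [eval_add, eval_pow, eval_prod, eval_mul, eval_sub, eval_X, eval_C] at h
  rw [h, Fintype.prod_prod_type]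
  refine Finset.prod_congr rfl fun i _ => ?_
  rw [Fintype.prod_bool, mul_comm]
  rfl

/-- The polynomial `W'² + f₀`. -/
def P : ℂ[X] := W.derivative ^ 2 + Γ.f

theorem eval_P (x : ℂ) : Γ.P.eval x = ∏ k, (x - Γ.lam (Γ.bp k)) := by
  rw [← eval_eq_prod, P, eval_add, eval_pow]

theorem y₀_sq' {x : ℂ} (hx : x ∉ Γ.cuts) : Γ.y₀ x ^ 2 = Γ.P.eval x := by
  rw [Γ.y₀_sq hx, P, eval_add, eval_pow]

theorem y₀_of_mem {x : ℂ} (hx : x ∈ Γ.cuts) : Γ.y₀ x = 0 :=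
  Set.indicator_of_notMem (Set.notMem_compl_iff.2 hx) _

theorem bp_mem_cutParams (k : Fin (m + 1) × Bool) : Γ.bp k ∈ Γ.cutParams := by
  obtain ⟨i, b⟩ := k
  refine Set.mem_iUnion.2 ⟨i, ?_⟩
  cases b
  · exact Set.left_mem_Icc.2 (Γ.sMinus_lt_sPlus i).le
  · exact Set.right_mem_Icc.2 (Γ.sMinus_lt_sPlus i).le

theorem eval_P_ne_zero {s : ℝ} (hs : s ∉ Set.range Γ.bp) : Γ.P.eval (Γ.lam s) ≠ 0 := by
  rw [eval_P]
  refine Finset.prod_ne_zero_iff.2 fun k _ h => hs ⟨k, ?_⟩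
  exact Γ.injective_lam (sub_eq_zero.1 h).symm

theorem eval_P_ne_zero_of_notMem {x : ℂ} (hx : x ∉ Γ.cuts) : Γ.P.eval x ≠ 0 := by
  rw [eval_P]
  refine Finset.prod_ne_zero_iff.2 fun k _ h => hx ?_
  rw [sub_eq_zero.1 h, lam_mem_cuts_iff]
  exact Γ.bp_mem_cutParams k

theorem y₀_ne_zero {x : ℂ} (hx : x ∉ Γ.cuts) : Γ.y₀ x ≠ 0 := by
  intro h
  have := Γ.y₀_sq' hx
  rw [h] at this
  exact Γ.eval_P_ne_zero_of_notMem hx (by rw [← this]; ring)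

/-- Only an inequality, because `y₀` is set to `0` on the cuts. It suffices to make `y₀` tend to `0`
at the branch points from every direction, the cut included. -/
theorem norm_y₀_sq_le (x : ℂ) : ‖Γ.y₀ x‖ ^ 2 ≤ ‖Γ.P.eval x‖ := by
  by_cases hx : x ∈ Γ.cuts
  · rw [Γ.y₀_of_mem hx]; simp
  · rw [← Γ.y₀_sq' hx, norm_pow]

theorem differentiableOn_y₀ : DifferentiableOn ℂ Γ.y₀ Γ.cutsᶜ := by
  intro x hx
  have hopen : Γ.cutsᶜ ∈ 𝓝 x := Γ.isClosed_cuts.isOpen_compl.mem_nhds hx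
  refine (HasDerivAt.of_sq (p := fun z => Γ.P.eval z) (Γ.continuousOn_y₀.continuousAt hopen) ?_
    (Γ.P.hasDerivAt x) (Γ.y₀_ne_zero hx)).differentiableAt.differentiableWithinAt
  filter_upwards [hopen] with z hz using Γ.y₀_sq' hz

theorem notMem_range_bp_of_mem_Ioo {i : Fin (m + 1)} {s : ℝ}
    (hs : s ∈ Set.Ioo (Γ.sMinus i) (Γ.sPlus i)) : s ∉ Set.range Γ.bp := by
  rintro ⟨⟨j, b⟩, rfl⟩
  have hj := Γ.sMinus_lt_sPlus j
  rcases lt_trichotomy i j with hij | hij | hij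
  · have := Γ.sPlus_lt_sMinus i j hij
    cases b <;> simp only [bp, Set.mem_Ioo] at hs <;> linarith [hs.1, hs.2]
  · subst hij
    cases b <;> simp only [bp, Set.mem_Ioo] at hs <;> linarith [hs.1, hs.2]
  · have := Γ.sPlus_lt_sMinus j i hij
    cases b <;> simp only [bp, Set.mem_Ioo] at hs <;> linarith [hs.1, hs.2]

theorem mem_Ioo_of_mem_cutParams {s : ℝ} (hs : s ∈ Γ.cutParams) (h : s ∉ Set.range Γ.bp) :
    ∃ i, s ∈ Set.Ioo (Γ.sMinus i) (Γ.sPlus i) := by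
  obtain ⟨i, hi⟩ := Set.mem_iUnion.1 hs
  refine ⟨i, lt_of_le_of_ne hi.1 fun h' => h ⟨(i, false), h'⟩,
    lt_of_le_of_ne hi.2 fun h' => h ⟨(i, true), h'.symm⟩⟩

/-- Near the interior of a cut, `y₀` is `±` a holomorphic branch on the two sides of the path. -/
theorem exists_local_branch {i : Fin (m + 1)} {s₀ : ℝ}
    (hs₀ : s₀ ∈ Set.Ioo (Γ.sMinus i) (Γ.sPlus i)) :
    ∃ (κ r : ℝ) (Y Lg : ℂ → ℂ), 0 < r ∧ IsWindow Γ.lam s₀ κ ∧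
      Set.Icc (s₀ - κ) (s₀ + κ) ⊆ Set.Ioo (Γ.sMinus i) (Γ.sPlus i) ∧
      DifferentiableOn ℂ Y (Metric.ball (Γ.lam s₀) r) ∧
      DifferentiableOn ℂ Lg (Metric.ball (Γ.lam s₀) r) ∧
      (∀ x ∈ Metric.ball (Γ.lam s₀) r, Y x ^ 2 = Γ.P.eval x ∧ Y x ≠ 0) ∧
      (∀ s ∈ Γ.cutParams \ Set.Icc (s₀ - κ) (s₀ + κ), Γ.lam s ∉ Metric.ball (Γ.lam s₀) r) ∧
      ∀ x ∈ Metric.ball (Γ.lam s₀) r,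
        ((∀ s ∈ Set.Icc (s₀ - κ) (s₀ + κ),
            Complex.I / deriv Γ.lam s₀ * (Γ.lam s - x) ∈ Complex.slitPlane) →
          Γ.y₀ x = Y x ∧ ∫ s in (s₀ - κ)..(s₀ + κ), deriv Γ.lam s / (Γ.lam s - x)
            = Lg x + Real.pi * Complex.I) ∧
        ((∀ s ∈ Set.Icc (s₀ - κ) (s₀ + κ),
            -Complex.I / deriv Γ.lam s₀ * (Γ.lam s - x) ∈ Complex.slitPlane) →
          Γ.y₀ x = -Y x ∧ ∫ s in (s₀ - κ)..(s₀ + κ), deriv Γ.lam s / (Γ.lam s - x)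
            = Lg x - Real.pi * Complex.I) := by
  obtain ⟨κ, hκ, hκle, hw⟩ := exists_isWindow Γ.contDiff_lam Γ.deriv_lam_ne_zero s₀
    (κ₀ := min (s₀ - Γ.sMinus i) (Γ.sPlus i - s₀) / 2)
    (half_pos (lt_min (sub_pos.2 hs₀.1) (sub_pos.2 hs₀.2)))
  have hlam := Γ.contDiff_lam
  have hlc := hlam.continuous
  have hdc := hlam.continuous_deriv le_rfl
  have hne := Γ.deriv_lam_ne_zero s₀
  have hsub : Set.Icc (s₀ - κ) (s₀ + κ) ⊆ Set.Ioo (Γ.sMinus i) (Γ.sPlus i) := by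
    intro s hs
    have h1 := min_le_left (s₀ - Γ.sMinus i) (Γ.sPlus i - s₀)
    have h2 := min_le_right (s₀ - Γ.sMinus i) (Γ.sPlus i - s₀)
    exact ⟨by linarith [hs.1, hs₀.1], by linarith [hs.2, hs₀.2]⟩
  set a := s₀ - κ with ha
  set b := s₀ + κ with hb
  set v := deriv Γ.lam s₀ with hv
  have ham : a ∈ Set.Icc a b := ⟨le_rfl, by linarith⟩
  have hbm : b ∈ Set.Icc a b := ⟨by linarith, le_rfl⟩
  have hs0m := hw.self_mem
  have hre1 : 0 < ((Γ.lam b - Γ.lam s₀) / v).re := hw.re_pos hlam hne hbm hs0m (by linarith)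
  have hre2 : 0 < ((Γ.lam s₀ - Γ.lam a) / v).re := hw.re_pos hlam hne hs0m ham (by linarith)
  -- the rest of the cuts
  have hcomp : IsCompact (Γ.lam '' (Γ.cutParams \ Set.Ioo a b)) :=
    (Γ.isCompact_cutParams.diff isOpen_Ioo).image hlc
  have hnot : Γ.lam s₀ ∉ Γ.lam '' (Γ.cutParams \ Set.Ioo a b) := by
    rw [Γ.injective_lam.mem_set_image]
    exact fun h => h.2 ⟨by linarith, by linarith⟩
  have hN1 : (Γ.lam '' (Γ.cutParams \ Set.Ioo a b))ᶜ ∈ 𝓝 (Γ.lam s₀) :=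
    hcomp.isClosed.isOpen_compl.mem_nhds hnot
  have hN2 : {x : ℂ | 0 < ((Γ.lam b - x) / v).re} ∈ 𝓝 (Γ.lam s₀) :=
    (isOpen_lt continuous_const (Complex.continuous_re.comp (by fun_prop))).mem_nhds hre1
  have hN3 : {x : ℂ | 0 < ((x - Γ.lam a) / v).re} ∈ 𝓝 (Γ.lam s₀) :=
    (isOpen_lt continuous_const (Complex.continuous_re.comp (by fun_prop))).mem_nhds hre2
  have hN4 : {x : ℂ | Γ.P.eval x ≠ 0} ∈ 𝓝 (Γ.lam s₀) :=
    (isOpen_ne_fun (by fun_prop) continuous_const).mem_nhds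
      (Γ.eval_P_ne_zero (Γ.notMem_range_bp_of_mem_Ioo hs₀))
  obtain ⟨r, hr, hball⟩ := Metric.mem_nhds_iff.1 (inter_mem (inter_mem hN1 hN2) (inter_mem hN3 hN4))
  -- the factors of `y₀` which do not see the window
  let N : ℂ → ℂ := fun x => (∏ j ∈ Finset.univ.erase i, (x - Γ.lam (Γ.sMinus j)) *
      Complex.exp ((∫ s in Γ.sMinus j..Γ.sPlus j, deriv Γ.lam s / (Γ.lam s - x)) / 2)) *
    ((x - Γ.lam (Γ.sMinus i)) * Complex.exp (((∫ s in Γ.sMinus i..a, deriv Γ.lam s / (Γ.lam s - x))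
      + ∫ s in b..Γ.sPlus i, deriv Γ.lam s / (Γ.lam s - x)) / 2))
  -- Up to `± π I`, the window contributes `Lg x` to the integral of `dz / (z - x)`, with `+` on the
  -- left of the path and `-` on the right. Both logarithms are principal because their arguments
  -- have positive real part on the ball. In `y₀` the integral is halved and exponentiated, so the
  -- jump `2 π I` becomes a change of sign.
  let Lg : ℂ → ℂ := fun x => Complex.log ((Γ.lam b - x) / v) - Complex.log ((x - Γ.lam a) / v)
  have hLg : DifferentiableOn ℂ Lg (Metric.ball (Γ.lam s₀) r) := by
    intro x hx
    have h2 := (hball hx).1.2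
    have h3 := (hball hx).2.1
    refine DifferentiableWithinAt.sub ?_ ?_
    · exact DifferentiableWithinAt.clog (by fun_prop) (Or.inl h2)
    · exact DifferentiableWithinAt.clog (by fun_prop) (Or.inl h3)
  have hai := (hsub ham)
  have hbi := (hsub hbm)
  have hoff : ∀ {α β : ℝ}, Set.Icc α β ⊆ Γ.cutParams \ Set.Ioo a b → ∀ x ∈ Metric.ball (Γ.lam s₀) r,
      x ∉ Γ.lam '' Set.Icc α β := fun hαβ x hx h => (hball hx).1.1 (Set.image_mono hαβ h)
  have hj1 : ∀ j ≠ i, Set.Icc (Γ.sMinus j) (Γ.sPlus j) ⊆ Γ.cutParams \ Set.Ioo a b := by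
    intro j hj s hs
    refine ⟨Set.mem_iUnion.2 ⟨j, hs⟩, fun hs' => ?_⟩
    have hs'' := hsub (Set.Ioo_subset_Icc_self hs')
    rcases lt_or_gt_of_ne hj with hlt | hlt
    · linarith [Γ.sPlus_lt_sMinus _ _ hlt, hs.2, hs''.1]
    · linarith [Γ.sPlus_lt_sMinus _ _ hlt, hs.1, hs''.2]
  have hi1 : Set.Icc (Γ.sMinus i) a ⊆ Γ.cutParams \ Set.Ioo a b := fun s hs =>
    ⟨Set.mem_iUnion.2 ⟨i, hs.1, by linarith [hs.2, hai.2]⟩, fun h => by linarith [h.1, hs.2]⟩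
  have hi2 : Set.Icc b (Γ.sPlus i) ⊆ Γ.cutParams \ Set.Ioo a b := fun s hs =>
    ⟨Set.mem_iUnion.2 ⟨i, by linarith [hs.1, hbi.1], hs.2⟩, fun h => by linarith [h.2, hs.1]⟩
  have hN : DifferentiableOn ℂ N (Metric.ball (Γ.lam s₀) r) := by
    intro x hx
    refine DifferentiableAt.differentiableWithinAt ?_
    refine DifferentiableAt.mul ?_ ?_
    · refine DifferentiableAt.fun_finsetProd fun j hj => ?_
      refine DifferentiableAt.mul (by fun_prop) ?_
      refine DifferentiableAt.cexp (DifferentiableAt.div_const ?_ _)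
      exact differentiableAt_integral_div_sub hlc (Γ.sMinus_lt_sPlus j).le hdc
        (hoff (hj1 j (Finset.ne_of_mem_erase hj)) x hx)
    · refine DifferentiableAt.mul (by fun_prop) ?_
      refine DifferentiableAt.cexp (DifferentiableAt.div_const ?_ _)
      exact (differentiableAt_integral_div_sub hlc hai.1.le hdc (hoff hi1 x hx)).add
        (differentiableAt_integral_div_sub hlc hbi.2.le hdc (hoff hi2 x hx))
  have hyN : ∀ x ∈ Metric.ball (Γ.lam s₀) r, x ∉ Γ.cuts → Γ.y₀ x = N x * Complex.exp
      ((∫ s in a..b, deriv Γ.lam s / (Γ.lam s - x)) / 2) := by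
    intro x hx hxc
    rw [y₀, Set.indicator_of_mem (show x ∈ Γ.cutsᶜ from hxc),
      ← Finset.mul_prod_erase _ _ (Finset.mem_univ i)]
    have hcont := Γ.continuousOn_integrand hxc i
    have hint : ∀ {α β}, α ∈ Set.Icc (Γ.sMinus i) (Γ.sPlus i) → β ∈ Set.Icc (Γ.sMinus i) (Γ.sPlus i) →
        IntervalIntegrable (fun s => deriv Γ.lam s / (Γ.lam s - x)) MeasureTheory.volume α β :=
      fun hα hβ => (hcont.mono (Set.uIcc_subset_Icc hα hβ)).intervalIntegrable
    have hml : Γ.sMinus i ∈ Set.Icc (Γ.sMinus i) (Γ.sPlus i) :=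
      Set.left_mem_Icc.2 (Γ.sMinus_lt_sPlus i).le
    have hmr : Γ.sPlus i ∈ Set.Icc (Γ.sMinus i) (Γ.sPlus i) :=
      Set.right_mem_Icc.2 (Γ.sMinus_lt_sPlus i).le
    have hai' := Set.Ioo_subset_Icc_self hai
    have hbi' := Set.Ioo_subset_Icc_self hbi
    rw [← intervalIntegral.integral_add_adjacent_intervals (hint hml hai') (hint hai' hmr),
      ← intervalIntegral.integral_add_adjacent_intervals (hint hai' hbi') (hint hbi' hmr)]
    simp only [N]
    rw [show ∀ A B C : ℂ, (A + (B + C)) / 2 = (A + C) / 2 + B / 2 from fun A B C => by ring,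
      Complex.exp_add]
    ring
  have hout : ∀ s ∈ Γ.cutParams \ Set.Icc a b, Γ.lam s ∉ Metric.ball (Γ.lam s₀) r := by
    intro s hs hmem
    exact (hball hmem).1.1 ⟨s, ⟨hs.1, fun h => hs.2 (Set.Ioo_subset_Icc_self h)⟩, rfl⟩
  have hoffc : ∀ {c : ℂ}, ∀ x ∈ Metric.ball (Γ.lam s₀) r,
      (∀ s ∈ Set.Icc a b, c * (Γ.lam s - x) ∈ Complex.slitPlane) → x ∉ Γ.cuts := by
    intro c x hx h hxc
    rw [cuts_eq_image] at hxc
    obtain ⟨s, hs, rfl⟩ := hxc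
    by_cases hsI : s ∈ Set.Icc a b
    · have := h s hsI
      rw [sub_self, mul_zero] at this
      exact Complex.zero_notMem_slitPlane this
    · exact hout s ⟨hs, hsI⟩ hx
  let Y : ℂ → ℂ := fun x => N x * Complex.exp ((Lg x + Real.pi * Complex.I) / 2)
  have hY : DifferentiableOn ℂ Y (Metric.ball (Γ.lam s₀) r) :=
    hN.mul ((hLg.add_const _).div_const _).cexp
  have hleft : ∀ x ∈ Metric.ball (Γ.lam s₀) r,
      (∀ s ∈ Set.Icc a b, Complex.I / v * (Γ.lam s - x) ∈ Complex.slitPlane) →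
      Γ.y₀ x = Y x ∧ ∫ s in a..b, deriv Γ.lam s / (Γ.lam s - x) = Lg x + Real.pi * Complex.I := by
    intro x hx h
    have h2 := (hball hx).1.2
    have h3 := (hball hx).2.1
    have e : ∫ s in a..b, deriv Γ.lam s / (Γ.lam s - x) = Lg x + Real.pi * Complex.I := by
      rw [integral_deriv_div_eq_log hlam (by linarith) h,
        show Complex.I / v * (Γ.lam b - x) = Complex.I * ((Γ.lam b - x) / v) by ring,
        show Complex.I / v * (Γ.lam a - x) = -Complex.I * ((x - Γ.lam a) / v) by ring,
        log_I_mul h2, log_neg_I_mul h3]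
      ring
    exact ⟨by rw [hyN x hx (hoffc x hx h), e], e⟩
  have hright : ∀ x ∈ Metric.ball (Γ.lam s₀) r,
      (∀ s ∈ Set.Icc a b, -Complex.I / v * (Γ.lam s - x) ∈ Complex.slitPlane) →
      Γ.y₀ x = -Y x ∧ ∫ s in a..b, deriv Γ.lam s / (Γ.lam s - x) = Lg x - Real.pi * Complex.I := by
    intro x hx h
    have h2 := (hball hx).1.2
    have h3 := (hball hx).2.1
    have e : ∫ s in a..b, deriv Γ.lam s / (Γ.lam s - x) = Lg x - Real.pi * Complex.I := by
      rw [integral_deriv_div_eq_log hlam (by linarith) h,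
        show -Complex.I / v * (Γ.lam b - x) = -Complex.I * ((Γ.lam b - x) / v) by ring,
        show -Complex.I / v * (Γ.lam a - x) = Complex.I * ((x - Γ.lam a) / v) by ring,
        log_neg_I_mul h2, log_I_mul h3]
      ring
    refine ⟨?_, e⟩
    rw [hyN x hx (hoffc x hx h), e]
    simp only [Y]
    rw [show (Lg x + Real.pi * Complex.I) / 2 = (Lg x - Real.pi * Complex.I) / 2
      + Real.pi * Complex.I by ring, Complex.exp_add, Complex.exp_pi_mul_I]
    ring
  have hsq : ∀ x ∈ Metric.ball (Γ.lam s₀) r, Y x ^ 2 = Γ.P.eval x := by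
    intro x hx
    -- On the cut itself the identity is the limit of the one at points displaced to the left, where
    -- `Y = y₀`.
    by_cases hxc : x ∈ Γ.cuts
    · have hxc' := hxc
      rw [cuts_eq_image] at hxc'
      obtain ⟨s, hs, rfl⟩ := hxc'
      have hsI : s ∈ Set.Icc a b := by
        by_contra hsI
        exact hout s ⟨hs, hsI⟩ hx
      have hlim : Tendsto (fun h : ℝ => Γ.lam s + Complex.I * h * v) (𝓝[>] 0) (𝓝 (Γ.lam s)) := by
        have : Continuous fun h : ℝ => Γ.lam s + Complex.I * h * v := by fun_prop
        simpa using (this.tendsto 0).mono_left nhdsWithin_le_nhds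
      have hYc := (hY.continuousOn.continuousAt (Metric.isOpen_ball.mem_nhds hx)).tendsto.comp hlim
      have hPc := (Γ.P.continuous.tendsto (Γ.lam s)).comp hlim
      refine tendsto_nhds_unique (hYc.pow 2) (hPc.congr' ?_)
      filter_upwards [hlim (Metric.isOpen_ball.mem_nhds hx), self_mem_nhdsWithin] with h hh hpos
      have hL : ∀ s' ∈ Set.Icc a b,
          Complex.I / v * (Γ.lam s' - (Γ.lam s + Complex.I * h * v)) ∈ Complex.slitPlane :=
        fun s' hs' => hw.left_of_offset hlam hne (d := v) hsI hs'
          (by rw [← hv, sub_self, norm_zero]; positivity) hpos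
      simp only [Function.comp_apply]
      rw [← Γ.y₀_sq' (hoffc _ hh hL), (hleft _ hh hL).1]
    · have hxI : x ∉ Γ.lam '' Set.Icc a b := by
        rintro ⟨s, hs, rfl⟩
        exact hxc (Γ.lam_mem_cuts_iff.2 (Set.mem_iUnion.2 ⟨i, Set.Ioo_subset_Icc_self (hsub hs)⟩))
      rw [← Γ.y₀_sq' hxc]
      rcases hw.left_or_right hlam hne subset_rfl hxI with h | h
      · rw [(hleft x hx h).1]
      · rw [(hright x hx h).1, neg_sq]
  refine ⟨κ, r, Y, Lg, hr, hw, hsub, hY, hLg, fun x hx => ⟨hsq x hx, fun h0 => ?_⟩, hout,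
    fun x hx => ⟨hleft x hx, hright x hx⟩⟩
  apply (hball hx).2.2
  rw [← hsq x hx, h0]
  ring
end CutCurve
end

/-! ### Integrable singularities and the boundary values of `y₀`. -/

noncomputable section

theorem locallyIntegrable_abs_sub_rpow (p : ℝ) {r : ℝ} (hr : -1 < r) :
    MeasureTheory.LocallyIntegrable (fun s : ℝ => |s - p| ^ r) := by
  have h0 : MeasureTheory.LocallyIntegrable (fun s : ℝ => |s| ^ r) := by
    refine MeasureTheory.locallyIntegrable_of_norm_le_rpow (C := 1) (α := -r) (by simp)
      (by simp; linarith) (Eventually.of_forall fun x => ?_) ?_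
    · rw [neg_neg, one_mul, Real.norm_of_nonneg (Real.rpow_nonneg (abs_nonneg x) r),
        Real.norm_eq_abs]
    · exact (measurable_norm.pow_const r).aestronglyMeasurable
  intro x
  obtain ⟨U, hU, hint⟩ := h0 (x - p)
  refine ⟨(fun s => s - p) ⁻¹' U, (continuous_sub_right p).continuousAt.preimage_mem_nhds hU, ?_⟩
  exact ((MeasureTheory.measurePreserving_sub_right MeasureTheory.volume p).integrableOn_comp_preimage
    (Homeomorph.subRight p).measurableEmbedding).2 hint

/-- The path is bi-Lipschitz on bounded intervals. -/
theorem exists_mul_abs_sub_le_norm_sub {lam : ℝ → ℂ} (hlam : ContDiff ℝ 1 lam)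
    (hne : ∀ s, deriv lam s ≠ 0) (hinj : Function.Injective lam) (A B : ℝ) :
    ∃ c > 0, ∀ s ∈ Set.Icc A B, ∀ s' ∈ Set.Icc A B, c * |s - s'| ≤ ‖lam s - lam s'‖ := by
  suffices h : ∃ c > 0, ∀ q ∈ Set.Icc A B ×ˢ Set.Icc A B, c * |q.1 - q.2| ≤ ‖lam q.1 - lam q.2‖ by
    obtain ⟨c, hc, h⟩ := h
    exact ⟨c, hc, fun s hs s' hs' => h (s, s') ⟨hs, hs'⟩⟩
  -- The estimate is local on the compact square. On the diagonal it is the window estimate;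
  -- elsewhere injectivity keeps `‖lam s - lam s'‖` away from `0` while `|s - s'|` stays bounded.
  refine (isCompact_Icc.prod isCompact_Icc).induction_on
    (p := fun T : Set (ℝ × ℝ) => ∃ c > 0, ∀ q ∈ T, c * |q.1 - q.2| ≤ ‖lam q.1 - lam q.2‖)
    ⟨1, one_pos, by simp⟩ (fun S T hST ⟨c, hc, h⟩ => ⟨c, hc, fun q hq => h q (hST hq)⟩) ?_ ?_
  · rintro S T ⟨c, hc, h⟩ ⟨c', hc', h'⟩
    refine ⟨min c c', lt_min hc hc', fun q hq => ?_⟩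
    rcases hq with hq | hq
    · exact (mul_le_mul_of_nonneg_right (min_le_left _ _) (abs_nonneg _)).trans (h q hq)
    · exact (mul_le_mul_of_nonneg_right (min_le_right _ _) (abs_nonneg _)).trans (h' q hq)
  · rintro ⟨s, s'⟩ _
    by_cases hss : s = s'
    · subst hss
      obtain ⟨κ, hκ, -, hw⟩ := exists_isWindow hlam hne s one_pos
      refine ⟨Set.Icc (s - κ) (s + κ) ×ˢ Set.Icc (s - κ) (s + κ), mem_nhdsWithin_of_mem_nhds
        (prod_mem_nhds (Icc_mem_nhds (by linarith) (by linarith))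
          (Icc_mem_nhds (by linarith) (by linarith))), ‖deriv lam s‖ / 2,
        half_pos (norm_pos_iff.2 (hne s)), fun q hq => hw.norm_ge hlam hq.1 hq.2⟩
    · have hd : 0 < ‖lam s - lam s'‖ := norm_pos_iff.2 (sub_ne_zero.2 (hinj.ne hss))
      have hlc := hlam.continuous
      have hM : 0 < |s - s'| + 1 := by positivity
      refine ⟨{q | ‖lam s - lam s'‖ / 2 < ‖lam q.1 - lam q.2‖ ∧ |q.1 - q.2| < |s - s'| + 1},
        mem_nhdsWithin_of_mem_nhds (IsOpen.mem_nhds ?_ ⟨half_lt_self hd, lt_add_one _⟩),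
        ‖lam s - lam s'‖ / 2 / (|s - s'| + 1), by positivity, fun q hq => ?_⟩
      · exact (isOpen_lt continuous_const ((hlc.comp continuous_fst).sub
          (hlc.comp continuous_snd)).norm).inter
          (isOpen_lt (continuous_fst.sub continuous_snd).abs continuous_const)
      · refine le_trans ?_ hq.1.le
        rw [div_mul_eq_mul_div, div_le_iff₀ hM]
        exact mul_le_mul_of_nonneg_left hq.2.le (by positivity)

/-- The product of the distances to finitely many points is comparable to the least of them. -/
theorem exists_mul_abs_sub_le_prod {ι : Type*} [Fintype ι] [Nonempty ι] {p : ι → ℝ}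
    (hp : Function.Injective p) : ∃ c > 0, ∀ s, ∃ k, c * |s - p k| ≤ ∏ j, |s - p j| := by
  classical
  obtain ⟨d, hd, hd1, hsep⟩ : ∃ d > 0, d ≤ 1 ∧ ∀ j k, j ≠ k → d ≤ |p j - p k| := by
    have hfin : (Set.univ : Set (ι × ι)).Finite := Set.finite_univ
    by_cases hne : (Finset.univ.filter fun q : ι × ι => q.1 ≠ q.2).Nonempty
    · obtain ⟨q, hq, hmin⟩ := Finset.exists_min_image _ (fun q : ι × ι => |p q.1 - p q.2|) hne
      refine ⟨min 1 |p q.1 - p q.2|, lt_min one_pos (abs_pos.2 (sub_ne_zero.2 (hp.ne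
        (Finset.mem_filter.1 hq).2))), min_le_left _ _, fun j k hjk => (min_le_right _ _).trans
        (hmin (j, k) (Finset.mem_filter.2 ⟨Finset.mem_univ _, hjk⟩))⟩
    · refine ⟨1, one_pos, le_rfl, fun j k hjk => absurd ?_ hne⟩
      exact ⟨(j, k), Finset.mem_filter.2 ⟨Finset.mem_univ _, hjk⟩⟩
  -- If `p k` is the point nearest to `s`, every other point satisfies `d ≤ |p j - p k| ≤ 2 * |s - p
  -- j|`. As `d / 2 ≤ 1`, the exponent may be the full cardinality instead of one less.
  refine ⟨(d / 2) ^ Fintype.card ι, by positivity, fun s => ?_⟩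
  obtain ⟨k, -, hk⟩ := Finset.exists_min_image Finset.univ (fun k => |s - p k|) Finset.univ_nonempty
  refine ⟨k, ?_⟩
  rw [← Finset.mul_prod_erase _ _ (Finset.mem_univ k), mul_comm]
  refine mul_le_mul_of_nonneg_left ?_ (abs_nonneg _)
  calc (d / 2) ^ Fintype.card ι ≤ (d / 2) ^ (Finset.univ.erase k).card := by
        refine pow_le_pow_of_le_one (by positivity) (by linarith) ?_
        rw [Finset.card_erase_of_mem (Finset.mem_univ k)]
        exact Nat.sub_le _ _
    _ = ∏ _j ∈ Finset.univ.erase k, d / 2 := by rw [Finset.prod_const]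
    _ ≤ ∏ j ∈ Finset.univ.erase k, |s - p j| := by
        refine Finset.prod_le_prod (fun _ _ => by positivity) fun j hj => ?_
        have h1 := hk j (Finset.mem_univ j)
        have h2 := hsep j k (Finset.ne_of_mem_erase hj)
        have h3 : |p j - p k| ≤ |s - p j| + |s - p k| := by
          rw [abs_sub_comm s (p j)]; exact abs_sub_le _ _ _
        linarith

namespace CutCurve
variable {m : ℕ} {W : ℂ[X]} (Γ : CutCurve m W)

/-- The boundary value of `y₀` on the left side of the path. -/
def yPlus (s : ℝ) : ℂ :=
  limUnder (𝓝[>] (0 : ℝ)) fun h : ℝ => Γ.y₀ (Γ.lam s + Complex.I * h * deriv Γ.lam s)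

theorem _root_.tendsto_offset (x d : ℂ) :
    Tendsto (fun h : ℝ => x + Complex.I * h * d) (𝓝[>] 0) (𝓝 x) := by
  have : Continuous fun h : ℝ => x + Complex.I * h * d := by fun_prop
  simpa using (this.tendsto 0).mono_left nhdsWithin_le_nhds

theorem _root_.tendsto_offset_right (x d : ℂ) :
    Tendsto (fun h : ℝ => x - Complex.I * h * d) (𝓝[>] 0) (𝓝 x) := by
  have : Continuous fun h : ℝ => x - Complex.I * h * d := by fun_prop
  simpa using (this.tendsto 0).mono_left nhdsWithin_le_nhds

theorem y₀_tendsto_of_notMem {s : ℝ} (hs : s ∉ Γ.cutParams) :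
    Tendsto Γ.y₀ (𝓝 (Γ.lam s)) (𝓝 (Γ.y₀ (Γ.lam s))) :=
  Γ.continuousOn_y₀.continuousAt (Γ.isClosed_cuts.isOpen_compl.mem_nhds fun h =>
    hs (Γ.lam_mem_cuts_iff.1 h))

theorem yPlus_of_notMem {s : ℝ} (hs : s ∉ Γ.cutParams) : Γ.yPlus s = Γ.y₀ (Γ.lam s) :=
  ((Γ.y₀_tendsto_of_notMem hs).comp (tendsto_offset _ _)).limUnder_eq

theorem eval_P_bp (k : Fin (m + 1) × Bool) : Γ.P.eval (Γ.lam (Γ.bp k)) = 0 := by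
  rw [eval_P]
  exact Finset.prod_eq_zero (Finset.mem_univ k) (sub_self _)

theorem tendsto_y₀_bp (k : Fin (m + 1) × Bool) :
    Tendsto Γ.y₀ (𝓝 (Γ.lam (Γ.bp k))) (𝓝 0) := by
  rw [tendsto_zero_iff_norm_tendsto_zero]
  have h1 : Tendsto (fun x => Real.sqrt ‖Γ.P.eval x‖) (𝓝 (Γ.lam (Γ.bp k))) (𝓝 0) := by
    have : Continuous fun x => Real.sqrt ‖Γ.P.eval x‖ := by fun_prop
    simpa [eval_P_bp] using this.tendsto (Γ.lam (Γ.bp k))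
  refine squeeze_zero (fun _ => norm_nonneg _) (fun x => ?_) h1
  exact Real.le_sqrt_of_sq_le (Γ.norm_y₀_sq_le x)

theorem yPlus_bp (k : Fin (m + 1) × Bool) : Γ.yPlus (Γ.bp k) = 0 :=
  ((Γ.tendsto_y₀_bp k).comp (tendsto_offset _ _)).limUnder_eq

/-- Near the interior of a cut, the boundary values of `y₀` are `±` a holomorphic branch. -/
theorem exists_local_yPlus {i : Fin (m + 1)} {s₀ : ℝ}
    (hs₀ : s₀ ∈ Set.Ioo (Γ.sMinus i) (Γ.sPlus i)) :
    ∃ (κ r : ℝ) (Y Lg : ℂ → ℂ), 0 < r ∧ IsWindow Γ.lam s₀ κ ∧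
      Set.Icc (s₀ - κ) (s₀ + κ) ⊆ Set.Ioo (Γ.sMinus i) (Γ.sPlus i) ∧
      DifferentiableOn ℂ Y (Metric.ball (Γ.lam s₀) r) ∧
      DifferentiableOn ℂ Lg (Metric.ball (Γ.lam s₀) r) ∧
      (∀ x ∈ Metric.ball (Γ.lam s₀) r, Y x ^ 2 = Γ.P.eval x ∧ Y x ≠ 0) ∧
      (∀ s ∈ Γ.cutParams \ Set.Icc (s₀ - κ) (s₀ + κ), Γ.lam s ∉ Metric.ball (Γ.lam s₀) r) ∧
      (∀ x ∈ Metric.ball (Γ.lam s₀) r,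
        ((∀ s ∈ Set.Icc (s₀ - κ) (s₀ + κ),
            Complex.I / deriv Γ.lam s₀ * (Γ.lam s - x) ∈ Complex.slitPlane) →
          Γ.y₀ x = Y x ∧ ∫ s in (s₀ - κ)..(s₀ + κ), deriv Γ.lam s / (Γ.lam s - x)
            = Lg x + Real.pi * Complex.I) ∧
        ((∀ s ∈ Set.Icc (s₀ - κ) (s₀ + κ),
            -Complex.I / deriv Γ.lam s₀ * (Γ.lam s - x) ∈ Complex.slitPlane) →
          Γ.y₀ x = -Y x ∧ ∫ s in (s₀ - κ)..(s₀ + κ), deriv Γ.lam s / (Γ.lam s - x)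
            = Lg x - Real.pi * Complex.I)) ∧
      ∀ s ∈ Set.Icc (s₀ - κ) (s₀ + κ), Γ.lam s ∈ Metric.ball (Γ.lam s₀) r →
        Γ.yPlus s = Y (Γ.lam s) ∧
        Tendsto (fun h : ℝ => Γ.y₀ (Γ.lam s - Complex.I * h * deriv Γ.lam s)) (𝓝[>] 0)
          (𝓝 (-Γ.yPlus s)) ∧
        ∀ d, ‖d - deriv Γ.lam s₀‖ ≤ ‖deriv Γ.lam s₀‖ / 4 →
          Tendsto (fun h : ℝ => Γ.y₀ (Γ.lam s + Complex.I * h * d)) (𝓝[>] 0) (𝓝 (Γ.yPlus s)) := by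
  obtain ⟨κ, r, Y, Lg, hr, hw, hsub, hY, hLg, hsq, hout, hside⟩ := Γ.exists_local_branch hs₀
  refine ⟨κ, r, Y, Lg, hr, hw, hsub, hY, hLg, hsq, hout, hside, fun s hs hsr => ?_⟩
  have hlam := Γ.contDiff_lam
  have hne := Γ.deriv_lam_ne_zero s₀
  have hYc := (hY.continuousOn.continuousAt (Metric.isOpen_ball.mem_nhds hsr)).tendsto
  -- A whole cone of directions about the tangent is allowed, because later an entire piece of path
  -- is shifted by one fixed vector and not by its own normal at each point.
  have hleft : ∀ d, ‖d - deriv Γ.lam s₀‖ ≤ ‖deriv Γ.lam s₀‖ / 4 →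
      Tendsto (fun h : ℝ => Γ.y₀ (Γ.lam s + Complex.I * h * d)) (𝓝[>] 0) (𝓝 (Y (Γ.lam s))) := by
    intro d hd
    refine (hYc.comp (tendsto_offset (Γ.lam s) d)).congr' ?_
    filter_upwards [tendsto_offset (Γ.lam s) d (Metric.isOpen_ball.mem_nhds hsr),
      self_mem_nhdsWithin] with h hh hpos
    exact ((hside _ hh).1 fun s' hs' => hw.left_of_offset hlam hne hs hs' hd hpos).1.symm
  have hval : Γ.yPlus s = Y (Γ.lam s) := (hleft _ (hw.2 s hs)).limUnder_eq
  rw [hval]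
  refine ⟨rfl, ?_, hleft⟩
  refine ((hYc.comp (tendsto_offset_right (Γ.lam s) (deriv Γ.lam s))).neg).congr' ?_
  filter_upwards [tendsto_offset_right (Γ.lam s) (deriv Γ.lam s) (Metric.isOpen_ball.mem_nhds hsr),
      self_mem_nhdsWithin] with h hh hpos
  exact ((hside _ hh).2 fun s' hs' => hw.right_of_offset hlam hne hs hs' (hw.2 s hs) hpos).1.symm

theorem yPlus_sq (s : ℝ) : Γ.yPlus s ^ 2 = Γ.P.eval (Γ.lam s) := by
  by_cases hs : s ∈ Γ.cutParams
  · by_cases hb : s ∈ Set.range Γ.bp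
    · obtain ⟨k, rfl⟩ := hb
      rw [yPlus_bp, eval_P_bp]; ring
    · obtain ⟨i, hi⟩ := Γ.mem_Ioo_of_mem_cutParams hs hb
      obtain ⟨κ, r, Y, Lg, hr, hw, hsub, hY, hLg, hsq, hout, hside, hval⟩ := Γ.exists_local_yPlus hi
      rw [(hval s hw.self_mem (Metric.mem_ball_self hr)).1, (hsq _ (Metric.mem_ball_self hr)).1]
  · rw [Γ.yPlus_of_notMem hs, Γ.y₀_sq' fun h => hs (Γ.lam_mem_cuts_iff.1 h)]

theorem yPlus_ne_zero {s : ℝ} (hs : s ∉ Set.range Γ.bp) : Γ.yPlus s ≠ 0 := fun h =>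
  Γ.eval_P_ne_zero hs (by rw [← yPlus_sq, h]; ring)

/-- Inside a cut `yPlus` is a holomorphic branch read along the path, off the cuts it is `y₀`, and
at a branch point its square `P` tends to `0`. It is thus a continuous square root of `P` along the
whole path. -/
theorem continuous_yPlus : Continuous Γ.yPlus := by
  have hlc := Γ.contDiff_lam.continuous
  rw [continuous_iff_continuousAt]
  intro s
  by_cases hb : s ∈ Set.range Γ.bp
  · obtain ⟨k, rfl⟩ := hb
    rw [ContinuousAt, yPlus_bp, tendsto_zero_iff_norm_tendsto_zero]
    have h1 : Tendsto (fun s => Real.sqrt ‖Γ.P.eval (Γ.lam s)‖) (𝓝 (Γ.bp k)) (𝓝 0) := by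
      have : Continuous fun s => Real.sqrt ‖Γ.P.eval (Γ.lam s)‖ := by fun_prop
      simpa [eval_P_bp] using this.tendsto (Γ.bp k)
    refine squeeze_zero (fun _ => norm_nonneg _) (fun s => ?_) h1
    rw [← yPlus_sq, norm_pow, Real.sqrt_sq (norm_nonneg _)]
  by_cases hs : s ∈ Γ.cutParams
  · obtain ⟨i, hi⟩ := Γ.mem_Ioo_of_mem_cutParams hs hb
    obtain ⟨κ, r, Y, Lg, hr, hw, hsub, hY, hLg, hsq, hout, hside, hval⟩ := Γ.exists_local_yPlus hi
    have h1 : ContinuousAt (fun s => Y (Γ.lam s)) s :=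
      ContinuousAt.comp (hY.continuousOn.continuousAt (Metric.ball_mem_nhds _ hr)) hlc.continuousAt
    refine h1.congr ?_
    filter_upwards [Icc_mem_nhds (show s - κ < s by linarith [hw.1]) (show s < s + κ by linarith [hw.1]),
      hlc.continuousAt (Metric.ball_mem_nhds _ hr)] with u hu hur
    exact (hval u hu hur).1.symm
  · have h1 : ContinuousAt (fun s => Γ.y₀ (Γ.lam s)) s :=
      (Γ.y₀_tendsto_of_notMem hs).comp hlc.continuousAt
    refine h1.congr ?_
    filter_upwards [Γ.isCompact_cutParams.isClosed.isOpen_compl.mem_nhds hs] with u hu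
    exact (Γ.yPlus_of_notMem hu).symm

/-- `t ρ₀ = yPlus · lam' / (2 π i)` on the cuts and `ρ₀ = 0` elsewhere. -/
theorem ρ₀_eq {s : ℝ} (hs : s ∉ Set.range Γ.bp) : Γ.ρ₀ s =
    Γ.cutParams.indicator
      (fun s => Γ.yPlus s * deriv Γ.lam s / (2 * Real.pi * Complex.I) / Γ.t) s := by
  have hW : Tendsto (fun x => W.derivative.eval x) (𝓝 (Γ.lam s)) (𝓝 (W.derivative.eval (Γ.lam s))) :=
    W.derivative.continuous.tendsto _
  have hWl := hW.comp (tendsto_offset (Γ.lam s) (deriv Γ.lam s))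
  have hWr := hW.comp (tendsto_offset_right (Γ.lam s) (deriv Γ.lam s))
  have hpi : (Real.pi : ℂ) ≠ 0 := Complex.ofReal_ne_zero.2 Real.pi_ne_zero
  have ht : Γ.t ≠ 0 := by
    rw [t]; exact div_ne_zero (neg_ne_zero.2 Γ.coeff_f_ne_zero) (by norm_num)
  by_cases hc : s ∈ Γ.cutParams
  · rw [Set.indicator_of_mem hc]
    obtain ⟨i, hi⟩ := Γ.mem_Ioo_of_mem_cutParams hc hs
    obtain ⟨κ, r, Y, Lg, hr, hw, hsub, hY, hLg, hsq, hout, hside, hval⟩ := Γ.exists_local_yPlus hi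
    obtain ⟨-, hR, hL⟩ := hval s hw.self_mem (Metric.mem_ball_self hr)
    have hL' := hL (deriv Γ.lam s) (by rw [sub_self, norm_zero]; positivity)
    have key := (((hWr.sub hR).div_const (2 * Γ.t)).sub ((hWl.sub hL').div_const (2 * Γ.t))).const_mul
      (1 / (2 * Real.pi * Complex.I))
    have e := Tendsto.limUnder_eq key
    rw [ρ₀]
    refine (congrArg (fun z => deriv Γ.lam s * z) e).trans ?_
    field_simp
    ring
  · rw [Set.indicator_of_notMem hc]
    have hR := (Γ.y₀_tendsto_of_notMem hc).comp (tendsto_offset_right (Γ.lam s) (deriv Γ.lam s))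
    have hL' := (Γ.y₀_tendsto_of_notMem hc).comp (tendsto_offset (Γ.lam s) (deriv Γ.lam s))
    have key := (((hWr.sub hR).div_const (2 * Γ.t)).sub ((hWl.sub hL').div_const (2 * Γ.t))).const_mul
      (1 / (2 * Real.pi * Complex.I))
    have e := Tendsto.limUnder_eq key
    rw [ρ₀]
    refine (congrArg (fun z => deriv Γ.lam s * z) e).trans ?_
    ring

/-- The singular weight `∑ₖ |s - s(aₖ)|^(-1/2)`. -/
def sing (s : ℝ) : ℝ := ∑ k, |s - Γ.bp k| ^ (-(1 / 2) : ℝ)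

theorem sing_nonneg (s : ℝ) : 0 ≤ Γ.sing s :=
  Finset.sum_nonneg fun _ _ => Real.rpow_nonneg (abs_nonneg _) _

theorem locallyIntegrable_sing : MeasureTheory.LocallyIntegrable Γ.sing :=
  MeasureTheory.locallyIntegrable_finsetSum _ fun k _ =>
    locallyIntegrable_abs_sub_rpow (Γ.bp k) (by norm_num)

/-- If `x` is as far from the branch points as the parameter `s` is, then `1 / √P(x)` is
controlled by the singular weight. -/
theorem exists_inv_le_sing {c : ℝ} (hc : 0 < c) : ∃ C > 0, ∀ (s : ℝ) (x y : ℂ), y ^ 2 = Γ.P.eval x →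
    (∀ k, c * |s - Γ.bp k| ≤ ‖x - Γ.lam (Γ.bp k)‖) → s ∉ Set.range Γ.bp → ‖y⁻¹‖ ≤ C * Γ.sing s := by
  obtain ⟨c', hc', h⟩ := exists_mul_abs_sub_le_prod Γ.bp_injective
  set N := Fintype.card (Fin (m + 1) × Bool)
  -- `|y|²` is the product of the distances from `x` to the branch points, so it is at least `c ^ N`
  -- times the product of the parameter distances. That product is at least `c'` times the least of
  -- them.
  refine ⟨(c ^ N * c') ^ (-(1 / 2) : ℝ), by positivity, fun s x y hy hx hs => ?_⟩
  obtain ⟨k, hk⟩ := h s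
  have hpos : 0 < |s - Γ.bp k| := abs_pos.2 (sub_ne_zero.2 fun h => hs ⟨k, h.symm⟩)
  have h1 : c ^ N * c' * |s - Γ.bp k| ≤ ‖y‖ ^ 2 := by
    rw [← norm_pow, hy, eval_P, norm_prod, mul_assoc]
    calc c ^ N * (c' * |s - Γ.bp k|) ≤ c ^ N * ∏ j, |s - Γ.bp j| := by gcongr
      _ = ∏ j, c * |s - Γ.bp j| := by
        rw [Finset.prod_mul_distrib, Finset.prod_const, Finset.card_univ]
      _ ≤ _ := Finset.prod_le_prod (fun _ _ => by positivity) fun j _ => hx j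
  have h2 : ‖y⁻¹‖ ≤ (c ^ N * c' * |s - Γ.bp k|) ^ (-(1 / 2) : ℝ) := by
    rw [norm_inv, Real.rpow_neg (by positivity)]
    refine inv_anti₀ (by positivity) ?_
    rw [← Real.sqrt_eq_rpow]
    exact Real.sqrt_le_iff.2 ⟨norm_nonneg _, h1⟩
  refine h2.trans ?_
  rw [Real.mul_rpow (by positivity) (by positivity)]
  refine mul_le_mul_of_nonneg_left ?_ (by positivity)
  exact Finset.single_le_sum (f := fun k => |s - Γ.bp k| ^ (-(1 / 2) : ℝ))
    (fun _ _ => Real.rpow_nonneg (abs_nonneg _) _) (Finset.mem_univ k)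

end CutCurve
end

/-! ### Removable singularities, local Cauchy transforms, densities on the cuts. -/

noncomputable section

/-- A function off a closed set with dense complement which extends holomorphically near each point
extends holomorphically. -/
theorem exists_holomorphic_extension {U K : Set ℂ} (hU : IsOpen U) (hK : IsClosed K)
    (hdense : Dense Kᶜ) {D : ℂ → ℂ} (hD : DifferentiableOn ℂ D (U \ K))
    (hloc : ∀ x ∈ U ∩ K, ∃ r > 0, ∃ g : ℂ → ℂ, DifferentiableOn ℂ g (Metric.ball x r) ∧
      ∀ z ∈ Metric.ball x r, z ∉ K → D z = g z) :
    ∃ F : ℂ → ℂ, DifferentiableOn ℂ F U ∧ ∀ z ∈ U \ K, F z = D z := by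
  have hbot : ∀ z, (𝓝[Kᶜ] z).NeBot := fun z => mem_closure_iff_nhdsWithin_neBot.1 (hdense z)
  have key : ∀ {x r} {g : ℂ → ℂ}, DifferentiableOn ℂ g (Metric.ball x r) →
      (∀ z ∈ Metric.ball x r, z ∉ K → D z = g z) → ∀ z ∈ Metric.ball x r,
        limUnder (𝓝[Kᶜ] z) D = g z := by
    intro x r g hg hDg z hz
    have := hbot z
    refine Tendsto.limUnder_eq (Tendsto.congr' ?_
      ((hg.continuousOn.continuousAt (Metric.isOpen_ball.mem_nhds hz)).tendsto.mono_left
        nhdsWithin_le_nhds))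
    filter_upwards [mem_nhdsWithin_of_mem_nhds (Metric.isOpen_ball.mem_nhds hz),
      self_mem_nhdsWithin] with u hu huK
    exact (hDg u hu huK).symm
  have hall : ∀ x ∈ U, ∃ r > 0, ∃ g : ℂ → ℂ, DifferentiableOn ℂ g (Metric.ball x r) ∧
      ∀ z ∈ Metric.ball x r, z ∉ K → D z = g z := by
    intro x hx
    by_cases hxK : x ∈ K
    · exact hloc x ⟨hx, hxK⟩
    · obtain ⟨r, hr, hball⟩ := Metric.isOpen_iff.1 (hU.sdiff hK) x ⟨hx, hxK⟩
      exact ⟨r, hr, D, hD.mono hball, fun _ _ _ => rfl⟩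
  -- Density makes the limit through the complement unique, so the local extensions agree with it
  -- and with each other.
  refine ⟨fun z => limUnder (𝓝[Kᶜ] z) D, fun x hx => ?_, fun z hz => ?_⟩
  · obtain ⟨r, hr, g, hg, hDg⟩ := hall x hx
    have h1 := hg.differentiableAt (Metric.ball_mem_nhds x hr)
    refine (h1.congr_of_eventuallyEq ?_).differentiableWithinAt
    filter_upwards [Metric.ball_mem_nhds x hr] with z hz using key hg hDg z hz
  · have := hbot z
    exact Tendsto.limUnder_eq ((hD.continuousOn.continuousAt
      ((hU.sdiff hK).mem_nhds hz)).tendsto.mono_left nhdsWithin_le_nhds)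

/-- An isolated singularity with at most polynomial growth is removable as soon as the function is
`o(1 / (z - a))` along some approach to it. -/
theorem exists_extension_of_pole_bound {F : ℂ → ℂ} {a : ℂ} {r C : ℝ} (hr : 0 < r) (n : ℕ)
    (hF : DifferentiableOn ℂ F (Metric.ball a r \ {a}))
    (hC : ∀ z ∈ Metric.ball a r \ {a}, ‖(z - a) ^ n * F z‖ ≤ C)
    {ι : Type*} {l : Filter ι} [l.NeBot] {γ : ι → ℂ} (hγ : Tendsto γ l (𝓝[≠] a))
    (hlim : Tendsto (fun h => (γ h - a) * F (γ h)) l (𝓝 0)) :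
    ∃ g : ℂ → ℂ, DifferentiableOn ℂ g (Metric.ball a r) ∧
      ∀ z ∈ Metric.ball a r \ {a}, F z = g z := by
  have hopen : IsOpen (Metric.ball a r \ {a}) := Metric.isOpen_ball.sdiff isClosed_singleton
  have hpunct : Metric.ball a r \ {a} ∈ 𝓝[≠] a := by
    rw [Set.sdiff_eq, Set.inter_comm]
    exact inter_mem_nhdsWithin _ (Metric.ball_mem_nhds a hr)
  have hmer : MeromorphicAt (fun z => (z - a) * F z) a := by
    refine ⟨n, ?_⟩
    refine Complex.analyticAt_of_differentiable_on_punctured_nhds_of_continuousAt ?_ ?_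
    · filter_upwards [hpunct] with z hz
      exact ((by fun_prop : DifferentiableAt ℂ (fun z => (z - a) ^ n) z)).smul
        ((by fun_prop : DifferentiableAt ℂ (fun z => z - a) z).mul
          (hF.differentiableAt (hopen.mem_nhds hz)))
    · simp only [ContinuousAt, sub_self, zero_mul, smul_zero]
      rw [tendsto_zero_iff_norm_tendsto_zero]
      have h1 : Tendsto (fun z : ℂ => C * ‖z - a‖) (𝓝 a) (𝓝 0) := by
        have : Continuous fun z : ℂ => C * ‖z - a‖ := by fun_prop
        simpa using this.tendsto a
      refine squeeze_zero' (Eventually.of_forall fun _ => norm_nonneg _) ?_ h1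
      filter_upwards [Metric.ball_mem_nhds a hr] with z hz
      by_cases hza : z = a
      · simp [hza]
      · rw [smul_eq_mul, mul_left_comm, norm_mul, mul_comm]
        exact mul_le_mul_of_nonneg_right (hC z ⟨hz, hza⟩) (norm_nonneg _)
  have hzero : Tendsto (fun z => (z - a) * F z) (𝓝[≠] a) (𝓝 0) := by
    -- A negative order would force blow-up along `γ`, and order zero would force a nonzero limit
    -- there. Both contradict `hlim`, so the order is positive.
    rcases lt_trichotomy (meromorphicOrderAt (fun z => (z - a) * F z) a) 0 with h | h | h
    · have := (tendsto_norm_cobounded_atTop.comp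
        (tendsto_cobounded_of_meromorphicOrderAt_neg h)).comp hγ
      exact absurd hlim.norm (not_tendsto_nhds_of_tendsto_atTop this _)
    · obtain ⟨c, hc, hlc⟩ := tendsto_ne_zero_of_meromorphicOrderAt_eq_zero hmer h
      exact absurd (tendsto_nhds_unique (hlc.comp hγ) hlim) hc
    · exact tendsto_zero_of_meromorphicOrderAt_pos h
  refine ⟨_, Complex.differentiableOn_update_limUnder_of_isLittleO (Metric.ball_mem_nhds a hr) hF ?_,
    fun z hz => (Function.update_of_ne hz.2 _ _).symm⟩
  rw [Asymptotics.isLittleO_iff_tendsto']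
  · have h1 : Tendsto (fun z => (z - a) * F z - (z - a) * F a) (𝓝[≠] a) (𝓝 (0 - (a - a) * F a)) :=
      hzero.sub (((by fun_prop : Continuous fun z => (z - a) * F a).tendsto a).mono_left
        nhdsWithin_le_nhds)
    simp only [sub_self, zero_mul] at h1
    refine h1.congr fun z => ?_
    rw [div_inv_eq_mul]; ring
  · filter_upwards [self_mem_nhdsWithin] with z hz h0
    exact absurd (sub_eq_zero.1 (inv_eq_zero.1 h0)) hz

theorem dslope_comm (H : ℂ → ℂ) (x z : ℂ) : dslope H x z = dslope H z x := by
  by_cases h : x = z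
  · rw [h]
  · rw [dslope_of_ne _ (Ne.symm h), dslope_of_ne _ h, slope_comm]

theorem norm_dslope_le {H : ℂ → ℂ} {B : Set ℂ} {M : ℝ} (hB : Convex ℝ B)
    (hH : ∀ z ∈ B, DifferentiableAt ℂ H z) (hM : ∀ z ∈ B, ‖deriv H z‖ ≤ M) {x z : ℂ}
    (hx : x ∈ B) (hz : z ∈ B) : ‖dslope H x z‖ ≤ M := by
  by_cases h : z = x
  · rw [h, dslope_same]; exact hM x hx
  · rw [dslope_of_ne _ h, slope_def_field, norm_div, div_le_iff₀ (norm_pos_iff.2 (sub_ne_zero.2 h))]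
    exact hB.norm_image_sub_le_of_norm_deriv_le hH hM hx hz

/-- The Cauchy transform of a holomorphic function along a piece of path differs from the function
times the transform of `1` by a holomorphic function. -/
theorem exists_local_cauchy {lam : ℝ → ℂ} (hlam : ContDiff ℝ 1 lam) {H : ℂ → ℂ} {z₀ : ℂ} {r α β : ℝ}
    (hαβ : α ≤ β) (hH : DifferentiableOn ℂ H (Metric.ball z₀ r))
    (hin : ∀ s ∈ Set.Icc α β, lam s ∈ Metric.ball z₀ r) :
    ∃ g : ℂ → ℂ, DifferentiableOn ℂ g (Metric.ball z₀ r) ∧ ∀ x ∈ Metric.ball z₀ r,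
      x ∉ lam '' Set.Icc α β →
      ∫ s in α..β, H (lam s) * deriv lam s / (lam s - x) =
        H x * (∫ s in α..β, deriv lam s / (lam s - x)) + g x := by
  have hlc := hlam.continuous
  have hdc := hlam.continuous_deriv le_rfl
  have hds : ∀ x ∈ Metric.ball z₀ r, DifferentiableOn ℂ (dslope H x) (Metric.ball z₀ r) :=
    fun x hx => (Complex.differentiableOn_dslope (Metric.isOpen_ball.mem_nhds hx)).2 hH
  have hcont : ∀ x ∈ Metric.ball z₀ r,
      ContinuousOn (fun s => dslope H x (lam s) * deriv lam s) (Set.Icc α β) := fun x hx =>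
    ((hds x hx).continuousOn.comp hlc.continuousOn hin).mul hdc.continuousOn
  have hI : Set.uIoc α β ⊆ Set.Icc α β := by
    rw [Set.uIoc_of_le hαβ]; exact Set.Ioc_subset_Icc_self
  -- The correction is the integral of the difference quotient `(H z - H x) / (z - x)`. It is
  -- holomorphic in `x` even on the path, since the quotient is symmetric and has a removable
  -- singularity.
  refine ⟨fun x => ∫ s in α..β, dslope H x (lam s) * deriv lam s, fun x hx => ?_, fun x hx hxn => ?_⟩
  · obtain ⟨ρ, hρr, hρ⟩ : ∃ ρ < r, ∀ z ∈ insert x (lam '' Set.Icc α β), dist z z₀ ≤ ρ := by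
      have hc : IsCompact (insert x (lam '' Set.Icc α β)) := (isCompact_Icc.image hlc).insert x
      obtain ⟨z, hz, hmax⟩ := hc.exists_isMaxOn ⟨x, Set.mem_insert _ _⟩
        (continuous_id.dist continuous_const : Continuous fun z => dist z z₀).continuousOn
      refine ⟨dist z z₀, ?_, fun w hw => hmax hw⟩
      rcases hz with rfl | ⟨s, hs, rfl⟩
      · exact hx
      · exact hin s hs
    obtain ⟨ρ', hρ', hρ'r⟩ := exists_between hρr
    have hsub : Metric.closedBall z₀ ρ' ⊆ Metric.ball z₀ r := Metric.closedBall_subset_ball hρ'r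
    have hHd : ∀ z ∈ Metric.closedBall z₀ ρ', DifferentiableAt ℂ H z := fun z hz =>
      hH.differentiableAt (Metric.isOpen_ball.mem_nhds (hsub hz))
    obtain ⟨M, hM⟩ := (isCompact_closedBall z₀ ρ').exists_bound_of_continuousOn
      (((hH.deriv Metric.isOpen_ball).continuousOn).mono hsub)
    have hδ : 0 < (ρ' - ρ) / 2 := by linarith
    set δ := (ρ' - ρ) / 2 with hδdef
    have hnear : ∀ u ∈ Metric.ball x δ, Metric.closedBall u δ ⊆ Metric.closedBall z₀ ρ' := by
      intro u hu w hw
      have h1 := hρ x (Set.mem_insert _ _)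
      have h2 := dist_triangle w u z₀
      have h3 := dist_triangle u x z₀
      rw [Metric.mem_ball] at hu
      rw [Metric.mem_closedBall] at hw ⊢
      linarith
    have hu_mem : ∀ u ∈ Metric.ball x δ, u ∈ Metric.closedBall z₀ ρ' := fun u hu =>
      hnear u hu (Metric.mem_closedBall_self hδ.le)
    have hs_mem : ∀ s ∈ Set.Icc α β, lam s ∈ Metric.closedBall z₀ ρ' := fun s hs =>
      (hρ _ (Set.mem_insert_of_mem _ ⟨s, hs, rfl⟩)).trans hρ'.le
    have hdiff : ∀ s ∈ Set.Icc α β, ∀ u ∈ Metric.ball x δ,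
        HasDerivAt (fun u => dslope H u (lam s) * deriv lam s)
          (deriv (dslope H (lam s)) u * deriv lam s) u := by
      intro s hs u hu
      rw [show (fun u => dslope H u (lam s) * deriv lam s)
        = fun u => dslope H (lam s) u * deriv lam s from funext fun u => by rw [dslope_comm]]
      exact (((hds _ (hin s hs)).differentiableAt (Metric.isOpen_ball.mem_nhds
        (hsub (hu_mem u hu)))).hasDerivAt).mul_const _
    have hmeas : ∀ u ∈ Metric.ball x δ, MeasureTheory.AEStronglyMeasurable
        (fun s => dslope H u (lam s) * deriv lam s)
        (MeasureTheory.volume.restrict (Set.uIoc α β)) := fun u hu =>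
      ((hcont u (hsub (hu_mem u hu))).mono hI).aestronglyMeasurable measurableSet_uIoc
    refine (intervalIntegral.hasDerivAt_integral_of_dominated_loc_of_deriv_le
      (F := fun u s => dslope H u (lam s) * deriv lam s)
      (F' := fun u s => deriv (dslope H (lam s)) u * deriv lam s)
      (bound := fun s => M / δ * ‖deriv lam s‖)
      (Metric.ball_mem_nhds x hδ) ?_ ?_ ?_ ?_ ?_ ?_).2.differentiableAt.differentiableWithinAt
    · filter_upwards [Metric.ball_mem_nhds x hδ] with u hu using hmeas u hu
    · exact ((hcont x hx).mono (by rw [Set.uIcc_of_le hαβ])).intervalIntegrable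
    -- Measurability in `s` of the `x`-derivative: it is the pointwise limit of slopes along a
    -- sequence that tends to `x`. The domination below is Cauchy's estimate on circles of radius
    -- `δ`, where the difference quotient is at most `M`.
    · have hlim : Tendsto (fun n : ℕ => x + ((δ / 2 * (1 / ((n : ℝ) + 1)) : ℝ) : ℂ)) atTop (𝓝[≠] x) := by
        refine tendsto_nhdsWithin_iff.2 ⟨?_, Eventually.of_forall fun n => ?_⟩
        · have h1 : Tendsto (fun n : ℕ => δ / 2 * (1 / ((n : ℝ) + 1))) atTop (𝓝 (δ / 2 * 0)) :=
            tendsto_one_div_add_atTop_nhds_zero_nat.const_mul _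
          rw [mul_zero] at h1
          have h2 := ((Complex.continuous_ofReal.tendsto 0).comp h1).const_add x
          simpa using h2
        · simp only [Set.mem_compl_iff, Set.mem_singleton_iff, add_eq_left, Complex.ofReal_eq_zero]
          positivity
      have hmem : ∀ n : ℕ, x + ((δ / 2 * (1 / ((n : ℝ) + 1)) : ℝ) : ℂ) ∈ Metric.ball x δ := by
        intro n
        rw [Metric.mem_ball, dist_eq_norm, add_sub_cancel_left, Complex.norm_real,
          Real.norm_of_nonneg (by positivity)]
        have : 1 / ((n : ℝ) + 1) ≤ 1 := by
          rw [div_le_one (by positivity)]; linarith [(Nat.cast_nonneg n : (0 : ℝ) ≤ n)]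
        nlinarith
      refine aestronglyMeasurable_of_tendsto_ae atTop
        (f := fun (n : ℕ) s => slope (fun u => dslope H u (lam s) * deriv lam s) x
          (x + ((δ / 2 * (1 / ((n : ℝ) + 1)) : ℝ) : ℂ))) (fun n => ?_) ?_
      · simp only [slope_def_field]
        exact ((hmeas _ (hmem n)).sub (hmeas x (Metric.mem_ball_self hδ))).div₀
          MeasureTheory.aestronglyMeasurable_const
      · refine (MeasureTheory.ae_restrict_iff' measurableSet_uIoc).2
          (Eventually.of_forall fun s hs => ?_)
        exact (hasDerivAt_iff_tendsto_slope.1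
          (hdiff s (hI hs) x (Metric.mem_ball_self hδ))).comp hlim
    · refine Eventually.of_forall fun s hs u hu => ?_
      rw [norm_mul]
      refine mul_le_mul_of_nonneg_right ?_ (norm_nonneg _)
      refine Complex.norm_deriv_le_of_forall_mem_sphere_norm_le hδ ?_ fun w hw => ?_
      · exact ((hds _ (hin s (hI hs))).mono (hsub.trans' (hnear u hu))).diffContOnCl_ball
          subset_rfl
      · exact norm_dslope_le (convex_closedBall z₀ ρ') hHd hM (hs_mem s (hI hs))
          (hnear u hu (Metric.sphere_subset_closedBall hw))
    · exact (hdc.norm.const_mul _).intervalIntegrable _ _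
    · exact Eventually.of_forall fun s hs u hu => hdiff s (hI hs) u hu
  · have hne : ∀ s ∈ Set.Icc α β, lam s ≠ x := fun s hs h => hxn ⟨s, hs, h⟩
    have hc1 : ContinuousOn (fun s => deriv lam s / (lam s - x)) (Set.uIcc α β) := by
      rw [Set.uIcc_of_le hαβ]
      exact hdc.continuousOn.div (hlc.sub continuous_const).continuousOn
        fun s hs => sub_ne_zero.2 (hne s hs)
    rw [← intervalIntegral.integral_const_mul, ← intervalIntegral.integral_add]
    · refine intervalIntegral.integral_congr fun s hs => ?_
      rw [Set.uIcc_of_le hαβ] at hs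
      have := sub_ne_zero.2 (hne s hs)
      rw [dslope_of_ne _ (hne s hs), slope_def_field]
      field_simp
      ring
    · exact hc1.intervalIntegrable.const_mul _
    · exact ((hcont x hx).mono (by rw [Set.uIcc_of_le hαβ])).intervalIntegrable

namespace CutCurve
variable {m : ℕ} {W : ℂ[X]} (Γ : CutCurve m W)

theorem dense_compl_cuts : Dense Γ.cutsᶜ := by
  refine (Γ.contDiff_lam.dense_compl_range_of_finrank_lt_finrank (by simp)).mono ?_
  rw [cuts_eq_image]
  exact Set.compl_subset_compl.2 (Set.image_subset_range _ _)

theorem exists_cutParams_subset_Icc : ∃ A B, A < B ∧ Γ.cutParams ⊆ Set.Ioo A B := by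
  obtain ⟨r, hr, h⟩ := Γ.isCompact_cutParams.isBounded.subset_ball_lt 0 0
  refine ⟨-r, r, by linarith, fun s hs => ?_⟩
  have := h hs
  rw [Metric.mem_ball, dist_zero_right, Real.norm_eq_abs] at this
  exact abs_lt.1 this

/-- `yPlus² = P` has simple zeros, and the path is bi-Lipschitz, so `1 / yPlus` has only inverse
square root singularities in the parameter. The densities `h dz / y₊` are integrable for this
reason. -/
theorem exists_norm_inv_yPlus_le (A B : ℝ) :
    ∃ C > 0, ∀ s ∈ Set.Icc A B, ‖(Γ.yPlus s)⁻¹‖ ≤ C * Γ.sing s := by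
  obtain ⟨A', B', -, h'⟩ := Γ.exists_cutParams_subset_Icc
  obtain ⟨c, hc, hbi⟩ := exists_mul_abs_sub_le_norm_sub Γ.contDiff_lam Γ.deriv_lam_ne_zero
    Γ.injective_lam (min A A') (max B B')
  obtain ⟨C, hC, h⟩ := Γ.exists_inv_le_sing hc
  refine ⟨C, hC, fun s hs => ?_⟩
  by_cases hb : s ∈ Set.range Γ.bp
  · obtain ⟨k, rfl⟩ := hb
    rw [yPlus_bp, inv_zero, norm_zero]
    exact mul_nonneg hC.le (Γ.sing_nonneg _)
  · refine h s (Γ.lam s) _ (Γ.yPlus_sq s) (fun k => hbi s ?_ _ ?_) hb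
    · exact ⟨(min_le_left _ _).trans hs.1, hs.2.trans (le_max_left _ _)⟩
    · have := h' (Γ.bp_mem_cutParams k)
      exact ⟨(min_le_right _ _).trans this.1.le, this.2.le.trans (le_max_right _ _)⟩

/-- The density `h dz / y₊` along the path. -/
def dens (h : ℂ[X]) (s : ℝ) : ℂ := h.eval (Γ.lam s) * deriv Γ.lam s / Γ.yPlus s

theorem continuous_deriv_lam : Continuous (deriv Γ.lam) := Γ.contDiff_lam.continuous_deriv le_rfl

theorem continuous_lam : Continuous Γ.lam := Γ.contDiff_lam.continuous

theorem measurable_dens (h : ℂ[X]) : Measurable (Γ.dens h) :=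
  (((h.continuous.comp Γ.continuous_lam).mul Γ.continuous_deriv_lam).measurable).div
    Γ.continuous_yPlus.measurable

theorem exists_norm_dens_le (h : ℂ[X]) (A B : ℝ) :
    ∃ C > 0, ∀ s ∈ Set.Icc A B, ‖Γ.dens h s‖ ≤ C * Γ.sing s := by
  obtain ⟨C, hC, hle⟩ := Γ.exists_norm_inv_yPlus_le A B
  obtain ⟨M, hM⟩ := (isCompact_Icc (a := A) (b := B)).exists_bound_of_continuousOn
    (((h.continuous.comp Γ.continuous_lam).mul Γ.continuous_deriv_lam).continuousOn)
  refine ⟨(|M| + 1) * C, by positivity, fun s hs => ?_⟩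
  rw [dens, div_eq_mul_inv, norm_mul, mul_assoc]
  have h1 := hM s hs
  have h2 : ‖eval (Γ.lam s) h * deriv Γ.lam s‖ ≤ |M| + 1 :=
    h1.trans ((le_abs_self M).trans (by linarith))
  exact mul_le_mul h2 (hle s hs) (norm_nonneg _) (by positivity)

theorem integrableOn_dens (h : ℂ[X]) (A B : ℝ) :
    MeasureTheory.IntegrableOn (Γ.dens h) (Set.Icc A B) := by
  obtain ⟨C, hC, hle⟩ := Γ.exists_norm_dens_le h A B
  refine MeasureTheory.Integrable.mono'
    ((Γ.locallyIntegrable_sing.integrableOn_isCompact isCompact_Icc).const_mul C)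
    (Γ.measurable_dens h).aestronglyMeasurable ?_
  exact (MeasureTheory.ae_restrict_iff' measurableSet_Icc).2 (Eventually.of_forall hle)

theorem measurableSet_cutParams : MeasurableSet Γ.cutParams := Γ.isCompact_cutParams.measurableSet

theorem integrableOn_dens_cutParams (h : ℂ[X]) :
    MeasureTheory.IntegrableOn (Γ.dens h) Γ.cutParams := by
  obtain ⟨A, B, -, hAB⟩ := Γ.exists_cutParams_subset_Icc
  exact (Γ.integrableOn_dens h A B).mono_set (hAB.trans Set.Ioo_subset_Icc_self)

/-- The Cauchy transform of `h dz / y₊`. -/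
def cauchy (h : ℂ[X]) (x : ℂ) : ℂ := ∫ s in Γ.cutParams, Γ.dens h s / (Γ.lam s - x)

theorem exists_le_norm_lam_sub {T : Set ℝ} (hT : IsCompact T) {x : ℂ} (hx : x ∉ Γ.lam '' T) :
    ∃ d > 0, ∀ s ∈ T, d ≤ ‖Γ.lam s - x‖ := by
  obtain ⟨d, hd, hball⟩ := Metric.isOpen_iff.1
    (hT.image Γ.continuous_lam).isClosed.isOpen_compl x hx
  refine ⟨d, hd, fun s hs => ?_⟩
  by_contra hlt
  exact hball (show Γ.lam s ∈ Metric.ball x d by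
    rw [Metric.mem_ball, dist_eq_norm]; exact not_le.1 hlt) ⟨s, hs, rfl⟩

theorem differentiableAt_integral_dens {T : Set ℝ} (hT : IsCompact T) (h : ℂ[X])
    (hint : MeasureTheory.IntegrableOn (Γ.dens h) T) {x : ℂ} (hx : x ∉ Γ.lam '' T) :
    DifferentiableAt ℂ (fun z => ∫ s in T, Γ.dens h s / (Γ.lam s - z)) x := by
  obtain ⟨d, hd, hle⟩ := Γ.exists_le_norm_lam_sub hT hx
  exact (hasDerivAt_integral_div_sub hT.measurableSet Γ.continuous_lam hint hd hle).differentiableAt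

theorem differentiableAt_cauchy (h : ℂ[X]) {x : ℂ} (hx : x ∉ Γ.cuts) :
    DifferentiableAt ℂ (Γ.cauchy h) x :=
  Γ.differentiableAt_integral_dens Γ.isCompact_cutParams h (Γ.integrableOn_dens_cutParams h)
    (by rwa [cuts_eq_image] at hx)

/-- The difference of the two sides of the dispersion relation. -/
def defect (h q : ℂ[X]) (x : ℂ) : ℂ :=
  h.eval x / Γ.y₀ x - q.eval x - 1 / (Real.pi * Complex.I) * Γ.cauchy h x

theorem differentiableOn_defect (h q : ℂ[X]) : DifferentiableOn ℂ (Γ.defect h q) Γ.cutsᶜ := by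
  intro x hx
  refine DifferentiableAt.differentiableWithinAt ?_
  have h1 := Γ.differentiableOn_y₀.differentiableAt (Γ.isClosed_cuts.isOpen_compl.mem_nhds hx)
  exact ((h.differentiableAt.div h1 (Γ.y₀_ne_zero hx)).sub q.differentiableAt).sub
    ((Γ.differentiableAt_cauchy h hx).const_mul _)


end CutCurve
end

/-! ### The defect of the dispersion relation across the interior of a cut. -/

noncomputable section

namespace CutCurve
variable {m : ℕ} {W : ℂ[X]} (Γ : CutCurve m W)

theorem notMem_image_diff {T : Set ℝ} {s : ℝ} (hs : s ∈ T) :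
    Γ.lam s ∉ Γ.lam '' (Γ.cutParams \ T) := by
  rw [Γ.injective_lam.mem_set_image]
  exact fun h => h.2 hs

theorem cauchy_eq_add (h : ℂ[X]) {T : Set ℝ} (hT : MeasurableSet T) {x : ℂ} (hx : x ∉ Γ.cuts) :
    Γ.cauchy h x = (∫ s in Γ.cutParams ∩ T, Γ.dens h s / (Γ.lam s - x)) +
      ∫ s in Γ.cutParams \ T, Γ.dens h s / (Γ.lam s - x) := by
  rw [cauchy, MeasureTheory.integral_inter_add_sdiff hT]
  rw [cuts_eq_image] at hx
  obtain ⟨d, hd, hle⟩ := Γ.exists_le_norm_lam_sub Γ.isCompact_cutParams hx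
  refine MeasureTheory.Integrable.mono' ((Γ.integrableOn_dens_cutParams h).norm.mul_const (1 / d))
    ((Γ.measurable_dens h).div
      (Γ.continuous_lam.sub continuous_const).measurable).aestronglyMeasurable ?_
  refine (MeasureTheory.ae_restrict_iff' Γ.measurableSet_cutParams).2
    (Eventually.of_forall fun s hs => ?_)
  rw [norm_div, div_eq_mul_one_div]
  gcongr
  exact hle s hs

/-- The defect extends holomorphically across the interior of a cut. -/
theorem exists_defect_extension_interior (h q : ℂ[X]) {i : Fin (m + 1)} {s₀ : ℝ}
    (hs₀ : s₀ ∈ Set.Ioo (Γ.sMinus i) (Γ.sPlus i)) :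
    ∃ r > 0, ∃ g : ℂ → ℂ, DifferentiableOn ℂ g (Metric.ball (Γ.lam s₀) r) ∧
      ∀ z ∈ Metric.ball (Γ.lam s₀) r, z ∉ Γ.cuts → Γ.defect h q z = g z := by
  obtain ⟨κ, r, Y, Lg, hr, hw, hsub, hY, hLg, hsq, hout, hside, hval⟩ := Γ.exists_local_yPlus hs₀
  have hne := Γ.deriv_lam_ne_zero s₀
  have hpi : (Real.pi : ℂ) ≠ 0 := Complex.ofReal_ne_zero.2 Real.pi_ne_zero
  -- a smaller window which is mapped into the ball
  obtain ⟨κ', hκ', hκle, hin⟩ : ∃ κ' > 0, κ' ≤ κ ∧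
      ∀ s ∈ Set.Icc (s₀ - κ') (s₀ + κ'), Γ.lam s ∈ Metric.ball (Γ.lam s₀) r := by
    obtain ⟨δ, hδ, hball⟩ := Metric.continuousAt_iff.1 (Γ.continuous_lam.continuousAt (x := s₀)) r hr
    refine ⟨min (δ / 2) κ, lt_min (half_pos hδ) hw.1, min_le_right _ _, fun s hs => ?_⟩
    refine hball ?_
    rw [Real.dist_eq, abs_lt]
    have := min_le_left (δ / 2) κ
    constructor <;> linarith [hs.1, hs.2]
  set a := s₀ - κ' with ha
  set b := s₀ + κ' with hb
  have hIsub : Set.Icc a b ⊆ Set.Icc (s₀ - κ) (s₀ + κ) :=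
    Set.Icc_subset_Icc (by linarith) (by linarith)
  have hIcut : Set.Icc a b ⊆ Γ.cutParams := fun s hs =>
    Set.mem_iUnion.2 ⟨i, Set.Ioo_subset_Icc_self (hsub (hIsub hs))⟩
  -- With the local branch `Y`, the function `h / y₀` is `H` on the left and `-H` on the right, and
  -- the density on the window is `H dz`.
  set H : ℂ → ℂ := fun x => h.eval x / Y x with hHdef
  have hH : DifferentiableOn ℂ H (Metric.ball (Γ.lam s₀) r) :=
    h.differentiable.differentiableOn.div hY fun x hx => (hsq x hx).2
  obtain ⟨g₁, hg₁, hg₁eq⟩ := exists_local_cauchy Γ.contDiff_lam (by linarith : a ≤ b) hH hin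
  -- the rest of the window and of the cuts
  have hcomp : IsCompact (Γ.cutParams \ Set.Ioo a b) := Γ.isCompact_cutParams.diff isOpen_Ioo
  have hfar : Γ.lam s₀ ∉ Γ.lam '' (Γ.cutParams \ Set.Ioo a b) :=
    Γ.notMem_image_diff ⟨by linarith, by linarith⟩
  obtain ⟨r', hr', hr'ball⟩ := Metric.isOpen_iff.1
    (hcomp.image Γ.continuous_lam).isClosed.isOpen_compl _ hfar
  -- Removing the open interval keeps the rest of the cuts compact; the two end points do not affect
  -- the integral.
  have hae : Γ.cutParams \ Set.Icc a b =ᵐ[MeasureTheory.volume] (Γ.cutParams \ Set.Ioo a b : Set ℝ) :=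
    (Filter.EventuallyEq.refl _ _).diff MeasureTheory.Ioo_ae_eq_Icc.symm
  have hwin : ∀ {α β : ℝ}, Set.Icc α β ⊆ Γ.cutParams \ Set.Ioo a b → α ≤ β →
      ∀ x ∈ Metric.ball (Γ.lam s₀) r',
      DifferentiableAt ℂ (fun z => ∫ s in α..β, deriv Γ.lam s / (Γ.lam s - z)) x := by
    intro α β hsub' hle x hx
    exact differentiableAt_integral_div_sub Γ.continuous_lam hle Γ.continuous_deriv_lam
      fun hx' => hr'ball hx (Set.image_mono hsub' hx')
  have hc1 : Set.Icc (s₀ - κ) a ⊆ Γ.cutParams \ Set.Ioo a b := fun s hs =>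
    ⟨Set.mem_iUnion.2 ⟨i, Set.Ioo_subset_Icc_self (hsub ⟨hs.1, by linarith [hs.2]⟩)⟩,
      fun h => by linarith [h.1, hs.2]⟩
  have hc2 : Set.Icc b (s₀ + κ) ⊆ Γ.cutParams \ Set.Ioo a b := fun s hs =>
    ⟨Set.mem_iUnion.2 ⟨i, Set.Ioo_subset_Icc_self (hsub ⟨by linarith [hs.1], hs.2⟩)⟩,
      fun h => by linarith [h.2, hs.1]⟩
  let R : ℂ → ℂ := fun z => (∫ s in (s₀ - κ)..a, deriv Γ.lam s / (Γ.lam s - z)) +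
    ∫ s in b..(s₀ + κ), deriv Γ.lam s / (Γ.lam s - z)
  let G₂ : ℂ → ℂ := fun z => ∫ s in Γ.cutParams \ Set.Ioo a b, Γ.dens h s / (Γ.lam s - z)
  -- The formula has no side dependence. On the two sides `h / y₀` is `± H`, and `1 / (π I)` times
  -- the contribution `± π I * H` of the logarithm is subtracted from it, so the jumps cancel.
  refine ⟨min r r', lt_min hr hr', fun z => - q.eval z - 1 / (Real.pi * Complex.I) *
    (H z * (Lg z - R z) + g₁ z + G₂ z), ?_, ?_⟩
  · intro x hx
    have hx1 := Metric.ball_subset_ball (min_le_left r r') hx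
    have hx2 := Metric.ball_subset_ball (min_le_right r r') hx
    have ho := Metric.isOpen_ball.mem_nhds hx1
    refine DifferentiableAt.differentiableWithinAt ?_
    refine q.differentiableAt.neg.sub (DifferentiableAt.const_mul ?_ _)
    refine ((hH.differentiableAt ho).mul ((hLg.differentiableAt ho).sub ?_)).add
      (hg₁.differentiableAt ho) |>.add ?_
    · exact (hwin hc1 (by linarith) x hx2).add (hwin hc2 (by linarith) x hx2)
    · exact Γ.differentiableAt_integral_dens hcomp h
        ((Γ.integrableOn_dens_cutParams h).mono_set Set.sdiff_subset) fun hx' => hr'ball hx2 hx'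
  · intro x hx hxc
    have hx1 := Metric.ball_subset_ball (min_le_left r r') hx
    have hxI : ∀ s ∈ Set.Icc (s₀ - κ) (s₀ + κ), Γ.lam s - x ≠ 0 := fun s hs h0 => by
      refine hxc ?_
      rw [← sub_eq_zero.1 h0]
      exact Γ.lam_mem_cuts_iff.2 (Set.mem_iUnion.2 ⟨i, Set.Ioo_subset_Icc_self (hsub hs)⟩)
    have hx' : x ∉ Γ.lam '' Set.Icc a b := by
      rintro ⟨s, hs, rfl⟩
      exact hxI s (hIsub hs) (sub_self _)
    have hx'' : x ∉ Γ.lam '' Set.Icc (s₀ - κ) (s₀ + κ) := by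
      rintro ⟨s, hs, rfl⟩
      exact hxI s hs (sub_self _)
    have hci : ∀ {α β}, α ∈ Set.Icc (s₀ - κ) (s₀ + κ) → β ∈ Set.Icc (s₀ - κ) (s₀ + κ) →
        IntervalIntegrable (fun s => deriv Γ.lam s / (Γ.lam s - x)) MeasureTheory.volume α β := by
      intro α β hα hβ
      refine ContinuousOn.intervalIntegrable ?_
      exact Γ.continuous_deriv_lam.continuousOn.div
        (Γ.continuous_lam.sub continuous_const).continuousOn
        fun s hs => hxI s (Set.uIcc_subset_Icc hα hβ hs)
    have hκ := hw.1
    have m1 : s₀ - κ ∈ Set.Icc (s₀ - κ) (s₀ + κ) := ⟨le_rfl, by linarith⟩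
    have m2 : s₀ + κ ∈ Set.Icc (s₀ - κ) (s₀ + κ) := ⟨by linarith, le_rfl⟩
    have m3 : a ∈ Set.Icc (s₀ - κ) (s₀ + κ) := ⟨by linarith, by linarith⟩
    have m4 : b ∈ Set.Icc (s₀ - κ) (s₀ + κ) := ⟨by linarith, by linarith⟩
    have hℓ : ∫ s in a..b, deriv Γ.lam s / (Γ.lam s - x)
        = (∫ s in (s₀ - κ)..(s₀ + κ), deriv Γ.lam s / (Γ.lam s - x)) - R x := by
      rw [← intervalIntegral.integral_add_adjacent_intervals (hci m1 m3) (hci m3 m2),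
        ← intervalIntegral.integral_add_adjacent_intervals (hci m3 m4) (hci m4 m2)]
      simp only [R]
      ring
    have hG : Γ.cauchy h x = (H x * (∫ s in a..b, deriv Γ.lam s / (Γ.lam s - x)) + g₁ x) + G₂ x := by
      have hG₂ : ∫ s in Γ.cutParams \ Set.Icc a b, Γ.dens h s / (Γ.lam s - x) = G₂ x :=
        MeasureTheory.setIntegral_congr_set hae
      rw [Γ.cauchy_eq_add h (measurableSet_Icc (a := a) (b := b)) hxc, hG₂,
        Set.inter_eq_right.2 hIcut, ← hg₁eq x hx1 hx', MeasureTheory.integral_Icc_eq_integral_Ioc,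
        ← intervalIntegral.integral_of_le (by linarith)]
      congr 1
      refine intervalIntegral.integral_congr fun s hs => ?_
      rw [Set.uIcc_of_le (by linarith)] at hs
      simp only [dens, hHdef]
      rw [(hval s (hIsub hs) (hin s hs)).1]
      ring
    rw [defect, hG, hℓ]
    rcases hw.left_or_right Γ.contDiff_lam hne subset_rfl hx'' with hL | hR
    · obtain ⟨e1, e2⟩ := (hside x hx1).1 hL
      have := (hsq x hx1).2
      rw [e1, e2]
      simp only [hHdef]
      field_simp
      ring
    · obtain ⟨e1, e2⟩ := (hside x hx1).2 hR
      have := (hsq x hx1).2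
      rw [e1, e2]
      simp only [hHdef]
      field_simp
      ring

/-- `P` without the root at the branch point `k`. -/
def Q (k : Fin (m + 1) × Bool) (x : ℂ) : ℂ := ∏ j ∈ Finset.univ.erase k, (x - Γ.lam (Γ.bp j))

theorem eval_P_eq_mul (k : Fin (m + 1) × Bool) (x : ℂ) :
    Γ.P.eval x = (x - Γ.lam (Γ.bp k)) * Γ.Q k x := by
  rw [eval_P, Q, Finset.mul_prod_erase _ (fun j => x - Γ.lam (Γ.bp j)) (Finset.mem_univ k)]

theorem Q_ne_zero (k : Fin (m + 1) × Bool) : Γ.Q k (Γ.lam (Γ.bp k)) ≠ 0 := by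
  refine Finset.prod_ne_zero_iff.2 fun j hj h => Finset.ne_of_mem_erase hj ?_
  exact (Γ.bp_injective (Γ.injective_lam (sub_eq_zero.1 h))).symm

theorem differentiable_Q (k : Fin (m + 1) × Bool) : Differentiable ℂ (Γ.Q k) := by
  unfold Q; fun_prop

/-- Near a branch point the cuts are a single piece of path that ends there. -/
theorem exists_cutParams_inter_eq (k : Fin (m + 1) × Bool) : ∃ κ₀ > 0, ∀ κ, 0 < κ → κ ≤ κ₀ →
    ∃ α β, α < β ∧ Γ.cutParams ∩ Set.Icc (Γ.bp k - κ) (Γ.bp k + κ) = Set.Icc α β ∧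
      (α = Γ.bp k ∨ β = Γ.bp k) := by
  obtain ⟨i, b⟩ := k
  have hlt := Γ.sMinus_lt_sPlus i
  have hclosed : IsClosed (⋃ j ∈ {j | j ≠ i}, Set.Icc (Γ.sMinus j) (Γ.sPlus j)) :=
    (Set.toFinite {j | j ≠ i}).isClosed_biUnion fun _ _ => isClosed_Icc
  have hnot : Γ.bp (i, b) ∉ ⋃ j ∈ {j | j ≠ i}, Set.Icc (Γ.sMinus j) (Γ.sPlus j) := by
    intro h
    obtain ⟨j, hj, hmem⟩ := Set.mem_iUnion₂.1 h
    rcases lt_or_gt_of_ne hj with h1 | h1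
    · have := Γ.sPlus_lt_sMinus _ _ h1
      cases b <;> simp only [bp, Set.mem_Icc] at hmem <;> linarith [hmem.1, hmem.2]
    · have := Γ.sPlus_lt_sMinus _ _ h1
      cases b <;> simp only [bp, Set.mem_Icc] at hmem <;> linarith [hmem.1, hmem.2]
  obtain ⟨ε, hε, hball⟩ := Metric.isOpen_iff.1 hclosed.isOpen_compl _ hnot
  refine ⟨min (ε / 2) (Γ.sPlus i - Γ.sMinus i), lt_min (half_pos hε) (sub_pos.2 hlt),
    fun κ hκ hκle => ?_⟩
  have hκ1 := hκle.trans (min_le_left _ _)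
  have hκ2 := hκle.trans (min_le_right _ _)
  have hinter : Γ.cutParams ∩ Set.Icc (Γ.bp (i, b) - κ) (Γ.bp (i, b) + κ)
      = Set.Icc (Γ.sMinus i) (Γ.sPlus i) ∩ Set.Icc (Γ.bp (i, b) - κ) (Γ.bp (i, b) + κ) := by
    ext s
    refine ⟨fun ⟨h1, h2⟩ => ⟨?_, h2⟩, fun ⟨h1, h2⟩ => ⟨Set.mem_iUnion.2 ⟨i, h1⟩, h2⟩⟩
    obtain ⟨j, hj⟩ := Set.mem_iUnion.1 h1
    by_cases hji : j = i
    · exact hji ▸ hj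
    · exfalso
      refine hball (?_ : s ∈ Metric.ball _ ε) (Set.mem_iUnion₂.2 ⟨j, hji, hj⟩)
      rw [Metric.mem_ball, Real.dist_eq, abs_lt]
      constructor <;> linarith [h2.1, h2.2]
  rw [hinter, Set.Icc_inter_Icc]
  cases b
  · refine ⟨Γ.sMinus i, Γ.sMinus i + κ, by linarith, ?_, Or.inl rfl⟩
    simp only [bp]
    rw [sup_of_le_left (by linarith), inf_of_le_right (by linarith)]
  · refine ⟨Γ.sPlus i - κ, Γ.sPlus i, by linarith, ?_, Or.inr rfl⟩
    simp only [bp]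
    rw [sup_of_le_right (by linarith), inf_of_le_left (by linarith)]

end CutCurve
end

/-! ### Growth of Cauchy transforms at a branch point. -/

noncomputable section

/-- A crude bound by a simple pole is enough here, since only polynomial growth at the branch points
is needed. -/
theorem norm_log_le (w : ℂ) (hw : w ≠ 0) : ‖Complex.log w‖ ≤ ‖w‖ + ‖w‖⁻¹ + Real.pi := by
  have hp := norm_pos_iff.2 hw
  have h1 := Complex.norm_le_abs_re_add_abs_im (Complex.log w)
  rw [Complex.log_re, Complex.log_im] at h1
  have h2 := Complex.abs_arg_le_pi w
  have h3 := Real.log_le_sub_one_of_pos hp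
  have h4 := Real.log_le_sub_one_of_pos (inv_pos.2 hp)
  rw [Real.log_inv] at h4
  have h5 : |Real.log ‖w‖| ≤ ‖w‖ + ‖w‖⁻¹ := by
    have := inv_pos.2 hp
    rw [abs_le]
    constructor <;> linarith
  linarith

namespace CutCurve
variable {m : ℕ} {W : ℂ[X]} (Γ : CutCurve m W)

theorem hasDerivAt_lam (s : ℝ) : HasDerivAt Γ.lam (deriv Γ.lam s) s :=
  (Γ.contDiff_lam.differentiable (by norm_num) s).hasDerivAt

theorem hasDerivAt_yPlus {s : ℝ} (hs : s ∉ Set.range Γ.bp) :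
    HasDerivAt Γ.yPlus (Γ.P.derivative.eval (Γ.lam s) * deriv Γ.lam s / (2 * Γ.yPlus s)) s :=
  HasDerivAt.of_sq (p := fun s => Γ.P.eval (Γ.lam s)) Γ.continuous_yPlus.continuousAt
    (Eventually.of_forall Γ.yPlus_sq) ((Γ.P.hasDerivAt _).comp s (Γ.hasDerivAt_lam s))
    (Γ.yPlus_ne_zero hs)

theorem Q_eq_zero_of_ne {k : Fin (m + 1) × Bool} {j : Fin (m + 1) × Bool} (h : j ≠ k) :
    Γ.Q k (Γ.lam (Γ.bp j)) = 0 :=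
  Finset.prod_eq_zero (Finset.mem_erase.2 ⟨h, Finset.mem_univ j⟩) (sub_self _)

/-- With `a` the branch point, `y₊² = (z - a) Q` turns the singular factor `(z - a) / y₊` of the
derivative into `y₊ / Q`, which is continuous up to the branch point. At `a` itself the difference
quotient carries a factor `y₊`, which tends to `0`. -/
theorem hasDerivAt_sub_mul_yPlus (k : Fin (m + 1) × Bool) {s : ℝ} (hs : Γ.Q k (Γ.lam s) ≠ 0) :
    HasDerivAt (fun s => (Γ.lam s - Γ.lam (Γ.bp k)) * Γ.yPlus s)
      (deriv Γ.lam s * Γ.yPlus s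
        + Γ.P.derivative.eval (Γ.lam s) * deriv Γ.lam s * Γ.yPlus s / (2 * Γ.Q k (Γ.lam s))) s := by
  by_cases hk : s = Γ.bp k
  · subst hk
    rw [yPlus_bp, mul_zero, mul_zero, zero_div, add_zero, hasDerivAt_iff_tendsto_slope]
    have h1 := hasDerivAt_iff_tendsto_slope.1 (Γ.hasDerivAt_lam (Γ.bp k))
    have h2 : Tendsto Γ.yPlus (𝓝[≠] (Γ.bp k)) (𝓝 0) := by
      have := Γ.continuous_yPlus.tendsto (Γ.bp k)
      rw [yPlus_bp] at this
      exact this.mono_left nhdsWithin_le_nhds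
    have h3 := h1.mul h2
    rw [mul_zero] at h3
    refine h3.congr fun u => ?_
    rw [slope_def_module, slope_def_module, sub_self, zero_mul, sub_zero, smul_mul_assoc]
  · have hb : s ∉ Set.range Γ.bp := by
      rintro ⟨j, rfl⟩
      exact hs (Γ.Q_eq_zero_of_ne fun h => hk (by rw [h]))
    refine (((Γ.hasDerivAt_lam s).sub_const _).mul (Γ.hasDerivAt_yPlus hb)).congr_deriv ?_
    have hy := Γ.yPlus_ne_zero hb
    have hsq : Γ.yPlus s ^ 2 = (Γ.lam s - Γ.lam (Γ.bp k)) * Γ.Q k (Γ.lam s) := by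
      rw [yPlus_sq, eval_P_eq_mul _ k]
    congr 1
    field_simp
    rw [hsq]
    ring

/-- `(z - a)² h / y₊` is Lipschitz along the path near the branch point `a`. -/
theorem exists_lipschitz (h : ℂ[X]) (k : Fin (m + 1) × Bool) {α β : ℝ}
    (hQ : ∀ s ∈ Set.Icc α β, Γ.Q k (Γ.lam s) ≠ 0) :
    ∃ L, ∀ s ∈ Set.Icc α β, ∀ s' ∈ Set.Icc α β,
      ‖(Γ.lam s - Γ.lam (Γ.bp k)) * Γ.yPlus s * (h.eval (Γ.lam s) / Γ.Q k (Γ.lam s))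
        - (Γ.lam s' - Γ.lam (Γ.bp k)) * Γ.yPlus s' * (h.eval (Γ.lam s') / Γ.Q k (Γ.lam s'))‖
        ≤ L * ‖s - s'‖ := by
  have hQd : Differentiable ℂ (deriv (Γ.Q k)) := (Γ.differentiable_Q k).deriv
  have hd : ∀ s ∈ Set.Icc α β, HasDerivAt (fun s => (Γ.lam s - Γ.lam (Γ.bp k)) * Γ.yPlus s
      * (h.eval (Γ.lam s) / Γ.Q k (Γ.lam s))) ((deriv Γ.lam s * Γ.yPlus s
        + Γ.P.derivative.eval (Γ.lam s) * deriv Γ.lam s * Γ.yPlus s / (2 * Γ.Q k (Γ.lam s)))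
        * (h.eval (Γ.lam s) / Γ.Q k (Γ.lam s)) + (Γ.lam s - Γ.lam (Γ.bp k)) * Γ.yPlus s
        * ((h.derivative.eval (Γ.lam s) * deriv Γ.lam s * Γ.Q k (Γ.lam s)
          - h.eval (Γ.lam s) * (deriv (Γ.Q k) (Γ.lam s) * deriv Γ.lam s))
          / Γ.Q k (Γ.lam s) ^ 2)) s := fun s hs =>
    (Γ.hasDerivAt_sub_mul_yPlus k (hQ s hs)).mul
      (((h.hasDerivAt _).comp s (Γ.hasDerivAt_lam s)).div
        (((Γ.differentiable_Q k _).hasDerivAt).comp s (Γ.hasDerivAt_lam s)) (hQ s hs))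
  have c1 := Γ.continuous_lam
  have c2 := Γ.continuous_deriv_lam
  have c3 := Γ.continuous_yPlus
  have c4 : Continuous fun s => Γ.Q k (Γ.lam s) := (Γ.differentiable_Q k).continuous.comp c1
  have c5 : Continuous fun s => deriv (Γ.Q k) (Γ.lam s) := hQd.continuous.comp c1
  have c6 : Continuous fun s => h.eval (Γ.lam s) := h.continuous.comp c1
  have c7 : Continuous fun s => h.derivative.eval (Γ.lam s) := h.derivative.continuous.comp c1
  have c8 : Continuous fun s => Γ.P.derivative.eval (Γ.lam s) := Γ.P.derivative.continuous.comp c1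
  obtain ⟨L, hL⟩ := (isCompact_Icc (a := α) (b := β)).exists_bound_of_continuousOn
    (f := fun s => (deriv Γ.lam s * Γ.yPlus s
        + Γ.P.derivative.eval (Γ.lam s) * deriv Γ.lam s * Γ.yPlus s / (2 * Γ.Q k (Γ.lam s)))
        * (h.eval (Γ.lam s) / Γ.Q k (Γ.lam s)) + (Γ.lam s - Γ.lam (Γ.bp k)) * Γ.yPlus s
        * ((h.derivative.eval (Γ.lam s) * deriv Γ.lam s * Γ.Q k (Γ.lam s)
          - h.eval (Γ.lam s) * (deriv (Γ.Q k) (Γ.lam s) * deriv Γ.lam s))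
          / Γ.Q k (Γ.lam s) ^ 2)) (by
      refine ContinuousOn.add (ContinuousOn.mul (ContinuousOn.add ?_ ?_) ?_) (ContinuousOn.mul ?_ ?_)
      · exact (c2.mul c3).continuousOn
      · exact ((c8.mul c2).mul c3).continuousOn.div (c4.const_mul 2).continuousOn
          fun s hs => mul_ne_zero two_ne_zero (hQ s hs)
      · exact c6.continuousOn.div c4.continuousOn hQ
      · exact ((c1.sub continuous_const).mul c3).continuousOn
      · exact (((c7.mul c2).mul c4).sub (c6.mul (c5.mul c2))).continuousOn.div
          (c4.pow 2).continuousOn fun s hs => pow_ne_zero 2 (hQ s hs))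
  exact ⟨L, fun s hs s' hs' => (convex_Icc α β).norm_image_sub_le_of_norm_hasDerivWithin_le
    (fun x hx => (hd x hx).hasDerivWithinAt) hL hs' hs⟩

/-- Off the cuts the squared modulus is `‖z - a‖ / ‖Q z‖`, since the zero of `P` at `a` is simple.
On the cuts the quotient is `0` by the value given to `y₀` there. -/
theorem tendsto_sub_div_y₀ (k : Fin (m + 1) × Bool) :
    Tendsto (fun z => (z - Γ.lam (Γ.bp k)) / Γ.y₀ z) (𝓝 (Γ.lam (Γ.bp k))) (𝓝 0) := by
  set a := Γ.lam (Γ.bp k)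
  have h1 : Tendsto (fun z => Real.sqrt (‖z - a‖ / ‖Γ.Q k z‖)) (𝓝 a) (𝓝 0) := by
    have hc : ContinuousAt (fun z => Real.sqrt (‖z - a‖ / ‖Γ.Q k z‖)) a := by
      refine ContinuousAt.sqrt (ContinuousAt.div (by fun_prop) ?_ ?_)
      · exact (Γ.differentiable_Q k).continuous.continuousAt.norm
      · exact norm_ne_zero_iff.2 (Γ.Q_ne_zero k)
    simpa [ContinuousAt] using hc.tendsto
  rw [tendsto_zero_iff_norm_tendsto_zero]
  refine squeeze_zero (fun _ => norm_nonneg _) (fun z => ?_) h1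
  by_cases hz : z ∈ Γ.cuts
  · rw [Γ.y₀_of_mem hz, div_zero, norm_zero]; exact Real.sqrt_nonneg _
  · refine Real.le_sqrt_of_sq_le (le_of_eq ?_)
    have hP := Γ.eval_P_ne_zero_of_notMem hz
    rw [eval_P_eq_mul _ k] at hP
    have h1 := left_ne_zero_of_mul hP
    rw [← norm_pow, div_pow, Γ.y₀_sq' hz, eval_P_eq_mul _ k, ← norm_div, sq, mul_div_mul_left _ _ h1]

/-- The Cauchy transform has at most polynomial growth at the branch points. -/
theorem exists_pole_bound_cauchy (h : ℂ[X]) (k : Fin (m + 1) × Bool) :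
    ∃ ρ > 0, ∃ C, ∀ z ∈ Metric.ball (Γ.lam (Γ.bp k)) ρ, z ∉ Γ.cuts →
      ‖(z - Γ.lam (Γ.bp k)) ^ 3 * Γ.cauchy h z‖ ≤ C := by
  set s₀ := Γ.bp k with hs₀
  set a := Γ.lam s₀ with ha
  set v := deriv Γ.lam s₀ with hv
  have hne : v ≠ 0 := Γ.deriv_lam_ne_zero s₀
  have hvp := norm_pos_iff.2 hne
  have hlam := Γ.contDiff_lam
  obtain ⟨κ₀, hκ₀, hinter⟩ := Γ.exists_cutParams_inter_eq k
  have hQopen : {s | Γ.Q k (Γ.lam s) ≠ 0} ∈ 𝓝 s₀ :=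
    (isOpen_ne_fun ((Γ.differentiable_Q k).continuous.comp Γ.continuous_lam)
      continuous_const).mem_nhds (Γ.Q_ne_zero k)
  obtain ⟨δ, hδ, hδQ⟩ := Metric.mem_nhds_iff.1 hQopen
  obtain ⟨κ, hκ, hκle, hw⟩ := exists_isWindow hlam Γ.deriv_lam_ne_zero s₀
    (lt_min hκ₀ (half_pos hδ))
  obtain ⟨α, β, hαβ, hI, hends⟩ := hinter κ hκ (hκle.trans (min_le_left _ _))
  have hIwin : Set.Icc α β ⊆ Set.Icc (s₀ - κ) (s₀ + κ) := hI ▸ Set.inter_subset_right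
  have hIcut : Set.Icc α β ⊆ Γ.cutParams := hI ▸ Set.inter_subset_left
  have hQ : ∀ s ∈ Set.Icc α β, Γ.Q k (Γ.lam s) ≠ 0 := by
    intro s hs
    refine hδQ (?_ : s ∈ Metric.ball s₀ δ)
    have h1 := hIwin hs
    have h2 := hκle.trans (min_le_right _ _)
    rw [Metric.mem_ball, Real.dist_eq, abs_lt]
    constructor <;> linarith [h1.1, h1.2]
  obtain ⟨L, hL⟩ := Γ.exists_lipschitz h k hQ
  set φ : ℝ → ℂ := fun s => (Γ.lam s - a) * Γ.yPlus s * (h.eval (Γ.lam s) / Γ.Q k (Γ.lam s)) with hφ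
  -- the far part
  have hcompact : IsCompact (Γ.cutParams \ Set.Ioo (s₀ - κ) (s₀ + κ)) :=
    Γ.isCompact_cutParams.diff isOpen_Ioo
  obtain ⟨d, hd, hfar⟩ := Γ.exists_le_norm_lam_sub hcompact
    (Γ.notMem_image_diff (T := Set.Ioo (s₀ - κ) (s₀ + κ)) (s := s₀) ⟨by linarith, by linarith⟩)
  obtain ⟨d', hd', hend⟩ : ∃ d' > 0, ∀ e ∈ ({α, β} : Set ℝ), e = s₀ ∨ d' ≤ ‖Γ.lam e - a‖ := by
    rcases hends with h1 | h1
    · refine ⟨‖Γ.lam β - a‖, norm_pos_iff.2 (sub_ne_zero.2 (Γ.injective_lam.ne ?_)), ?_⟩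
      · exact fun h2 => hαβ.ne (h1.trans h2.symm)
      · rintro e (rfl | rfl)
        · exact Or.inl h1
        · exact Or.inr le_rfl
    · refine ⟨‖Γ.lam α - a‖, norm_pos_iff.2 (sub_ne_zero.2 (Γ.injective_lam.ne ?_)), ?_⟩
      · exact fun h2 => hαβ.ne (h2.trans h1.symm)
      · rintro e (rfl | rfl)
        · exact Or.inr le_rfl
        · exact Or.inl h1
  -- For `‖z - a‖ < ρ`, the bound `d / 2` keeps `z` away from the far part of the cuts. The bound
  -- `d' / 2` makes the end of the piece other than `a` at least as far from `z` as `a` is.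
  set ρ := min 1 (min (d / 2) (d' / 2)) with hρ
  have hρ0 : 0 < ρ := by positivity
  have hρ1 : ρ ≤ 1 := min_le_left _ _
  have hρd : ρ ≤ d / 2 := (min_le_right _ _).trans (min_le_left _ _)
  have hρd' : ρ ≤ d' / 2 := (min_le_right _ _).trans (min_le_right _ _)
  have hdint := Γ.integrableOn_dens_cutParams h
  have hφc : ContinuousOn φ (Set.Icc α β) :=
    ((Γ.continuous_lam.sub continuous_const).mul Γ.continuous_yPlus).continuousOn.mul
      ((h.continuous.comp Γ.continuous_lam).continuousOn.div
        ((Γ.differentiable_Q k).continuous.comp Γ.continuous_lam).continuousOn hQ)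
  obtain ⟨Mφ, hMφ⟩ := isCompact_Icc.exists_bound_of_continuousOn hφc
  obtain ⟨Mlam, hMlam⟩ := (isCompact_Icc (a := α) (b := β)).exists_bound_of_continuousOn
    Γ.continuous_lam.continuousOn
  have hαm : α ∈ Set.Icc α β := ⟨le_rfl, hαβ.le⟩
  have hβm : β ∈ Set.Icc α β := ⟨hαβ.le, le_rfl⟩
  have hMφ0 : 0 ≤ Mφ := (norm_nonneg _).trans (hMφ α hαm)
  have hMlam0 : 0 ≤ Mlam := (norm_nonneg _).trans (hMlam α hαm)
  -- the logarithm at an end point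
  set E := (Mlam + ‖a‖ + 1) / ‖v‖ + ‖v‖ + Real.pi with hE
  have hlog : ∀ z ∈ Metric.ball a ρ, ∀ c : ℂ, ‖c‖ = 1 / ‖v‖ → ∀ e ∈ ({α, β} : Set ℝ),
      Γ.lam e - z ≠ 0 → ‖z - a‖ * ‖Complex.log (c * (Γ.lam e - z))‖ ≤ E := by
    intro z hz c hc e he hez
    rw [Metric.mem_ball, dist_eq_norm] at hz
    have hem : e ∈ Set.Icc α β := by rcases he with rfl | rfl <;> assumption
    have hcne : c ≠ 0 := norm_pos_iff.1 (by rw [hc]; positivity)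
    have h1 := norm_log_le (c * (Γ.lam e - z)) (mul_ne_zero hcne hez)
    rw [norm_mul, hc] at h1
    have hp := norm_pos_iff.2 hez
    -- At either end of the piece, `‖z - a‖` therefore absorbs the simple pole in the bound for the
    -- logarithm.
    have h2 : ‖z - a‖ ≤ ‖Γ.lam e - z‖ := by
      rcases hend e he with rfl | h2
      · rw [norm_sub_rev]
      · have : ‖Γ.lam e - a‖ ≤ ‖Γ.lam e - z‖ + ‖z - a‖ := by
          simpa using norm_add_le (Γ.lam e - z) (z - a)
        linarith
    have h3 : ‖Γ.lam e - z‖ ≤ Mlam + ‖a‖ + 1 := by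
      have e1 : Γ.lam e - z = Γ.lam e - a - (z - a) := by ring
      have e2 := norm_sub_le (Γ.lam e - a) (z - a)
      have e3 := norm_sub_le (Γ.lam e) a
      have e4 := hMlam e hem
      rw [e1]; linarith
    have h4 : ‖z - a‖ * (1 / ‖v‖ * ‖Γ.lam e - z‖)⁻¹ ≤ ‖v‖ := by
      rw [mul_inv, one_div, inv_inv, ← mul_assoc, ← div_eq_mul_inv, div_le_iff₀ hp, mul_comm]
      gcongr
    have h5 : ‖z - a‖ * (1 / ‖v‖ * ‖Γ.lam e - z‖) ≤ (Mlam + ‖a‖ + 1) / ‖v‖ := by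
      calc ‖z - a‖ * (1 / ‖v‖ * ‖Γ.lam e - z‖) ≤ 1 * (1 / ‖v‖ * (Mlam + ‖a‖ + 1)) := by
            gcongr; linarith
        _ = _ := by ring
    have h6 : ‖z - a‖ * Real.pi ≤ Real.pi := by
      have := Real.pi_pos
      nlinarith
    calc ‖z - a‖ * ‖Complex.log (c * (Γ.lam e - z))‖
        ≤ ‖z - a‖ * (1 / ‖v‖ * ‖Γ.lam e - z‖ + (1 / ‖v‖ * ‖Γ.lam e - z‖)⁻¹ + Real.pi) := by gcongr
      _ ≤ E := by rw [mul_add, mul_add]; linarith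
  have hE0 : 0 ≤ E := by positivity
  -- assembling
  set B₁ := ∫ s in Γ.cutParams, ‖Γ.dens h s‖ with hB₁
  set B₂ := ∫ s in Γ.cutParams, ‖(Γ.lam s - a) * Γ.dens h s‖ with hB₂
  set B₃ := ∫ s in Γ.cutParams, ‖(Γ.lam s - a) ^ 2 * Γ.dens h s‖ with hB₃
  set B₄ := ∫ s in α..β, ‖deriv Γ.lam s‖ with hB₄
  refine ⟨ρ, hρ0, E * (2 * Mφ) + 4 * L / ‖v‖ * B₄ + 2 / d * B₃ + B₂ + B₁, fun z hz hzc => ?_⟩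
  have hz' := hz
  rw [Metric.mem_ball, dist_eq_norm] at hz'
  have hzI : z ∉ Γ.lam '' Set.Icc α β := fun hm => by
    obtain ⟨s, hs, rfl⟩ := hm
    exact hzc (Γ.lam_mem_cuts_iff.2 (hIcut hs))
  have hnear : ∀ s ∈ Set.Icc α β, Γ.lam s - z ≠ 0 := fun s hs h0 => hzI ⟨s, hs, sub_eq_zero.1 h0⟩
  have hdc := Γ.continuous_deriv_lam
  have hc1 : Continuous fun s => Γ.lam s - a := Γ.continuous_lam.sub continuous_const
  have hint1 := hdint.continuousOn_mul hc1.continuousOn Γ.isCompact_cutParams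
  have hc2 : Continuous fun s => (Γ.lam s - a) ^ 2 := hc1.pow 2
  have hint2 := hdint.continuousOn_mul hc2.continuousOn Γ.isCompact_cutParams
  have hzcp : ∀ s ∈ Γ.cutParams, Γ.lam s - z ≠ 0 := fun s hs h0 =>
    hzc ((sub_eq_zero.1 h0) ▸ Γ.lam_mem_cuts_iff.2 hs)
  have hinv : ContinuousOn (fun s => (Γ.lam s - z)⁻¹) Γ.cutParams :=
    (Γ.continuous_lam.sub continuous_const).continuousOn.inv₀ hzcp
  have hint3 := hint2.continuousOn_mul hinv Γ.isCompact_cutParams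
  set N := ∫ s in Set.Icc α β, (Γ.lam s - z)⁻¹ * ((Γ.lam s - a) ^ 2 * Γ.dens h s) with hN
  set Fr := ∫ s in Γ.cutParams \ Set.Icc (s₀ - κ) (s₀ + κ),
    (Γ.lam s - z)⁻¹ * ((Γ.lam s - a) ^ 2 * Γ.dens h s) with hFr
  -- This is `(z - a)² / (λ - z) = (λ - a)² / (λ - z) - (λ - a) - (z - a)` under the integral. The
  -- new weight `(λ - a)²` makes the density Lipschitz near the branch point.
  have hkey : (z - a) ^ 2 * Γ.cauchy h z = N + Fr - (∫ s in Γ.cutParams, (Γ.lam s - a) * Γ.dens h s)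
      - (z - a) * ∫ s in Γ.cutParams, Γ.dens h s := by
    have e1 : N + Fr = ∫ s in Γ.cutParams, (Γ.lam s - z)⁻¹ * ((Γ.lam s - a) ^ 2 * Γ.dens h s) := by
      rw [hN, hFr, ← hI, MeasureTheory.integral_inter_add_sdiff measurableSet_Icc hint3]
    rw [e1, cauchy, ← MeasureTheory.integral_const_mul, ← MeasureTheory.integral_const_mul,
      ← MeasureTheory.integral_sub hint3 hint1,
      ← MeasureTheory.integral_sub (by exact hint3.sub hint1) (hdint.const_mul _)]
    refine MeasureTheory.setIntegral_congr_fun Γ.measurableSet_cutParams fun s hs => ?_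
    have := hzcp s hs
    field_simp
    ring
  have hFrle : ‖Fr‖ ≤ 2 / d * B₃ := by
    have hsub : Γ.cutParams \ Set.Icc (s₀ - κ) (s₀ + κ) ⊆ Γ.cutParams := Set.sdiff_subset
    calc ‖Fr‖ ≤ ∫ s in Γ.cutParams \ Set.Icc (s₀ - κ) (s₀ + κ),
          2 / d * ‖(Γ.lam s - a) ^ 2 * Γ.dens h s‖ := by
          refine MeasureTheory.norm_integral_le_of_norm_le ((hint2.mono_set hsub).norm.const_mul _) ?_
          refine (MeasureTheory.ae_restrict_iff' (Γ.measurableSet_cutParams.diff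
            measurableSet_Icc)).2 (Eventually.of_forall fun s hs => ?_)
          rw [norm_mul, norm_inv]
          have h1 := hfar s ⟨hs.1, fun h => hs.2 (Set.Ioo_subset_Icc_self h)⟩
          have h2 : ‖Γ.lam s - a‖ ≤ ‖Γ.lam s - z‖ + ‖z - a‖ := by
            simpa using norm_add_le (Γ.lam s - z) (z - a)
          have h3 : d / 2 ≤ ‖Γ.lam s - z‖ := by linarith
          have h4 : ‖Γ.lam s - z‖⁻¹ ≤ 2 / d := by
            rw [← inv_div]; exact inv_anti₀ (by positivity) h3
          gcongr
      _ = 2 / d * ∫ s in Γ.cutParams \ Set.Icc (s₀ - κ) (s₀ + κ),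
          ‖(Γ.lam s - a) ^ 2 * Γ.dens h s‖ := MeasureTheory.integral_const_mul _ _
      _ ≤ 2 / d * B₃ := by
          gcongr
          exact MeasureTheory.setIntegral_mono_set hint2.norm
            (Eventually.of_forall fun _ => norm_nonneg _) hsub.eventuallyLE
  have hφeq : ∀ s ∈ Set.Icc α β, (Γ.lam s - a) ^ 2 * Γ.dens h s = φ s * deriv Γ.lam s := by
    intro s hs
    have hq := hQ s hs
    have hsq : Γ.yPlus s ^ 2 = (Γ.lam s - a) * Γ.Q k (Γ.lam s) := by
      rw [yPlus_sq, eval_P_eq_mul _ k]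
    by_cases hy : Γ.yPlus s = 0
    · simp [dens, hφ, hy]
    · simp only [dens, hφ]
      field_simp
      rw [hsq]
      ring
  -- `lam s₁` is the point of the piece nearest to `z`. Then `‖lam s - lam s₁‖ ≤ 2 * ‖lam s - z‖`,
  -- so `φ s - φ s₁` cancels the denominator. What is left is `φ s₁` times a difference of
  -- logarithms, which a third factor `z - a` makes bounded.
  obtain ⟨s₁, hs₁, hmin⟩ := isCompact_Icc.exists_isMinOn ⟨α, hαm⟩
    ((Γ.continuous_lam.sub continuous_const : Continuous fun s => Γ.lam s - z).norm.continuousOn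
      (s := Set.Icc α β))
  have hL0 : 0 ≤ L := by
    have h1 := (norm_nonneg _).trans (hL α hαm β hβm)
    exact nonneg_of_mul_nonneg_left h1 (norm_pos_iff.2 (by linarith [hαβ]  : α - β ≠ 0))
  have hinvI : ContinuousOn (fun s => deriv Γ.lam s / (Γ.lam s - z)) (Set.Icc α β) :=
    hdc.continuousOn.div (Γ.continuous_lam.sub continuous_const).continuousOn hnear
  have hNeq : N = (∫ s in α..β, (φ s - φ s₁) * (deriv Γ.lam s / (Γ.lam s - z)))
      + φ s₁ * ∫ s in α..β, deriv Γ.lam s / (Γ.lam s - z) := by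
    rw [← intervalIntegral.integral_const_mul, ← intervalIntegral.integral_add, hN,
      intervalIntegral.integral_of_le hαβ.le, ← MeasureTheory.integral_Icc_eq_integral_Ioc]
    · refine MeasureTheory.setIntegral_congr_fun measurableSet_Icc fun s hs => ?_
      simp only [hφeq s hs]
      ring
    · exact ContinuousOn.intervalIntegrable_of_Icc hαβ.le
        ((hφc.sub continuousOn_const).mul hinvI)
    · exact (ContinuousOn.intervalIntegrable_of_Icc hαβ.le hinvI).const_mul _
  have hN1 : ‖∫ s in α..β, (φ s - φ s₁) * (deriv Γ.lam s / (Γ.lam s - z))‖ ≤ 4 * L / ‖v‖ * B₄ := by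
    rw [hB₄, ← intervalIntegral.integral_const_mul]
    refine intervalIntegral.norm_integral_le_of_norm_le hαβ.le
      (Eventually.of_forall fun s hs => ?_) ((hdc.norm.const_mul _).intervalIntegrable _ _)
      |>.trans (le_of_eq rfl)
    have hs' : s ∈ Set.Icc α β := Set.Ioc_subset_Icc_self hs
    have hp := norm_pos_iff.2 (hnear s hs')
    have h1 := hL s hs' s₁ hs₁
    have h2 := hw.norm_ge hlam (hIwin hs') (hIwin hs₁)
    have h3 : ‖Γ.lam s - Γ.lam s₁‖ ≤ ‖Γ.lam s - z‖ + ‖Γ.lam s₁ - z‖ := by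
      simpa using norm_sub_le (Γ.lam s - z) (Γ.lam s₁ - z)
    have h4 : ‖Γ.lam s₁ - z‖ ≤ ‖Γ.lam s - z‖ := hmin hs'
    have h5 : |s - s₁| ≤ 4 / ‖v‖ * ‖Γ.lam s - z‖ := by
      rw [div_mul_eq_mul_div, le_div_iff₀ hvp]
      linarith
    rw [norm_mul, norm_div]
    calc ‖φ s - φ s₁‖ * (‖deriv Γ.lam s‖ / ‖Γ.lam s - z‖)
        ≤ (L * (4 / ‖v‖ * ‖Γ.lam s - z‖)) * (‖deriv Γ.lam s‖ / ‖Γ.lam s - z‖) := by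
          gcongr
          exact h1.trans (by rw [Real.norm_eq_abs]; gcongr)
      _ = 4 * L / ‖v‖ * ‖deriv Γ.lam s‖ := by field_simp
  have hN2 : ‖z - a‖ * ‖∫ s in α..β, deriv Γ.lam s / (Γ.lam s - z)‖ ≤ 2 * E := by
    obtain ⟨c, hc, hcs⟩ : ∃ c : ℂ, ‖c‖ = 1 / ‖v‖ ∧
        ∀ s ∈ Set.Icc α β, c * (Γ.lam s - z) ∈ Complex.slitPlane := by
      rcases hw.left_or_right hlam hne hIwin hzI with h1 | h1
      · exact ⟨_, by simp [hv], h1⟩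
      · exact ⟨_, by simp [hv], h1⟩
    rw [integral_deriv_div_eq_log hlam hαβ.le hcs]
    have h1 := hlog z hz c hc α (by simp) (hnear α hαm)
    have h2 := hlog z hz c hc β (by simp) (hnear β hβm)
    calc _ ≤ ‖z - a‖ * (‖Complex.log (c * (Γ.lam β - z))‖ + ‖Complex.log (c * (Γ.lam α - z))‖) := by
          gcongr; exact norm_sub_le _ _
      _ ≤ 2 * E := by linarith
  have hza : ‖z - a‖ ≤ 1 := hz'.le.trans hρ1
  have hB1 : ‖∫ s in Γ.cutParams, Γ.dens h s‖ ≤ B₁ := MeasureTheory.norm_integral_le_integral_norm _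
  have hB2 : ‖∫ s in Γ.cutParams, (Γ.lam s - a) * Γ.dens h s‖ ≤ B₂ :=
    MeasureTheory.norm_integral_le_integral_norm _
  have hB2' : 0 ≤ B₂ := (norm_nonneg _).trans hB2
  have hB1' : 0 ≤ B₁ := (norm_nonneg _).trans hB1
  have hN' : ‖z - a‖ * ‖N‖ ≤ E * (2 * Mφ) + 4 * L / ‖v‖ * B₄ := by
    rw [hNeq]
    have h1 : ‖z - a‖ * ‖∫ s in α..β, (φ s - φ s₁) * (deriv Γ.lam s / (Γ.lam s - z))‖
        ≤ 4 * L / ‖v‖ * B₄ := (mul_le_of_le_one_left (norm_nonneg _) hza).trans hN1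
    have h2 : ‖z - a‖ * ‖φ s₁ * ∫ s in α..β, deriv Γ.lam s / (Γ.lam s - z)‖ ≤ E * (2 * Mφ) := by
      rw [norm_mul, mul_left_comm]
      calc _ ≤ Mφ * (2 * E) := by gcongr; exact hMφ s₁ hs₁
        _ = _ := by ring
    calc _ ≤ ‖z - a‖ * (‖∫ s in α..β, (φ s - φ s₁) * (deriv Γ.lam s / (Γ.lam s - z))‖
          + ‖φ s₁ * ∫ s in α..β, deriv Γ.lam s / (Γ.lam s - z)‖) := by
          gcongr; exact norm_add_le _ _
      _ ≤ _ := by rw [mul_add]; linarith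
  have e3 : (z - a) ^ 3 * Γ.cauchy h z = (z - a) * N + (z - a) * (Fr
      - (∫ s in Γ.cutParams, (Γ.lam s - a) * Γ.dens h s)
      - (z - a) * ∫ s in Γ.cutParams, Γ.dens h s) := by
    rw [pow_succ', mul_assoc, hkey]; ring
  rw [e3]
  refine (norm_add_le _ _).trans ?_
  rw [norm_mul, norm_mul]
  have h5 : ‖Fr - (∫ s in Γ.cutParams, (Γ.lam s - a) * Γ.dens h s)
      - (z - a) * ∫ s in Γ.cutParams, Γ.dens h s‖ ≤ 2 / d * B₃ + B₂ + B₁ := by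
    refine (norm_sub_le _ _).trans (add_le_add ((norm_sub_le _ _).trans (add_le_add hFrle hB2)) ?_)
    rw [norm_mul]
    exact (mul_le_of_le_one_left (norm_nonneg _) hza).trans hB1
  have h6 := (mul_le_of_le_one_left (norm_nonneg (Fr
    - (∫ s in Γ.cutParams, (Γ.lam s - a) * Γ.dens h s)
      - (z - a) * ∫ s in Γ.cutParams, Γ.dens h s)) hza).trans h5
  linarith

end CutCurve
end

/-! ### The dispersion relation. -/

noncomputable section

namespace CutCurve
variable {m : ℕ} {W : ℂ[X]} (Γ : CutCurve m W)

/-- A point slightly to the left of the path at parameter `s₀` is comparably far from the cuts. -/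
theorem eventually_norm_offset_le {s₀ : ℝ} :
    ∀ᶠ h : ℝ in 𝓝[>] 0, ∀ s ∈ Γ.cutParams, ‖Complex.I * h * deriv Γ.lam s₀‖
      ≤ 4 / 3 * ‖Γ.lam s - (Γ.lam s₀ + Complex.I * h * deriv Γ.lam s₀)‖ := by
  set v := deriv Γ.lam s₀ with hv
  have hne : v ≠ 0 := Γ.deriv_lam_ne_zero s₀
  have hvp := norm_pos_iff.2 hne
  have hlam := Γ.contDiff_lam
  obtain ⟨κ, hκ, -, hw⟩ := exists_isWindow hlam Γ.deriv_lam_ne_zero s₀ one_pos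
  have hcompact : IsCompact (Γ.cutParams \ Set.Ioo (s₀ - κ) (s₀ + κ)) :=
    Γ.isCompact_cutParams.diff isOpen_Ioo
  obtain ⟨d, hd, hfar⟩ := Γ.exists_le_norm_lam_sub hcompact
    (Γ.notMem_image_diff (T := Set.Ioo (s₀ - κ) (s₀ + κ)) (s := s₀) ⟨by linarith, by linarith⟩)
  have h0 : Tendsto (fun h : ℝ => ‖Complex.I * h * v‖) (𝓝[>] 0) (𝓝 0) := by
    have := (tendsto_offset 0 v).norm
    simpa using this
  filter_upwards [h0.eventually (gt_mem_nhds (half_pos hd)), self_mem_nhdsWithin] with h hhd hpos s hs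
  have hpos' : 0 < h := hpos
  have hn : ‖Complex.I * h * v‖ = h * ‖v‖ := by
    rw [norm_mul, norm_mul, Complex.norm_I, one_mul, Complex.norm_real, Real.norm_of_nonneg hpos'.le]
  by_cases hsI : s ∈ Set.Ioo (s₀ - κ) (s₀ + κ)
  · have h1 := hw.norm_div_sub_le hlam hne (Set.Ioo_subset_Icc_self hsI) hw.self_mem
    set w := (Γ.lam s - Γ.lam s₀) / v with hwdef
    set u : ℝ := s - s₀
    have e1 : Γ.lam s - (Γ.lam s₀ + Complex.I * h * v) = (w - Complex.I * h) * v := by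
      rw [hwdef, sub_mul, div_mul_cancel₀ _ hne]; ring
    rw [e1, hn, norm_mul]
    have h2 : ‖((u : ℂ) - Complex.I * h)‖ ≤ ‖w - Complex.I * h‖ + ‖w - (u : ℂ)‖ := by
      have := norm_sub_le (w - Complex.I * h) (w - (u : ℂ))
      rwa [sub_sub_sub_cancel_left, ← norm_neg, neg_sub, norm_sub_rev] at this
    have h3 : h ≤ ‖((u : ℂ) - Complex.I * h)‖ := by
      have := Complex.abs_im_le_norm ((u : ℂ) - Complex.I * h)
      simpa [abs_of_pos hpos'] using this
    have h4 : |u| ≤ ‖((u : ℂ) - Complex.I * h)‖ := by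
      have := Complex.abs_re_le_norm ((u : ℂ) - Complex.I * h)
      simpa using this
    have h5 : h ≤ 4 / 3 * ‖w - Complex.I * h‖ := by linarith
    calc h * ‖v‖ ≤ (4 / 3 * ‖w - Complex.I * h‖) * ‖v‖ := by gcongr
      _ = _ := by ring
  · have h1 := hfar s ⟨hs, hsI⟩
    have h2 : ‖Γ.lam s - Γ.lam s₀‖ ≤ ‖Γ.lam s - (Γ.lam s₀ + Complex.I * h * v)‖
        + ‖Complex.I * h * v‖ := by
      have e2 : Γ.lam s - Γ.lam s₀ = Γ.lam s - (Γ.lam s₀ + Complex.I * h * v) + Complex.I * h * v := by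
        ring
      rw [e2]
      exact norm_add_le _ _
    linarith

theorem eventually_offset_notMem_cuts (s₀ : ℝ) :
    ∀ᶠ h : ℝ in 𝓝[>] 0, Γ.lam s₀ + Complex.I * h * deriv Γ.lam s₀ ∉ Γ.cuts := by
  filter_upwards [Γ.eventually_norm_offset_le (s₀ := s₀), self_mem_nhdsWithin] with h hh hpos hmem
  rw [cuts_eq_image] at hmem
  obtain ⟨s, hs, he⟩ := hmem
  have h1 := hh s hs
  rw [he, sub_self, norm_zero, mul_zero] at h1
  have h2 := norm_le_zero_iff.1 h1
  have hpos' : (0 : ℝ) < h := hpos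
  simp [hpos'.ne', Γ.deriv_lam_ne_zero] at h2

/-- Along a normal approach, the distance to `lam s₀` is at most `4 / 3` of the distance to any
point of the cuts, so the integrable density dominates while the integrand tends to `0` for `s ≠
s₀`. This bound is not available tangentially; one approach is all that
`exists_extension_of_pole_bound` asks for. -/
theorem tendsto_offset_mul_cauchy (h : ℂ[X]) (s₀ : ℝ) :
    Tendsto (fun ε : ℝ => Complex.I * ε * deriv Γ.lam s₀ *
      Γ.cauchy h (Γ.lam s₀ + Complex.I * ε * deriv Γ.lam s₀)) (𝓝[>] 0) (𝓝 0) := by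
  have h1 : ∀ ε : ℝ, Complex.I * ε * deriv Γ.lam s₀ *
      Γ.cauchy h (Γ.lam s₀ + Complex.I * ε * deriv Γ.lam s₀) = ∫ s in Γ.cutParams,
      Complex.I * ε * deriv Γ.lam s₀ *
        (Γ.dens h s / (Γ.lam s - (Γ.lam s₀ + Complex.I * ε * deriv Γ.lam s₀))) := fun ε => by
    rw [cauchy, MeasureTheory.integral_const_mul]
  simp only [h1]
  rw [← MeasureTheory.integral_zero ℝ ℂ (μ := MeasureTheory.volume.restrict Γ.cutParams)]
  refine MeasureTheory.tendsto_integral_filter_of_dominated_convergence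
    (fun s => 4 / 3 * ‖Γ.dens h s‖) ?_ ?_ ((Γ.integrableOn_dens_cutParams h).norm.const_mul _) ?_
  · exact Eventually.of_forall fun ε => (((Γ.measurable_dens h).div
      (Γ.continuous_lam.sub continuous_const).measurable).const_mul _).aestronglyMeasurable
  · filter_upwards [Γ.eventually_norm_offset_le (s₀ := s₀), Γ.eventually_offset_notMem_cuts s₀]
      with ε hε hc
    refine (MeasureTheory.ae_restrict_iff' Γ.measurableSet_cutParams).2
      (Eventually.of_forall fun s hs => ?_)
    have hp : 0 < ‖Γ.lam s - (Γ.lam s₀ + Complex.I * ε * deriv Γ.lam s₀)‖ :=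
      norm_pos_iff.2 (sub_ne_zero.2 fun h0 => hc (h0 ▸ Γ.lam_mem_cuts_iff.2 hs))
    rw [norm_mul, norm_div, mul_div_assoc', div_le_iff₀ hp]
    calc _ ≤ (4 / 3 * ‖Γ.lam s - (Γ.lam s₀ + Complex.I * ε * deriv Γ.lam s₀)‖) * ‖Γ.dens h s‖ := by
          gcongr; exact hε s hs
      _ = _ := by ring
  · have hnull : ∀ᵐ s : ℝ ∂(MeasureTheory.volume.restrict Γ.cutParams), s ≠ s₀ :=
      MeasureTheory.ae_restrict_of_ae (MeasureTheory.Measure.ae_ne _ _)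
    filter_upwards [hnull] with s hs
    have h2 := tendsto_offset (Γ.lam s₀) (deriv Γ.lam s₀)
    have h3 := (tendsto_offset 0 (deriv Γ.lam s₀)).mul ((tendsto_const_nhds (x := Γ.dens h s)).div
      ((tendsto_const_nhds (x := Γ.lam s)).sub h2) (sub_ne_zero.2 (Γ.injective_lam.ne hs)))
    simpa using h3

/-- Extending across the interior of the cut leaves an isolated singularity. The cubic bound makes
it at worst a pole, and the behaviour along the normal excludes a pole. -/
theorem exists_defect_extension_bp (h q : ℂ[X]) (k : Fin (m + 1) × Bool) :
    ∃ r > 0, ∃ g : ℂ → ℂ, DifferentiableOn ℂ g (Metric.ball (Γ.lam (Γ.bp k)) r) ∧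
      ∀ z ∈ Metric.ball (Γ.lam (Γ.bp k)) r, z ∉ Γ.cuts → Γ.defect h q z = g z := by
  set a := Γ.lam (Γ.bp k) with ha
  obtain ⟨ρ, hρ, C, hC⟩ := Γ.exists_pole_bound_cauchy h k
  have hQopen : {z | Γ.Q k z ≠ 0} ∈ 𝓝 a :=
    (isOpen_ne_fun (Γ.differentiable_Q k).continuous continuous_const).mem_nhds (Γ.Q_ne_zero k)
  have hsmall : ∀ᶠ z in 𝓝 a, ‖(z - a) / Γ.y₀ z‖ < 1 := by
    have := (Γ.tendsto_sub_div_y₀ k).norm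
    rw [norm_zero] at this
    exact this.eventually (gt_mem_nhds one_pos)
  obtain ⟨r₁, hr₁, hsub⟩ := Metric.mem_nhds_iff.1 (inter_mem hQopen hsmall)
  set r := min (min ρ r₁) 1
  have hr : 0 < r := by positivity
  have hrρ : Metric.ball a r ⊆ Metric.ball a ρ :=
    Metric.ball_subset_ball ((min_le_left _ _).trans (min_le_left _ _))
  have hr1 : Metric.ball a r ⊆ Metric.ball a r₁ :=
    Metric.ball_subset_ball ((min_le_left _ _).trans (min_le_right _ _))
  have hopen : IsOpen (Metric.ball a r \ {a}) := Metric.isOpen_ball.sdiff isClosed_singleton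
  obtain ⟨F, hF, hFeq⟩ := exists_holomorphic_extension hopen Γ.isClosed_cuts Γ.dense_compl_cuts
    ((Γ.differentiableOn_defect h q).mono fun z hz => hz.2) (by
      rintro x ⟨hx, hxc⟩
      rw [cuts_eq_image] at hxc
      obtain ⟨s, hs, rfl⟩ := hxc
      have hb : s ∉ Set.range Γ.bp := by
        rintro ⟨j, rfl⟩
        by_cases hjk : j = k
        · exact hx.2 (by rw [hjk]; exact rfl)
        · exact (hsub (hr1 hx.1)).1 (Γ.Q_eq_zero_of_ne hjk)
      obtain ⟨i, hi⟩ := Γ.mem_Ioo_of_mem_cutParams hs hb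
      exact Γ.exists_defect_extension_interior h q hi)
  obtain ⟨Mh, hMh⟩ := (isCompact_closedBall a r).exists_bound_of_continuousOn h.continuous.continuousOn
  obtain ⟨Mq, hMq⟩ := (isCompact_closedBall a r).exists_bound_of_continuousOn q.continuous.continuousOn
  have hbd : ∀ z ∈ Metric.ball a r, z ∉ Γ.cuts →
      ‖(z - a) ^ 3 * Γ.defect h q z‖ ≤ Mh + Mq + 1 / Real.pi * C := by
    intro z hz hzc
    have hz1 : ‖z - a‖ ≤ 1 := by
      rw [← dist_eq_norm]; exact (Metric.mem_ball.1 hz).le.trans (min_le_right _ _)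
    have h1 := hMh z (Metric.ball_subset_closedBall hz)
    have h2 := hMq z (Metric.ball_subset_closedBall hz)
    have h3 : ‖(z - a) / Γ.y₀ z‖ ≤ 1 := le_of_lt (hsub (hr1 hz)).2
    have h4 := hC z (hrρ hz) hzc
    have e : (z - a) ^ 3 * Γ.defect h q z = (z - a) ^ 2 * ((z - a) / Γ.y₀ z) * h.eval z
        - (z - a) ^ 3 * q.eval z - 1 / (Real.pi * Complex.I) * ((z - a) ^ 3 * Γ.cauchy h z) := by
      rw [defect]; ring
    rw [e]
    refine (norm_sub_le _ _).trans (add_le_add ((norm_sub_le _ _).trans (add_le_add ?_ ?_)) ?_)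
    · rw [norm_mul, norm_mul, norm_pow]
      calc _ ≤ 1 ^ 2 * 1 * Mh := by gcongr
        _ = Mh := by ring
    · rw [norm_mul, norm_pow]
      calc _ ≤ 1 ^ 3 * Mq := by gcongr
        _ = Mq := by ring
    · rw [norm_mul]
      have : ‖1 / ((Real.pi : ℂ) * Complex.I)‖ = 1 / Real.pi := by
        simp [abs_of_pos Real.pi_pos]
      rw [this]
      gcongr
  -- The bound is known off the cuts only; it passes to the extension on the cuts by density and
  -- continuity.
  have hbdF : ∀ z ∈ Metric.ball a r \ {a}, ‖(z - a) ^ 3 * F z‖ ≤ Mh + Mq + 1 / Real.pi * C := by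
    intro z hz
    have hbot : (𝓝[Γ.cutsᶜ] z).NeBot :=
      mem_closure_iff_nhdsWithin_neBot.1 (Γ.dense_compl_cuts z)
    have hcont : ContinuousAt (fun z => ‖(z - a) ^ 3 * F z‖) z :=
      (((continuousAt_id.sub continuousAt_const).pow 3).mul
        (hF.differentiableAt (hopen.mem_nhds hz)).continuousAt).norm
    have hcw : Tendsto (fun z => ‖(z - a) ^ 3 * F z‖) (𝓝[Γ.cutsᶜ] z) (𝓝 ‖(z - a) ^ 3 * F z‖) :=
      hcont.tendsto.mono_left nhdsWithin_le_nhds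
    refine le_of_tendsto hcw ?_
    filter_upwards [self_mem_nhdsWithin, mem_nhdsWithin_of_mem_nhds (hopen.mem_nhds hz)] with w hw hw'
    rw [hFeq w ⟨hw', hw⟩]
    exact hbd w hw'.1 hw
  obtain ⟨g, hg, hgeq⟩ := exists_extension_of_pole_bound hr 3 hF hbdF
    (l := 𝓝[>] (0 : ℝ)) (γ := fun ε : ℝ => a + Complex.I * ε * deriv Γ.lam (Γ.bp k)) (by
      refine tendsto_nhdsWithin_iff.2 ⟨tendsto_offset _ _, ?_⟩
      filter_upwards [self_mem_nhdsWithin] with ε hε h0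
      have hpos' : (0 : ℝ) < ε := hε
      simp [hpos'.ne', Γ.deriv_lam_ne_zero] at h0) (by
      have hoff := tendsto_offset a (deriv Γ.lam (Γ.bp k))
      have h1 := ((Γ.tendsto_sub_div_y₀ k).comp hoff).mul ((h.continuous.tendsto _).comp hoff)
      have h2 := (tendsto_offset 0 (deriv Γ.lam (Γ.bp k))).mul ((q.continuous.tendsto _).comp hoff)
      have h3 := (Γ.tendsto_offset_mul_cauchy h (Γ.bp k)).const_mul (1 / (Real.pi * Complex.I))
      have h4 := (h1.sub h2).sub h3
      simp only [zero_mul, mul_zero, sub_zero] at h4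
      refine h4.congr' ?_
      filter_upwards [Γ.eventually_offset_notMem_cuts (Γ.bp k), self_mem_nhdsWithin,
        hoff.eventually (Metric.ball_mem_nhds a hr)] with ε hε hpos hball
      have hpos' : (0 : ℝ) < ε := hpos
      rw [hFeq _ ⟨⟨hball, by simp [hpos'.ne', Γ.deriv_lam_ne_zero]⟩, hε⟩, defect]
      simp only [Function.comp_apply, zero_add, ← ha]
      ring)
  refine ⟨r, hr, g, hg, fun z hz hzc => ?_⟩
  have hza : z ≠ a := fun h0 => hzc (h0 ▸ Γ.lam_mem_cuts_iff.2 (Γ.bp_mem_cutParams k))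
  rw [← hFeq z ⟨⟨hz, hza⟩, hzc⟩]
  exact hgeq z ⟨hz, hza⟩

theorem exists_entire_defect (h q : ℂ[X]) :
    ∃ F : ℂ → ℂ, Differentiable ℂ F ∧ ∀ z ∉ Γ.cuts, F z = Γ.defect h q z := by
  obtain ⟨F, hF, hFeq⟩ := exists_holomorphic_extension isOpen_univ Γ.isClosed_cuts Γ.dense_compl_cuts
    ((Γ.differentiableOn_defect h q).mono fun z hz => hz.2) (by
      rintro x ⟨-, hxc⟩
      rw [cuts_eq_image] at hxc
      obtain ⟨s, hs, rfl⟩ := hxc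
      by_cases hb : s ∈ Set.range Γ.bp
      · obtain ⟨k, rfl⟩ := hb
        exact Γ.exists_defect_extension_bp h q k
      · obtain ⟨i, hi⟩ := Γ.mem_Ioo_of_mem_cutParams hs hb
        exact Γ.exists_defect_extension_interior h q hi)
  exact ⟨F, differentiableOn_univ.1 hF, fun z hz => hFeq z ⟨trivial, hz⟩⟩

theorem eventually_notMem_cuts : ∀ᶠ x in Bornology.cobounded ℂ, x ∉ Γ.cuts :=
  Bornology.isBounded_def.1 Γ.isCompact_cuts.isBounded

theorem tendsto_mul_cauchy (h : ℂ[X]) : Tendsto (fun x => x * Γ.cauchy h x) (Bornology.cobounded ℂ)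
    (𝓝 (-∫ s in Γ.cutParams, Γ.dens h s)) := by
  have : (Bornology.cobounded ℂ).IsCountablyGenerated := by
    rw [← comap_norm_atTop]; infer_instance
  obtain ⟨M, hM⟩ := Γ.isCompact_cutParams.exists_bound_of_continuousOn Γ.continuous_lam.continuousOn
  have h1 : ∀ x, x * Γ.cauchy h x = ∫ s in Γ.cutParams, x * (Γ.dens h s / (Γ.lam s - x)) := fun x => by
    rw [cauchy, MeasureTheory.integral_const_mul]
  simp only [h1]
  rw [← MeasureTheory.integral_neg]
  refine MeasureTheory.tendsto_integral_filter_of_dominated_convergence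
    (fun s => 2 * ‖Γ.dens h s‖) ?_ ?_ ((Γ.integrableOn_dens_cutParams h).norm.const_mul _) ?_
  · exact Eventually.of_forall fun x => (((Γ.measurable_dens h).div
      (Γ.continuous_lam.sub continuous_const).measurable).const_mul _).aestronglyMeasurable
  · filter_upwards [tendsto_norm_cobounded_atTop.eventually_ge_atTop (2 * M + 1)] with x hx
    refine (MeasureTheory.ae_restrict_iff' Γ.measurableSet_cutParams).2
      (Eventually.of_forall fun s hs => ?_)
    have h2 := hM s hs
    have h3 := norm_sub_norm_le x (Γ.lam s)
    rw [norm_sub_rev] at h3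
    have h0 := (norm_nonneg _).trans h2
    rw [norm_mul, norm_div, mul_div_assoc', div_le_iff₀ (by linarith)]
    calc ‖x‖ * ‖Γ.dens h s‖ ≤ (2 * ‖Γ.lam s - x‖) * ‖Γ.dens h s‖ := by gcongr; linarith
      _ = _ := by ring
  · refine Eventually.of_forall fun s => ?_
    have h5 : Tendsto (fun x : ℂ => Γ.lam s * x⁻¹ - 1) (Bornology.cobounded ℂ) (𝓝 (-1)) := by
      simpa using (tendsto_inv₀_cobounded.const_mul (Γ.lam s)).sub_const 1
    have h6 := (tendsto_const_nhds (x := Γ.dens h s)).div h5 (by norm_num)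
    rw [div_neg, div_one] at h6
    refine h6.congr' ?_
    filter_upwards [tendsto_norm_cobounded_atTop.eventually_gt_atTop 0] with x hx
    have hx0 : x ≠ 0 := norm_pos_iff.1 hx
    have : Γ.lam s * x⁻¹ - 1 = (Γ.lam s - x) / x := by field_simp
    simp only [Pi.div_apply]
    rw [this, div_div_eq_mul_div]
    ring

theorem tendsto_cauchy (h : ℂ[X]) : Tendsto (Γ.cauchy h) (Bornology.cobounded ℂ) (𝓝 0) := by
  have h1 := (tendsto_inv₀_cobounded (α := ℂ)).mul (Γ.tendsto_mul_cauchy h)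
  rw [zero_mul] at h1
  refine h1.congr' ?_
  filter_upwards [tendsto_norm_cobounded_atTop.eventually_gt_atTop 0] with x hx
  have hx0 : x ≠ 0 := norm_pos_iff.1 hx
  rw [← mul_assoc, inv_mul_cancel₀ hx0, one_mul]

/-- The dispersion relation: `h / y₀` is the sum of its polynomial part at infinity and of the
Cauchy transform of its jump on the cuts. -/
theorem div_y₀_eq {h q : ℂ[X]}
    (hlim : Tendsto (fun x => h.eval x / Γ.y₀ x - q.eval x) (Bornology.cobounded ℂ) (𝓝 0)) {x : ℂ}
    (hx : x ∉ Γ.cuts) :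
    h.eval x / Γ.y₀ x = q.eval x + 1 / (Real.pi * Complex.I) * Γ.cauchy h x := by
  obtain ⟨F, hF, hFeq⟩ := Γ.exists_entire_defect h q
  have h1 : Tendsto F (cocompact ℂ) (𝓝 0) := by
    rw [← Metric.cobounded_eq_cocompact]
    have := hlim.sub ((Γ.tendsto_cauchy h).const_mul (1 / (Real.pi * Complex.I)))
    rw [mul_zero, sub_zero] at this
    refine this.congr' ?_
    filter_upwards [Γ.eventually_notMem_cuts] with z hz using (hFeq z hz).symm
  have h2 := hF.apply_eq_of_tendsto_cocompact x h1
  rw [hFeq x hx, defect] at h2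
  linear_combination h2

end CutCurve
end

/-! ### Behaviour at infinity, total masses, and the cycle `α̂`. -/

noncomputable section

theorem tendsto_eval_div_pow (p : ℂ[X]) {n : ℕ} (hp : p.natDegree ≤ n) :
    Tendsto (fun x => p.eval x / x ^ n) (Bornology.cobounded ℂ) (𝓝 (p.coeff n)) := by
  have h1 : Tendsto (fun x : ℂ => ∑ i ∈ Finset.range (n + 1), p.coeff i * x⁻¹ ^ (n - i))
      (Bornology.cobounded ℂ) (𝓝 (∑ i ∈ Finset.range (n + 1), p.coeff i * 0 ^ (n - i))) :=
    tendsto_finsetSum _ fun i _ => (tendsto_inv₀_cobounded.pow _).const_mul _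
  have h2 : ∑ i ∈ Finset.range (n + 1), p.coeff i * 0 ^ (n - i) = p.coeff n := by
    rw [Finset.sum_range_succ, Nat.sub_self, pow_zero, mul_one, Finset.sum_eq_zero, zero_add]
    intro i hi
    rw [zero_pow (by have := Finset.mem_range.1 hi; omega), mul_zero]
  rw [h2] at h1
  refine h1.congr' ?_
  filter_upwards [tendsto_norm_cobounded_atTop.eventually_gt_atTop 0] with x hx
  have hx0 : x ≠ 0 := norm_pos_iff.1 hx
  rw [eval_eq_sum_range' (Nat.lt_succ_of_le hp), Finset.sum_div]
  refine Finset.sum_congr rfl fun i hi => ?_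
  have hle : i ≤ n := Nat.lt_succ_iff.1 (Finset.mem_range.1 hi)
  rw [show x ^ n = x ^ i * x ^ (n - i) by rw [← pow_add]; congr 1; omega, inv_pow]
  field_simp

namespace CutCurve
variable {m : ℕ} {W : ℂ[X]} (Γ : CutCurve m W)

theorem tendsto_mul_div_y₀ {h : ℂ[X]} (hh : h.natDegree ≤ m) :
    Tendsto (fun x => x * (h.eval x / Γ.y₀ x)) (Bornology.cobounded ℂ) (𝓝 (h.coeff m)) := by
  have h1 := (tendsto_eval_div_pow h hh).div Γ.tendsto_y₀_div one_ne_zero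
  rw [div_one] at h1
  refine h1.congr' ?_
  filter_upwards [tendsto_norm_cobounded_atTop.eventually_gt_atTop 0, Γ.eventually_notMem_cuts]
    with x hx hc
  have hx0 : x ≠ 0 := norm_pos_iff.1 hx
  have := Γ.y₀_ne_zero hc
  simp only [Pi.div_apply]
  rw [pow_succ]
  field_simp

theorem _root_.tendsto_zero_of_tendsto_mul {g : ℂ → ℂ} {c : ℂ}
    (hg : Tendsto (fun x => x * g x) (Bornology.cobounded ℂ) (𝓝 c)) :
    Tendsto g (Bornology.cobounded ℂ) (𝓝 0) := by
  have h1 := (tendsto_inv₀_cobounded (α := ℂ)).mul hg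
  rw [zero_mul] at h1
  refine h1.congr' ?_
  filter_upwards [tendsto_norm_cobounded_atTop.eventually_gt_atTop 0] with x hx
  rw [← mul_assoc, inv_mul_cancel₀ (norm_pos_iff.1 hx), one_mul]

/-- `y₀ - W' = f / (y₀ + W')`, where `f` has leading term `-4 t x ^ m` and `y₀ + W'` behaves as `2 x
^ (m + 1)`. -/
theorem tendsto_mul_y₀_sub (hmonic : W.derivative.Monic) (hdeg : W.derivative.natDegree = m + 1) :
    Tendsto (fun x => x * (Γ.y₀ x - W.derivative.eval x)) (Bornology.cobounded ℂ)
      (𝓝 (-2 * Γ.t)) := by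
  have h1 := tendsto_eval_div_pow W.derivative hdeg.le
  have hc : W.derivative.coeff (m + 1) = 1 := by
    have := hmonic.coeff_natDegree
    rwa [hdeg] at this
  rw [hc] at h1
  have h2 := Γ.tendsto_y₀_div.add h1
  have h3 := (tendsto_eval_div_pow Γ.f Γ.natDegree_f).div h2 (by norm_num)
  have e : Γ.f.coeff m / (1 + 1) = -2 * Γ.t := by rw [t]; ring
  rw [e] at h3
  refine h3.congr' ?_
  have h4 : ∀ᶠ x in Bornology.cobounded ℂ, Γ.y₀ x / x ^ (m + 1)
      + W.derivative.eval x / x ^ (m + 1) ≠ 0 := h2.eventually_ne (by norm_num)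
  filter_upwards [tendsto_norm_cobounded_atTop.eventually_gt_atTop 0, Γ.eventually_notMem_cuts, h4]
    with x hx hc hne
  have hx0 : x ≠ 0 := norm_pos_iff.1 hx
  rw [← add_div] at hne
  have hs : Γ.y₀ x + W.derivative.eval x ≠ 0 := fun h => hne (by rw [h, zero_div])
  have hsq := Γ.y₀_sq hc
  simp only [Pi.div_apply]
  rw [← add_div, div_div_div_eq, div_eq_iff (mul_ne_zero (pow_ne_zero _ hx0) hs)]
  linear_combination (-x ^ (m + 1)) * hsq

theorem eval_P_div_y₀ {x : ℂ} (hx : x ∉ Γ.cuts) : Γ.P.eval x / Γ.y₀ x = Γ.y₀ x := by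
  rw [← Γ.y₀_sq' hx, sq, mul_div_cancel_right₀ _ (Γ.y₀_ne_zero hx)]

theorem dens_P (s : ℝ) : Γ.dens Γ.P s = Γ.yPlus s * deriv Γ.lam s := by
  rw [dens, ← yPlus_sq, sq]
  by_cases h : Γ.yPlus s = 0
  · simp [h]
  · field_simp

theorem tendsto_P_div_y₀_sub (hmonic : W.derivative.Monic) (hdeg : W.derivative.natDegree = m + 1) :
    Tendsto (fun x => Γ.P.eval x / Γ.y₀ x - W.derivative.eval x) (Bornology.cobounded ℂ)
      (𝓝 0) := by
  refine (tendsto_zero_of_tendsto_mul (Γ.tendsto_mul_y₀_sub hmonic hdeg)).congr' ?_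
  filter_upwards [Γ.eventually_notMem_cuts] with x hx
  rw [Γ.eval_P_div_y₀ hx]

theorem y₀_eq (hmonic : W.derivative.Monic) (hdeg : W.derivative.natDegree = m + 1) {x : ℂ}
    (hx : x ∉ Γ.cuts) :
    Γ.y₀ x = W.derivative.eval x + 1 / (Real.pi * Complex.I) * Γ.cauchy Γ.P x := by
  rw [← Γ.div_y₀_eq (Γ.tendsto_P_div_y₀_sub hmonic hdeg) hx, Γ.eval_P_div_y₀ hx]

/-- Comparison of the `1 / x` terms in `y₀ = W' + (1 / (π I)) * cauchy P`: the Cauchy transform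
contributes minus the total mass, and `y₀ - W'` contributes `-2 t`. -/
theorem integral_dens_P (hmonic : W.derivative.Monic) (hdeg : W.derivative.natDegree = m + 1) :
    ∫ s in Γ.cutParams, Γ.dens Γ.P s = 2 * Real.pi * Complex.I * Γ.t := by
  have hpi : (Real.pi : ℂ) ≠ 0 := Complex.ofReal_ne_zero.2 Real.pi_ne_zero
  have h1 := (Γ.tendsto_mul_cauchy Γ.P).const_mul (1 / (Real.pi * Complex.I))
  have h2 := tendsto_nhds_unique (h1.congr' ?_) (Γ.tendsto_mul_y₀_sub hmonic hdeg)
  · have hI := Complex.I_ne_zero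
    field_simp at h2
    linear_combination -h2
  · filter_upwards [Γ.eventually_notMem_cuts] with x hx
    rw [Γ.y₀_eq hmonic hdeg hx]
    ring

theorem tendsto_div_y₀_sub_zero {h : ℂ[X]} (hh : h.natDegree ≤ m) :
    Tendsto (fun x => h.eval x / Γ.y₀ x - (0 : ℂ[X]).eval x) (Bornology.cobounded ℂ) (𝓝 0) := by
  simpa using tendsto_zero_of_tendsto_mul (Γ.tendsto_mul_div_y₀ hh)

/-- The same comparison with no polynomial part, as `h` has smaller degree than `y₀`. -/
theorem integral_dens {h : ℂ[X]} (hh : h.natDegree ≤ m) :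
    ∫ s in Γ.cutParams, Γ.dens h s = -(Real.pi * Complex.I * h.coeff m) := by
  have hpi : (Real.pi : ℂ) ≠ 0 := Complex.ofReal_ne_zero.2 Real.pi_ne_zero
  have h1 := (Γ.tendsto_mul_cauchy h).const_mul (1 / (Real.pi * Complex.I))
  have h2 := tendsto_nhds_unique (h1.congr' ?_) (Γ.tendsto_mul_div_y₀ hh)
  · have hI := Complex.I_ne_zero
    field_simp at h2
    linear_combination -h2
  · filter_upwards [Γ.eventually_notMem_cuts] with x hx
    rw [Γ.div_y₀_eq (Γ.tendsto_div_y₀_sub_zero hh) hx, eval_zero]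
    ring

theorem continuous_dens_P : Continuous (Γ.dens Γ.P) := by
  have : Γ.dens Γ.P = fun s => Γ.yPlus s * deriv Γ.lam s := funext Γ.dens_P
  rw [this]
  exact Γ.continuous_yPlus.mul Γ.continuous_deriv_lam

/-- In the dispersion relation for `y₀` the term `W' dx` is exact on a closed curve. After Fubini,
winding number `-1` about each `z` in the cuts gives `∫ dx / (z - x) = 2 π I`, which multiplies the
total mass `2 π I t`. -/
theorem zetaIntegral_alphaHat (hmonic : W.derivative.Monic) (hdeg : W.derivative.natDegree = m + 1)
    {c : ℝ → ℂ} (hc : Γ.IsAlphaHat c) :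
    1 / (4 * Real.pi * Complex.I) * zetaIntegral (Γ.upperLift c) 0 1 = Γ.t := by
  have hpi : (Real.pi : ℂ) ≠ 0 := Complex.ofReal_ne_zero.2 Real.pi_ne_zero
  have hI := Complex.I_ne_zero
  set J := Set.Icc (0 : ℝ) 1 with hJ
  -- `c` is differentiable only within `[0, 1]`. The one-sided derivative is continuous up to the
  -- ends and agrees with `deriv c` inside, so all the integrals can use it.
  set c' := derivWithin c J with hc'
  have huniq : UniqueDiffOn ℝ J := uniqueDiffOn_Icc zero_lt_one
  have hc'c : ContinuousOn c' J := hc.contDiffOn.continuousOn_derivWithin huniq le_rfl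
  have hcc : ContinuousOn c J := hc.contDiffOn.continuousOn
  have hder : ∀ r ∈ Set.Ioo (0 : ℝ) 1, HasDerivAt c (c' r) r := fun r hr =>
    ((hc.contDiffOn.differentiableOn (by norm_num) r (Set.Ioo_subset_Icc_self hr)).hasDerivWithinAt).hasDerivAt
      (Icc_mem_nhds hr.1 hr.2)
  have hae : ∀ g : ℝ → ℂ → ℂ, (∫ r in (0 : ℝ)..1, g r (deriv c r)) = ∫ r in J, g r (c' r) := by
    intro g
    rw [intervalIntegral.integral_of_le zero_le_one, MeasureTheory.integral_Ioc_eq_integral_Ioo,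
      MeasureTheory.integral_Icc_eq_integral_Ioo]
    exact MeasureTheory.setIntegral_congr_fun measurableSet_Ioo fun r hr => by
      rw [(hder r hr).deriv]
  have hwind : ∀ s ∈ Γ.cutParams, ∫ r in J, c' r / (Γ.lam s - c r) = 2 * Real.pi * Complex.I := by
    intro s hs
    have h1 := hc.winding _ (Γ.lam_mem_cuts_iff.2 hs)
    rw [hae fun r d => d / (c r - Γ.lam s)] at h1
    have h2 : ∀ r, c' r / (Γ.lam s - c r) = -(c' r / (c r - Γ.lam s)) := fun r => by
      rw [← neg_sub, div_neg]
    simp only [h2]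
    rw [MeasureTheory.integral_neg]
    field_simp at h1
    linear_combination -h1
  have hnc := hc.notMem_cuts
  have hW : ∫ r in J, W.derivative.eval (c r) * c' r = 0 := by
    rw [MeasureTheory.integral_Icc_eq_integral_Ioc, ← intervalIntegral.integral_of_le zero_le_one,
      intervalIntegral.integral_eq_sub_of_hasDerivAt_of_le zero_le_one
        (f := fun r => W.eval (c r)) (W.continuous.comp_continuousOn hcc)
        (fun r hr => (W.hasDerivAt (c r)).comp r (hder r hr)) ?_, hc.closed, sub_self]
    exact ContinuousOn.intervalIntegrable_of_Icc zero_le_one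
      ((W.derivative.continuous.comp_continuousOn hcc).mul hc'c)
  have hcont : ContinuousOn (fun q : ℝ × ℝ => Γ.dens Γ.P q.1 / (Γ.lam q.1 - c q.2) * c' q.2)
      (Γ.cutParams ×ˢ J) := by
    refine ContinuousOn.mul (ContinuousOn.div ?_ ?_ ?_) ?_
    · exact (Γ.continuous_dens_P.comp continuous_fst).continuousOn
    · exact (Γ.continuous_lam.comp continuous_fst).continuousOn.sub
        (hcc.comp continuousOn_snd fun q hq => hq.2)
    · exact fun q hq h0 => hnc q.2 hq.2 (sub_eq_zero.1 h0 ▸ Γ.lam_mem_cuts_iff.2 hq.1)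
    · exact hc'c.comp continuousOn_snd fun q hq => hq.2
  have hint := hcont.integrableOn_compact (μ := (MeasureTheory.volume.prod MeasureTheory.volume))
    (Γ.isCompact_cutParams.prod isCompact_Icc)
  rw [MeasureTheory.IntegrableOn, ← MeasureTheory.Measure.prod_restrict] at hint
  have hswap := MeasureTheory.integral_integral_swap
    (f := fun s r => Γ.dens Γ.P s / (Γ.lam s - c r) * c' r) hint
  have hleft : ∫ s in Γ.cutParams, ∫ r in J, Γ.dens Γ.P s / (Γ.lam s - c r) * c' r
      = 2 * Real.pi * Complex.I * (2 * Real.pi * Complex.I * Γ.t) := by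
    rw [← Γ.integral_dens_P hmonic hdeg, ← MeasureTheory.integral_const_mul]
    refine MeasureTheory.setIntegral_congr_fun Γ.measurableSet_cutParams fun s hs => ?_
    rw [← hwind s hs, mul_comm, ← MeasureTheory.integral_const_mul]
    refine MeasureTheory.integral_congr_ae (Eventually.of_forall fun r => ?_)
    ring
  have hz : zetaIntegral (Γ.upperLift c) 0 1 = ∫ r in J, Γ.y₀ (c r) * c' r :=
    hae fun r d => Γ.y₀ (c r) * d
  have hsplit : ∫ r in J, Γ.y₀ (c r) * c' r = (∫ r in J, W.derivative.eval (c r) * c' r)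
      + 1 / (Real.pi * Complex.I) *
        ∫ r in J, ∫ s in Γ.cutParams, Γ.dens Γ.P s / (Γ.lam s - c r) * c' r := by
    rw [← MeasureTheory.integral_const_mul, ← MeasureTheory.integral_add]
    · refine MeasureTheory.setIntegral_congr_fun measurableSet_Icc fun r hr => ?_
      rw [Γ.y₀_eq hmonic hdeg (hnc r hr), MeasureTheory.integral_mul_const, cauchy]
      ring
    · exact ((W.derivative.continuous.comp_continuousOn hcc).mul hc'c).integrableOn_compact
        isCompact_Icc
    · exact hint.integral_prod_right.const_mul _
  rw [hz, hsplit, hW, ← hswap, hleft]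
  field_simp
  ring

end CutCurve
end

/-! ### The continuous logarithm along the path and its boundary values. -/

noncomputable section

section pathLog
variable {lam : ℝ → ℂ}

theorem exists_forall_lt_re {lam : ℝ → ℂ} (htop : Tendsto (fun s => (lam s).re) atTop atTop)
    (M b : ℝ) : ∃ R > b, ∀ u ≥ R, M < (lam u).re := by
  obtain ⟨R, hR⟩ := eventually_atTop.1 (htop.eventually_gt_atTop M)
  exact ⟨max R (b + 1), lt_of_lt_of_le (lt_add_one b) (le_max_right _ _),
    fun u hu => hR u ((le_max_left _ _).trans hu)⟩

theorem continuousOn_deriv_div (hlam : ContDiff ℝ 1 lam) {x : ℂ} {T : Set ℝ}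
    (h : ∀ u ∈ T, lam u ≠ x) : ContinuousOn (fun u => deriv lam u / (lam u - x)) T :=
  (hlam.continuous_deriv le_rfl).continuousOn.div (hlam.continuous.sub continuous_const).continuousOn
    fun u hu => sub_ne_zero.2 (h u hu)

theorem intervalIntegrable_deriv_div (hlam : ContDiff ℝ 1 lam) {x : ℂ} {a b : ℝ}
    (h : ∀ u ∈ Set.uIcc a b, lam u ≠ x) :
    IntervalIntegrable (fun u => deriv lam u / (lam u - x)) MeasureTheory.volume a b :=
  (continuousOn_deriv_div hlam h).intervalIntegrable

/-- The limit that defines `pathLog` is attained. -/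
theorem pathLog_eq (hlam : ContDiff ℝ 1 lam) (hinj : Function.Injective lam) {s s' R : ℝ}
    (hlt : s' < s) (hR : s ≤ R) (hre : ∀ u ≥ R, (lam s').re < (lam u).re) :
    pathLog lam s s' = Complex.log (lam R - lam s') - ∫ u in s..R, deriv lam u / (lam u - lam s') := by
  refine Tendsto.limUnder_eq (tendsto_const_nhds.congr' ?_)
  filter_upwards [eventually_ge_atTop R] with R' hR'
  have hii : ∀ a b, s ≤ a → s ≤ b →
      IntervalIntegrable (fun u => deriv lam u / (lam u - lam s')) MeasureTheory.volume a b :=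
    fun a b ha hb => intervalIntegrable_deriv_div hlam fun u hu h0 => by
      have h1 := (le_inf ha hb).trans hu.1
      rw [hinj h0] at h1
      exact absurd h1 (not_le.2 hlt)
  have h1 := integral_deriv_div_eq_log hlam (c := 1) (x := lam s') hR' fun u hu => by
    rw [one_mul]
    exact Or.inl (by rw [Complex.sub_re, sub_pos]; exact hre u hu.1)
  rw [one_mul, one_mul] at h1
  rw [← intervalIntegral.integral_add_adjacent_intervals (hii s R le_rfl hR)
    (hii R R' hR (hR.trans hR')), h1]
  ring

theorem pathLog_of_le (hlam : ContDiff ℝ 1 lam) (hinj : Function.Injective lam) {s s' : ℝ}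
    (hlt : s' < s) (hre : ∀ u ≥ s, (lam s').re < (lam u).re) :
    pathLog lam s s' = Complex.log (lam s - lam s') := by
  rw [pathLog_eq hlam hinj hlt le_rfl hre, intervalIntegral.integral_same, sub_zero]

theorem pathLog_sub_left (hlam : ContDiff ℝ 1 lam) (hinj : Function.Injective lam)
    (htop : Tendsto (fun s => (lam s).re) atTop atTop) {s₁ s₂ s' : ℝ} (h1 : s' < s₁) (h2 : s' < s₂) :
    pathLog lam s₂ s' - pathLog lam s₁ s' = ∫ u in s₁..s₂, deriv lam u / (lam u - lam s') := by
  obtain ⟨R, hR, hre⟩ := exists_forall_lt_re htop (lam s').re (max s₁ s₂)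
  have hii : ∀ a b, s' < a → s' < b →
      IntervalIntegrable (fun u => deriv lam u / (lam u - lam s')) MeasureTheory.volume a b :=
    fun a b ha hb => intervalIntegrable_deriv_div hlam fun u hu h0 => by
      have h1 := (lt_inf_iff.2 ⟨ha, hb⟩).trans_le hu.1
      rw [hinj h0] at h1
      exact lt_irrefl _ h1
  have h3 : s₁ ≤ R := (le_max_left _ _).trans hR.le
  have h4 : s₂ ≤ R := (le_max_right _ _).trans hR.le
  rw [pathLog_eq hlam hinj h1 h3 hre, pathLog_eq hlam hinj h2 h4 hre,
    ← intervalIntegral.integral_add_adjacent_intervals (hii s₁ s₂ h1 h2) (hii s₂ R h2 (h2.trans_le h4))]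
  ring

/-- Differentiation under the integral yields `lam' / (lam - x)²`, which has a primitive. Its value
at the far end `R` cancels the derivative of the principal logarithm, so only the term at `s`
survives. -/
theorem hasDerivAt_pathLog_right (hlam : ContDiff ℝ 1 lam) (hinj : Function.Injective lam)
    (htop : Tendsto (fun s => (lam s).re) atTop atTop) {s s' : ℝ} (hlt : s' < s) :
    HasDerivAt (pathLog lam s) (deriv lam s' / (lam s' - lam s)) s' := by
  obtain ⟨R, hR, hre⟩ := exists_forall_lt_re htop ((lam s').re + 1) s
  have hd : ∀ u, HasDerivAt lam (deriv lam u) u := fun u =>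
    (hlam.differentiable (by norm_num) u).hasDerivAt
  have hcompact : IsCompact (Set.Icc s R) := isCompact_Icc
  have hx : lam s' ∉ lam '' Set.Icc s R := by
    rw [hinj.mem_set_image]; exact fun h => absurd h.1 (not_le.2 hlt)
  obtain ⟨d, hdp, hball⟩ := Metric.isOpen_iff.1
    (hcompact.image hlam.continuous).isClosed.isOpen_compl _ hx
  have hfar : ∀ u ∈ Set.Icc s R, d ≤ ‖lam u - lam s'‖ := fun u hu => by
    by_contra h0
    exact hball (by rw [Metric.mem_ball, dist_eq_norm]; exact not_le.1 h0) ⟨u, hu, rfl⟩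
  have hne : ∀ u ∈ Set.Icc s R, lam u - lam s' ≠ 0 := fun u hu =>
    norm_pos_iff.1 (hdp.trans_le (hfar u hu))
  have h1 := hasDerivAt_integral_div_sub measurableSet_Icc hlam.continuous
    ((hlam.continuous_deriv le_rfl).continuousOn.integrableOn_Icc (a := s) (b := R)) hdp hfar
  have h2 : HasDerivAt (fun x => Complex.log (lam R - x)) (-1 / (lam R - lam s')) (lam s') :=
    ((hasDerivAt_id (lam s')).const_sub (lam R)).clog
      (Or.inl (by rw [id_eq, Complex.sub_re, sub_pos]; linarith [hre R le_rfl]))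
  have h3 : ∫ u in Set.Icc s R, deriv lam u / (lam u - lam s') ^ 2
      = 1 / (lam s - lam s') - 1 / (lam R - lam s') := by
    rw [MeasureTheory.integral_Icc_eq_integral_Ioc, ← intervalIntegral.integral_of_le hR.le,
      intervalIntegral.integral_eq_sub_of_hasDerivAt (f := fun u => -(1 / (lam u - lam s')))]
    · ring
    · intro u hu
      rw [Set.uIcc_of_le hR.le] at hu
      have := ((hasDerivAt_const u (1 : ℂ)).div ((hd u).sub_const (lam s')) (hne u hu)).neg
      refine this.congr_deriv ?_
      ring
    · refine ContinuousOn.intervalIntegrable ?_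
      rw [Set.uIcc_of_le hR.le]
      exact (hlam.continuous_deriv le_rfl).continuousOn.div
        ((hlam.continuous.sub continuous_const).pow 2).continuousOn fun u hu => pow_ne_zero 2 (hne u hu)
  have h4 := ((h2.sub h1).congr_deriv (g' := 1 / (lam s' - lam s)) (by
    rw [h3, ← neg_sub (lam s), div_neg]; ring)).comp s' (hd s')
  refine (h4.congr_of_eventuallyEq ?_).congr_deriv (by ring)
  have hnear : ∀ᶠ w in 𝓝 s', (lam w).re < (lam s').re + 1 :=
    (Complex.continuous_re.comp hlam.continuous).continuousAt.eventually_lt continuousAt_const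
      (lt_add_one _)
  filter_upwards [hnear, gt_mem_nhds hlt] with w hw hws
  rw [pathLog_eq hlam hinj hws hR.le fun u hu => hw.trans (hre u hu)]
  simp only [Function.comp_apply, Pi.sub_apply]
  rw [MeasureTheory.integral_Icc_eq_integral_Ioc, ← intervalIntegral.integral_of_le hR.le]

theorem pathLog_sub_right (hlam : ContDiff ℝ 1 lam) (hinj : Function.Injective lam)
    (htop : Tendsto (fun s => (lam s).re) atTop atTop) {s₁ s₂ s : ℝ} (h1 : s₁ < s) (h2 : s₂ < s) :
    pathLog lam s s₂ - pathLog lam s s₁ = ∫ u in s₁..s₂, deriv lam u / (lam u - lam s) := by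
  have hlt : ∀ u ∈ Set.uIcc s₁ s₂, u < s := fun u hu => hu.2.trans_lt (max_lt h1 h2)
  refine (intervalIntegral.integral_eq_sub_of_hasDerivAt
    (fun u hu => hasDerivAt_pathLog_right hlam hinj htop (hlt u hu)) ?_).symm
  exact intervalIntegrable_deriv_div hlam fun u hu h0 => (hlt u hu).ne (hinj h0)

theorem principalLog_of_lt {s s' : ℝ} (h : s' < s) : principalLog lam s s' = pathLog lam s s' :=
  if_pos h

/-- The two half turns `± π I` about `lam s'` cancel in the mean. -/
theorem principalLog_of_le {s s' : ℝ} (h : s ≤ s') : principalLog lam s s' = pathLog lam s' s := by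
  rw [principalLog, if_neg (not_lt.2 h)]; ring

/-- This makes the double logarithmic integral a symmetric form in the two densities. -/
theorem principalLog_comm (s s' : ℝ) : principalLog lam s s' = principalLog lam s' s := by
  rcases lt_trichotomy s s' with h | h | h
  · rw [principalLog_of_le h.le, principalLog_of_lt h]
  · rw [h]
  · rw [principalLog_of_le h.le, principalLog_of_lt h]

theorem principalLog_sub (hlam : ContDiff ℝ 1 lam) (hinj : Function.Injective lam)
    (htop : Tendsto (fun s => (lam s).re) atTop atTop) {s₁ s₂ s' : ℝ} (hle : s₁ ≤ s₂)
    (h : s' < s₁ ∨ s₂ < s') :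
    principalLog lam s₂ s' - principalLog lam s₁ s' =
      ∫ u in s₁..s₂, deriv lam u / (lam u - lam s') := by
  rcases h with h | h
  · rw [principalLog_of_lt h, principalLog_of_lt (h.trans_le hle),
      pathLog_sub_left hlam hinj htop h (h.trans_le hle)]
  · rw [principalLog_of_le h.le, principalLog_of_le (hle.trans h.le),
      pathLog_sub_right hlam hinj htop (hle.trans_lt h) h]

/-- On a window the continuous logarithm is a constant plus a principal logarithm. -/
theorem IsWindow.exists_pathLog_eq {s₀ κ : ℝ} (hw : IsWindow lam s₀ κ) (hlam : ContDiff ℝ 1 lam)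
    (hinj : Function.Injective lam) (htop : Tendsto (fun s => (lam s).re) atTop atTop)
    (hne : deriv lam s₀ ≠ 0) :
    ∃ C : ℂ, ∀ s ∈ Set.Icc (s₀ - κ) (s₀ + κ), ∀ s' ∈ Set.Icc (s₀ - κ) (s₀ + κ), s' < s →
      pathLog lam s s' = C + Complex.log ((lam s - lam s') / deriv lam s₀) := by
  set v := deriv lam s₀ with hv
  set J := Set.Icc (s₀ - κ) (s₀ + κ)
  have hκ := hw.1
  have hslit : ∀ s ∈ J, ∀ s' ∈ J, s' < s → 1 / v * (lam s - lam s') ∈ Complex.slitPlane :=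
    fun s hs s' hs' h => Or.inl (by
      rw [one_div_mul_eq_div]
      exact hw.re_pos hlam hne hs hs' h)
  have hslit' : ∀ s ∈ J, ∀ s' ∈ J, s' < s → -1 / v * (lam s' - lam s) ∈ Complex.slitPlane :=
    fun s hs s' hs' h => by
      have := hslit s hs s' hs' h
      rwa [neg_div, neg_mul, ← mul_neg, neg_sub]
  have key1 : ∀ s₁ ∈ J, ∀ s₂ ∈ J, ∀ s' ∈ J, s' < s₁ → s₁ ≤ s₂ →
      pathLog lam s₂ s' - Complex.log ((lam s₂ - lam s') / v)
        = pathLog lam s₁ s' - Complex.log ((lam s₁ - lam s') / v) := by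
    intro s₁ h1 s₂ h2 s' h3 hlt hle
    have e1 := pathLog_sub_left hlam hinj htop hlt (hlt.trans_le hle)
    have e2 := integral_deriv_div_eq_log hlam (c := 1 / v) (x := lam s') hle fun u hu =>
      hslit u ⟨h1.1.trans hu.1, hu.2.trans h2.2⟩ s' h3 (hlt.trans_le hu.1)
    rw [one_div_mul_eq_div, one_div_mul_eq_div] at e2
    linear_combination e1 + e2
  have key2 : ∀ s₁ ∈ J, ∀ s₂ ∈ J, ∀ s ∈ J, s₁ ≤ s₂ → s₂ < s →
      pathLog lam s s₂ - Complex.log ((lam s - lam s₂) / v)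
        = pathLog lam s s₁ - Complex.log ((lam s - lam s₁) / v) := by
    intro s₁ h1 s₂ h2 s h3 hle hlt
    have e1 := pathLog_sub_right hlam hinj htop (hle.trans_lt hlt) hlt
    have e2 := integral_deriv_div_eq_log hlam (c := -1 / v) (x := lam s) hle fun u hu =>
      hslit' s h3 u ⟨h1.1.trans hu.1, hu.2.trans h2.2⟩ (hu.2.trans_lt hlt)
    have e3 : ∀ u, -1 / v * (lam u - lam s) = (lam s - lam u) / v := fun u => by ring
    rw [e3, e3] at e2
    linear_combination e1 + e2
  have ha : s₀ - κ ∈ J := ⟨le_rfl, by linarith⟩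
  have hb : s₀ + κ ∈ J := ⟨by linarith, le_rfl⟩
  refine ⟨pathLog lam (s₀ + κ) (s₀ - κ) - Complex.log ((lam (s₀ + κ) - lam (s₀ - κ)) / v),
    fun s hs s' hs' hlt => ?_⟩
  have e1 := key1 s hs _ hb s' hs' hlt hs.2
  have e2 := key2 _ ha s' hs' _ hb hs'.1 (hlt.trans_le hs.2)
  linear_combination -e1 + e2

open Classical in
/-- The boundary value of the logarithm from the left of the path. -/
def leftLog (lam : ℝ → ℂ) (s s' : ℝ) : ℂ :=
  principalLog lam s s' + if s < s' then Real.pi * Complex.I else 0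

/-- The function `log (-I / v * ·)` is one branch for both orders of `s` and `s'`: it adds `π / 2`
times `I` before `lam s'` and subtracts it after. Their difference is the `π I` of a half turn on
the left. -/
theorem IsWindow.exists_leftLog_eq {s₀ κ : ℝ} (hw : IsWindow lam s₀ κ) (hlam : ContDiff ℝ 1 lam)
    (hinj : Function.Injective lam) (htop : Tendsto (fun s => (lam s).re) atTop atTop)
    (hne : deriv lam s₀ ≠ 0) :
    ∃ C : ℂ, ∀ s ∈ Set.Icc (s₀ - κ) (s₀ + κ), ∀ s' ∈ Set.Icc (s₀ - κ) (s₀ + κ), s ≠ s' →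
      -Complex.I / deriv lam s₀ * (lam s - lam s') ∈ Complex.slitPlane ∧
      leftLog lam s s' = C + Complex.log (-Complex.I / deriv lam s₀ * (lam s - lam s')) := by
  obtain ⟨C, hC⟩ := hw.exists_pathLog_eq hlam hinj htop hne
  refine ⟨C + Real.pi / 2 * Complex.I, fun s hs s' hs' hss => ?_⟩
  set v := deriv lam s₀ with hv
  rcases lt_or_gt_of_ne hss with h | h
  · have hre := hw.re_pos hlam hne hs' hs h
    have e : -Complex.I / v * (lam s - lam s') = Complex.I * ((lam s' - lam s) / v) := by ring
    rw [e]
    refine ⟨I_mul_mem_slitPlane fun h0 => absurd h0 hre.ne', ?_⟩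
    rw [log_I_mul hre, leftLog, principalLog_of_le h.le, hC s' hs' s hs h, if_pos h]
    ring
  · have hre := hw.re_pos hlam hne hs hs' h
    have e : -Complex.I / v * (lam s - lam s') = -Complex.I * ((lam s - lam s') / v) := by ring
    rw [e]
    refine ⟨neg_I_mul_mem_slitPlane fun h0 => absurd h0 hre.ne', ?_⟩
    rw [log_neg_I_mul hre, leftLog, principalLog_of_lt h, hC s hs s' hs' h, if_neg (not_lt.2 h.le)]
    ring

/-- The exponent `1 / 4` is chosen so that, against the inverse square roots of the densities, the
total exponent stays below `1`. -/
theorem abs_log_le_rpow {x : ℝ} (hx : 0 < x) :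
    |Real.log x| ≤ 4 * (x ^ (1 / 4 : ℝ) + x ^ (-(1 / 4) : ℝ)) := by
  have h1 := Real.log_le_rpow_div hx.le (by norm_num : (0 : ℝ) < 1 / 4)
  have h2 := Real.log_le_rpow_div (inv_pos.2 hx).le (by norm_num : (0 : ℝ) < 1 / 4)
  rw [Real.log_inv, Real.inv_rpow hx.le, ← Real.rpow_neg hx.le] at h2
  have h3 : 0 ≤ x ^ (1 / 4 : ℝ) := Real.rpow_nonneg hx.le _
  have h4 : 0 ≤ x ^ (-(1 / 4) : ℝ) := Real.rpow_nonneg hx.le _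
  rw [abs_le]
  constructor <;> linarith

theorem norm_log_le_of_norm_mem {z : ℂ} {c M r : ℝ} (hc : 0 < c) (hr : 0 < r) (h1 : c * r ≤ ‖z‖)
    (h2 : ‖z‖ ≤ M) : ‖Complex.log z‖ ≤
      (4 * M ^ (1 / 4 : ℝ) + Real.pi + 4 * c ^ (-(1 / 4) : ℝ)) * (1 + r ^ (-(1 / 4) : ℝ)) := by
  have hz : 0 < ‖z‖ := (mul_pos hc hr).trans_le h1
  have hM : 0 < M := hz.trans_le h2
  have e1 := Complex.norm_le_abs_re_add_abs_im (Complex.log z)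
  rw [Complex.log_re, Complex.log_im] at e1
  have e2 := Complex.abs_arg_le_pi z
  have e3 := abs_log_le_rpow hz
  have e4 : ‖z‖ ^ (1 / 4 : ℝ) ≤ M ^ (1 / 4 : ℝ) := by gcongr
  have e5 : ‖z‖ ^ (-(1 / 4) : ℝ) ≤ c ^ (-(1 / 4) : ℝ) * r ^ (-(1 / 4) : ℝ) := by
    rw [← Real.mul_rpow hc.le hr.le]
    exact Real.rpow_le_rpow_of_nonpos (mul_pos hc hr) h1 (by norm_num)
  have p1 : 0 ≤ M ^ (1 / 4 : ℝ) := by positivity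
  have p2 : 0 ≤ c ^ (-(1 / 4) : ℝ) := by positivity
  have p3 : 0 ≤ r ^ (-(1 / 4) : ℝ) := by positivity
  have p4 := Real.pi_pos
  nlinarith [mul_nonneg p1 p3, mul_nonneg p2 p3, mul_nonneg p4.le p3]

/-- The bound is local on the square of parameters and, by symmetry, needed only for `s' < s`. Near
the diagonal the logarithm is a constant plus a principal one of comparable argument; away from it
the defining formula is bounded. -/
theorem exists_norm_principalLog_le (hlam : ContDiff ℝ 1 lam) (hinj : Function.Injective lam)
    (htop : Tendsto (fun s => (lam s).re) atTop atTop) (hne : ∀ s, deriv lam s ≠ 0) (A B : ℝ) :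
    ∃ C > 0, ∀ s ∈ Set.Icc A B, ∀ s' ∈ Set.Icc A B, s ≠ s' →
      ‖principalLog lam s s'‖ ≤ C * (1 + |s - s'| ^ (-(1 / 4) : ℝ)) := by
  suffices h : ∃ C > 0, ∀ q ∈ Set.Icc A B ×ˢ Set.Icc A B, q.2 < q.1 →
      ‖pathLog lam q.1 q.2‖ ≤ C * (1 + |q.1 - q.2| ^ (-(1 / 4) : ℝ)) by
    obtain ⟨C, hC, h⟩ := h
    refine ⟨C, hC, fun s hs s' hs' hss => ?_⟩
    rcases lt_or_gt_of_ne hss with h1 | h1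
    · rw [principalLog_of_le h1.le, abs_sub_comm]; exact h (s', s) ⟨hs', hs⟩ h1
    · rw [principalLog_of_lt h1]; exact h (s, s') ⟨hs, hs'⟩ h1
  have hpos : ∀ x : ℝ, 1 ≤ 1 + |x| ^ (-(1 / 4) : ℝ) := fun x => by
    have : 0 ≤ |x| ^ (-(1 / 4) : ℝ) := by positivity
    linarith
  refine (isCompact_Icc.prod isCompact_Icc).induction_on
    (p := fun T => ∃ C > 0, ∀ q ∈ T, q.2 < q.1 →
      ‖pathLog lam q.1 q.2‖ ≤ C * (1 + |q.1 - q.2| ^ (-(1 / 4) : ℝ))) ⟨1, one_pos, by simp⟩ ?_ ?_ ?_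
  · rintro T T' hTT ⟨C, hC, h⟩
    exact ⟨C, hC, fun q hq => h q (hTT hq)⟩
  · rintro T T' ⟨C, hC, h⟩ ⟨C', hC', h'⟩
    refine ⟨max C C', lt_max_of_lt_left hC, fun q hq hlt => ?_⟩
    have h0 := (zero_le_one.trans (hpos (q.1 - q.2)))
    rcases hq with hq | hq
    · exact (h q hq hlt).trans (mul_le_mul_of_nonneg_right (le_max_left _ _) h0)
    · exact (h' q hq hlt).trans (mul_le_mul_of_nonneg_right (le_max_right _ _) h0)
  · rintro ⟨s₀, s₀'⟩ -
    rcases lt_trichotomy s₀' s₀ with hlt | heq | hgt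
    · obtain ⟨δ, hδ, hδ'⟩ : ∃ δ > 0, s₀' + δ < s₀ - δ :=
        ⟨(s₀ - s₀') / 3, by linarith, by linarith⟩
      obtain ⟨M, hM⟩ := (isCompact_Icc (a := s₀' - δ) (b := s₀' + δ)).exists_bound_of_continuousOn
        hlam.continuous.continuousOn
      obtain ⟨R, hR, hre⟩ := exists_forall_lt_re htop (M + 1) (s₀ + δ)
      obtain ⟨c, hc, hbi⟩ := exists_mul_abs_sub_le_norm_sub hlam hne hinj (s₀' - δ) R
      obtain ⟨D, hD⟩ := (isCompact_Icc (a := s₀ - δ) (b := R)).exists_bound_of_continuousOn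
        (hlam.continuous_deriv le_rfl).continuousOn
      set e := s₀ - δ - (s₀' + δ)
      have he : 0 < e := by simp only [e]; linarith
      refine ⟨Set.Icc (s₀ - δ) (s₀ + δ) ×ˢ Set.Icc (s₀' - δ) (s₀' + δ), mem_nhdsWithin_of_mem_nhds
        (prod_mem_nhds (Icc_mem_nhds (by linarith) (by linarith))
          (Icc_mem_nhds (by linarith) (by linarith))),
        (‖lam R‖ + M + 1 + Real.pi) + (D + 1) / (c * e) * (R - (s₀ - δ)) + 1, ?_, ?_⟩
      · have hM0 := (norm_nonneg _).trans (hM s₀' ⟨by linarith, by linarith⟩)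
        have hD0 := (norm_nonneg _).trans (hD s₀ ⟨by linarith, by linarith⟩)
        have : 0 ≤ R - (s₀ - δ) := by linarith
        have := Real.pi_pos
        positivity
      · rintro ⟨s, s'⟩ ⟨hs, hs'⟩ hss
        simp only at hs hs' hss ⊢
        have hM1 := hM s' hs'
        have hM0 := (norm_nonneg _).trans hM1
        have hD0 := (norm_nonneg _).trans (hD s₀ ⟨by linarith, by linarith⟩)
        have hR1 := hre R le_rfl
        have hre1 := (le_abs_self _).trans (Complex.abs_re_le_norm (lam s'))
        rw [pathLog_eq hlam hinj hss (show s ≤ R by linarith [hs.2]) fun u hu => by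
          linarith [hre u hu]]
        have b1 : ‖Complex.log (lam R - lam s')‖ ≤ ‖lam R‖ + M + 1 + Real.pi := by
          have g1 : 1 ≤ ‖lam R - lam s'‖ := by
            refine le_trans ?_ ((le_abs_self _).trans (Complex.abs_re_le_norm _))
            rw [Complex.sub_re]; linarith
          have g2 := norm_log_le (lam R - lam s') (norm_pos_iff.1 (by linarith))
          have g3 : ‖lam R - lam s'‖⁻¹ ≤ 1 := inv_le_one_of_one_le₀ g1
          have g4 := norm_sub_le (lam R) (lam s')
          linarith
        have b2 : ‖∫ u in s..R, deriv lam u / (lam u - lam s')‖ ≤ (D + 1) / (c * e) * (R - (s₀ - δ)) := by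
          refine (intervalIntegral.norm_integral_le_of_norm_le_const
            (C := (D + 1) / (c * e)) fun u hu => ?_).trans ?_
          · rw [Set.uIoc_of_le (by linarith [hs.2])] at hu
            rw [norm_div]
            have g1 := hD u ⟨by linarith [hs.1, hu.1], hu.2⟩
            have g2 := hbi u ⟨by linarith [hs.1, hu.1], hu.2⟩ s' ⟨hs'.1, by linarith [hs'.2]⟩
            have g3 : e ≤ |u - s'| := by
              refine le_trans ?_ (le_abs_self _)
              simp only [e]; linarith [hs.1, hu.1, hs'.2]
            have g4 : c * e ≤ ‖lam u - lam s'‖ := le_trans (by gcongr) g2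
            gcongr
            linarith
          · rw [abs_of_nonneg (by linarith [hs.2])]
            gcongr
            exact hs.1
        have b3 := norm_sub_le (Complex.log (lam R - lam s'))
          (∫ u in s..R, deriv lam u / (lam u - lam s'))
        refine (b3.trans (by linarith : _ ≤ (‖lam R‖ + M + 1 + Real.pi)
          + (D + 1) / (c * e) * (R - (s₀ - δ)) + 1)).trans (le_mul_of_one_le_right ?_ (hpos _))
        have : 0 ≤ R - (s₀ - δ) := by linarith
        have := Real.pi_pos
        positivity
    · subst heq
      obtain ⟨κ, hκ, -, hw⟩ := exists_isWindow hlam hne s₀' one_pos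
      obtain ⟨C, hC⟩ := hw.exists_pathLog_eq hlam hinj htop (hne s₀')
      set v := deriv lam s₀' with hv
      refine ⟨Set.Icc (s₀' - κ) (s₀' + κ) ×ˢ Set.Icc (s₀' - κ) (s₀' + κ), mem_nhdsWithin_of_mem_nhds
        (prod_mem_nhds (Icc_mem_nhds (by linarith) (by linarith))
          (Icc_mem_nhds (by linarith) (by linarith))),
        ‖C‖ + (4 * (4 * κ) ^ (1 / 4 : ℝ) + Real.pi + 4 * (1 / 2 : ℝ) ^ (-(1 / 4) : ℝ)) , ?_, ?_⟩
      · have := Real.pi_pos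
        positivity
      · rintro ⟨s, s'⟩ ⟨hs, hs'⟩ hss
        simp only at hs hs' hss ⊢
        rw [hC s hs s' hs' hss]
        have hvp := norm_pos_iff.2 (hne s₀')
        have g1 := hw.norm_ge hlam hs hs'
        have g2 := hw.norm_div_sub_le hlam (hne s₀') hs hs'
        have g3 : 0 < |s - s'| := abs_pos.2 (sub_ne_zero.2 hss.ne')
        have g4 : |s - s'| ≤ 2 * κ := by
          rw [abs_le]; constructor <;> linarith [hs.1, hs.2, hs'.1, hs'.2]
        have g5 := norm_log_le_of_norm_mem (z := (lam s - lam s') / v) (c := 1 / 2) (M := 4 * κ)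
          (r := |s - s'|) (by norm_num) g3 (by
            rw [norm_div, le_div_iff₀ hvp]; linarith) (by
            have h1 := norm_add_le ((lam s - lam s') / v - ((s - s' : ℝ) : ℂ)) ((s - s' : ℝ) : ℂ)
            rw [sub_add_cancel, Complex.norm_real, Real.norm_eq_abs] at h1
            linarith)
        have g6 : ‖C‖ ≤ ‖C‖ * (1 + |s - s'| ^ (-(1 / 4) : ℝ)) :=
          le_mul_of_one_le_right (norm_nonneg _) (hpos _)
        rw [add_mul]
        exact (norm_add_le _ _).trans (add_le_add g6 g5)
    · refine ⟨{q | q.1 < q.2}, mem_nhdsWithin_of_mem_nhds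
        ((isOpen_lt continuous_fst continuous_snd).mem_nhds hgt), 1, one_pos, fun q hq h => ?_⟩
      exact absurd h (not_lt.2 (le_of_lt hq))

theorem continuousOn_pathLog (hlam : ContDiff ℝ 1 lam) (hinj : Function.Injective lam)
    (htop : Tendsto (fun s => (lam s).re) atTop atTop) :
    ContinuousOn (fun q : ℝ × ℝ => pathLog lam q.1 q.2) {q | q.2 < q.1} := by
  rintro ⟨s₀, s₀'⟩ hq
  have hlt : s₀' < s₀ := hq
  obtain ⟨R, hR, hre⟩ := exists_forall_lt_re htop ((lam s₀').re + 1) s₀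
  set X : Set (ℝ × ℝ) := {q | q.2 < q.1 ∧ q.1 < R ∧ (lam q.2).re < (lam s₀').re + 1}
  have hXo : IsOpen X := by
    have h1 : Continuous fun q : ℝ × ℝ => (lam q.2).re :=
      Complex.continuous_re.comp (hlam.continuous.comp continuous_snd)
    exact (isOpen_lt continuous_snd continuous_fst).inter
      ((isOpen_lt continuous_fst continuous_const).inter (isOpen_lt h1 continuous_const))
  have hmem : (s₀, s₀') ∈ X := ⟨hlt, hR, lt_add_one _⟩
  refine ContinuousAt.continuousWithinAt (ContinuousOn.continuousAt (s := X) ?_ (hXo.mem_nhds hmem))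
  -- Replacing `u` by `max u s` makes the integrand continuous in all variables and changes nothing
  -- for `u` between `s` and `R`.
  have hF : Continuous (fun x : X => ∫ u in R..x.1.1,
      deriv lam (max u x.1.1) / (lam (max u x.1.1) - lam x.1.2)) := by
    refine intervalIntegral.continuous_parametric_intervalIntegral_of_continuous ?_ (by fun_prop)
    have hmax : Continuous fun p : X × ℝ => max p.2 p.1.1.1 := by fun_prop
    refine Continuous.div ((hlam.continuous_deriv le_rfl).comp hmax)
      ((hlam.continuous.comp hmax).sub (hlam.continuous.comp (by fun_prop))) ?_
    rintro ⟨x, u⟩ h0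
    have h1 := hinj (sub_eq_zero.1 h0)
    have h2 := x.2.1
    simp only at h1
    have h3 := le_max_right u x.1.1
    linarith
  have hG : Continuous (fun x : X => Complex.log (lam R - lam x.1.2)) := by
    refine Continuous.clog (continuous_const.sub (hlam.continuous.comp (by fun_prop))) fun x => ?_
    refine Or.inl ?_
    rw [Complex.sub_re, sub_pos]
    linarith [x.2.2.2, hre R le_rfl]
  rw [continuousOn_iff_continuous_domRestrict]
  refine (hG.add hF).congr fun x => ?_
  have e : ∫ u in R..x.1.1, deriv lam (max u x.1.1) / (lam (max u x.1.1) - lam x.1.2)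
      = ∫ u in R..x.1.1, deriv lam u / (lam u - lam x.1.2) :=
    intervalIntegral.integral_congr fun u hu => by
      rw [Set.uIcc_of_ge x.2.2.1.le] at hu
      simp only [max_eq_left hu.1]
  rw [Set.domRestrict_apply, pathLog_eq hlam hinj x.2.1 x.2.2.1.le fun u hu => by
    linarith [x.2.2.2, hre u hu], Pi.add_apply, e, intervalIntegral.integral_symm x.1.1 R]
  ring

theorem _root_.ContinuousOn.measurable_indicator {f : ℝ × ℝ → ℂ} {T : Set (ℝ × ℝ)}
    (hf : ContinuousOn f T) (hT : MeasurableSet T) : Measurable (T.indicator f) := by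
  classical
  rw [← Set.piecewise_eq_indicator]
  exact hf.measurable_piecewise continuousOn_const hT

/-- A jointly measurable function that agrees with the principal value off the diagonal. -/
def offDiagLog (lam : ℝ → ℂ) (q : ℝ × ℝ) : ℂ :=
  {q : ℝ × ℝ | q.2 < q.1}.indicator (fun q => pathLog lam q.1 q.2) q
    + {q : ℝ × ℝ | q.1 < q.2}.indicator (fun q => pathLog lam q.2 q.1) q

theorem measurable_offDiagLog (hlam : ContDiff ℝ 1 lam) (hinj : Function.Injective lam)
    (htop : Tendsto (fun s => (lam s).re) atTop atTop) : Measurable (offDiagLog lam) := by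
  have h1 := continuousOn_pathLog hlam hinj htop
  have h2 : ContinuousOn (fun q : ℝ × ℝ => pathLog lam q.2 q.1) {q | q.1 < q.2} :=
    h1.comp (f := fun q : ℝ × ℝ => (q.2, q.1)) (by fun_prop) fun q hq => hq
  exact (h1.measurable_indicator (isOpen_lt continuous_snd continuous_fst).measurableSet).add
    (h2.measurable_indicator (isOpen_lt continuous_fst continuous_snd).measurableSet)

theorem offDiagLog_of_ne {s s' : ℝ} (h : s ≠ s') : offDiagLog lam (s, s') = principalLog lam s s' := by
  rcases lt_or_gt_of_ne h with h1 | h1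
  · rw [principalLog_of_le h1.le]
    simp [offDiagLog, h1, h1.not_gt]
  · rw [principalLog_of_lt h1]
    simp [offDiagLog, h1, h1.not_gt]

end pathLog
end

/-! ### Integrability of logarithmic potentials, and distances from shifted paths. -/

noncomputable section

/-- Both factors decrease, so the product is at most its value with both bases equal to the smaller
one, and `1 / 2 + 1 / 4 = 3 / 4`. -/
theorem rpow_mul_rpow_le {a b : ℝ} (ha : 0 ≤ a) (hb : 0 ≤ b) :
    a ^ (-(1 / 2) : ℝ) * b ^ (-(1 / 4) : ℝ) ≤ a ^ (-(3 / 4) : ℝ) + b ^ (-(3 / 4) : ℝ) := by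
  have hna : 0 ≤ a ^ (-(3 / 4) : ℝ) := Real.rpow_nonneg ha _
  have hnb : 0 ≤ b ^ (-(3 / 4) : ℝ) := Real.rpow_nonneg hb _
  rcases ha.eq_or_lt with rfl | ha'
  · rw [Real.zero_rpow (by norm_num), zero_mul]; positivity
  rcases hb.eq_or_lt with rfl | hb'
  · rw [Real.zero_rpow (by norm_num), mul_zero]; positivity
  rcases le_total a b with h | h
  · calc a ^ (-(1 / 2) : ℝ) * b ^ (-(1 / 4) : ℝ) ≤ a ^ (-(1 / 2) : ℝ) * a ^ (-(1 / 4) : ℝ) := by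
          gcongr ?_ * ?_
          exact Real.rpow_le_rpow_of_nonpos ha' h (by norm_num)
      _ = a ^ (-(3 / 4) : ℝ) := by rw [← Real.rpow_add ha']; norm_num
      _ ≤ _ := by linarith
  · calc a ^ (-(1 / 2) : ℝ) * b ^ (-(1 / 4) : ℝ) ≤ b ^ (-(1 / 2) : ℝ) * b ^ (-(1 / 4) : ℝ) := by
          gcongr ?_ * ?_
          exact Real.rpow_le_rpow_of_nonpos hb' h (by norm_num)
      _ = b ^ (-(3 / 4) : ℝ) := by rw [← Real.rpow_add hb']; norm_num
      _ ≤ _ := by linarith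

namespace CutCurve
variable {m : ℕ} {W : ℂ[X]} (Γ : CutCurve m W)

/-- The singular weight that controls the product of a logarithm at `s` and of a density. -/
def logSing (s s' : ℝ) : ℝ :=
  Γ.sing s' + (∑ k, |s' - Γ.bp k| ^ (-(3 / 4) : ℝ))
    + Fintype.card (Fin (m + 1) × Bool) * |s' - s| ^ (-(3 / 4) : ℝ)

theorem mul_sing_le (s s' : ℝ) : (1 + |s - s'| ^ (-(1 / 4) : ℝ)) * Γ.sing s' ≤ Γ.logSing s s' := by
  rw [add_mul, one_mul, logSing, add_assoc]
  gcongr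
  rw [sing, Finset.mul_sum]
  calc _ ≤ ∑ k, (|s' - Γ.bp k| ^ (-(3 / 4) : ℝ) + |s' - s| ^ (-(3 / 4) : ℝ)) := by
        refine Finset.sum_le_sum fun k _ => ?_
        rw [mul_comm, abs_sub_comm s s']
        exact rpow_mul_rpow_le (abs_nonneg _) (abs_nonneg _)
    _ = _ := by rw [Finset.sum_add_distrib, Finset.sum_const, Finset.card_univ, nsmul_eq_mul]

theorem logSing_nonneg (s s' : ℝ) : 0 ≤ Γ.logSing s s' := by
  have h1 := Γ.sing_nonneg s'
  have h2 : 0 ≤ ∑ k, |s' - Γ.bp k| ^ (-(3 / 4) : ℝ) :=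
    Finset.sum_nonneg fun _ _ => Real.rpow_nonneg (abs_nonneg _) _
  have h3 : 0 ≤ |s' - s| ^ (-(3 / 4) : ℝ) := Real.rpow_nonneg (abs_nonneg _) _
  unfold logSing
  positivity

theorem locallyIntegrable_logSing (s : ℝ) : MeasureTheory.LocallyIntegrable (Γ.logSing s) := by
  have h1 : MeasureTheory.LocallyIntegrable fun s' => ∑ k, |s' - Γ.bp k| ^ (-(3 / 4) : ℝ) :=
    MeasureTheory.locallyIntegrable_finsetSum _ fun k _ =>
      locallyIntegrable_abs_sub_rpow (Γ.bp k) (by norm_num)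
  have h2 := (locallyIntegrable_abs_sub_rpow s (r := -(3 / 4)) (by norm_num)).smul
    (Fintype.card (Fin (m + 1) × Bool) : ℝ)
  exact (Γ.locallyIntegrable_sing.add h1).add h2

theorem integrableOn_logSing (s A B : ℝ) : MeasureTheory.IntegrableOn (Γ.logSing s) (Set.Icc A B) :=
  (Γ.locallyIntegrable_logSing s).integrableOn_isCompact isCompact_Icc

/-- Uniformity in `s`: the only part that moves with `s` is a translate of one integrable function,
and all the translated intervals lie in `[A - B, B - A]`. Fubini for the double logarithmic integral
depends on it. -/
theorem exists_integral_logSing_le (A B : ℝ) :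
    ∃ C, ∀ s ∈ Set.Icc A B, ∫ s' in Set.Icc A B, Γ.logSing s s' ≤ C := by
  set G : ℝ → ℝ := fun s' => Γ.sing s' + ∑ k, |s' - Γ.bp k| ^ (-(3 / 4) : ℝ)
  have hG : MeasureTheory.IntegrableOn G (Set.Icc A B) :=
    (Γ.locallyIntegrable_sing.add (MeasureTheory.locallyIntegrable_finsetSum _ fun k _ =>
      locallyIntegrable_abs_sub_rpow (Γ.bp k) (by norm_num))).integrableOn_isCompact isCompact_Icc
  have h0 := (locallyIntegrable_abs_sub_rpow 0 (r := -(3 / 4)) (by norm_num)).integrableOn_isCompact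
    (isCompact_Icc (a := A - B) (b := B - A))
  refine ⟨(∫ s' in Set.Icc A B, G s') + Fintype.card (Fin (m + 1) × Bool) *
    ∫ x in Set.Icc (A - B) (B - A), |x - 0| ^ (-(3 / 4) : ℝ), fun s hs => ?_⟩
  have hs1 := (locallyIntegrable_abs_sub_rpow s (r := -(3 / 4)) (by norm_num)).integrableOn_isCompact
    (isCompact_Icc (a := A) (b := B))
  have e : ∫ s' in Set.Icc A B, Γ.logSing s s' = (∫ s' in Set.Icc A B, G s')
      + Fintype.card (Fin (m + 1) × Bool) * ∫ s' in Set.Icc A B, |s' - s| ^ (-(3 / 4) : ℝ) := by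
    rw [← MeasureTheory.integral_const_mul, ← MeasureTheory.integral_add hG (hs1.const_mul _)]
    rfl
  rw [e]
  gcongr
  have hAB := hs.1.trans hs.2
  rw [MeasureTheory.integral_Icc_eq_integral_Ioc, ← intervalIntegral.integral_of_le hAB,
    intervalIntegral.integral_comp_sub_right (fun x => |x| ^ (-(3 / 4) : ℝ)) s,
    intervalIntegral.integral_of_le (by linarith)]
  simp only [sub_zero] at h0 ⊢
  refine MeasureTheory.setIntegral_mono_set h0
    (Eventually.of_forall fun x => Real.rpow_nonneg (abs_nonneg _) _) (LE.le.eventuallyLE ?_)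
  intro x hx
  exact ⟨by linarith [hx.1, hs.2], by linarith [hx.2, hs.1]⟩

theorem norm_mul_dens_le (h : ℂ[X]) (A B : ℝ) : ∃ C > 0, ∀ s ∈ Set.Icc A B, ∀ s' ∈ Set.Icc A B,
    s ≠ s' → ‖principalLog Γ.lam s s'‖ * ‖Γ.dens h s'‖ ≤ C * Γ.logSing s s' := by
  obtain ⟨C, hC, h1⟩ := exists_norm_principalLog_le Γ.contDiff_lam Γ.injective_lam Γ.tendsto_atTop
    Γ.deriv_lam_ne_zero A B
  obtain ⟨C', hC', h2⟩ := Γ.exists_norm_dens_le h A B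
  refine ⟨C * C', by positivity, fun s hs s' hs' hss => ?_⟩
  calc _ ≤ (C * (1 + |s - s'| ^ (-(1 / 4) : ℝ))) * (C' * Γ.sing s') := by
        gcongr
        · exact h1 s hs s' hs' hss
        · exact h2 s' hs'
    _ = C * C' * ((1 + |s - s'| ^ (-(1 / 4) : ℝ)) * Γ.sing s') := by ring
    _ ≤ _ := by gcongr; exact Γ.mul_sing_le s s'

theorem measurable_offDiagLog_mul_dens (h : ℂ[X]) (s : ℝ) :
    Measurable fun s' => offDiagLog Γ.lam (s, s') * Γ.dens h s' :=
  ((measurable_offDiagLog Γ.contDiff_lam Γ.injective_lam Γ.tendsto_atTop).comp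
    (by fun_prop : Measurable fun s' : ℝ => (s, s'))).mul (Γ.measurable_dens h)

theorem ae_offDiagLog_eq (s : ℝ) (μ : MeasureTheory.Measure ℝ) [MeasureTheory.NullSingletonClass μ] :
    ∀ᵐ s' ∂μ, offDiagLog Γ.lam (s, s') = principalLog Γ.lam s s' := by
  filter_upwards [MeasureTheory.Measure.ae_ne μ s] with s' hs'
  exact offDiagLog_of_ne (Ne.symm hs')

theorem integrableOn_principalLog_mul_dens (h : ℂ[X]) (s : ℝ) {T : Set ℝ} (hT : T ⊆ Γ.cutParams) :
    MeasureTheory.IntegrableOn (fun s' => principalLog Γ.lam s s' * Γ.dens h s') T := by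
  obtain ⟨A, B, -, hAB⟩ := Γ.exists_cutParams_subset_Icc
  set A' := min A s
  set B' := max B s
  have hs : s ∈ Set.Icc A' B' := ⟨min_le_right _ _, le_max_right _ _⟩
  have hsub : T ⊆ Set.Icc A' B' := fun u hu =>
    ⟨(min_le_left _ _).trans (hAB (hT hu)).1.le, (hAB (hT hu)).2.le.trans (le_max_left _ _)⟩
  obtain ⟨C, hC, hle⟩ := Γ.norm_mul_dens_le h A' B'
  refine MeasureTheory.IntegrableOn.mono_set ?_ hsub
  refine MeasureTheory.Integrable.mono' ((Γ.integrableOn_logSing s A' B').const_mul C) ?_ ?_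
  · refine (Γ.measurable_offDiagLog_mul_dens h s).aestronglyMeasurable.congr ?_
    filter_upwards [Γ.ae_offDiagLog_eq s _] with s' hs'
    rw [hs']
  · filter_upwards [MeasureTheory.ae_restrict_mem measurableSet_Icc,
      MeasureTheory.Measure.ae_ne _ s] with s' hs' hne
    rw [norm_mul]
    exact hle s hs s' hs' (Ne.symm hne)

/-- The logarithmic potential of the density `h dz / y₊` on the path. -/
def potential (h : ℂ[X]) (s : ℝ) : ℂ := ∫ s' in Γ.cutParams, principalLog Γ.lam s s' * Γ.dens h s'

/-- Fubini on a piece of curve off the cuts: the kernel is bounded there and the density is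
integrable. -/
theorem integral_mul_cauchy (h : ℂ[X]) {z g : ℝ → ℂ} {s₁ s₂ : ℝ} (hle : s₁ ≤ s₂)
    (hz : Continuous z) (hg : Continuous g) (hzc : ∀ u ∈ Set.Icc s₁ s₂, z u ∉ Γ.cuts) :
    ∫ u in s₁..s₂, g u * Γ.cauchy h (z u) =
      ∫ s in Γ.cutParams, Γ.dens h s * ∫ u in s₁..s₂, g u / (Γ.lam s - z u) := by
  set J := Set.Icc s₁ s₂
  have hk : ContinuousOn (fun q : ℝ × ℝ => g q.2 / (Γ.lam q.1 - z q.2)) (Γ.cutParams ×ˢ J) :=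
    (hg.comp continuous_snd).continuousOn.div
      ((Γ.continuous_lam.comp continuous_fst).sub (hz.comp continuous_snd)).continuousOn
      fun q hq h0 => hzc q.2 hq.2 (sub_eq_zero.1 h0 ▸ Γ.lam_mem_cuts_iff.2 hq.1)
  obtain ⟨M, hM⟩ := (Γ.isCompact_cutParams.prod isCompact_Icc).exists_bound_of_continuousOn hk
  have hint : MeasureTheory.Integrable (Function.uncurry fun s u => Γ.dens h s * (g u / (Γ.lam s - z u)))
      ((MeasureTheory.volume.restrict Γ.cutParams).prod (MeasureTheory.volume.restrict J)) := by
    have h1 : MeasureTheory.Integrable (fun q : ℝ × ℝ => Γ.dens h q.1 * (M : ℂ))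
        ((MeasureTheory.volume.restrict Γ.cutParams).prod (MeasureTheory.volume.restrict J)) :=
      (Γ.integrableOn_dens_cutParams h).mul_prod
        (MeasureTheory.integrableOn_const (μ := MeasureTheory.volume) (s := J) (C := (M : ℂ))
          measure_Icc_lt_top.ne)
    refine MeasureTheory.Integrable.mono h1 ?_ ?_
    · exact ((Γ.measurable_dens h).comp measurable_fst).mul (((hg.comp continuous_snd).measurable).div
        ((Γ.continuous_lam.comp continuous_fst).sub (hz.comp continuous_snd)).measurable)
        |>.aestronglyMeasurable
    · rw [MeasureTheory.Measure.prod_restrict]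
      filter_upwards [MeasureTheory.ae_restrict_mem (Γ.measurableSet_cutParams.prod measurableSet_Icc)]
        with q hq
      simp only [Function.uncurry]
      rw [norm_mul, norm_mul]
      have := hM q hq
      gcongr
      rw [Complex.norm_real]
      exact this.trans (le_abs_self _)
  have hswap := MeasureTheory.integral_integral_swap hint
  simp only [intervalIntegral.integral_of_le hle, ← MeasureTheory.integral_Icc_eq_integral_Ioc]
  rw [show (∫ s in Γ.cutParams, Γ.dens h s * ∫ u in Set.Icc s₁ s₂, g u / (Γ.lam s - z u))
    = ∫ s in Γ.cutParams, ∫ u in Set.Icc s₁ s₂, Γ.dens h s * (g u / (Γ.lam s - z u)) by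
      simp only [MeasureTheory.integral_const_mul], hswap]
  refine MeasureTheory.integral_congr_ae (Eventually.of_forall fun u => ?_)
  simp only [cauchy]
  rw [← MeasureTheory.integral_const_mul]
  refine MeasureTheory.integral_congr_ae (Eventually.of_forall fun s => ?_)
  ring

/-- The distances survive a small shift to the left, uniformly in `ε`. Near the window the shift is
almost normal to the path and cannot shorten them much; farther away it is small compared with the
distance itself. Domination in the limit `ε → 0` comes from here. -/
theorem exists_offset_lower_bound {s₀ κ : ℝ} (hw : IsWindow Γ.lam s₀ κ) (A B : ℝ) :
    ∃ c > 0, ∀ᶠ ε : ℝ in 𝓝[>] 0, ∀ u ∈ Set.Icc (s₀ - κ / 2) (s₀ + κ / 2), ∀ s' ∈ Set.Icc A B,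
      c * |u - s'| ≤ ‖Γ.lam u + Complex.I * ε * deriv Γ.lam s₀ - Γ.lam s'‖ ∧
        Γ.lam u + Complex.I * ε * deriv Γ.lam s₀ ≠ Γ.lam s' := by
  set v := deriv Γ.lam s₀ with hv
  have hne : v ≠ 0 := Γ.deriv_lam_ne_zero s₀
  have hvp := norm_pos_iff.2 hne
  have hlam := Γ.contDiff_lam
  have hκ := hw.1
  obtain ⟨c, hc, hbi⟩ := exists_mul_abs_sub_le_norm_sub hlam Γ.deriv_lam_ne_zero Γ.injective_lam
    (min A (s₀ - κ)) (max B (s₀ + κ))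
  have h0 : Tendsto (fun h : ℝ => ‖Complex.I * h * v‖) (𝓝[>] 0) (𝓝 0) := by
    have := (tendsto_offset 0 v).norm
    simpa using this
  refine ⟨min (c / 2) (3 / 4 * ‖v‖), by positivity, ?_⟩
  -- Outside the window `|u - s'| ≥ κ / 2`, so a shift below `c * κ / 4` costs at most half of the
  -- bi-Lipschitz bound.
  filter_upwards [h0.eventually (gt_mem_nhds (by positivity : 0 < c * κ / 4)), self_mem_nhdsWithin]
    with ε hε hpos u hu s' hs'
  have hpos' : (0 : ℝ) < ε := hpos
  have hu' : u ∈ Set.Icc (s₀ - κ) (s₀ + κ) := ⟨by linarith [hu.1], by linarith [hu.2]⟩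
  suffices h : (0 < ‖Γ.lam u + Complex.I * ε * v - Γ.lam s'‖) ∧ (c / 2 * |u - s'| ≤
      ‖Γ.lam u + Complex.I * ε * v - Γ.lam s'‖ ∨ 3 / 4 * ‖v‖ * |u - s'| ≤
      ‖Γ.lam u + Complex.I * ε * v - Γ.lam s'‖) by
    refine ⟨?_, fun h1 => by rw [h1, sub_self, norm_zero] at h; exact lt_irrefl _ h.1⟩
    rcases h.2 with h1 | h1
    · exact (mul_le_mul_of_nonneg_right (min_le_left _ _) (abs_nonneg _)).trans h1
    · exact (mul_le_mul_of_nonneg_right (min_le_right _ _) (abs_nonneg _)).trans h1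
  by_cases hsI : s' ∈ Set.Icc (s₀ - κ) (s₀ + κ)
  · have h1 := hw.norm_div_sub_le hlam hne hu' hsI
    set w := (Γ.lam u - Γ.lam s') / v with hwdef
    have e1 : Γ.lam u + Complex.I * ε * v - Γ.lam s' = (w + Complex.I * ε) * v := by
      rw [hwdef, add_mul, div_mul_cancel₀ _ hne]; ring
    have h2 : ‖(((u - s' : ℝ) : ℂ) + Complex.I * ε)‖
        ≤ ‖w + Complex.I * ε‖ + ‖w - ((u - s' : ℝ) : ℂ)‖ := by
      have e2 : (((u - s' : ℝ) : ℂ) + Complex.I * ε)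
        = (w + Complex.I * ε) - (w - ((u - s' : ℝ) : ℂ)) := by ring
      rw [e2]; exact norm_sub_le _ _
    have h3 : ε ≤ ‖(((u - s' : ℝ) : ℂ) + Complex.I * ε)‖ := by
      have := Complex.abs_im_le_norm (((u - s' : ℝ) : ℂ) + Complex.I * ε)
      simpa [abs_of_pos hpos'] using this
    have h4 : |u - s'| ≤ ‖(((u - s' : ℝ) : ℂ) + Complex.I * ε)‖ := by
      have := Complex.abs_re_le_norm (((u - s' : ℝ) : ℂ) + Complex.I * ε)
      simpa using this
    have h5 : 3 / 4 * |u - s'| ≤ ‖w + Complex.I * ε‖ := by linarith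
    have h6 : 0 < ‖w + Complex.I * ε‖ := by linarith
    rw [e1, norm_mul]
    refine ⟨by positivity, Or.inr ?_⟩
    calc _ = (3 / 4 * |u - s'|) * ‖v‖ := by ring
      _ ≤ _ := by gcongr
  · have h1 := hbi u ⟨(min_le_right _ _).trans hu'.1, hu'.2.trans (le_max_right _ _)⟩ s'
      ⟨(min_le_left _ _).trans hs'.1, hs'.2.trans (le_max_left _ _)⟩
    have h2 : κ / 2 ≤ |u - s'| := by
      by_contra hlt
      rw [not_le, abs_lt] at hlt
      exact hsI ⟨by linarith [hu.1], by linarith [hu.2]⟩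
    have h3 : ‖Γ.lam u - Γ.lam s'‖ ≤ ‖Γ.lam u + Complex.I * ε * v - Γ.lam s'‖ + ‖Complex.I * ε * v‖ := by
      have e2 : Γ.lam u - Γ.lam s' = (Γ.lam u + Complex.I * ε * v - Γ.lam s') - Complex.I * ε * v := by
        ring
      rw [e2]; exact norm_sub_le _ _
    have h4 : c * (κ / 2) ≤ c * |u - s'| := by gcongr
    exact ⟨by nlinarith, Or.inl (by linarith)⟩

end CutCurve
end

/-! ### Limits of integrals along shifted pieces of path. -/

noncomputable section

namespace CutCurve
variable {m : ℕ} {W : ℂ[X]} (Γ : CutCurve m W)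

theorem tendsto_y₀_offset {u : ℝ} (hu : u ∉ Set.range Γ.bp) {d : ℂ}
    (hd : ‖d - deriv Γ.lam u‖ ≤ ‖deriv Γ.lam u‖ / 4) :
    Tendsto (fun ε : ℝ => Γ.y₀ (Γ.lam u + Complex.I * ε * d)) (𝓝[>] 0) (𝓝 (Γ.yPlus u)) := by
  by_cases hc : u ∈ Γ.cutParams
  · obtain ⟨i, hi⟩ := Γ.mem_Ioo_of_mem_cutParams hc hu
    obtain ⟨κ, r, Y, Lg, hr, hw, -, -, -, -, -, -, hval⟩ := Γ.exists_local_yPlus hi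
    exact (hval u hw.self_mem (Metric.mem_ball_self hr)).2.2 d hd
  · rw [Γ.yPlus_of_notMem hc]
    exact (Γ.y₀_tendsto_of_notMem hc).comp (tendsto_offset _ _)

/-- Convergence of the integrals of `q - h / y₀` along shifted paths. -/
theorem tendsto_integral_offset (h q : ℂ[X]) {s₀ κ : ℝ} (hw : IsWindow Γ.lam s₀ κ)
    (hd : ∀ u ∈ Set.Icc (s₀ - κ) (s₀ + κ), ‖deriv Γ.lam s₀ - deriv Γ.lam u‖ ≤ ‖deriv Γ.lam u‖ / 4)
    {s₁ s₂ : ℝ} (hle : s₁ ≤ s₂) (h1 : s₀ - κ / 2 ≤ s₁) (h2 : s₂ ≤ s₀ + κ / 2) :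
    Tendsto (fun ε : ℝ => ∫ u in s₁..s₂, deriv Γ.lam u *
      (q.eval (Γ.lam u + Complex.I * ε * deriv Γ.lam s₀)
        - h.eval (Γ.lam u + Complex.I * ε * deriv Γ.lam s₀) /
          Γ.y₀ (Γ.lam u + Complex.I * ε * deriv Γ.lam s₀))) (𝓝[>] 0)
      (𝓝 (∫ u in s₁..s₂, (q.eval (Γ.lam u) * deriv Γ.lam u - Γ.dens h u))) := by
  set v := deriv Γ.lam s₀ with hv
  obtain ⟨A, B, hAB, hsub⟩ := Γ.exists_cutParams_subset_Icc
  have hbpm : ∀ k, Γ.bp k ∈ Set.Icc A B := fun k =>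
    Set.Ioo_subset_Icc_self (hsub (Γ.bp_mem_cutParams k))
  obtain ⟨c, hc, hlow⟩ := Γ.exists_offset_lower_bound hw A B
  obtain ⟨C, hC, hinv⟩ := Γ.exists_inv_le_sing hc
  obtain ⟨D, hD⟩ := (isCompact_Icc (a := s₁) (b := s₂)).exists_bound_of_continuousOn
    Γ.continuous_deriv_lam.continuousOn
  have hzc : Continuous fun x : ℝ × ℝ => Γ.lam x.2 + Complex.I * x.1 * v := by
    have := Γ.continuous_lam; fun_prop
  obtain ⟨Mq, hMq⟩ := ((isCompact_Icc (a := (0 : ℝ)) (b := 1)).prod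
    (isCompact_Icc (a := s₁) (b := s₂))).exists_bound_of_continuousOn
    ((q.continuous.comp hzc).continuousOn)
  obtain ⟨Mh, hMh⟩ := ((isCompact_Icc (a := (0 : ℝ)) (b := 1)).prod
    (isCompact_Icc (a := s₁) (b := s₂))).exists_bound_of_continuousOn
    ((h.continuous.comp hzc).continuousOn)
  have hnull : ∀ᵐ u : ℝ, u ∉ Set.range Γ.bp :=
    (Set.finite_range Γ.bp).countable.ae_notMem _
  have hJ : ∀ u ∈ Set.uIoc s₁ s₂, u ∈ Set.Icc s₁ s₂ := fun u hu => by
    rw [Set.uIoc_of_le hle] at hu; exact Set.Ioc_subset_Icc_self hu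
  have hmemκ : ∀ u ∈ Set.Icc s₁ s₂, u ∈ Set.Icc (s₀ - κ / 2) (s₀ + κ / 2) := fun u hu =>
    ⟨h1.trans hu.1, hu.2.trans h2⟩
  have hcuts : ∀ᶠ ε : ℝ in 𝓝[>] 0, ∀ u ∈ Set.Icc s₁ s₂, Γ.lam u + Complex.I * ε * v ∉ Γ.cuts := by
    filter_upwards [hlow] with ε hε u hu hmem
    rw [cuts_eq_image] at hmem
    obtain ⟨s, hs, he⟩ := hmem
    exact (hε u (hmemκ u hu) s (Set.Ioo_subset_Icc_self (hsub hs))).2 he.symm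
  -- The shifted point at `u` keeps distance at least `c * |u - bp k|` from each branch point, so `1
  -- / y₀` there is dominated by the singular weight at `u`, whatever `ε` is.
  refine intervalIntegral.tendsto_integral_filter_of_dominated_convergence
    (fun u => D * (Mq + Mh * (C * Γ.sing u))) ?_ ?_ ?_ ?_
  · filter_upwards [hcuts] with ε hε
    have hz : Continuous fun u => Γ.lam u + Complex.I * ε * v := by
      have := Γ.continuous_lam; fun_prop
    refine ContinuousOn.aestronglyMeasurable ?_ measurableSet_uIoc
    refine ContinuousOn.mono ?_ hJ
    refine Γ.continuous_deriv_lam.continuousOn.mul ((q.continuous.comp hz).continuousOn.sub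
      ((h.continuous.comp hz).continuousOn.div (Γ.continuousOn_y₀.comp hz.continuousOn hε)
        fun u hu => Γ.y₀_ne_zero (hε u hu)))
  · filter_upwards [hlow, hcuts, self_mem_nhdsWithin,
      mem_nhdsWithin_of_mem_nhds (Iio_mem_nhds one_pos)] with ε hε hεc hpos hlt
    have hpos' : (0 : ℝ) < ε := hpos
    have hlt' : ε < 1 := hlt
    filter_upwards [hnull] with u hub hu
    have hu' := hJ u hu
    have e1 := hD u hu'
    have e2 := hMq (ε, u) ⟨⟨hpos'.le, hlt'.le⟩, hu'⟩
    have e3 := hMh (ε, u) ⟨⟨hpos'.le, hlt'.le⟩, hu'⟩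
    have e4 := hinv u _ _ (Γ.y₀_sq' (hεc u hu')) (fun k => (hε u (hmemκ u hu') _ (hbpm k)).1) hub
    rw [norm_mul, div_eq_mul_inv]
    have hD0 := (norm_nonneg _).trans e1
    have hMh0 := (norm_nonneg _).trans e3
    gcongr
    refine (norm_sub_le _ _).trans (add_le_add e2 ?_)
    rw [norm_mul]
    exact mul_le_mul e3 e4 (norm_nonneg _) hMh0
  · have h3 : IntervalIntegrable Γ.sing MeasureTheory.volume s₁ s₂ :=
      (Γ.locallyIntegrable_sing.integrableOn_isCompact isCompact_uIcc).intervalIntegrable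
    exact ((intervalIntegrable_const).add ((h3.const_mul C).const_mul Mh)).const_mul D
  · filter_upwards [hnull] with u hub hu
    have hu' := hmemκ u (hJ u hu)
    have hκ := hw.1
    have t0 := tendsto_offset (Γ.lam u) v
    have t1 := Γ.tendsto_y₀_offset hub (hd u ⟨by linarith [hu'.1], by linarith [hu'.2]⟩)
    have t2 := ((h.continuous.tendsto (Γ.lam u)).comp t0).div t1 (Γ.yPlus_ne_zero hub)
    have t3 := (((q.continuous.tendsto (Γ.lam u)).comp t0).sub t2).const_mul (deriv Γ.lam u)
    have e : q.eval (Γ.lam u) * deriv Γ.lam u - Γ.dens h u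
        = deriv Γ.lam u * (q.eval (Γ.lam u) - h.eval (Γ.lam u) / Γ.yPlus u) := by
      rw [dens]; ring
    rw [e]
    exact t3

/-- Convergence of the logarithmic kernels along shifted paths, near the window. -/
theorem exists_kernel_bound {s₀ κ : ℝ} (hw : IsWindow Γ.lam s₀ κ) (A B : ℝ)
    {s₁ s₂ : ℝ} (hle : s₁ ≤ s₂) (h1 : s₀ - κ / 2 ≤ s₁) (h2 : s₂ ≤ s₀ + κ / 2) :
    ∃ C > 0, (∀ᶠ ε : ℝ in 𝓝[>] 0, ∀ s' ∈ Set.Icc A B, s' ≠ s₁ → s' ≠ s₂ →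
      ‖∫ u in s₁..s₂, deriv Γ.lam u / (Γ.lam u + Complex.I * ε * deriv Γ.lam s₀ - Γ.lam s')‖
        ≤ C * ((1 + |s₁ - s'| ^ (-(1 / 4) : ℝ)) + (1 + |s₂ - s'| ^ (-(1 / 4) : ℝ)))) ∧
      ∀ s' ∈ Set.Icc A B, s' ≠ s₁ → s' ≠ s₂ →
      Tendsto (fun ε : ℝ => ∫ u in s₁..s₂,
        deriv Γ.lam u / (Γ.lam u + Complex.I * ε * deriv Γ.lam s₀ - Γ.lam s')) (𝓝[>] 0)
        (𝓝 (leftLog Γ.lam s₂ s' - leftLog Γ.lam s₁ s')) := by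
  set v := deriv Γ.lam s₀ with hv
  have hne : v ≠ 0 := Γ.deriv_lam_ne_zero s₀
  have hvp := norm_pos_iff.2 hne
  have hlam := Γ.contDiff_lam
  have hκ := hw.1
  obtain ⟨c, hc, hlow⟩ := Γ.exists_offset_lower_bound hw (min A (s₀ - κ)) (max B (s₀ + κ))
  obtain ⟨D, hD⟩ := (isCompact_Icc (a := s₁) (b := s₂)).exists_bound_of_continuousOn
    Γ.continuous_deriv_lam.continuousOn
  obtain ⟨M, hM⟩ := (isCompact_Icc (a := min A (s₀ - κ)) (b := max B (s₀ + κ))).exists_bound_of_continuousOn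
    Γ.continuous_lam.continuousOn
  have hmemκ : ∀ u ∈ Set.Icc s₁ s₂, u ∈ Set.Icc (s₀ - κ / 2) (s₀ + κ / 2) := fun u hu =>
    ⟨h1.trans hu.1, hu.2.trans h2⟩
  have hbig : ∀ u ∈ Set.Icc s₁ s₂, u ∈ Set.Icc (s₀ - κ) (s₀ + κ) := fun u hu =>
    ⟨by linarith [hu.1], by linarith [hu.2]⟩
  have hm1 : s₁ ∈ Set.Icc s₁ s₂ := ⟨le_rfl, hle⟩
  have hm2 : s₂ ∈ Set.Icc s₁ s₂ := ⟨hle, le_rfl⟩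
  have hsubW : Set.Icc (s₀ - κ) (s₀ + κ) ⊆ Set.Icc (min A (s₀ - κ)) (max B (s₀ + κ)) := fun u hu =>
    ⟨(min_le_right _ _).trans hu.1, hu.2.trans (le_max_right _ _)⟩
  have hsubAB : Set.Icc A B ⊆ Set.Icc (min A (s₀ - κ)) (max B (s₀ + κ)) := fun u hu =>
    ⟨(min_le_left _ _).trans hu.1, hu.2.trans (le_max_left _ _)⟩
  have hM0 := (norm_nonneg _).trans (hM s₁ (hsubW (hbig s₁ hm1)))
  have hD0 := (norm_nonneg _).trans (hD s₁ hm1)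
  have hcI : ‖-Complex.I / v‖ = 1 / ‖v‖ := by simp
  -- the formula near the window
  have hnear : ∀ ε : ℝ, 0 < ε → ∀ s' ∈ Set.Icc (s₀ - κ) (s₀ + κ),
      ∫ u in s₁..s₂, deriv Γ.lam u / (Γ.lam u + Complex.I * ε * v - Γ.lam s') =
        Complex.log (-Complex.I / v * (Γ.lam s₂ + Complex.I * ε * v - Γ.lam s'))
        - Complex.log (-Complex.I / v * (Γ.lam s₁ + Complex.I * ε * v - Γ.lam s')) := by
    intro ε hε s' hs'
    -- Shifting the path to the left is the same as shifting `lam s'` to the right. The path then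
    -- stays in the slit plane seen from there, even when `s'` lies between `s₁` and `s₂`.
    have e : ∀ u, Γ.lam u + Complex.I * ε * v - Γ.lam s' = Γ.lam u - (Γ.lam s' - Complex.I * ε * v) :=
      fun u => by ring
    simp only [e]
    refine integral_deriv_div_eq_log hlam hle fun u hu => ?_
    exact hw.right_of_offset hlam hne hs' (hbig u hu) (d := v)
      (by rw [sub_self, norm_zero]; positivity) hε
  have hfarle : ∀ u ∈ Set.Icc s₁ s₂, ∀ s' ∉ Set.Icc (s₀ - κ) (s₀ + κ), κ / 2 ≤ |u - s'| := by
    intro u hu s' hs'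
    by_contra hlt
    rw [not_le, abs_lt] at hlt
    have := hmemκ u hu
    exact hs' ⟨by linarith [this.1], by linarith [this.2]⟩
  -- An upper bound for the argument of the logarithm: two points of norm at most `M`, a shift of
  -- norm at most `‖v‖` as `ε < 1`, and division by `v`.
  set Mz := (2 * M + ‖v‖) / ‖v‖ with hMz
  set C₁ := 4 * Mz ^ (1 / 4 : ℝ) + Real.pi + 4 * (c / ‖v‖) ^ (-(1 / 4) : ℝ) with hC₁
  have hC₁0 : 0 < C₁ := by have := Real.pi_pos; positivity
  set C₂ := D / (c * (κ / 2)) * (s₂ - s₁)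
  have hC₂0 : 0 ≤ C₂ := mul_nonneg (by positivity) (by linarith)
  have hfarb : ∀ ε : ℝ, (∀ u ∈ Set.Icc (s₀ - κ / 2) (s₀ + κ / 2),
      ∀ s' ∈ Set.Icc (min A (s₀ - κ)) (max B (s₀ + κ)),
      c * |u - s'| ≤ ‖Γ.lam u + Complex.I * ε * v - Γ.lam s'‖ ∧
        Γ.lam u + Complex.I * ε * v ≠ Γ.lam s') → ∀ s' ∈ Set.Icc A B, s' ∉ Set.Icc (s₀ - κ) (s₀ + κ) →
      ∀ u ∈ Set.Icc s₁ s₂, ‖deriv Γ.lam u / (Γ.lam u + Complex.I * ε * v - Γ.lam s')‖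
        ≤ D / (c * (κ / 2)) := by
    intro ε hε s' hs' hsI u hu
    have g1 := hfarle u hu s' hsI
    have g2 := (hε u (hmemκ u hu) s' (hsubAB hs')).1
    have g3 := hD u hu
    rw [norm_div]
    have g4 : c * (κ / 2) ≤ ‖Γ.lam u + Complex.I * ε * v - Γ.lam s'‖ := le_trans (by gcongr) g2
    gcongr
  refine ⟨C₁ + C₂, by positivity, ?_, ?_⟩
  · filter_upwards [hlow, self_mem_nhdsWithin, mem_nhdsWithin_of_mem_nhds (Iio_mem_nhds one_pos)]
      with ε hε hpos hlt s' hs' hn1 hn2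
    have hpos' : (0 : ℝ) < ε := hpos
    have hlt' : ε < 1 := hlt
    have p1 : 0 ≤ |s₁ - s'| ^ (-(1 / 4) : ℝ) := by positivity
    have p2 : 0 ≤ |s₂ - s'| ^ (-(1 / 4) : ℝ) := by positivity
    by_cases hsI : s' ∈ Set.Icc (s₀ - κ) (s₀ + κ)
    · rw [hnear ε hpos' s' hsI]
      have hend : ∀ e ∈ Set.Icc s₁ s₂, s' ≠ e →
          ‖Complex.log (-Complex.I / v * (Γ.lam e + Complex.I * ε * v - Γ.lam s'))‖
            ≤ C₁ * (1 + |e - s'| ^ (-(1 / 4) : ℝ)) := by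
        intro e he hne'
        refine norm_log_le_of_norm_mem (c := c / ‖v‖) (M := Mz) (by positivity)
          (abs_pos.2 (sub_ne_zero.2 (Ne.symm hne'))) ?_ ?_
        · rw [norm_mul, hcI, div_mul_eq_mul_div, one_div_mul_eq_div]
          gcongr
          exact (hε e (hmemκ e he) s' (hsubW hsI)).1
        · rw [norm_mul, hcI, one_div_mul_eq_div, hMz]
          gcongr
          have g1 := norm_sub_le (Γ.lam e + Complex.I * ε * v) (Γ.lam s')
          have g2 := norm_add_le (Γ.lam e) (Complex.I * ε * v)
          have g3 := hM e (hsubW (hbig e he))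
          have g4 := hM s' (hsubW hsI)
          have g5 : ‖Complex.I * ε * v‖ ≤ ‖v‖ := by
            rw [norm_mul, norm_mul, Complex.norm_I, one_mul, Complex.norm_real,
              Real.norm_of_nonneg hpos'.le]
            exact mul_le_of_le_one_left (norm_nonneg _) hlt'.le
          linarith
      have g1 := hend s₁ hm1 hn1
      have g2 := hend s₂ hm2 hn2
      refine (norm_sub_le _ _).trans ?_
      nlinarith
    · have g1 := intervalIntegral.norm_integral_le_of_norm_le_const (a := s₁) (b := s₂)
        (fun u hu => hfarb ε hε s' hs' hsI u (by
          rw [Set.uIoc_of_le hle] at hu; exact Set.Ioc_subset_Icc_self hu))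
      rw [abs_of_nonneg (by linarith)] at g1
      refine g1.trans ?_
      change C₂ ≤ _
      nlinarith
  · intro s' hs' hn1 hn2
    by_cases hsI : s' ∈ Set.Icc (s₀ - κ) (s₀ + κ)
    · obtain ⟨C, hC⟩ := hw.exists_leftLog_eq hlam Γ.injective_lam Γ.tendsto_atTop hne
      have hend : ∀ e ∈ Set.Icc s₁ s₂, s' ≠ e →
          Tendsto (fun ε : ℝ => Complex.log (-Complex.I / v * (Γ.lam e + Complex.I * ε * v - Γ.lam s')))
            (𝓝[>] 0) (𝓝 (leftLog Γ.lam e s' - C)) := by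
        intro e he hne'
        obtain ⟨g1, g2⟩ := hC e (hbig e he) s' hsI (Ne.symm hne')
        rw [g2, add_sub_cancel_left]
        exact (((tendsto_offset (Γ.lam e) v).sub_const (Γ.lam s')).const_mul _).clog g1
      have t := (hend s₂ hm2 hn2).sub (hend s₁ hm1 hn1)
      rw [sub_sub_sub_cancel_right] at t
      refine t.congr' ?_
      filter_upwards [self_mem_nhdsWithin] with ε hε
      exact (hnear ε hε s' hsI).symm
    · have hout : s' < s₁ ∨ s₂ < s' := by
        by_contra hcon
        rw [not_or, not_lt, not_lt] at hcon
        exact hsI (hbig s' hcon)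
      -- `s'` is not between `s₁` and `s₂`, so the half turns in the two left logarithms are both
      -- present or both absent.
      have e1 : leftLog Γ.lam s₂ s' - leftLog Γ.lam s₁ s'
          = ∫ u in s₁..s₂, deriv Γ.lam u / (Γ.lam u - Γ.lam s') := by
        rw [← principalLog_sub hlam Γ.injective_lam Γ.tendsto_atTop hle hout, leftLog, leftLog]
        rcases hout with h | h
        · rw [if_neg (by linarith), if_neg (by linarith)]; ring
        · rw [if_pos (by linarith), if_pos (by linarith)]; ring
      rw [e1]
      refine intervalIntegral.tendsto_integral_filter_of_dominated_convergence
        (fun _ => D / (c * (κ / 2))) ?_ ?_ intervalIntegrable_const ?_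
      · refine Eventually.of_forall fun ε => Measurable.aestronglyMeasurable ?_
        have := Γ.continuous_lam
        exact Γ.continuous_deriv_lam.measurable.div (by fun_prop :
          Continuous fun u => Γ.lam u + Complex.I * ε * v - Γ.lam s').measurable
      · filter_upwards [hlow] with ε hε
        refine Eventually.of_forall fun u hu => hfarb ε hε s' hs' hsI u ?_
        rw [Set.uIoc_of_le hle] at hu; exact Set.Ioc_subset_Icc_self hu
      · refine Eventually.of_forall fun u hu => ?_
        rw [Set.uIoc_of_le hle] at hu
        have hus : u ≠ s' := by
          rintro rfl
          rcases hout with h | h <;> linarith [hu.1, hu.2]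
        exact (tendsto_const_nhds (x := deriv Γ.lam u)).div
          ((tendsto_offset (Γ.lam u) v).sub_const _)
          (sub_ne_zero.2 (Γ.injective_lam.ne hus))

end CutCurve
end

/-! ### Variation of the potential along the path, and its symmetry. -/

noncomputable section

namespace CutCurve
variable {m : ℕ} {W : ℂ[X]} (Γ : CutCurve m W)

/-- Besides the window property, the tangents are compared relative to the one at `u`. The single
vector `lam'(s₀)` is then an admissible shift at every point of the window. -/
theorem exists_fine_window (s₀ : ℝ) : ∃ κ, IsWindow Γ.lam s₀ κ ∧
    ∀ u ∈ Set.Icc (s₀ - κ) (s₀ + κ), ‖deriv Γ.lam s₀ - deriv Γ.lam u‖ ≤ ‖deriv Γ.lam u‖ / 4 := by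
  obtain ⟨δ, hδ, h⟩ := Metric.continuousAt_iff.1 (Γ.continuous_deriv_lam.continuousAt (x := s₀))
    (‖deriv Γ.lam s₀‖ / 8) (by have := norm_pos_iff.2 (Γ.deriv_lam_ne_zero s₀); positivity)
  obtain ⟨κ, hκ, hle, hw⟩ := exists_isWindow Γ.contDiff_lam Γ.deriv_lam_ne_zero s₀ (half_pos hδ)
  refine ⟨κ, hw, fun u hu => ?_⟩
  have h1 := h (x := u) (by
    rw [Real.dist_eq, abs_lt]; constructor <;> linarith [hu.1, hu.2])
  rw [dist_eq_norm, norm_sub_rev] at h1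
  have h2 := norm_sub_norm_le (deriv Γ.lam s₀) (deriv Γ.lam u)
  have h3 := norm_nonneg (deriv Γ.lam u)
  linarith

theorem tendsto_integral_kernel (h : ℂ[X]) {s₀ κ : ℝ} (hw : IsWindow Γ.lam s₀ κ)
    {s₁ s₂ : ℝ} (hle : s₁ ≤ s₂) (h1 : s₀ - κ / 2 ≤ s₁) (h2 : s₂ ≤ s₀ + κ / 2) :
    Tendsto (fun ε : ℝ => ∫ s' in Γ.cutParams, Γ.dens h s' * ∫ u in s₁..s₂,
      deriv Γ.lam u / (Γ.lam u + Complex.I * ε * deriv Γ.lam s₀ - Γ.lam s')) (𝓝[>] 0)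
      (𝓝 (∫ s' in Γ.cutParams, Γ.dens h s' * (leftLog Γ.lam s₂ s' - leftLog Γ.lam s₁ s'))) := by
  obtain ⟨A₀, B₀, hAB₀, hsub₀⟩ := Γ.exists_cutParams_subset_Icc
  set A := min A₀ s₁
  set B := max B₀ s₂
  have hsub : ∀ s' ∈ Γ.cutParams, s' ∈ Set.Icc A B := fun s' hs' =>
    ⟨(min_le_left _ _).trans (hsub₀ hs').1.le, (hsub₀ hs').2.le.trans (le_max_left _ _)⟩
  obtain ⟨C, hC, hbd, hlim⟩ := Γ.exists_kernel_bound hw A B hle h1 h2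
  obtain ⟨C', hC', hdens⟩ := Γ.exists_norm_dens_le h A B
  have hae : ∀ᵐ s' : ℝ ∂(MeasureTheory.volume.restrict Γ.cutParams),
      s' ∈ Set.Icc A B ∧ s' ≠ s₁ ∧ s' ≠ s₂ := by
    filter_upwards [MeasureTheory.ae_restrict_mem Γ.measurableSet_cutParams,
      MeasureTheory.Measure.ae_ne _ s₁, MeasureTheory.Measure.ae_ne _ s₂] with s' g1 g2 g3
    exact ⟨hsub s' g1, g2, g3⟩
  refine MeasureTheory.tendsto_integral_filter_of_dominated_convergence
    (fun s' => C' * C * (Γ.logSing s₁ s' + Γ.logSing s₂ s')) ?_ ?_ ?_ ?_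
  · refine Eventually.of_forall fun ε => ((Γ.measurable_dens h).mul ?_).aestronglyMeasurable
    have hm : Measurable (Function.uncurry fun (s' u : ℝ) =>
        deriv Γ.lam u / (Γ.lam u + Complex.I * ε * deriv Γ.lam s₀ - Γ.lam s')) := by
      have c1 := Γ.continuous_lam
      have c2 := Γ.continuous_deriv_lam
      exact (c2.comp continuous_snd).measurable.div (by fun_prop :
        Continuous fun q : ℝ × ℝ => Γ.lam q.2 + Complex.I * ε * deriv Γ.lam s₀ - Γ.lam q.1).measurable
    simp only [intervalIntegral.integral_of_le hle]
    exact (hm.stronglyMeasurable.integral_prod_right (ν := MeasureTheory.volume.restrict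
      (Set.Ioc s₁ s₂))).measurable
  · filter_upwards [hbd] with ε hε
    filter_upwards [hae] with s' ⟨g1, g2, g3⟩
    rw [norm_mul]
    have e1 := hdens s' g1
    have e2 := hε s' g1 g2 g3
    calc _ ≤ (C' * Γ.sing s') * (C * ((1 + |s₁ - s'| ^ (-(1 / 4) : ℝ))
          + (1 + |s₂ - s'| ^ (-(1 / 4) : ℝ)))) := by
          gcongr
          exact mul_nonneg hC'.le (Γ.sing_nonneg _)
      _ = C' * C * ((1 + |s₁ - s'| ^ (-(1 / 4) : ℝ)) * Γ.sing s'
          + (1 + |s₂ - s'| ^ (-(1 / 4) : ℝ)) * Γ.sing s') := by ring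
      _ ≤ _ := by
          gcongr
          · exact Γ.mul_sing_le s₁ s'
          · exact Γ.mul_sing_le s₂ s'
  · refine (((Γ.integrableOn_logSing s₁ A B).add (Γ.integrableOn_logSing s₂ A B)).mono_set
      (show Γ.cutParams ⊆ Set.Icc A B from hsub)).const_mul _
  · filter_upwards [hae] with s' ⟨g1, g2, g3⟩
    exact (hlim s' g1 g2 g3).const_mul _

/-- This is the dispersion relation integrated along the piece of path shifted by `ε` to the left,
in the limit `ε → 0`. The kernels become differences of left logarithms, and `y₀` becomes `yPlus`.
-/
theorem integral_leftLog_sub {h q : ℂ[X]}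
    (hlim : Tendsto (fun x => h.eval x / Γ.y₀ x - q.eval x) (Bornology.cobounded ℂ) (𝓝 0))
    {s₀ κ : ℝ} (hw : IsWindow Γ.lam s₀ κ)
    (hd : ∀ u ∈ Set.Icc (s₀ - κ) (s₀ + κ), ‖deriv Γ.lam s₀ - deriv Γ.lam u‖ ≤ ‖deriv Γ.lam u‖ / 4)
    {s₁ s₂ : ℝ} (hle : s₁ ≤ s₂) (h1 : s₀ - κ / 2 ≤ s₁) (h2 : s₂ ≤ s₀ + κ / 2) :
    ∫ s' in Γ.cutParams, Γ.dens h s' * (leftLog Γ.lam s₂ s' - leftLog Γ.lam s₁ s')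
      = Real.pi * Complex.I * ∫ u in s₁..s₂, (q.eval (Γ.lam u) * deriv Γ.lam u - Γ.dens h u) := by
  have hpi : (Real.pi : ℂ) ≠ 0 := Complex.ofReal_ne_zero.2 Real.pi_ne_zero
  have hI := Complex.I_ne_zero
  have t1 := (Γ.tendsto_integral_offset h q hw hd hle h1 h2).const_mul (Real.pi * Complex.I)
  refine tendsto_nhds_unique (Γ.tendsto_integral_kernel h hw hle h1 h2) (t1.congr' ?_)
  obtain ⟨A, B, hAB, hsub⟩ := Γ.exists_cutParams_subset_Icc
  obtain ⟨c, hc, hlow⟩ := Γ.exists_offset_lower_bound hw A B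
  filter_upwards [hlow] with ε hε
  have hcuts : ∀ u ∈ Set.Icc s₁ s₂, Γ.lam u + Complex.I * ε * deriv Γ.lam s₀ ∉ Γ.cuts := by
    intro u hu hmem
    rw [cuts_eq_image] at hmem
    obtain ⟨s, hs, he⟩ := hmem
    exact (hε u ⟨h1.trans hu.1, hu.2.trans h2⟩ s (Set.Ioo_subset_Icc_self (hsub hs))).2 he.symm
  have hz : Continuous fun u => Γ.lam u + Complex.I * ε * deriv Γ.lam s₀ := by
    have := Γ.continuous_lam; fun_prop
  have e1 := Γ.integral_mul_cauchy h hle hz Γ.continuous_deriv_lam hcuts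
  have e2 : ∀ s' : ℝ, ∫ u in s₁..s₂, deriv Γ.lam u / (Γ.lam s' - (Γ.lam u
      + Complex.I * ε * deriv Γ.lam s₀)) = -∫ u in s₁..s₂, deriv Γ.lam u / (Γ.lam u
      + Complex.I * ε * deriv Γ.lam s₀ - Γ.lam s') := fun s' => by
    rw [← intervalIntegral.integral_neg]
    refine intervalIntegral.integral_congr fun u _ => ?_
    rw [← neg_sub, div_neg]
  simp only [e2, mul_neg] at e1
  rw [MeasureTheory.integral_neg] at e1
  rw [← neg_eq_iff_eq_neg.2 e1, ← intervalIntegral.integral_const_mul,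
    ← intervalIntegral.integral_neg]
  refine intervalIntegral.integral_congr fun u hu => ?_
  rw [Set.uIcc_of_le hle] at hu
  rw [Γ.div_y₀_eq hlim (hcuts u hu)]
  field_simp
  ring

theorem integral_cutParams_Ioc (h : ℂ[X]) {s₁ s₂ : ℝ} (hle : s₁ ≤ s₂) :
    ∫ s' in Γ.cutParams, (Set.Ioc s₁ s₂).indicator (Γ.dens h) s'
      = ∫ u in s₁..s₂, Γ.cutParams.indicator (Γ.dens h) u := by
  rw [intervalIntegral.integral_of_le hle, MeasureTheory.setIntegral_indicator measurableSet_Ioc,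
    MeasureTheory.setIntegral_indicator Γ.measurableSet_cutParams, Set.inter_comm]

theorem intervalIntegrable_dens (h : ℂ[X]) (a b : ℝ) :
    IntervalIntegrable (Γ.dens h) MeasureTheory.volume a b :=
  (Γ.integrableOn_dens h (min a b) (max a b)).intervalIntegrable

theorem intervalIntegrable_indicator_dens (h : ℂ[X]) {T : Set ℝ} (hT : MeasurableSet T) (a b : ℝ) :
    IntervalIntegrable (T.indicator (Γ.dens h)) MeasureTheory.volume a b :=
  ((Γ.integrableOn_dens h (min a b) (max a b)).indicator hT).intervalIntegrable

/-- Passing from left logarithms to principal values removes `π I` for every `s'` beyond the point.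
The difference between `s₁` and `s₂` is `π I` times the density on the cuts between them, which is
exactly what cancels the on-cut part of `h dz / y₊` on the right. -/
theorem potential_sub_local {h q : ℂ[X]}
    (hlim : Tendsto (fun x => h.eval x / Γ.y₀ x - q.eval x) (Bornology.cobounded ℂ) (𝓝 0))
    {s₀ κ : ℝ} (hw : IsWindow Γ.lam s₀ κ)
    (hd : ∀ u ∈ Set.Icc (s₀ - κ) (s₀ + κ), ‖deriv Γ.lam s₀ - deriv Γ.lam u‖ ≤ ‖deriv Γ.lam u‖ / 4)
    {s₁ s₂ : ℝ} (hle : s₁ ≤ s₂) (h1 : s₀ - κ / 2 ≤ s₁) (h2 : s₂ ≤ s₀ + κ / 2) :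
    Γ.potential h s₂ - Γ.potential h s₁ = Real.pi * Complex.I *
      ∫ u in s₁..s₂, (q.eval (Γ.lam u) * deriv Γ.lam u - Γ.cutParamsᶜ.indicator (Γ.dens h) u) := by
  have e1 := Γ.integral_leftLog_sub hlim hw hd hle h1 h2
  have i1 := Γ.integrableOn_principalLog_mul_dens h s₁ le_rfl
  have i2 := Γ.integrableOn_principalLog_mul_dens h s₂ le_rfl
  have i3 : MeasureTheory.IntegrableOn ((Set.Ioc s₁ s₂).indicator (Γ.dens h)) Γ.cutParams :=
    (Γ.integrableOn_dens_cutParams h).indicator measurableSet_Ioc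
  have e2 : ∫ s' in Γ.cutParams, Γ.dens h s' * (leftLog Γ.lam s₂ s' - leftLog Γ.lam s₁ s')
      = Γ.potential h s₂ - Γ.potential h s₁
        - Real.pi * Complex.I * ∫ u in s₁..s₂, Γ.cutParams.indicator (Γ.dens h) u := by
    rw [potential, potential, ← Γ.integral_cutParams_Ioc h hle, ← MeasureTheory.integral_const_mul,
      ← MeasureTheory.integral_sub i2 i1, ← MeasureTheory.integral_sub (by exact i2.sub i1)
        (by exact i3.const_mul _)]
    refine MeasureTheory.integral_congr_ae (Eventually.of_forall fun s' => ?_)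
    simp only [leftLog, Set.indicator, Set.mem_Ioc]
    by_cases g1 : s₁ < s' <;> by_cases g2 : s₂ < s'
    · simp only [g1, g2, if_true, not_le.2 g2, and_false, if_false]; ring
    · simp only [g1, g2, if_true, not_lt.1 g2, and_true, if_false]; ring
    · exact absurd (hle.trans_lt g2) g1
    · simp only [g1, g2, if_false, false_and]; ring
  have hqc : Continuous fun u => q.eval (Γ.lam u) * deriv Γ.lam u :=
    (q.continuous.comp Γ.continuous_lam).mul Γ.continuous_deriv_lam
  have iq : IntervalIntegrable (fun u => q.eval (Γ.lam u) * deriv Γ.lam u) MeasureTheory.volume s₁ s₂ :=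
    hqc.intervalIntegrable _ _
  have e3 : ∫ u in s₁..s₂, Γ.dens h u = (∫ u in s₁..s₂, Γ.cutParams.indicator (Γ.dens h) u)
      + ∫ u in s₁..s₂, Γ.cutParamsᶜ.indicator (Γ.dens h) u := by
    rw [← intervalIntegral.integral_add
      (Γ.intervalIntegrable_indicator_dens h Γ.measurableSet_cutParams _ _)
      (Γ.intervalIntegrable_indicator_dens h Γ.measurableSet_cutParams.compl _ _)]
    refine intervalIntegral.integral_congr fun u _ => ?_
    exact (Set.indicator_self_add_compl_apply Γ.cutParams (Γ.dens h) u).symm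
  rw [intervalIntegral.integral_sub iq (Γ.intervalIntegrable_dens h _ _), e2, e3] at e1
  rw [intervalIntegral.integral_sub iq
    (Γ.intervalIntegrable_indicator_dens h Γ.measurableSet_cutParams.compl _ _)]
  linear_combination e1

/-- The variation of the logarithmic potential along the path. -/
theorem potential_sub {h q : ℂ[X]}
    (hlim : Tendsto (fun x => h.eval x / Γ.y₀ x - q.eval x) (Bornology.cobounded ℂ) (𝓝 0))
    (s₁ s₂ : ℝ) :
    Γ.potential h s₂ - Γ.potential h s₁ = Real.pi * Complex.I *
      ∫ u in s₁..s₂, (q.eval (Γ.lam u) * deriv Γ.lam u - Γ.cutParamsᶜ.indicator (Γ.dens h) u) := by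
  have hqc : Continuous fun u => q.eval (Γ.lam u) * deriv Γ.lam u :=
    (q.continuous.comp Γ.continuous_lam).mul Γ.continuous_deriv_lam
  have hii : ∀ a b, IntervalIntegrable (fun u => q.eval (Γ.lam u) * deriv Γ.lam u
      - Γ.cutParamsᶜ.indicator (Γ.dens h) u) MeasureTheory.volume a b := fun a b =>
    (hqc.intervalIntegrable _ _).sub
      (Γ.intervalIntegrable_indicator_dens h Γ.measurableSet_cutParams.compl _ _)
  set E : ℝ → ℂ := fun s => Γ.potential h s - Real.pi * Complex.I *
      ∫ u in s₁..s, (q.eval (Γ.lam u) * deriv Γ.lam u - Γ.cutParamsᶜ.indicator (Γ.dens h) u) with hE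
  have hEsub : ∀ a b, E b - E a = Γ.potential h b - Γ.potential h a - Real.pi * Complex.I *
      ∫ u in a..b, (q.eval (Γ.lam u) * deriv Γ.lam u - Γ.cutParamsᶜ.indicator (Γ.dens h) u) := by
    intro a b
    simp only [hE]
    rw [← intervalIntegral.integral_add_adjacent_intervals (hii s₁ a) (hii a b)]
    ring
  have hloc : IsLocallyConstant E := by
    rw [IsLocallyConstant.iff_eventually_eq]
    intro s₀
    obtain ⟨κ, hw, hd⟩ := Γ.exists_fine_window s₀
    have hκ := hw.1
    have hmem : Set.Icc (s₀ - κ / 2) (s₀ + κ / 2) ∈ 𝓝 s₀ :=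
      Icc_mem_nhds (by linarith) (by linarith)
    filter_upwards [hmem] with s hs
    rcases le_total s s₀ with g | g
    · have := hEsub s s₀
      rw [Γ.potential_sub_local hlim hw hd g hs.1 (by linarith), sub_self] at this
      exact (sub_eq_zero.1 this).symm
    · have := hEsub s₀ s
      rw [Γ.potential_sub_local hlim hw hd g (by linarith) hs.2, sub_self] at this
      exact sub_eq_zero.1 this
  have h1 : E s₂ = E s₁ := hloc.apply_eq_of_preconnectedSpace s₂ s₁
  have h2 := hEsub s₁ s₂
  rw [h1, sub_self] at h2
  linear_combination -h2

/-- The double integral of the logarithm against two densities is symmetric. -/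
theorem integral_potential_mul_dens (h : ℂ[X]) :
    ∫ s in Γ.cutParams, Γ.potential h s * Γ.dens Γ.P s
      = ∫ s in Γ.cutParams, Γ.potential Γ.P s * Γ.dens h s := by
  obtain ⟨A, B, hAB, hsub⟩ := Γ.exists_cutParams_subset_Icc
  have hsub' : Γ.cutParams ⊆ Set.Icc A B := hsub.trans Set.Ioo_subset_Icc_self
  obtain ⟨C, hC, hle⟩ := Γ.norm_mul_dens_le h A B
  obtain ⟨C', hC'⟩ := Γ.exists_integral_logSing_le A B
  -- The density of `P` is `y₊ dz`, which is bounded, so only one of the two densities is singular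
  -- and the single integral of `logSing` controls the kernel.
  obtain ⟨M, hM⟩ := Γ.isCompact_cutParams.exists_bound_of_continuousOn Γ.continuous_dens_P.continuousOn
  set μ := MeasureTheory.volume.restrict Γ.cutParams with hμ
  set k : ℝ × ℝ → ℂ := fun p => offDiagLog Γ.lam p * Γ.dens h p.2 * Γ.dens Γ.P p.1 with hk
  have hkm : Measurable k :=
    ((measurable_offDiagLog Γ.contDiff_lam Γ.injective_lam Γ.tendsto_atTop).mul
      ((Γ.measurable_dens h).comp measurable_snd)).mul (Γ.continuous_dens_P.measurable.comp measurable_fst)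
  have hdensL : ∀ s ∈ Γ.cutParams, ∀ s' ∈ Γ.cutParams, s ≠ s' → ‖k (s, s')‖ ≤ M * (C * Γ.logSing s s') := by
    intro s hs s' hs' hne
    have hM0 := (norm_nonneg _).trans (hM s hs)
    simp only [hk]
    rw [norm_mul, norm_mul, offDiagLog_of_ne hne, mul_comm]
    exact mul_le_mul (hM s hs) (hle s (hsub' hs) s' (hsub' hs') hne) (by positivity) hM0
  have hrow : ∀ s ∈ Γ.cutParams, MeasureTheory.Integrable (fun s' => k (s, s')) μ := by
    intro s hs
    refine MeasureTheory.Integrable.mono' ((((Γ.integrableOn_logSing s A B).mono_set hsub').const_mul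
      C).const_mul M) (hkm.comp (by fun_prop : Measurable fun s' : ℝ => (s, s'))).aestronglyMeasurable ?_
    filter_upwards [MeasureTheory.ae_restrict_mem Γ.measurableSet_cutParams,
      MeasureTheory.Measure.ae_ne _ s] with s' hs' hne
    exact hdensL s hs s' hs' (Ne.symm hne)
  have hint : MeasureTheory.Integrable k (μ.prod μ) := by
    rw [MeasureTheory.integrable_prod_iff hkm.aestronglyMeasurable]
    refine ⟨?_, ?_⟩
    · filter_upwards [MeasureTheory.ae_restrict_mem Γ.measurableSet_cutParams] with s hs using hrow s hs
    · refine MeasureTheory.Integrable.mono' (g := fun _ => M * (C * C')) ?_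
        hkm.norm.stronglyMeasurable.integral_prod_right.aestronglyMeasurable ?_
      · exact MeasureTheory.integrableOn_const Γ.isCompact_cutParams.measure_lt_top.ne
      · filter_upwards [MeasureTheory.ae_restrict_mem Γ.measurableSet_cutParams] with s hs
        have hM0 := (norm_nonneg _).trans (hM s hs)
        rw [Real.norm_of_nonneg (MeasureTheory.integral_nonneg fun _ => norm_nonneg _)]
        calc ∫ s', ‖k (s, s')‖ ∂μ ≤ ∫ s' in Γ.cutParams, M * (C * Γ.logSing s s') := by
              refine MeasureTheory.integral_mono_ae (hrow s hs).norm
                ((((Γ.integrableOn_logSing s A B).mono_set hsub').const_mul C).const_mul M) ?_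
              filter_upwards [MeasureTheory.ae_restrict_mem Γ.measurableSet_cutParams,
                MeasureTheory.Measure.ae_ne _ s] with s' hs' hne
              exact hdensL s hs s' hs' (Ne.symm hne)
          _ = M * (C * ∫ s' in Γ.cutParams, Γ.logSing s s') := by
              rw [MeasureTheory.integral_const_mul, MeasureTheory.integral_const_mul]
          _ ≤ M * (C * ∫ s' in Set.Icc A B, Γ.logSing s s') := by
              refine mul_le_mul_of_nonneg_left (mul_le_mul_of_nonneg_left ?_ hC.le) hM0
              exact MeasureTheory.setIntegral_mono_set (Γ.integrableOn_logSing s A B)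
                (Eventually.of_forall fun s' => Γ.logSing_nonneg s s') (LE.le.eventuallyLE hsub')
          _ ≤ M * (C * C') := mul_le_mul_of_nonneg_left
              (mul_le_mul_of_nonneg_left (hC' s (hsub' hs)) hC.le) hM0
  have hswap := MeasureTheory.integral_integral_swap (f := fun s s' => k (s, s')) hint
  have hL : ∀ s, ∫ s', k (s, s') ∂μ = Γ.potential h s * Γ.dens Γ.P s := fun s => by
    rw [potential, ← MeasureTheory.integral_mul_const]
    refine MeasureTheory.integral_congr_ae ?_
    filter_upwards [Γ.ae_offDiagLog_eq s μ] with s' hs'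
    simp only [hk, hs']
  have hR : ∀ s', ∫ s, k (s, s') ∂μ = Γ.potential Γ.P s' * Γ.dens h s' := fun s' => by
    rw [potential, ← MeasureTheory.integral_mul_const]
    refine MeasureTheory.integral_congr_ae ?_
    filter_upwards [MeasureTheory.Measure.ae_ne μ s'] with s hs
    simp only [hk]
    rw [offDiagLog_of_ne hs, principalLog_comm]
    ring
  simp only [hL, hR] at hswap
  exact hswap

end CutCurve
end

/-! ### Differentiating integrals of a moving branch of a square root. -/

noncomputable section

section polynomialFamily
variable {p : ℂ → ℂ[X]} {pd : ℂ[X]} {n : ℕ} {t₀ : ℂ}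

theorem eval_eq_sum_of_natDegree_le {q : ℂ[X]} (hq : q.natDegree ≤ n) (z : ℂ) :
    q.eval z = ∑ k ∈ Finset.range (n + 1), q.coeff k * z ^ k :=
  eval_eq_sum_range' (Nat.lt_succ_of_le hq) z

theorem exists_eval_sub_le (hn : ∀ᶠ τ in 𝓝 t₀, (p τ).natDegree ≤ n)
    (hp : ∀ k, HasDerivAt (fun τ => (p τ).coeff k) (pd.coeff k) t₀) (R : ℝ) :
    ∃ A, 0 ≤ A ∧ ∀ᶠ τ in 𝓝 t₀, ∀ z ∈ Metric.ball (0 : ℂ) R,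
      ‖(p τ).eval z - (p t₀).eval z‖ ≤ A * ‖τ - t₀‖ := by
  have hk : ∀ k, ∃ A, 0 ≤ A ∧ ∀ᶠ τ in 𝓝 t₀, ‖(p τ).coeff k - (p t₀).coeff k‖ ≤ A * ‖τ - t₀‖ := by
    intro k
    obtain ⟨A, hA, h⟩ := (hp k).differentiableAt.isBigO_sub.exists_nonneg
    exact ⟨A, hA, h.bound⟩
  choose A hA hle using hk
  refine ⟨∑ k ∈ Finset.range (n + 1), A k * |R| ^ k,
    Finset.sum_nonneg fun k _ => mul_nonneg (hA k) (by positivity), ?_⟩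
  have hall : ∀ᶠ τ in 𝓝 t₀, ∀ k ∈ Finset.range (n + 1),
      ‖(p τ).coeff k - (p t₀).coeff k‖ ≤ A k * ‖τ - t₀‖ :=
    (Finset.range (n + 1)).eventually_all.2 fun k _ => hle k
  filter_upwards [hall, hn] with τ hτ hnτ z hz
  rw [eval_eq_sum_of_natDegree_le hnτ, eval_eq_sum_of_natDegree_le hn.self_of_nhds,
    ← Finset.sum_sub_distrib, Finset.sum_mul]
  refine (norm_sum_le _ _).trans (Finset.sum_le_sum fun k hk => ?_)
  rw [← sub_mul, norm_mul, norm_pow]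
  have hz' : ‖z‖ ≤ |R| := by
    rw [mem_ball_zero_iff] at hz; exact hz.le.trans (le_abs_self _)
  calc _ ≤ (A k * ‖τ - t₀‖) * |R| ^ k := by
        exact mul_le_mul (hτ k hk) (pow_le_pow_left₀ (norm_nonneg _) hz' k) (by positivity)
          ((norm_nonneg _).trans (hτ k hk))
    _ = _ := by ring

theorem tendsto_eval_slope (hn : ∀ᶠ τ in 𝓝 t₀, (p τ).natDegree ≤ n) (hnd : pd.natDegree ≤ n)
    (hp : ∀ k, HasDerivAt (fun τ => (p τ).coeff k) (pd.coeff k) t₀) {ξ : ℂ → ℂ} {z : ℂ}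
    (hξ : Tendsto ξ (𝓝[≠] t₀) (𝓝 z)) :
    Tendsto (fun τ => ((p τ).eval (ξ τ) - (p t₀).eval (ξ τ)) / (τ - t₀)) (𝓝[≠] t₀)
      (𝓝 (pd.eval z)) := by
  rw [eval_eq_sum_of_natDegree_le hnd]
  have h1 : Tendsto (fun τ => ∑ k ∈ Finset.range (n + 1), slope (fun τ => (p τ).coeff k) t₀ τ * ξ τ ^ k)
      (𝓝[≠] t₀) (𝓝 (∑ k ∈ Finset.range (n + 1), pd.coeff k * z ^ k)) :=
    tendsto_finsetSum _ fun k _ => (hasDerivAt_iff_tendsto_slope.1 (hp k)).mul (hξ.pow k)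
  refine h1.congr' ?_
  filter_upwards [nhdsWithin_le_nhds hn] with τ hτ
  rw [eval_eq_sum_of_natDegree_le hτ, eval_eq_sum_of_natDegree_le hn.self_of_nhds,
    ← Finset.sum_sub_distrib, Finset.sum_div]
  refine Finset.sum_congr rfl fun k _ => ?_
  rw [slope_def_field]
  ring

theorem tendsto_eval_of_hasDerivAt (hn : ∀ᶠ τ in 𝓝 t₀, (p τ).natDegree ≤ n)
    (hp : ∀ k, HasDerivAt (fun τ => (p τ).coeff k) (pd.coeff k) t₀) {l : Filter ℂ} (hl : l ≤ 𝓝 t₀)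
    {ξ : ℂ → ℂ} {z : ℂ}
    (hξ : Tendsto ξ l (𝓝 z)) :
    Tendsto (fun τ => (p τ).eval (ξ τ)) l (𝓝 ((p t₀).eval z)) := by
  rw [eval_eq_sum_of_natDegree_le hn.self_of_nhds]
  have h1 : Tendsto (fun τ => ∑ k ∈ Finset.range (n + 1), (p τ).coeff k * ξ τ ^ k)
      l (𝓝 (∑ k ∈ Finset.range (n + 1), (p t₀).coeff k * z ^ k)) :=
    tendsto_finsetSum _ fun k _ => (((hp k).continuousAt.tendsto).mono_left hl).mul (hξ.pow k)
  refine h1.congr' ?_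
  filter_upwards [hl hn] with τ hτ
  rw [eval_eq_sum_of_natDegree_le hτ]

theorem hasDerivAt_coeff_derivative (hp : ∀ k, HasDerivAt (fun τ => (p τ).coeff k) (pd.coeff k) t₀)
    (k : ℕ) : HasDerivAt (fun τ => (p τ).derivative.coeff k) (pd.derivative.coeff k) t₀ := by
  simp only [coeff_derivative]
  exact (hp (k + 1)).mul_const _

end polynomialFamily

theorem norm_dslope_le_of_forall_hasDerivAt {f f' : ℂ → ℂ} {c : ℂ} {R M : ℝ}
    (hf : ∀ z ∈ Metric.ball c R, HasDerivAt f (f' z) z) (hM : ∀ z ∈ Metric.ball c R, ‖f' z‖ ≤ M)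
    {a b : ℂ} (ha : a ∈ Metric.ball c R) (hb : b ∈ Metric.ball c R) : ‖dslope f a b‖ ≤ M :=
  norm_dslope_le (convex_ball c R) (fun z hz => (hf z hz).differentiableAt)
    (fun z hz => by rw [(hf z hz).deriv]; exact hM z hz) ha hb

/-- The derivative with respect to a parameter of the integral of `g(x) y dx`, where `y` is a branch
of the square root of a polynomial on a moving path whose ends are branch points or fixed. -/
theorem hasDerivAt_integral_branch {x x' Y : ℂ → ℝ → ℂ} {p : ℂ → ℂ[X]} {pd : ℂ[X]} {n : ℕ}
    {g g' : ℂ → ℂ} {t₀ : ℂ} {α β R C M : ℝ} (hαβ : α < β)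
    (hn : ∀ᶠ τ in 𝓝 t₀, (p τ).natDegree ≤ n) (hnd : pd.natDegree ≤ n)
    (hp : ∀ k, HasDerivAt (fun τ => (p τ).coeff k) (pd.coeff k) t₀)
    (hg : ∀ z ∈ Metric.ball 0 R, HasDerivAt g (g' z) z) (hg'c : ContinuousOn g' (Metric.ball 0 R))
    (hgM : ∀ z ∈ Metric.ball 0 R, ‖g z‖ ≤ M) (hg'M : ∀ z ∈ Metric.ball 0 R, ‖g' z‖ ≤ M)
    (hxR : ∀ᶠ τ in 𝓝 t₀, ∀ r ∈ Set.Icc α β, x τ r ∈ Metric.ball (0 : ℂ) R)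
    (hx : ∀ᶠ τ in 𝓝 t₀, ∀ r ∈ Set.Icc α β, HasDerivAt (x τ) (x' τ r) r)
    (hx'c : ∀ᶠ τ in 𝓝 t₀, ContinuousOn (x' τ) (Set.Icc α β))
    (hY : ∀ᶠ τ in 𝓝 t₀, ContinuousOn (Y τ) (Set.Icc α β))
    (hsq : ∀ᶠ τ in 𝓝 t₀, ∀ r ∈ Set.Icc α β, Y τ r ^ 2 = (p τ).eval (x τ r))
    (hY0 : ∀ r ∈ Set.Ioo α β, Y t₀ r ≠ 0)
    (hbdry : ∀ᶠ τ in 𝓝 t₀, ∀ r ∈ ({α, β} : Set ℝ),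
      (Y τ r = 0 ∧ Y t₀ r = 0) ∨ x τ r = x t₀ r)
    (hδ : ∀ᶠ τ in 𝓝 t₀, ∀ r ∈ Set.Icc α β, ‖x τ r - x t₀ r‖ ≤ C * ‖τ - t₀‖)
    (hx' : ∀ η > 0, ∀ᶠ τ in 𝓝 t₀, ∀ r ∈ Set.Icc α β, ‖x' τ r - x' t₀ r‖ ≤ η)
    (hYc : ∀ η > 0, ∀ᶠ τ in 𝓝 t₀, ∀ r ∈ Set.Ioo α β, ‖Y τ r - Y t₀ r‖ ≤ η * ‖Y t₀ r‖)
    (hint : MeasureTheory.IntegrableOn (fun r => ‖Y t₀ r‖⁻¹) (Set.Ioo α β)) :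
    HasDerivAt (fun τ => ∫ r in α..β, g (x τ r) * Y τ r * x' τ r)
      (∫ r in α..β, g (x t₀ r) * (pd.eval (x t₀ r) * x' t₀ r / (2 * Y t₀ r))) t₀ := by
  set J := Set.Ioo α β with hJ
  have hJI : J ⊆ Set.Icc α β := Set.Ioo_subset_Icc_self
  -- the derivative of `g(x) Y` along the path
  set ZD : ℂ → ℝ → ℂ := fun τ r => g' (x τ r) * x' τ r * Y τ r
    + g (x τ r) * ((p τ).derivative.eval (x τ r) * x' τ r / (2 * Y τ r)) with hZD
  set Z : ℂ → ℝ → ℂ := fun τ r => g (x τ r) * Y τ r with hZ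
  -- The increment of `Z x'` is half of `(Z τ - Z t₀) (x' τ + x' t₀) + (Z τ + Z t₀) (x' τ - x' t₀)`,
  -- and the second product is integrated by parts. The displacement `x τ - x t₀` then appears
  -- undifferentiated. A Lipschitz bound for it in `τ` is enough, and `x` need not be complex
  -- differentiable in `τ`.
  set T : ℂ → ℝ → ℂ := fun τ r => (Z τ r - Z t₀ r) * (x' τ r + x' t₀ r)
    - (ZD τ r + ZD t₀ r) * (x τ r - x t₀ r) with hT
  obtain ⟨MY, hMY⟩ := isCompact_Icc.exists_bound_of_continuousOn hY.self_of_nhds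
  obtain ⟨MX, hMX⟩ := isCompact_Icc.exists_bound_of_continuousOn hx'c.self_of_nhds
  have hαm : α ∈ Set.Icc α β := ⟨le_rfl, hαβ.le⟩
  have hβm : β ∈ Set.Icc α β := ⟨hαβ.le, le_rfl⟩
  have hMY0 : 0 ≤ MY := (norm_nonneg _).trans (hMY α hαm)
  have hMX0 : 0 ≤ MX := (norm_nonneg _).trans (hMX α hαm)
  have hM0 : 0 ≤ M := (norm_nonneg _).trans (hgM _ (hxR.self_of_nhds α hαm))
  obtain ⟨A, hA0, hA⟩ := exists_eval_sub_le hn hp R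
  obtain ⟨A', hA'0, hA'⟩ := exists_eval_sub_le (p := fun τ => (p τ).derivative) (pd := pd.derivative)
    (n := n) (hn.mono fun τ h => (natDegree_derivative_le _).trans ((Nat.sub_le _ _).trans h))
    (hasDerivAt_coeff_derivative hp) R
  obtain ⟨MP, hMP⟩ := (isCompact_closedBall (0 : ℂ) R).exists_bound_of_continuousOn
    (p t₀).derivative.continuous.continuousOn
  have hMP0 : 0 ≤ MP := (norm_nonneg _).trans
    (hMP _ (Metric.ball_subset_closedBall (hxR.self_of_nhds α hαm)))
  -- what holds for all nearby parameters
  have hnear : ∀ᶠ τ in 𝓝 t₀, (∀ r ∈ Set.Icc α β, x τ r ∈ Metric.ball (0 : ℂ) R) ∧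
      (∀ r ∈ Set.Icc α β, HasDerivAt (x τ) (x' τ r) r) ∧ ContinuousOn (x' τ) (Set.Icc α β) ∧
      ContinuousOn (Y τ) (Set.Icc α β) ∧ (∀ r ∈ Set.Icc α β, Y τ r ^ 2 = (p τ).eval (x τ r)) ∧
      (∀ r ∈ J, ‖Y τ r - Y t₀ r‖ ≤ 1 / 2 * ‖Y t₀ r‖) ∧
      (∀ r ∈ Set.Icc α β, ‖x' τ r - x' t₀ r‖ ≤ 1) := by
    filter_upwards [hxR, hx, hx'c, hY, hsq, hYc (1 / 2) (by norm_num), hx' 1 one_pos]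
      with τ h1 h2 h3 h4 h5 h6 h7
    exact ⟨h1, h2, h3, h4, h5, h6, h7⟩
  have hfacts : ∀ τ, ((∀ r ∈ Set.Icc α β, x τ r ∈ Metric.ball (0 : ℂ) R) ∧
      (∀ r ∈ Set.Icc α β, HasDerivAt (x τ) (x' τ r) r) ∧ ContinuousOn (x' τ) (Set.Icc α β) ∧
      ContinuousOn (Y τ) (Set.Icc α β) ∧ (∀ r ∈ Set.Icc α β, Y τ r ^ 2 = (p τ).eval (x τ r)) ∧
      (∀ r ∈ J, ‖Y τ r - Y t₀ r‖ ≤ 1 / 2 * ‖Y t₀ r‖) ∧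
      (∀ r ∈ Set.Icc α β, ‖x' τ r - x' t₀ r‖ ≤ 1)) →
      (∀ r ∈ J, 1 / 2 * ‖Y t₀ r‖ ≤ ‖Y τ r‖ ∧ ‖Y τ r‖ ≤ 2 * MY ∧ Y τ r ≠ 0 ∧ ‖Y t₀ r‖ ≤ ‖Y τ r + Y t₀ r‖ ∧
        0 < ‖Y t₀ r‖) ∧
      ContinuousOn (Z τ) (Set.Icc α β) ∧ (∀ r ∈ J, HasDerivAt (Z τ) (ZD τ r) r) ∧
      ContinuousOn (ZD τ) J := by
    rintro τ ⟨h1, h2, h3, h4, h5, h6, h7⟩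
    have hnz : ∀ r ∈ J, 1 / 2 * ‖Y t₀ r‖ ≤ ‖Y τ r‖ ∧ ‖Y τ r‖ ≤ 2 * MY ∧ Y τ r ≠ 0 ∧
        ‖Y t₀ r‖ ≤ ‖Y τ r + Y t₀ r‖ ∧ 0 < ‖Y t₀ r‖ := by
      intro r hr
      have e0 := norm_pos_iff.2 (hY0 r hr)
      have e1 := h6 r hr
      have e2 := norm_sub_norm_le (Y t₀ r) (Y τ r)
      rw [norm_sub_rev] at e2
      have e3 := norm_sub_norm_le (Y τ r) (Y t₀ r)
      have e4 := hMY r (hJI hr)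
      have e5 : ‖(2 : ℂ) * Y t₀ r‖ ≤ ‖Y τ r + Y t₀ r‖ + ‖Y τ r - Y t₀ r‖ := by
        have : (2 : ℂ) * Y t₀ r = (Y τ r + Y t₀ r) - (Y τ r - Y t₀ r) := by ring
        rw [this]; exact norm_sub_le _ _
      rw [norm_mul, Complex.norm_ofNat] at e5
      refine ⟨by linarith, by linarith, norm_pos_iff.1 (by linarith), by linarith, e0⟩
    have hxcont : ContinuousOn (x τ) (Set.Icc α β) := fun r hr => (h2 r hr).continuousAt.continuousWithinAt
    have hgc : ContinuousOn (fun r => g (x τ r)) (Set.Icc α β) := fun r hr =>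
      (hg _ (h1 r hr)).continuousAt.comp_continuousWithinAt (hxcont r hr)
    have hg'c' : ContinuousOn (fun r => g' (x τ r)) (Set.Icc α β) := hg'c.comp hxcont h1
    refine ⟨hnz, hgc.mul h4, fun r hr => ?_, ?_⟩
    · have hyc : ContinuousAt (Y τ) r := h4.continuousAt (Icc_mem_nhds hr.1 hr.2)
      have hyd := HasDerivAt.of_sq (p := fun r => (p τ).eval (x τ r)) hyc (by
        filter_upwards [Icc_mem_nhds hr.1 hr.2] with u hu using h5 u hu)
        (((p τ).hasDerivAt (x τ r)).comp r (h2 r (hJI hr))) (hnz r hr).2.2.1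
      exact (((hg _ (h1 r (hJI hr))).comp r (h2 r (hJI hr))).mul hyd)
    · refine ContinuousOn.add (((hg'c'.mul h3).mul h4).mono hJI) ((hgc.mono hJI).mul ?_)
      exact ((((p τ).derivative.continuous.comp_continuousOn hxcont).mul h3).mono hJI).div
        ((continuousOn_const.mul h4).mono hJI) fun r hr => mul_ne_zero two_ne_zero (hnz r hr).2.2.1
  have hf0 := hfacts t₀ hnear.self_of_nhds
  have h0 := hnear.self_of_nhds
  -- a bound for the derivative of `g(x) Y`
  set K := M * (MX + 1) * (2 * MY) with hK
  set K' := M * ((MP + 1) * (MX + 1)) with hK'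
  have hZDle : ∀ᶠ τ in 𝓝 t₀, ∀ r ∈ J, ‖ZD τ r‖ ≤ K + K' * ‖Y t₀ r‖⁻¹ := by
    have hsmall : ∀ᶠ τ in 𝓝 t₀, A' * ‖τ - t₀‖ < 1 := by
      have : ContinuousAt (fun τ : ℂ => A' * ‖τ - t₀‖) t₀ := by fun_prop
      exact this.eventually_lt continuousAt_const (by simp)
    filter_upwards [hnear, hA', hsmall] with τ hτ hA'τ hsm r hr
    have hfτ := hfacts τ hτ
    obtain ⟨h1, h2, h3, h4, h5, h6, h7⟩ := hτ
    obtain ⟨e1, e2, e3, e4, e5⟩ := hfτ.1 r hr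
    have hrI := hJI hr
    have b1 := hgM _ (h1 r hrI)
    have b2 := hg'M _ (h1 r hrI)
    have b3 : ‖x' τ r‖ ≤ MX + 1 := by
      have := norm_sub_norm_le (x' τ r) (x' t₀ r)
      linarith [hMX r hrI, h7 r hrI]
    have b4 : ‖(p τ).derivative.eval (x τ r)‖ ≤ MP + 1 := by
      have g1 := hA'τ _ (h1 r hrI)
      have g2 := hMP _ (Metric.ball_subset_closedBall (h1 r hrI))
      have g3 := norm_sub_norm_le ((p τ).derivative.eval (x τ r)) ((p t₀).derivative.eval (x τ r))
      linarith
    have b5 : ‖(2 * Y τ r)‖⁻¹ ≤ ‖Y t₀ r‖⁻¹ := by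
      rw [norm_mul, Complex.norm_ofNat]
      exact inv_anti₀ e5 (by linarith)
    refine (norm_add_le _ _).trans (add_le_add ?_ ?_)
    · rw [norm_mul, norm_mul, hK]; gcongr
    · rw [norm_mul, norm_div, norm_mul, div_eq_mul_inv, hK', mul_assoc M]
      gcongr
  have hvolJ : MeasureTheory.IntegrableOn (fun _ : ℝ => (1 : ℝ)) J :=
    MeasureTheory.integrableOn_const measure_Ioo_lt_top.ne
  have hdomint : ∀ a b : ℝ, MeasureTheory.IntegrableOn (fun r => a + b * ‖Y t₀ r‖⁻¹) J := fun a b =>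
    (MeasureTheory.integrableOn_const measure_Ioo_lt_top.ne).add (hint.const_mul b)
  have hZDint : ∀ᶠ τ in 𝓝 t₀, MeasureTheory.IntegrableOn (ZD τ) J := by
    filter_upwards [hnear, hZDle] with τ hτ hle
    refine MeasureTheory.Integrable.mono' (hdomint K K')
      ((hfacts τ hτ).2.2.2.aestronglyMeasurable measurableSet_Ioo) ?_
    filter_upwards [MeasureTheory.ae_restrict_mem measurableSet_Ioo] with r hr using hle r hr
  have hII : ∀ f : ℝ → ℂ, ∫ r in α..β, f r = ∫ r in J, f r := fun f => by
    rw [intervalIntegral.integral_of_le hαβ.le, MeasureTheory.integral_Ioc_eq_integral_Ioo]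
  have hcontint : ∀ f : ℝ → ℂ, ContinuousOn f (Set.Icc α β) → MeasureTheory.IntegrableOn f J :=
    fun f hf => (hf.integrableOn_Icc).mono_set hJI
  have hmain : ∀ᶠ τ in 𝓝 t₀, (∫ r in α..β, Z τ r * x' τ r) - (∫ r in α..β, Z t₀ r * x' t₀ r)
      = 1 / 2 * ∫ r in J, T τ r := by
    filter_upwards [hnear, hZDint, hbdry] with τ hτ hi hb
    have hfτ := hfacts τ hτ
    obtain ⟨h1, h2, h3, h4, h5, h6, h7⟩ := hτ
    have hd1 : ContinuousOn (fun r => x τ r - x t₀ r) (Set.Icc α β) := fun r hr =>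
      ((h2 r hr).continuousAt.sub (h0.2.1 r hr).continuousAt).continuousWithinAt
    have i0 := hZDint.self_of_nhds
    have iZD : MeasureTheory.IntegrableOn (fun r => (ZD τ r + ZD t₀ r) * (x τ r - x t₀ r)) J := by
      obtain ⟨B, hB⟩ := isCompact_Icc.exists_bound_of_continuousOn hd1
      refine MeasureTheory.Integrable.mul_bdd (c := B) (hi.add i0)
        ((hd1.mono hJI).aestronglyMeasurable measurableSet_Ioo) ?_
      filter_upwards [MeasureTheory.ae_restrict_mem measurableSet_Ioo] with r hr using hB r (hJI hr)
    have iZ : MeasureTheory.IntegrableOn (fun r => (Z τ r + Z t₀ r) * (x' τ r - x' t₀ r)) J :=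
      hcontint _ ((hfτ.2.1.add hf0.2.1).mul (h3.sub h0.2.2.1))
    have i3 : MeasureTheory.IntegrableOn (fun r => (Z τ r - Z t₀ r) * (x' τ r + x' t₀ r)) J :=
      hcontint _ ((hfτ.2.1.sub hf0.2.1).mul (h3.add h0.2.2.1))
    have hparts := intervalIntegral.integral_eq_sub_of_hasDerivAt_of_le hαβ.le
      (f := fun r => (Z τ r + Z t₀ r) * (x τ r - x t₀ r))
      (f' := fun r => (ZD τ r + ZD t₀ r) * (x τ r - x t₀ r) + (Z τ r + Z t₀ r) * (x' τ r - x' t₀ r))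
      ((hfτ.2.1.add hf0.2.1).mul hd1)
      (fun r hr => ((hfτ.2.2.1 r hr).add (hf0.2.2.1 r hr)).mul
        ((h2 r (hJI hr)).sub (h0.2.1 r (hJI hr))))
      ((intervalIntegrable_iff_integrableOn_Ioo_of_le hαβ.le).2 (iZD.add iZ))
    -- The boundary terms: at each end either the branch vanishes at both parameters or the point
    -- does not move.
    have hz : ∀ r ∈ ({α, β} : Set ℝ), (Z τ r + Z t₀ r) * (x τ r - x t₀ r) = 0 := by
      intro r hr
      rcases hb r hr with ⟨e1, e2⟩ | e1
      · simp only [hZ, e1, e2]; ring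
      · rw [e1, sub_self, mul_zero]
    rw [hz α (by simp), hz β (by simp), sub_zero, hII, MeasureTheory.integral_add iZD iZ] at hparts
    have hT' : ∫ r in J, T τ r = (∫ r in J, (Z τ r - Z t₀ r) * (x' τ r + x' t₀ r))
        - ∫ r in J, (ZD τ r + ZD t₀ r) * (x τ r - x t₀ r) := MeasureTheory.integral_sub i3 iZD
    have e3 : (∫ r in J, Z τ r * x' τ r) - (∫ r in J, Z t₀ r * x' t₀ r)
        = 1 / 2 * ((∫ r in J, (Z τ r - Z t₀ r) * (x' τ r + x' t₀ r))
          + ∫ r in J, (Z τ r + Z t₀ r) * (x' τ r - x' t₀ r)) := by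
      have i1 : MeasureTheory.IntegrableOn (fun r => Z τ r * x' τ r) J :=
        hcontint _ (hfτ.2.1.mul h3)
      have i2 : MeasureTheory.IntegrableOn (fun r => Z t₀ r * x' t₀ r) J :=
        hcontint _ (hf0.2.1.mul h0.2.2.1)
      rw [← MeasureTheory.integral_add i3 iZ, ← MeasureTheory.integral_sub i1 i2,
        ← MeasureTheory.integral_const_mul]
      refine MeasureTheory.integral_congr_ae (Eventually.of_forall fun r => ?_)
      simp only
      ring
    rw [hII, hII, e3, hT']
    linear_combination (1 / 2) * hparts
  -- decomposition of the integrand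
  set dP : ℂ → ℝ → ℂ := fun τ r => dslope (fun z => (p t₀).eval z) (x t₀ r) (x τ r) with hdP
  set dg : ℂ → ℝ → ℂ := fun τ r => dslope g (x t₀ r) (x τ r) with hdg
  set Fs : ℂ → ℝ → ℂ := fun τ r => ((p τ).eval (x τ r) - (p t₀).eval (x τ r)) / (τ - t₀) with hFs
  -- The coefficient of the displacement. As `τ → t₀` its first two terms tend to `g P' x' / Y + 2
  -- g' Y x'`, which is twice the derivative of `g(x) Y` along the path, so `E` tends to `0`. The
  -- motion of the path thus has no first-order effect.
  set E : ℂ → ℝ → ℂ := fun τ r => g (x τ r) * dP τ r * (x' τ r + x' t₀ r) / (Y τ r + Y t₀ r)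
    + dg τ r * Y t₀ r * (x' τ r + x' t₀ r) - (ZD τ r + ZD t₀ r) with hE
  have hdecomp : ∀ᶠ τ in 𝓝[≠] t₀, ∀ r ∈ J, T τ r / (τ - t₀) =
      g (x τ r) * Fs τ r * (x' τ r + x' t₀ r) / (Y τ r + Y t₀ r)
        + (x τ r - x t₀ r) / (τ - t₀) * E τ r := by
    filter_upwards [nhdsWithin_le_nhds hnear, self_mem_nhdsWithin] with τ hτ hne r hr
    have hs : τ - t₀ ≠ 0 := sub_ne_zero.2 hne
    have e4 := ((hfacts τ hτ).1 r hr).2.2.2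
    have hsum : Y τ r + Y t₀ r ≠ 0 := norm_pos_iff.1 (by linarith [e4.1, e4.2])
    have q1 : (x τ r - x t₀ r) * dP τ r = (p t₀).eval (x τ r) - (p t₀).eval (x t₀ r) := by
      have := sub_smul_dslope (fun z => (p t₀).eval z) (x t₀ r) (x τ r)
      simpa [smul_eq_mul] using this
    have q2 : (x τ r - x t₀ r) * dg τ r = g (x τ r) - g (x t₀ r) := by
      have := sub_smul_dslope g (x t₀ r) (x τ r)
      simpa [smul_eq_mul] using this
    have q3 : (Y τ r - Y t₀ r) * (Y τ r + Y t₀ r)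
        = ((p τ).eval (x τ r) - (p t₀).eval (x τ r)) + (x τ r - x t₀ r) * dP τ r := by
      have := hτ.2.2.2.2.1 r (hJI hr)
      have := h0.2.2.2.2.1 r (hJI hr)
      rw [q1]
      linear_combination hτ.2.2.2.2.1 r (hJI hr) - h0.2.2.2.2.1 r (hJI hr)
    have q4 : Y τ r - Y t₀ r = (((p τ).eval (x τ r) - (p t₀).eval (x τ r))
        + (x τ r - x t₀ r) * dP τ r) / (Y τ r + Y t₀ r) := by
      rw [← q3, mul_div_cancel_right₀ _ hsum]
    have q5 : Z τ r - Z t₀ r = g (x τ r) * (Y τ r - Y t₀ r) + (x τ r - x t₀ r) * dg τ r * Y t₀ r := by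
      rw [q2]; simp only [hZ]; ring
    simp only [hT, hE, hFs]
    rw [q5, q4]
    field_simp
    ring
  have hcoefδ : ∀ᶠ τ in 𝓝[≠] t₀, ∀ r ∈ J, ‖(x τ r - x t₀ r) / (τ - t₀)‖ ≤ C := by
    filter_upwards [nhdsWithin_le_nhds hδ, self_mem_nhdsWithin] with τ hτ hne r hr
    have hs : 0 < ‖τ - t₀‖ := norm_pos_iff.2 (sub_ne_zero.2 hne)
    rw [norm_div, div_le_iff₀ hs]
    exact hτ r (hJI hr)
  have hC0 : 0 ≤ C := by
    obtain ⟨τ, hτ⟩ := hcoefδ.exists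
    exact (norm_nonneg _).trans (hτ ((α + β) / 2) ⟨by linarith, by linarith⟩)
  have hxlim : ∀ r ∈ Set.Icc α β, Tendsto (fun τ => x τ r) (𝓝 t₀) (𝓝 (x t₀ r)) := by
    intro r hr
    rw [tendsto_iff_norm_sub_tendsto_zero]
    have : Tendsto (fun τ : ℂ => C * ‖τ - t₀‖) (𝓝 t₀) (𝓝 0) := by
      have : ContinuousAt (fun τ : ℂ => C * ‖τ - t₀‖) t₀ := by fun_prop
      simpa [ContinuousAt] using this
    exact squeeze_zero' (Eventually.of_forall fun _ => norm_nonneg _)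
      (hδ.mono fun τ h => h r hr) this
  have hx'lim : ∀ r ∈ Set.Icc α β, Tendsto (fun τ => x' τ r) (𝓝 t₀) (𝓝 (x' t₀ r)) := by
    intro r hr
    rw [Metric.tendsto_nhds]
    intro ε hε
    filter_upwards [hx' (ε / 2) (half_pos hε)] with τ hτ
    rw [dist_eq_norm]
    linarith [hτ r hr]
  have hYlim : ∀ r ∈ J, Tendsto (fun τ => Y τ r) (𝓝 t₀) (𝓝 (Y t₀ r)) := by
    intro r hr
    have hp0 := norm_pos_iff.2 (hY0 r hr)
    rw [Metric.tendsto_nhds]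
    intro ε hε
    filter_upwards [hYc (ε / (2 * ‖Y t₀ r‖)) (by positivity)] with τ hτ
    rw [dist_eq_norm]
    have := hτ r hr
    have e : ε / (2 * ‖Y t₀ r‖) * ‖Y t₀ r‖ = ε / 2 := by field_simp
    linarith
  have hZDlim : ∀ r ∈ J, Tendsto (fun τ => ZD τ r) (𝓝 t₀) (𝓝 (ZD t₀ r)) := by
    intro r hr
    have hrI := hJI hr
    have hxr := h0.1 r hrI
    have l1 := (hg'c.continuousAt (Metric.isOpen_ball.mem_nhds hxr)).tendsto.comp (hxlim r hrI)
    have l2 := (hg _ hxr).continuousAt.tendsto.comp (hxlim r hrI)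
    have l3 := tendsto_eval_of_hasDerivAt (p := fun τ => (p τ).derivative) (pd := pd.derivative)
      (n := n) (hn.mono fun τ h => (natDegree_derivative_le _).trans ((Nat.sub_le _ _).trans h))
      (hasDerivAt_coeff_derivative hp) le_rfl (hxlim r hrI)
    exact ((l1.mul (hx'lim r hrI)).mul (hYlim r hr)).add (l2.mul ((l3.mul (hx'lim r hrI)).div
      ((hYlim r hr).const_mul 2) (mul_ne_zero two_ne_zero (hY0 r hr))))
  have hElim : ∀ r ∈ J, Tendsto (fun τ => E τ r) (𝓝 t₀) (𝓝 0) := by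
    intro r hr
    have hrI := hJI hr
    have hxr := h0.1 r hrI
    have hy := hY0 r hr
    have l2 := (hg _ hxr).continuousAt.tendsto.comp (hxlim r hrI)
    have l4 : Tendsto (fun τ => dP τ r) (𝓝 t₀) (𝓝 ((p t₀).derivative.eval (x t₀ r))) := by
      have := (continuousAt_dslope_same.2 ((p t₀).differentiableAt (x := x t₀ r))).tendsto.comp
        (hxlim r hrI)
      rwa [dslope_same, Polynomial.deriv] at this
    have l5 : Tendsto (fun τ => dg τ r) (𝓝 t₀) (𝓝 (g' (x t₀ r))) := by
      have := (continuousAt_dslope_same.2 (hg _ hxr).differentiableAt).tendsto.comp (hxlim r hrI)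
      rwa [dslope_same, (hg _ hxr).deriv] at this
    have l6 := (hx'lim r hrI).add_const (x' t₀ r)
    have l7 := (hYlim r hr).add_const (Y t₀ r)
    have hy2 : Y t₀ r + Y t₀ r ≠ 0 := by rw [← two_mul]; exact mul_ne_zero two_ne_zero hy
    have l8 := (((l2.mul l4).mul l6).div l7 hy2).add ((l5.mul_const (Y t₀ r)).mul l6)
      |>.sub ((hZDlim r hr).add_const (ZD t₀ r))
    have hzero : g (x t₀ r) * (p t₀).derivative.eval (x t₀ r) * (x' t₀ r + x' t₀ r)
        / (Y t₀ r + Y t₀ r) + g' (x t₀ r) * Y t₀ r * (x' t₀ r + x' t₀ r)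
        - (ZD t₀ r + ZD t₀ r) = 0 := by
      simp only [hZD]
      field_simp
      ring
    rw [hzero] at l8
    exact l8
  have hdomT : ∀ᶠ τ in 𝓝[≠] t₀, ∀ r ∈ J, ‖T τ r / (τ - t₀)‖ ≤
      (C * (M * MY * (2 * MX + 1) + 2 * K))
        + (M * (A + C * MP) * (2 * MX + 1) + C * (2 * K')) * ‖Y t₀ r‖⁻¹ := by
    filter_upwards [hdecomp, hcoefδ, nhdsWithin_le_nhds hnear, nhdsWithin_le_nhds hZDle,
      nhdsWithin_le_nhds hA, self_mem_nhdsWithin] with τ h1 h2 h3 h4 h5 hne r hr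
    have hs : 0 < ‖τ - t₀‖ := norm_pos_iff.2 (sub_ne_zero.2 hne)
    have hrI := hJI hr
    have hxτ := h3.1 r hrI
    have hx0 := h0.1 r hrI
    have b1 := hgM _ hxτ
    have b2 : ‖Fs τ r‖ ≤ A := by
      rw [hFs, norm_div, div_le_iff₀ hs]; exact h5 _ hxτ
    have b3 : ‖x' τ r + x' t₀ r‖ ≤ 2 * MX + 1 := by
      have e : x' τ r + x' t₀ r = (x' τ r - x' t₀ r) + 2 * x' t₀ r := by ring
      have := norm_add_le (x' τ r - x' t₀ r) (2 * x' t₀ r)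
      rw [← e, norm_mul, Complex.norm_ofNat] at this
      linarith [hMX r hrI, h3.2.2.2.2.2.2 r hrI]
    have b4 : ‖(Y τ r + Y t₀ r)⁻¹‖ ≤ ‖Y t₀ r‖⁻¹ := by
      rw [norm_inv]
      have e := ((hfacts τ h3).1 r hr).2.2.2
      exact inv_anti₀ e.2 e.1
    have b5 : ‖dP τ r‖ ≤ MP := by
      refine norm_dslope_le_of_forall_hasDerivAt (f' := fun z => (p t₀).derivative.eval z)
        (fun z _ => (p t₀).hasDerivAt z) (fun z hz => hMP z (Metric.ball_subset_closedBall hz)) hx0 hxτ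
    have b6 : ‖dg τ r‖ ≤ M := norm_dslope_le_of_forall_hasDerivAt hg hg'M hx0 hxτ
    have b7 : ‖ZD τ r + ZD t₀ r‖ ≤ 2 * K + 2 * K' * ‖Y t₀ r‖⁻¹ := by
      have := norm_add_le (ZD τ r) (ZD t₀ r)
      linarith [h4 r hr, hZDle.self_of_nhds r hr]
    have b8 := hMY r hrI
    have hi : 0 ≤ ‖Y t₀ r‖⁻¹ := inv_nonneg.2 (norm_nonneg _)
    have c1 : ‖g (x τ r) * Fs τ r * (x' τ r + x' t₀ r) / (Y τ r + Y t₀ r)‖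
        ≤ M * A * (2 * MX + 1) * ‖Y t₀ r‖⁻¹ := by
      rw [div_eq_mul_inv]; simp only [norm_mul]; gcongr
    have c2 : ‖g (x τ r) * dP τ r * (x' τ r + x' t₀ r) / (Y τ r + Y t₀ r)‖
        ≤ M * MP * (2 * MX + 1) * ‖Y t₀ r‖⁻¹ := by
      rw [div_eq_mul_inv]; simp only [norm_mul]; gcongr
    have c3 : ‖dg τ r * Y t₀ r * (x' τ r + x' t₀ r)‖ ≤ M * MY * (2 * MX + 1) := by
      simp only [norm_mul]; gcongr
    have c4 : ‖E τ r‖ ≤ M * MP * (2 * MX + 1) * ‖Y t₀ r‖⁻¹ + M * MY * (2 * MX + 1)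
        + (2 * K + 2 * K' * ‖Y t₀ r‖⁻¹) :=
      (norm_sub_le _ _).trans (add_le_add ((norm_add_le _ _).trans (add_le_add c2 c3)) b7)
    rw [h1 r hr]
    have c5 := mul_le_mul (h2 r hr) c4 (norm_nonneg _) hC0
    rw [← norm_mul] at c5
    refine (norm_add_le _ _).trans ((add_le_add c1 c5).trans (le_of_eq ?_))
    ring
  have hlim : Tendsto (fun τ => ∫ r in J, T τ r / (τ - t₀)) (𝓝[≠] t₀)
      (𝓝 (∫ r in J, g (x t₀ r) * (pd.eval (x t₀ r) * x' t₀ r / Y t₀ r))) := by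
    refine MeasureTheory.tendsto_integral_filter_of_dominated_convergence _ ?_ ?_
      (hdomint (C * (M * MY * (2 * MX + 1) + 2 * K))
        (M * (A + C * MP) * (2 * MX + 1) + C * (2 * K'))) ?_
    · filter_upwards [nhdsWithin_le_nhds hnear] with τ hτ
      have hfτ := hfacts τ hτ
      have hd1 : ContinuousOn (fun r => x τ r - x t₀ r) J := fun r hr =>
        ((hτ.2.1 r (hJI hr)).continuousAt.sub (h0.2.1 r (hJI hr)).continuousAt).continuousWithinAt
      have hTc : ContinuousOn (fun r => T τ r / (τ - t₀)) J :=
        ((((hfτ.2.1.sub hf0.2.1).mul (hτ.2.2.1.add h0.2.2.1)).mono hJI).sub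
          ((hfτ.2.2.2.add hf0.2.2.2).mul hd1)).div_const _
      exact hTc.aestronglyMeasurable measurableSet_Ioo
    · filter_upwards [hdomT] with τ hτ
      filter_upwards [MeasureTheory.ae_restrict_mem measurableSet_Ioo] with r hr using hτ r hr
    · filter_upwards [MeasureTheory.ae_restrict_mem measurableSet_Ioo] with r hr
      have hrI := hJI hr
      have hxr := h0.1 r hrI
      have hy := hY0 r hr
      have hle : 𝓝[≠] t₀ ≤ 𝓝 t₀ := nhdsWithin_le_nhds
      have l2 := ((hg _ hxr).continuousAt.tendsto.comp (hxlim r hrI)).mono_left hle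
      have l3 : Tendsto (fun τ => Fs τ r) (𝓝[≠] t₀) (𝓝 (pd.eval (x t₀ r))) :=
        tendsto_eval_slope hn hnd hp ((hxlim r hrI).mono_left hle)
      have l6 := ((hx'lim r hrI).add_const (x' t₀ r)).mono_left hle
      have l7 := ((hYlim r hr).add_const (Y t₀ r)).mono_left hle
      have hy2 : Y t₀ r + Y t₀ r ≠ 0 := by rw [← two_mul]; exact mul_ne_zero two_ne_zero hy
      have l8 := ((l2.mul l3).mul l6).div l7 hy2
      -- The displacement quotient need not converge; it is bounded by `C`, and its coefficient
      -- tends to `0`.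
      have l9 : Tendsto (fun τ => (x τ r - x t₀ r) / (τ - t₀) * E τ r) (𝓝[≠] t₀) (𝓝 0) := by
        have hz := ((hElim r hr).mono_left hle).norm.const_mul C
        rw [norm_zero, mul_zero] at hz
        refine squeeze_zero_norm' ?_ hz
        filter_upwards [hcoefδ] with τ hτ
        rw [norm_mul]
        exact mul_le_mul_of_nonneg_right (hτ r hr) (norm_nonneg _)
      have l10 := l8.add l9
      have hval : g (x t₀ r) * pd.eval (x t₀ r) * (x' t₀ r + x' t₀ r) / (Y t₀ r + Y t₀ r) + 0
          = g (x t₀ r) * (pd.eval (x t₀ r) * x' t₀ r / Y t₀ r) := by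
        field_simp
        ring
      rw [hval] at l10
      refine l10.congr' ?_
      filter_upwards [hdecomp] with τ hτ using (hτ r hr).symm
  rw [hasDerivAt_iff_tendsto_slope]
  have hfin := hlim.const_mul (1 / 2)
  rw [← MeasureTheory.integral_const_mul] at hfin
  have hval : ∫ r in α..β, g (x t₀ r) * (pd.eval (x t₀ r) * x' t₀ r / (2 * Y t₀ r))
      = ∫ r in J, 1 / 2 * (g (x t₀ r) * (pd.eval (x t₀ r) * x' t₀ r / Y t₀ r)) := by
    rw [hII]
    refine MeasureTheory.integral_congr_ae (Eventually.of_forall fun r => ?_)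
    simp only [div_eq_mul_inv, mul_inv]
    ring
  rw [hval]
  refine hfin.congr' ?_
  filter_upwards [nhdsWithin_le_nhds hmain] with τ hτ
  rw [slope_def_field, hτ, MeasureTheory.integral_div]
  ring
end

/-! ### The effective potential, the cycle `β̂`, and a formula for the prepotential. -/

noncomputable section

namespace CutCurve
variable {m : ℕ} {W : ℂ[X]} (Γ : CutCurve m W)

theorem t_ne_zero : Γ.t ≠ 0 := by
  rw [t]
  exact div_ne_zero (neg_ne_zero.2 Γ.coeff_f_ne_zero) (by norm_num)

theorem integral_indicator_compl_cutParams_of_forall_mem {F : ℝ → ℂ} {a b : ℝ} (hab : a ≤ b)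
    (h : ∀ s ∈ Set.Ioo a b, s ∈ Γ.cutParams) : ∫ s in a..b, Γ.cutParamsᶜ.indicator F s = 0 := by
  rw [intervalIntegral.integral_of_le hab, MeasureTheory.integral_Ioc_eq_integral_Ioo]
  exact MeasureTheory.setIntegral_eq_zero_of_forall_eq_zero fun s hs =>
    Set.indicator_of_notMem (Set.notMem_compl_iff.2 (h s hs)) _

theorem integral_indicator_compl_cutParams_of_forall_notMem {F : ℝ → ℂ} {a b : ℝ} (hab : a ≤ b)
    (h : ∀ s ∈ Set.Ioo a b, s ∉ Γ.cutParams) :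
    ∫ s in a..b, Γ.cutParamsᶜ.indicator F s = ∫ s in a..b, F s := by
  rw [intervalIntegral.integral_of_le hab, intervalIntegral.integral_of_le hab,
    MeasureTheory.integral_Ioc_eq_integral_Ioo, MeasureTheory.integral_Ioc_eq_integral_Ioo]
  exact MeasureTheory.setIntegral_congr_fun measurableSet_Ioo fun s hs =>
    Set.indicator_of_mem (h s hs) _

theorem mem_cutParams {i : Fin (m + 1)} {s : ℝ} (hs : s ∈ Set.Icc (Γ.sMinus i) (Γ.sPlus i)) :
    s ∈ Γ.cutParams := Set.mem_iUnion.2 ⟨i, hs⟩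

theorem notMem_cutParams_of_gap {i : Fin m} {s : ℝ}
    (hs : s ∈ Set.Ioo (Γ.sPlus i.castSucc) (Γ.sMinus i.succ)) : s ∉ Γ.cutParams := by
  intro h
  obtain ⟨j, hj⟩ := Set.mem_iUnion.1 h
  rcases le_or_gt j i.castSucc with hle | hlt
  · rcases hle.eq_or_lt with rfl | hlt
    · linarith [hs.1, hj.2]
    · linarith [hs.1, hj.2, Γ.sPlus_lt_sMinus _ _ hlt, Γ.sMinus_lt_sPlus i.castSucc]
  · have hle : i.succ ≤ j := by
      rw [Fin.le_def, Fin.val_succ]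
      exact hlt
    rcases hle.eq_or_lt with rfl | hlt
    · linarith [hs.2, hj.1]
    · linarith [hs.2, hj.1, Γ.sPlus_lt_sMinus _ _ hlt, Γ.sMinus_lt_sPlus i.succ]

theorem le_sPlus_last {s : ℝ} (hs : s ∈ Γ.cutParams) : s ≤ Γ.sPlus (Fin.last m) := by
  obtain ⟨j, hj⟩ := Set.mem_iUnion.1 hs
  rcases (Fin.le_last j).eq_or_lt with rfl | hlt
  · exact hj.2
  · linarith [hj.2, Γ.sPlus_lt_sMinus _ _ hlt, Γ.sMinus_lt_sPlus (Fin.last m)]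

theorem integral_cutParams {F : ℝ → ℂ} (hF : MeasureTheory.IntegrableOn F Γ.cutParams) :
    ∫ s in Γ.cutParams, F s = ∑ i, ∫ s in Γ.sMinus i..Γ.sPlus i, F s := by
  rw [cutParams, MeasureTheory.integral_iUnion_fintype (fun _ => measurableSet_Icc) ?_
    fun i => hF.mono_set (Set.subset_iUnion (fun i => Set.Icc (Γ.sMinus i) (Γ.sPlus i)) i)]
  · refine Finset.sum_congr rfl fun i _ => ?_
    rw [intervalIntegral.integral_of_le (Γ.sMinus_lt_sPlus i).le,
      MeasureTheory.integral_Icc_eq_integral_Ioc]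
  · intro i j hij
    rw [Function.onFun, Set.disjoint_left]
    intro s hi hj
    rcases lt_or_gt_of_ne hij with h | h
    · linarith [hi.2, hj.1, Γ.sPlus_lt_sMinus _ _ h]
    · linarith [hj.2, hi.1, Γ.sPlus_lt_sMinus _ _ h]

theorem integrableOn_mul_dens {F : ℝ → ℂ} {T : Set ℝ} (hT : MeasurableSet T) (hTc : T ⊆ Γ.cutParams)
    (hF : ContinuousOn F Γ.cutParams) (h : ℂ[X]) :
    MeasureTheory.IntegrableOn (fun s => F s * Γ.dens h s) T := by
  obtain ⟨M, hM⟩ := Γ.isCompact_cutParams.exists_bound_of_continuousOn hF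
  refine MeasureTheory.Integrable.bdd_mul (c := M)
    ((Γ.integrableOn_dens_cutParams h).mono_set hTc)
    ((hF.mono hTc).aestronglyMeasurable hT) ?_
  filter_upwards [MeasureTheory.ae_restrict_mem hT] with s hs using hM s (hTc hs)

theorem potential_sub_of_natDegree_le {h : ℂ[X]} (hh : h.natDegree ≤ m) (s₁ s₂ : ℝ) :
    Γ.potential h s₂ - Γ.potential h s₁ =
      -(Real.pi * Complex.I * ∫ u in s₁..s₂, Γ.cutParamsᶜ.indicator (Γ.dens h) u) := by
  rw [Γ.potential_sub (Γ.tendsto_div_y₀_sub_zero hh) s₁ s₂]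
  simp only [eval_zero, zero_mul, zero_sub]
  rw [intervalIntegral.integral_neg]
  ring

/-- The effective potential along the path, which is constant on each cut. -/
def effPot (s : ℝ) : ℂ :=
  W.eval (Γ.lam s) - Γ.potential Γ.P s / (Real.pi * Complex.I)

/-- The polynomial part of `P / y₀` is `W'`, and its integral cancels the increment of `W`. Only `y
dz` off the cuts remains, hence constancy on each cut: the equilibrium condition for the density. -/
theorem effPot_sub (hmonic : W.derivative.Monic) (hdeg : W.derivative.natDegree = m + 1) (s₁ s₂ : ℝ) :
    Γ.effPot s₂ - Γ.effPot s₁ = ∫ u in s₁..s₂, Γ.cutParamsᶜ.indicator (Γ.dens Γ.P) u := by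
  have hpi : (Real.pi : ℂ) ≠ 0 := Complex.ofReal_ne_zero.2 Real.pi_ne_zero
  have h1 := Γ.potential_sub (Γ.tendsto_P_div_y₀_sub hmonic hdeg) s₁ s₂
  have hc : Continuous fun u => W.derivative.eval (Γ.lam u) * deriv Γ.lam u :=
    (W.derivative.continuous.comp Γ.continuous_lam).mul Γ.continuous_deriv_lam
  rw [intervalIntegral.integral_sub (hc.intervalIntegrable _ _)
    (Γ.intervalIntegrable_indicator_dens Γ.P Γ.measurableSet_cutParams.compl _ _),
    intervalIntegral.integral_eq_sub_of_hasDerivAt (f := fun u => W.eval (Γ.lam u))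
      (fun u _ => (W.hasDerivAt (Γ.lam u)).comp u (Γ.hasDerivAt_lam u))
      (hc.intervalIntegrable _ _)] at h1
  have hI := Complex.I_ne_zero
  simp only [effPot]
  have e : W.eval (Γ.lam s₂) - Γ.potential Γ.P s₂ / (Real.pi * Complex.I)
      - (W.eval (Γ.lam s₁) - Γ.potential Γ.P s₁ / (Real.pi * Complex.I))
      = W.eval (Γ.lam s₂) - W.eval (Γ.lam s₁)
        - (Γ.potential Γ.P s₂ - Γ.potential Γ.P s₁) / (Real.pi * Complex.I) := by ring
  rw [e, h1, mul_div_cancel_left₀ _ (mul_ne_zero hpi hI)]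
  ring

theorem integral_indicator_cut {F : ℝ → ℂ} {i : Fin (m + 1)} {s : ℝ}
    (hs : s ∈ Set.Icc (Γ.sMinus i) (Γ.sPlus i)) :
    ∫ u in s..Γ.sPlus i, Γ.cutParamsᶜ.indicator F u = 0 :=
  Γ.integral_indicator_compl_cutParams_of_forall_mem hs.2 fun _ hu =>
    Γ.mem_cutParams ⟨hs.1.trans hu.1.le, hu.2.le⟩

theorem effPot_eq (hmonic : W.derivative.Monic) (hdeg : W.derivative.natDegree = m + 1)
    {i : Fin (m + 1)} {s : ℝ} (hs : s ∈ Set.Icc (Γ.sMinus i) (Γ.sPlus i)) :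
    Γ.effPot s = Γ.effPot (Γ.sPlus i) := by
  have := Γ.effPot_sub hmonic hdeg s (Γ.sPlus i)
  rw [Γ.integral_indicator_cut hs] at this
  exact (sub_eq_zero.1 this).symm

theorem potential_eq {h : ℂ[X]} (hh : h.natDegree ≤ m) {i : Fin (m + 1)} {s : ℝ}
    (hs : s ∈ Set.Icc (Γ.sMinus i) (Γ.sPlus i)) :
    Γ.potential h s = Γ.potential h (Γ.sPlus i) := by
  have := Γ.potential_sub_of_natDegree_le hh s (Γ.sPlus i)
  rw [Γ.integral_indicator_cut hs, mul_zero, neg_zero] at this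
  exact (sub_eq_zero.1 this).symm

theorem integral_indicator_gap {F : ℝ → ℂ} (i : Fin m)
    (hF : IntervalIntegrable (Γ.cutParamsᶜ.indicator F) MeasureTheory.volume (Γ.sPlus i.castSucc)
      (Γ.sPlus i.succ))
    : ∫ u in Γ.sPlus i.castSucc..Γ.sPlus i.succ, Γ.cutParamsᶜ.indicator F u
      = ∫ u in Γ.sPlus i.castSucc..Γ.sMinus i.succ, F u := by
  have h1 := Γ.sPlus_lt_sMinus i.castSucc i.succ Fin.castSucc_lt_succ
  have h2 := Γ.sMinus_lt_sPlus i.succ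
  rw [← intervalIntegral.integral_add_adjacent_intervals (b := Γ.sMinus i.succ)
    (hF.mono_set ?_) (hF.mono_set ?_),
    Γ.integral_indicator_cut ⟨le_rfl, h2.le⟩, add_zero,
    Γ.integral_indicator_compl_cutParams_of_forall_notMem h1.le fun s hs => Γ.notMem_cutParams_of_gap hs]
  · rw [Set.uIcc_of_le h1.le, Set.uIcc_of_le (h1.trans h2).le]
    exact Set.Icc_subset_Icc_right h2.le
  · rw [Set.uIcc_of_le h2.le, Set.uIcc_of_le (h1.trans h2).le]
    exact Set.Icc_subset_Icc_left h1.le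

theorem effPot_succ (hmonic : W.derivative.Monic) (hdeg : W.derivative.natDegree = m + 1) (i : Fin m) :
    Γ.effPot (Γ.sPlus i.succ) - Γ.effPot (Γ.sPlus i.castSucc)
      = ∫ u in Γ.sPlus i.castSucc..Γ.sMinus i.succ, Γ.dens Γ.P u := by
  rw [Γ.effPot_sub hmonic hdeg, Γ.integral_indicator_gap i
    (Γ.intervalIntegrable_indicator_dens Γ.P Γ.measurableSet_cutParams.compl _ _)]

theorem potential_succ {h : ℂ[X]} (hh : h.natDegree ≤ m) (i : Fin m) :
    Γ.potential h (Γ.sPlus i.succ) - Γ.potential h (Γ.sPlus i.castSucc)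
      = -(Real.pi * Complex.I * ∫ u in Γ.sPlus i.castSucc..Γ.sMinus i.succ, Γ.dens h u) := by
  rw [Γ.potential_sub_of_natDegree_le hh, Γ.integral_indicator_gap i
    (Γ.intervalIntegrable_indicator_dens h Γ.measurableSet_cutParams.compl _ _)]

theorem integral_indicator_last {F : ℝ → ℂ} {s : ℝ} (hs : Γ.sPlus (Fin.last m) ≤ s) :
    ∫ u in Γ.sPlus (Fin.last m)..s, Γ.cutParamsᶜ.indicator F u
      = ∫ u in Γ.sPlus (Fin.last m)..s, F u :=
  Γ.integral_indicator_compl_cutParams_of_forall_notMem hs fun _ hu hc =>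
    (Γ.le_sPlus_last hc).not_gt hu.1

theorem effPot_sub_last (hmonic : W.derivative.Monic) (hdeg : W.derivative.natDegree = m + 1) {s : ℝ}
    (hs : Γ.sPlus (Fin.last m) ≤ s) :
    Γ.effPot s - Γ.effPot (Γ.sPlus (Fin.last m)) = ∫ u in Γ.sPlus (Fin.last m)..s, Γ.dens Γ.P u := by
  rw [Γ.effPot_sub hmonic hdeg, Γ.integral_indicator_last hs]

theorem potential_sub_last {h : ℂ[X]} (hh : h.natDegree ≤ m) {s : ℝ}
    (hs : Γ.sPlus (Fin.last m) ≤ s) :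
    Γ.potential h s - Γ.potential h (Γ.sPlus (Fin.last m))
      = -(Real.pi * Complex.I * ∫ u in Γ.sPlus (Fin.last m)..s, Γ.dens h u) := by
  rw [Γ.potential_sub_of_natDegree_le hh, Γ.integral_indicator_last hs]

/-- The parameter `s` lies beyond the cuts, on a part of the path to the right of them. -/
def IsFar (s : ℝ) : Prop := ∀ s' ∈ Γ.cutParams, s' < s ∧ ∀ u ≥ s, (Γ.lam s').re < (Γ.lam u).re

variable {Γ} in
theorem IsFar.sPlus_last_lt {s : ℝ} (hs : Γ.IsFar s) : Γ.sPlus (Fin.last m) < s :=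
  (hs _ (Γ.bp_mem_cutParams (Fin.last m, true))).1

variable {Γ} in
theorem IsFar.potential_eq {s : ℝ} (hs : Γ.IsFar s) (h : ℂ[X]) :
    Γ.potential h s = ∫ s' in Γ.cutParams, Complex.log (Γ.lam s - Γ.lam s') * Γ.dens h s' := by
  refine MeasureTheory.setIntegral_congr_fun Γ.measurableSet_cutParams fun s' hs' => ?_
  obtain ⟨h1, h2⟩ := hs s' hs'
  simp only [principalLog_of_lt h1, pathLog_of_le Γ.contDiff_lam Γ.injective_lam h1 h2]

/-- By the intermediate value theorem the real end of the path passes through every large `Λ`. The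
parameter `R` is taken so late that the path stays to the right of all the cuts from then on. -/
theorem exists_isFar_of_le (b : ℝ) : ∃ Λ₁ : ℝ, 0 < Λ₁ ∧ ∀ Λ ≥ Λ₁, ∃ s > b, Γ.IsFar s ∧ Γ.lam s = (Λ : ℂ) := by
  obtain ⟨T, hT⟩ := Γ.eventually_real
  obtain ⟨A, B, -, hAB⟩ := Γ.exists_cutParams_subset_Icc
  obtain ⟨M, hM⟩ := Γ.isCompact_cutParams.exists_bound_of_continuousOn Γ.continuous_lam.continuousOn
  obtain ⟨R, hR, hRe⟩ := exists_forall_lt_re Γ.tendsto_atTop (max M 0) (max T (max B b))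
  have hc : Continuous fun s => (Γ.lam s).re := Complex.continuous_re.comp Γ.continuous_lam
  refine ⟨(Γ.lam R).re, (le_max_right M 0).trans_lt (hRe R le_rfl), fun Λ hΛ => ?_⟩
  obtain ⟨s, hs, hsΛ⟩ : ∃ s, R ≤ s ∧ (Γ.lam s).re = Λ := by
    obtain ⟨R', hR'⟩ := ((Γ.tendsto_atTop.eventually_ge_atTop Λ).and (eventually_ge_atTop R)).exists
    obtain ⟨s, hs, h⟩ := intermediate_value_Icc hR'.2 hc.continuousOn ⟨hΛ, hR'.1⟩
    exact ⟨s, hs.1, h⟩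
  have hTR : T ≤ R := (le_max_left _ _).trans hR.le
  have hBR : B ≤ R := (le_max_left _ _).trans ((le_max_right T _).trans hR.le)
  have hbR : b < R := (le_max_right B b).trans_lt ((le_max_right T _).trans_lt hR)
  refine ⟨s, hbR.trans_le hs, fun s' hs' => ⟨(hAB hs').2.trans_le (hBR.trans hs), fun u hu => ?_⟩,
    Complex.ext (by simpa using hsΛ) (by simpa using hT s (hTR.trans hs))⟩
  calc (Γ.lam s').re ≤ M := (Complex.re_le_norm _).trans (hM s' hs')
    _ ≤ max M 0 := le_max_left _ _
    _ < _ := hRe u (hs.trans hu)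

/-- On the lower sheet both `y` and the direction of travel change sign, so the two halves
contribute equally. They are computed on open intervals, since the turning point `r = 0` is a
corner. -/
theorem betaHatIntegral_eq {s : ℝ} (hs : Γ.sPlus (Fin.last m) < s) :
    Γ.betaHatIntegral s = 2 * ∫ u in Γ.sPlus (Fin.last m)..s, Γ.dens Γ.P u := by
  set b := Γ.sPlus (Fin.last m) with hb
  have hy : ∀ u ∈ Set.Ioo b s, Γ.y₀ (Γ.lam u) * deriv Γ.lam u = Γ.dens Γ.P u := fun u hu => by
    rw [dens_P, Γ.yPlus_of_notMem fun h => (Γ.le_sPlus_last h).not_gt hu.1]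
  have hbs : 0 < s - b := sub_pos.2 hs
  have hlow : ∀ r ∈ Set.Ioo (-(s - b)) 0,
      (Γ.betaHat r).2 * deriv (fun u => (Γ.betaHat u).1) r = Γ.dens Γ.P (b - r) := by
    intro r hr
    have e : (fun u => (Γ.betaHat u).1) =ᶠ[𝓝 r] fun u => Γ.lam (b - u) := by
      filter_upwards [eventually_lt_nhds hr.2] with u hu
      simp only [betaHat, if_pos hu, hb]
    rw [e.deriv_eq, deriv_comp_const_sub, ← hy (b - r) ⟨by linarith [hr.2], by linarith [hr.1]⟩]
    simp only [betaHat, if_pos hr.2, hb]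
    ring
  have hup : ∀ r ∈ Set.Ioo 0 (s - b),
      (Γ.betaHat r).2 * deriv (fun u => (Γ.betaHat u).1) r = Γ.dens Γ.P (b + r) := by
    intro r hr
    have e : (fun u => (Γ.betaHat u).1) =ᶠ[𝓝 r] fun u => Γ.lam (b + u) := by
      filter_upwards [eventually_gt_nhds hr.1] with u hu
      simp only [betaHat, if_neg (not_lt.2 hu.le), hb]
    rw [e.deriv_eq, deriv_comp_const_add, ← hy (b + r) ⟨by linarith [hr.1], by linarith [hr.2]⟩]
    simp only [betaHat, if_neg (not_lt.2 hr.1.le), hb]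
  have hc := Γ.continuous_dens_P
  have congr : ∀ {f g : ℝ → ℂ} {c d : ℝ}, c ≤ d → (∀ r ∈ Set.Ioo c d, f r = g r) →
      f =ᵐ[MeasureTheory.volume.restrict (Set.uIoc c d)] g := by
    intro f g c d hcd h
    rw [Set.uIoc_of_le hcd, MeasureTheory.restrict_Ioo_eq_restrict_Ioc.symm]
    filter_upwards [MeasureTheory.ae_restrict_mem measurableSet_Ioo] with r hr using h r hr
  have e1 := congr (by linarith) hlow
  have e2 := congr hbs.le hup
  have i1 : IntervalIntegrable (fun r => Γ.dens Γ.P (b - r)) MeasureTheory.volume (-(s - b)) 0 :=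
    (hc.comp (continuous_const.sub continuous_id)).intervalIntegrable _ _
  have i2 : IntervalIntegrable (fun r => Γ.dens Γ.P (b + r)) MeasureTheory.volume 0 (s - b) :=
    (hc.comp (continuous_const.add continuous_id)).intervalIntegrable _ _
  rw [betaHatIntegral, zetaIntegral, ← hb, ← intervalIntegral.integral_add_adjacent_intervals
    (i1.congr_ae e1.symm) (i2.congr_ae e2.symm)]
  have f1 : ∫ r in (-(s - b))..0, (Γ.betaHat r).2 * deriv (fun u => (Γ.betaHat u).1) r
      = ∫ u in b..s, Γ.dens Γ.P u := by
    rw [intervalIntegral.integral_congr_ae_restrict e1,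
      intervalIntegral.integral_comp_sub_left (fun u => Γ.dens Γ.P u)]
    congr 1 <;> ring
  have f2 : ∫ r in (0 : ℝ)..(s - b), (Γ.betaHat r).2 * deriv (fun u => (Γ.betaHat u).1) r
      = ∫ u in b..s, Γ.dens Γ.P u := by
    rw [intervalIntegral.integral_congr_ae_restrict e2,
      intervalIntegral.integral_comp_add_left (fun u => Γ.dens Γ.P u)]
    congr 1 <;> ring
  rw [f1, f2]
  ring

/-- The asymptotic expansion of the integral of `ζ` over the cut-off cycle `β̂`. -/
theorem exists_betaHatIntegral_sub_le (hmonic : W.derivative.Monic)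
    (hdeg : W.derivative.natDegree = m + 1) :
    ∃ K Λ₁ : ℝ, 0 < Λ₁ ∧ ∀ Λ₀ ≥ Λ₁, ∃ s : ℝ, Γ.sPlus (Fin.last m) < s ∧ Γ.lam s = (Λ₀ : ℂ) ∧
      ‖1 / 2 * Γ.betaHatIntegral s - (-Γ.effPot (Γ.sPlus (Fin.last m)) + W.eval (Λ₀ : ℂ)
        - Γ.t * (Real.log (Λ₀ ^ 2) : ℂ))‖ ≤ K / Λ₀ := by
  have hpi : (Real.pi : ℂ) ≠ 0 := Complex.ofReal_ne_zero.2 Real.pi_ne_zero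
  obtain ⟨Λ₁, hΛ₁, hfar⟩ := Γ.exists_isFar_of_le 0
  obtain ⟨M, hM⟩ := Γ.isCompact_cutParams.exists_bound_of_continuousOn Γ.continuous_lam.continuousOn
  set N := ∫ s' in Γ.cutParams, ‖Γ.dens Γ.P s'‖ with hN
  -- The error is the integral of `log (1 - z / Λ)` against the density. For `Λ ≥ 2 * M + 1` one has
  -- `‖z / Λ‖ ≤ 1 / 2`, where the logarithm is at most `3 / 2` times its argument.
  refine ⟨‖(Real.pi * Complex.I : ℂ)⁻¹‖ * (3 / 2 * M * N), max Λ₁ (2 * M + 1), lt_max_of_lt_left hΛ₁,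
    fun Λ hΛ => ?_⟩
  obtain ⟨s, -, hs, hlam⟩ := hfar Λ ((le_max_left _ _).trans hΛ)
  have hΛ0 : 0 < Λ := hΛ₁.trans_le ((le_max_left _ _).trans hΛ)
  have hΛM : 2 * M + 1 ≤ Λ := (le_max_right _ _).trans hΛ
  refine ⟨s, hs.sPlus_last_lt, hlam, ?_⟩
  have h1 := Γ.effPot_sub_last hmonic hdeg hs.sPlus_last_lt.le
  have h2 := hs.potential_eq Γ.P
  have hcl : ContinuousOn (fun s' => Complex.log (Γ.lam s - Γ.lam s')) Γ.cutParams := by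
    refine ContinuousOn.clog (continuous_const.sub Γ.continuous_lam).continuousOn fun s' hs' => ?_
    left
    rw [Complex.sub_re]
    linarith [(hs s' hs').2 s le_rfl]
  have i1 := Γ.integrableOn_mul_dens Γ.measurableSet_cutParams subset_rfl hcl Γ.P
  have i2 : MeasureTheory.IntegrableOn (fun s' => (Real.log Λ : ℂ) * Γ.dens Γ.P s') Γ.cutParams :=
    (Γ.integrableOn_dens_cutParams Γ.P).const_mul _
  have e1 : 1 / 2 * Γ.betaHatIntegral s - (-Γ.effPot (Γ.sPlus (Fin.last m)) + W.eval (Λ : ℂ)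
        - Γ.t * (Real.log (Λ ^ 2) : ℂ)) = -((Real.pi * Complex.I : ℂ)⁻¹ *
          ∫ s' in Γ.cutParams, (Complex.log (Γ.lam s - Γ.lam s') * Γ.dens Γ.P s'
            - (Real.log Λ : ℂ) * Γ.dens Γ.P s')) := by
    rw [MeasureTheory.integral_sub i1 i2, MeasureTheory.integral_const_mul,
      Γ.integral_dens_P hmonic hdeg, ← h2, Γ.betaHatIntegral_eq hs.sPlus_last_lt, ← h1, effPot, hlam,
      Real.log_pow]
    have hI := Complex.I_ne_zero
    push_cast
    field_simp
    ring
  have hbound : ∀ s' ∈ Γ.cutParams, ‖Complex.log (Γ.lam s - Γ.lam s') * Γ.dens Γ.P s'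
      - (Real.log Λ : ℂ) * Γ.dens Γ.P s'‖ ≤ 3 / 2 * M / Λ * ‖Γ.dens Γ.P s'‖ := by
    intro s' hs'
    rw [← sub_mul, norm_mul]
    refine mul_le_mul_of_nonneg_right ?_ (norm_nonneg _)
    have hMs := hM s' hs'
    have hM0 : 0 ≤ M := (norm_nonneg _).trans hMs
    have hΛc : (Λ : ℂ) ≠ 0 := Complex.ofReal_ne_zero.2 hΛ0.ne'
    have hz : ‖-(Γ.lam s' / Λ)‖ ≤ M / Λ := by
      rw [norm_neg, norm_div, Complex.norm_real, Real.norm_of_nonneg hΛ0.le]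
      exact div_le_div_of_nonneg_right hMs hΛ0.le
    have hz2 : M / Λ ≤ 1 / 2 := by rw [div_le_iff₀ hΛ0]; linarith
    have hne : (1 : ℂ) + -(Γ.lam s' / Λ) ≠ 0 := by
      intro h
      have : -(Γ.lam s' / Λ) = (-1 : ℂ) := by linear_combination h
      rw [this, norm_neg, norm_one] at hz
      linarith
    have e : Γ.lam s - Γ.lam s' = (Λ : ℂ) * (1 + -(Γ.lam s' / Λ)) := by
      rw [hlam]; field_simp; ring
    rw [e, Complex.log_ofReal_mul hΛ0 hne, add_sub_cancel_left]
    refine (Complex.norm_log_one_add_half_le_self (hz.trans hz2)).trans ?_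
    rw [mul_div_assoc]
    exact mul_le_mul_of_nonneg_left hz (by norm_num)
  rw [e1, norm_neg, norm_mul]
  have h3 := MeasureTheory.norm_integral_le_of_norm_le
    ((Γ.integrableOn_dens_cutParams Γ.P).norm.const_mul (3 / 2 * M / Λ))
    ((MeasureTheory.ae_restrict_mem Γ.measurableSet_cutParams).mono hbound)
  rw [MeasureTheory.integral_const_mul, ← hN] at h3
  calc _ ≤ _ := mul_le_mul_of_nonneg_left h3 (norm_nonneg _)
    _ = _ := by ring

theorem ρ₀_ae_eq : Γ.ρ₀ =ᵐ[MeasureTheory.volume] Γ.cutParams.indicator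
    (fun s => (2 * Real.pi * Complex.I * Γ.t)⁻¹ * Γ.dens Γ.P s) := by
  filter_upwards [(Set.finite_range Γ.bp).countable.ae_notMem MeasureTheory.volume] with s hs
  rw [Γ.ρ₀_eq hs]
  congr 1
  ext s
  rw [dens_P, div_div, div_eq_inv_mul]

theorem S_eq (i : Fin (m + 1)) : Γ.S i =
    (2 * Real.pi * Complex.I)⁻¹ * ∫ s in Γ.sMinus i..Γ.sPlus i, Γ.dens Γ.P s := by
  have h : ∫ s in Γ.sMinus i..Γ.sPlus i, Γ.ρ₀ s
      = ∫ s in Γ.sMinus i..Γ.sPlus i, (2 * Real.pi * Complex.I * Γ.t)⁻¹ * Γ.dens Γ.P s := by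
    refine intervalIntegral.integral_congr_ae ?_
    filter_upwards [Γ.ρ₀_ae_eq] with s hs hsi
    rw [Set.uIoc_of_le (Γ.sMinus_lt_sPlus i).le] at hsi
    rw [hs, Set.indicator_of_mem (Γ.mem_cutParams (Set.Ioc_subset_Icc_self hsi))]
  have ht := Γ.t_ne_zero
  rw [S, h, intervalIntegral.integral_const_mul, mul_inv]
  field_simp

/-- The explicit factors `t` in the definition are cancelled by the normalisation `ρ₀ = y₊ lam' / (2
π I t)` on the cuts. The values of `ρ₀` at the branch points and of the logarithm on the diagonal do
not matter. -/
theorem prepotential_eq_integral : Γ.prepotential =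
    (2 * Real.pi * Complex.I)⁻¹ ^ 2 * (∫ s in Γ.cutParams, Γ.potential Γ.P s * Γ.dens Γ.P s)
      - (2 * Real.pi * Complex.I)⁻¹ * ∫ s in Γ.cutParams, W.eval (Γ.lam s) * Γ.dens Γ.P s := by
  set κ := (2 * Real.pi * Complex.I * Γ.t)⁻¹ with hκ
  have h1 : ∀ s, ∫ s', principalLog Γ.lam s s' * Γ.ρ₀ s * Γ.ρ₀ s' = Γ.ρ₀ s * (κ * Γ.potential Γ.P s) := by
    intro s
    rw [potential, ← MeasureTheory.integral_const_mul, ← MeasureTheory.integral_const_mul,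
      ← MeasureTheory.integral_indicator Γ.measurableSet_cutParams]
    refine MeasureTheory.integral_congr_ae ?_
    filter_upwards [Γ.ρ₀_ae_eq] with s' hs'
    rw [hs']
    by_cases h : s' ∈ Γ.cutParams
    · rw [Set.indicator_of_mem h, Set.indicator_of_mem h]; ring
    · rw [Set.indicator_of_notMem h, Set.indicator_of_notMem h, mul_zero]
  have h2 : ∀ G : ℝ → ℂ, ∫ s, G s * Γ.ρ₀ s = κ * ∫ s in Γ.cutParams, G s * Γ.dens Γ.P s := by
    intro G
    rw [← MeasureTheory.integral_const_mul, ← MeasureTheory.integral_indicator Γ.measurableSet_cutParams]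
    refine MeasureTheory.integral_congr_ae ?_
    filter_upwards [Γ.ρ₀_ae_eq] with s hs
    rw [hs]
    by_cases h : s ∈ Γ.cutParams
    · rw [Set.indicator_of_mem h, Set.indicator_of_mem h]; ring
    · rw [Set.indicator_of_notMem h, Set.indicator_of_notMem h, mul_zero]
  have h3 : ∫ s, ∫ s', principalLog Γ.lam s s' * Γ.ρ₀ s * Γ.ρ₀ s'
      = κ * (κ * ∫ s in Γ.cutParams, Γ.potential Γ.P s * Γ.dens Γ.P s) := by
    rw [← MeasureTheory.integral_const_mul κ]
    simp only [h1, ← mul_assoc κ (Γ.potential Γ.P _) (Γ.dens Γ.P _)]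
    rw [← h2 (fun s => κ * Γ.potential Γ.P s)]
    exact MeasureTheory.integral_congr_ae (Eventually.of_forall fun s => mul_comm _ _)
  have ht := Γ.t_ne_zero
  rw [prepotential, h3, h2, hκ, mul_inv]
  field_simp

theorem integrableOn_eval_mul_dens (h : ℂ[X]) :
    MeasureTheory.IntegrableOn (fun s => W.eval (Γ.lam s) * Γ.dens h s) Γ.cutParams :=
  Γ.integrableOn_mul_dens Γ.measurableSet_cutParams subset_rfl
    (W.continuous.comp Γ.continuous_lam).continuousOn h

/-- On the `i`-th cut the potential of `P` equals `π I * (W - V_i)` with `V_i` the constant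
effective potential there. The double integral thus becomes a sum of single ones. -/
theorem integral_potential_P_mul_dens (hmonic : W.derivative.Monic)
    (hdeg : W.derivative.natDegree = m + 1) (h : ℂ[X]) :
    ∫ s in Γ.cutParams, Γ.potential Γ.P s * Γ.dens h s = Real.pi * Complex.I *
      ∑ i, ((∫ s in Γ.sMinus i..Γ.sPlus i, W.eval (Γ.lam s) * Γ.dens h s)
        - Γ.effPot (Γ.sPlus i) * ∫ s in Γ.sMinus i..Γ.sPlus i, Γ.dens h s) := by
  have hpi : (Real.pi : ℂ) ≠ 0 := Complex.ofReal_ne_zero.2 Real.pi_ne_zero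
  have hI := Complex.I_ne_zero
  have hV : ∀ i, ∀ s ∈ Set.Icc (Γ.sMinus i) (Γ.sPlus i), Γ.potential Γ.P s * Γ.dens h s
      = Real.pi * Complex.I * (W.eval (Γ.lam s) * Γ.dens h s
        - Γ.effPot (Γ.sPlus i) * Γ.dens h s) := by
    intro i s hs
    rw [← Γ.effPot_eq hmonic hdeg hs, effPot]
    field_simp
    ring
  have hcut : ∀ i, Set.Ioc (Γ.sMinus i) (Γ.sPlus i) ⊆ Γ.cutParams := fun i s hs =>
    Γ.mem_cutParams (Set.Ioc_subset_Icc_self hs)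
  have hint : MeasureTheory.IntegrableOn (fun s => Γ.potential Γ.P s * Γ.dens h s) Γ.cutParams := by
    rw [cutParams, MeasureTheory.integrableOn_finite_iUnion]
    intro i
    refine MeasureTheory.IntegrableOn.congr_fun ?_ (fun s hs => (hV i s hs).symm) measurableSet_Icc
    have hsub : Set.Icc (Γ.sMinus i) (Γ.sPlus i) ⊆ Γ.cutParams := fun s hs => Γ.mem_cutParams hs
    exact (((Γ.integrableOn_eval_mul_dens h).mono_set hsub).sub
      (((Γ.integrableOn_dens_cutParams h).mono_set hsub).const_mul _)).const_mul _
  rw [Γ.integral_cutParams hint, Finset.mul_sum]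
  refine Finset.sum_congr rfl fun i _ => ?_
  have hle := (Γ.sMinus_lt_sPlus i).le
  rw [intervalIntegral.integral_congr (g := fun s => Real.pi * Complex.I * (W.eval (Γ.lam s) * Γ.dens h s
        - Γ.effPot (Γ.sPlus i) * Γ.dens h s)) fun s hs => hV i s (by rwa [Set.uIcc_of_le hle] at hs),
    intervalIntegral.integral_const_mul, intervalIntegral.integral_sub, intervalIntegral.integral_const_mul]
  · rw [intervalIntegrable_iff_integrableOn_Ioc_of_le hle]
    exact (Γ.integrableOn_eval_mul_dens h).mono_set (hcut i)
  · exact (Γ.intervalIntegrable_dens h _ _).const_mul _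

theorem integral_potential_mul_dens_P {h : ℂ[X]} (hh : h.natDegree ≤ m) :
    ∫ s in Γ.cutParams, Γ.potential h s * Γ.dens Γ.P s
      = ∑ i, Γ.potential h (Γ.sPlus i) * ∫ s in Γ.sMinus i..Γ.sPlus i, Γ.dens Γ.P s := by
  have hV : ∀ i, ∀ s ∈ Set.Icc (Γ.sMinus i) (Γ.sPlus i), Γ.potential h s * Γ.dens Γ.P s
      = Γ.potential h (Γ.sPlus i) * Γ.dens Γ.P s := fun i s hs => by rw [Γ.potential_eq hh hs]
  have hint : MeasureTheory.IntegrableOn (fun s => Γ.potential h s * Γ.dens Γ.P s) Γ.cutParams := by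
    rw [cutParams, MeasureTheory.integrableOn_finite_iUnion]
    intro i
    refine MeasureTheory.IntegrableOn.congr_fun ?_ (fun s hs => (hV i s hs).symm) measurableSet_Icc
    exact ((Γ.integrableOn_dens_cutParams Γ.P).mono_set fun s hs => Γ.mem_cutParams hs).const_mul _
  rw [Γ.integral_cutParams hint]
  refine Finset.sum_congr rfl fun i _ => ?_
  rw [← intervalIntegral.integral_const_mul]
  refine intervalIntegral.integral_congr fun s hs => hV i s ?_
  rwa [Set.uIcc_of_le (Γ.sMinus_lt_sPlus i).le] at hs

/-- The double integral contributes `1 / (4 π I)` times the sums of `W` minus `V_i`, and the `W`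
term is subtracted with twice that weight. The result contains only single integrals over the cuts
and the constants `V_i`, all of which can be differentiated in the family. -/
theorem prepotential_eq (hmonic : W.derivative.Monic) (hdeg : W.derivative.natDegree = m + 1) :
    Γ.prepotential = -(1 / (4 * Real.pi * Complex.I)) *
      ∑ i, ((∫ s in Γ.sMinus i..Γ.sPlus i, W.eval (Γ.lam s) * Γ.dens Γ.P s)
        + Γ.effPot (Γ.sPlus i) * ∫ s in Γ.sMinus i..Γ.sPlus i, Γ.dens Γ.P s) := by
  have hpi : (Real.pi : ℂ) ≠ 0 := Complex.ofReal_ne_zero.2 Real.pi_ne_zero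
  have hI := Complex.I_ne_zero
  rw [prepotential_eq_integral, Γ.integral_potential_P_mul_dens hmonic hdeg,
    Γ.integral_cutParams (Γ.integrableOn_eval_mul_dens Γ.P), Finset.sum_sub_distrib,
    Finset.sum_add_distrib]
  field_simp
  ring

end CutCurve
end

/-! ### One-parameter families: first-order bounds for paths and branch points. -/

noncomputable section

namespace CutCurve
variable {m : ℕ} {W : ℂ[X]}

/-- On its real end the path is injective and its real part tends to `+∞`. A step back would have to
be made up later, which would repeat a value. -/
theorem strictMonoOn_re_lam (Γ : CutCurve m W) {T : ℝ} (hT : ∀ s ≥ T, (Γ.lam s).im = 0) :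
    StrictMonoOn (fun s => (Γ.lam s).re) (Set.Ici T) := by
  intro a ha b hb hab
  by_contra! hle
  have hc : Continuous fun s => (Γ.lam s).re := Complex.continuous_re.comp Γ.continuous_lam
  obtain ⟨R, hR⟩ := ((Γ.tendsto_atTop.eventually_ge_atTop (Γ.lam a).re).and
    (eventually_ge_atTop b)).exists
  obtain ⟨v, hv, h⟩ := intermediate_value_Icc hR.2 hc.continuousOn ⟨hle, hR.1⟩
  have hva : Γ.lam v = Γ.lam a := Complex.ext h (by rw [hT v (hb.trans hv.1), hT a ha])
  linarith [Γ.injective_lam hva, hv.1]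

/-- A one-parameter family of curves with cuts near the parameter value `t₀`, at which
`t = τ` varies and the `S̃ᵢ` are fixed. -/
structure IsFamilyAt (Γ : ℂ → CutCurve m W) (t₀ : ℂ) : Prop where
  t_eq : ∀ᶠ τ in 𝓝 t₀, (Γ τ).t = τ
  tildeS_eq : ∀ᶠ τ in 𝓝 t₀, ∀ i, (Γ τ).tildeS i = (Γ t₀).tildeS i
  differentiableAt_coeff : ∀ k, DifferentiableAt ℂ (fun τ => (Γ τ).f.coeff k) t₀
  contDiffAt_lam : ∀ s, ContDiffAt ℝ 1 (fun q : ℂ × ℝ => (Γ q.1).lam q.2) (t₀, s)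
  continuousAt_sMinus : ∀ i, ContinuousAt (fun τ => (Γ τ).sMinus i) t₀
  continuousAt_sPlus : ∀ i, ContinuousAt (fun τ => (Γ τ).sPlus i) t₀
  eventually_real : ∃ T : ℝ, ∀ᶠ τ in 𝓝 t₀, ∀ s ≥ T, ((Γ τ).lam s).im = 0

/-- The derivative of the polynomial `f₀` along the family. -/
def fdot (Γ : ℂ → CutCurve m W) (t₀ : ℂ) : ℂ[X] :=
  ∑ k ∈ Finset.range (m + 1), C (deriv (fun τ => (Γ τ).f.coeff k) t₀) * X ^ k

theorem natDegree_fdot_le (Γ : ℂ → CutCurve m W) (t₀ : ℂ) : (fdot Γ t₀).natDegree ≤ m :=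
  natDegree_sum_le_of_forall_le _ _ fun _ hk =>
    (natDegree_C_mul_X_pow_le _ _).trans (Nat.lt_succ_iff.1 (Finset.mem_range.1 hk))

theorem coeff_fdot (Γ : ℂ → CutCurve m W) (t₀ : ℂ) (k : ℕ) :
    (fdot Γ t₀).coeff k = deriv (fun τ => (Γ τ).f.coeff k) t₀ := by
  simp only [fdot, finsetSum_coeff, coeff_C_mul, coeff_X_pow, mul_ite, mul_one, mul_zero,
    Finset.sum_ite_eq, Finset.mem_range]
  split_ifs with hk
  · rfl
  · have : (fun τ => (Γ τ).f.coeff k) = fun _ => 0 := by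
      ext τ
      exact coeff_eq_zero_of_natDegree_lt (lt_of_le_of_lt (Γ τ).natDegree_f (by omega))
    rw [this, deriv_const]

namespace IsFamilyAt

variable {Γ : ℂ → CutCurve m W} {t₀ : ℂ} (h : IsFamilyAt Γ t₀)
include h

theorem coeff_fdot_eq : (fdot Γ t₀).coeff m = -4 := by
  rw [coeff_fdot]
  have e : (fun τ => (Γ τ).f.coeff m) =ᶠ[𝓝 t₀] fun τ => -4 * τ := by
    filter_upwards [h.t_eq] with τ hτ
    rw [t] at hτ
    linear_combination -4 * hτ
  rw [e.deriv_eq, deriv_const_mul_field, deriv_id'']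
  simp

theorem hasDerivAt_coeff_P (k : ℕ) :
    HasDerivAt (fun τ => (Γ τ).P.coeff k) ((fdot Γ t₀).coeff k) t₀ := by
  simp only [P, coeff_add, coeff_fdot]
  exact (h.differentiableAt_coeff k).hasDerivAt.const_add _

omit h in
theorem natDegree_P_le (τ : ℂ) : (Γ τ).P.natDegree ≤ max (W.derivative ^ 2).natDegree m :=
  (natDegree_add_le _ _).trans (max_le_max le_rfl (Γ τ).natDegree_f)

theorem exists_norm_eval_P_sub_le (R : ℝ) : ∃ A, 0 ≤ A ∧ ∀ᶠ τ in 𝓝 t₀, ∀ z ∈ Metric.ball (0 : ℂ) R,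
    ‖(Γ τ).P.eval z - (Γ t₀).P.eval z‖ ≤ A * ‖τ - t₀‖ :=
  exists_eval_sub_le (Eventually.of_forall natDegree_P_le) h.hasDerivAt_coeff_P R

theorem continuousAt_lam (s : ℝ) : ContinuousAt (fun q : ℂ × ℝ => (Γ q.1).lam q.2) (t₀, s) :=
  (h.contDiffAt_lam s).continuousAt

theorem continuousAt_deriv_lam (s : ℝ) :
    ContinuousAt (fun q : ℂ × ℝ => deriv (Γ q.1).lam q.2) (t₀, s) := by
  set F := fun q : ℂ × ℝ => (Γ q.1).lam q.2 with hF
  have h1 : ContinuousAt (fun q => fderiv ℝ F q (0, 1)) (t₀, s) :=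
    ((h.contDiffAt_lam s).continuousAt_fderiv one_ne_zero).clm_apply continuousAt_const
  refine h1.congr ?_
  filter_upwards [(h.contDiffAt_lam s).eventually (by simp)] with q hq
  have h2 : HasFDerivAt F (fderiv ℝ F q) (q.1, q.2) := (hq.differentiableAt one_ne_zero).hasFDerivAt
  have h3 : HasDerivAt (fun u : ℝ => (q.1, u)) (0, 1) q.2 :=
    (hasDerivAt_const q.2 q.1).prodMk (hasDerivAt_id q.2)
  exact (h2.comp_hasDerivAt q.2 h3).deriv.symm

/-- Joint `C¹` dependence gives Lipschitz bounds near each parameter, and compactness of the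
interval makes them uniform. -/
theorem exists_norm_lam_sub_le (A B : ℝ) : ∃ C, 0 ≤ C ∧ ∀ᶠ τ in 𝓝 t₀, ∀ s ∈ Set.Icc A B,
    ‖(Γ τ).lam s - (Γ t₀).lam s‖ ≤ C * ‖τ - t₀‖ := by
  refine isCompact_Icc.induction_on (p := fun S => ∃ C, 0 ≤ C ∧ ∀ᶠ τ in 𝓝 t₀, ∀ s ∈ S,
    ‖(Γ τ).lam s - (Γ t₀).lam s‖ ≤ C * ‖τ - t₀‖) ⟨0, le_rfl, by simp⟩ ?_ ?_ ?_
  · rintro S T hST ⟨C, hC, hT⟩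
    exact ⟨C, hC, hT.mono fun τ hτ s hs => hτ s (hST hs)⟩
  · rintro S T ⟨C, hC, hS⟩ ⟨D, hD, hT⟩
    refine ⟨max C D, hC.trans (le_max_left _ _), ?_⟩
    filter_upwards [hS, hT] with τ h1 h2 s hs
    rcases hs with hs | hs
    · exact (h1 s hs).trans (mul_le_mul_of_nonneg_right (le_max_left _ _) (norm_nonneg _))
    · exact (h2 s hs).trans (mul_le_mul_of_nonneg_right (le_max_right _ _) (norm_nonneg _))
  · intro s _
    obtain ⟨K, T, hT, hK⟩ := (h.contDiffAt_lam s).exists_lipschitzOnWith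
    rw [nhds_prod_eq] at hT
    obtain ⟨V, hV, S, hS, hsub⟩ := Filter.mem_prod_iff.1 hT
    refine ⟨S, mem_nhdsWithin_of_mem_nhds hS, K, K.2, ?_⟩
    filter_upwards [hV] with τ hτ u hu
    have := hK.norm_sub_le (hsub (Set.mk_mem_prod hτ hu)) (hsub (Set.mk_mem_prod (mem_of_mem_nhds hV) hu))
    simpa [Prod.norm_def] using this

theorem eventually_norm_lam_sub_le (A B : ℝ) {η : ℝ} (hη : 0 < η) :
    ∀ᶠ τ in 𝓝 t₀, ∀ s ∈ Set.Icc A B, ‖(Γ τ).lam s - (Γ t₀).lam s‖ ≤ η := by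
  obtain ⟨C, hC, hle⟩ := h.exists_norm_lam_sub_le A B
  have hsmall : ∀ᶠ τ in 𝓝 t₀, C * ‖τ - t₀‖ < η := by
    have : ContinuousAt (fun τ : ℂ => C * ‖τ - t₀‖) t₀ := by fun_prop
    exact this.eventually_lt continuousAt_const (by simpa using hη)
  filter_upwards [hle, hsmall] with τ h1 h2 s hs using (h1 s hs).trans h2.le

theorem continuousAt_bp (k : Fin (m + 1) × Bool) : ContinuousAt (fun τ => (Γ τ).bp k) t₀ := by
  obtain ⟨i, b⟩ := k
  cases b
  · exact h.continuousAt_sMinus i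
  · exact h.continuousAt_sPlus i

theorem eventually_cutParams_subset {A B : ℝ} (hAB : (Γ t₀).cutParams ⊆ Set.Ioo A B) :
    ∀ᶠ τ in 𝓝 t₀, (Γ τ).cutParams ⊆ Set.Ioo A B := by
  have h1 : ∀ᶠ τ in 𝓝 t₀, ∀ i, A < (Γ τ).sMinus i ∧ (Γ τ).sPlus i < B :=
    eventually_all.2 fun i =>
      (continuousAt_const.eventually_lt (h.continuousAt_sMinus i)
        (hAB ((Γ t₀).bp_mem_cutParams (i, false))).1).and
      ((h.continuousAt_sPlus i).eventually_lt continuousAt_const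
        (hAB ((Γ t₀).bp_mem_cutParams (i, true))).2)
  filter_upwards [h1] with τ hτ s hs
  obtain ⟨i, hi⟩ := Set.mem_iUnion.1 hs
  exact ⟨(hτ i).1.trans_le hi.1, hi.2.trans_lt (hτ i).2⟩

/-- A point of the path that stays at a distance `O(τ - t₀)` of its original place moves along the
path by `O(τ - t₀)`. -/
theorem exists_abs_sub_le {e : ℂ → ℝ} {C A B : ℝ}
    (he : ∀ᶠ τ in 𝓝 t₀, e τ ∈ Set.Icc A B)
    (hC : ∀ᶠ τ in 𝓝 t₀, ‖(Γ τ).lam (e τ) - (Γ t₀).lam (e t₀)‖ ≤ C * ‖τ - t₀‖) :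
    ∃ C, ∀ᶠ τ in 𝓝 t₀, |e τ - e t₀| ≤ C * ‖τ - t₀‖ := by
  obtain ⟨c, hc, hbi⟩ := exists_mul_abs_sub_le_norm_sub (Γ t₀).contDiff_lam (Γ t₀).deriv_lam_ne_zero
    (Γ t₀).injective_lam A B
  obtain ⟨D, hD, hle⟩ := h.exists_norm_lam_sub_le A B
  refine ⟨(C + D) / c, ?_⟩
  filter_upwards [he, hC, hle] with τ h1 h2 h3
  have h4 := hbi _ h1 _ he.self_of_nhds
  have h5 := h3 _ h1
  have h6 : ‖(Γ t₀).lam (e τ) - (Γ t₀).lam (e t₀)‖ ≤ (C + D) * ‖τ - t₀‖ := by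
    have : (Γ t₀).lam (e τ) - (Γ t₀).lam (e t₀) = ((Γ τ).lam (e τ) - (Γ t₀).lam (e t₀))
      - ((Γ τ).lam (e τ) - (Γ t₀).lam (e τ)) := by ring
    rw [this, add_mul]
    exact (norm_sub_le _ _).trans (add_le_add h2 h5)
  rw [div_mul_eq_mul_div, le_div_iff₀ hc]
  linarith

/-- Branch points are simple roots. At the moved branch point the old polynomial takes a value of
size `O(τ - t₀)`, and its cofactor `Q k` is bounded away from `0` there, so the root has moved by
`O(τ - t₀)`. This upgrades continuity of the parameters to a Lipschitz bound at `t₀`. -/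
theorem exists_abs_bp_sub_le (k : Fin (m + 1) × Bool) :
    ∃ C, ∀ᶠ τ in 𝓝 t₀, |(Γ τ).bp k - (Γ t₀).bp k| ≤ C * ‖τ - t₀‖ := by
  have hb := h.continuousAt_bp k
  set b := (Γ t₀).bp k with hbdef
  have hmem : ∀ᶠ τ in 𝓝 t₀, (Γ τ).bp k ∈ Set.Icc (b - 1) (b + 1) :=
    hb.eventually_mem (Icc_mem_nhds (by linarith) (by linarith))
  have hcont : Tendsto (fun τ => (Γ τ).lam ((Γ τ).bp k)) (𝓝 t₀) (𝓝 ((Γ t₀).lam b)) :=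
    (h.continuousAt_lam b).tendsto.comp (tendsto_id.prodMk_nhds hb)
  obtain ⟨A, hA, hle⟩ := h.exists_norm_eval_P_sub_le (‖(Γ t₀).lam b‖ + 1)
  have hQc : ContinuousAt ((Γ t₀).Q k) ((Γ t₀).lam b) := ((Γ t₀).differentiable_Q k).continuous.continuousAt
  have hQ0 := (Γ t₀).Q_ne_zero k
  have hQ : ∀ᶠ τ in 𝓝 t₀, ‖(Γ t₀).Q k ((Γ t₀).lam b)‖ / 2 < ‖(Γ t₀).Q k ((Γ τ).lam ((Γ τ).bp k))‖ :=
    ((hQc.tendsto.comp hcont).norm).eventually_const_lt (half_lt_self (norm_pos_iff.2 hQ0))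
  have hball : ∀ᶠ τ in 𝓝 t₀, (Γ τ).lam ((Γ τ).bp k) ∈ Metric.ball (0 : ℂ) (‖(Γ t₀).lam b‖ + 1) :=
    hcont.eventually_mem (Metric.isOpen_ball.mem_nhds (by simp))
  set c := ‖(Γ t₀).Q k ((Γ t₀).lam b)‖ with hc
  have hcpos : 0 < c := norm_pos_iff.2 hQ0
  refine h.exists_abs_sub_le (e := fun τ => (Γ τ).bp k) (C := A / (c / 2)) hmem ?_
  filter_upwards [hle, hQ, hball] with τ h1 h2 h3
  have h4 := h1 _ h3
  rw [eval_P_bp, zero_sub, norm_neg, (Γ t₀).eval_P_eq_mul k, norm_mul] at h4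
  rw [div_mul_eq_mul_div, le_div_iff₀ (half_pos hcpos)]
  exact (mul_le_mul_of_nonneg_left h2.le (norm_nonneg _)).trans h4

/-- The parameter of a fixed far point of the real end of the path. -/
theorem exists_far_param : ∃ e : ℂ → ℝ, (∃ C, ∀ᶠ τ in 𝓝 t₀, |e τ - e t₀| ≤ C * ‖τ - t₀‖) ∧
    (∀ᶠ τ in 𝓝 t₀, (Γ τ).lam (e τ) = (Γ t₀).lam (e t₀)) ∧ (∀ᶠ τ in 𝓝 t₀, (Γ τ).IsFar (e τ)) ∧
    ∃ Λ R : ℝ, R < Λ ∧ (Γ t₀).lam (e t₀) = (Λ : ℂ) ∧ (∀ᶠ τ in 𝓝 t₀, ∀ s ∈ (Γ τ).cutParams,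
      ‖(Γ τ).lam s‖ < R) := by
  obtain ⟨T, hT⟩ := h.eventually_real
  obtain ⟨A, B, -, hAB⟩ := (Γ t₀).exists_cutParams_subset_Icc
  have hsub := h.eventually_cutParams_subset hAB
  obtain ⟨M, hM⟩ := (isCompact_Icc (a := A) (b := B)).exists_bound_of_continuousOn
    (Γ t₀).continuous_lam.continuousOn
  have hKle : ∀ᶠ τ in 𝓝 t₀, ∀ s ∈ (Γ τ).cutParams, ‖(Γ τ).lam s‖ < M + 2 := by
    filter_upwards [hsub, h.eventually_norm_lam_sub_le A B one_pos] with τ h1 h2 s hs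
    have hs' := Set.Ioo_subset_Icc_self (h1 hs)
    have := norm_sub_norm_le ((Γ τ).lam s) ((Γ t₀).lam s)
    linarith [h2 s hs', hM s hs']
  obtain ⟨Λ₁, hΛ₁, hex⟩ := (Γ t₀).exists_isFar_of_le (max T B + 1)
  obtain ⟨s, hsb, hfar, hsΛ⟩ := hex (max Λ₁ (M + 3)) (le_max_left _ _)
  set Λ := max Λ₁ (M + 3) with hΛ
  have hsT : T < s - 1 := by linarith [le_max_left T B]
  have hsB : B < s - 1 := by linarith [le_max_right T B]
  have hmono := (Γ t₀).strictMonoOn_re_lam hT.self_of_nhds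
  have hre : ((Γ t₀).lam s).re = Λ := by rw [hsΛ, Complex.ofReal_re]
  have hcont : ∀ u, ContinuousAt (fun τ => ((Γ τ).lam u).re) t₀ := fun u =>
    Complex.continuous_re.continuousAt.comp
      ((h.continuousAt_lam u).comp_of_eq (f := fun τ : ℂ => (τ, u)) (by fun_prop) rfl)
  have hlow : ∀ᶠ τ in 𝓝 t₀, ((Γ τ).lam (s - 1)).re < Λ :=
    (hcont (s - 1)).eventually_lt continuousAt_const (by
      rw [← hre]; exact hmono hsT.le (show T ≤ s by linarith) (by linarith))
  have hup : ∀ᶠ τ in 𝓝 t₀, Λ < ((Γ τ).lam (s + 1)).re :=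
    continuousAt_const.eventually_lt (hcont (s + 1)) (by
      rw [← hre]; exact hmono (show T ≤ s by linarith) (show T ≤ s + 1 by linarith) (by linarith))
  have hsol : ∀ᶠ τ in 𝓝 t₀, ∃ u ∈ Set.Icc (s - 1) (s + 1), (Γ τ).lam u = (Λ : ℂ) := by
    filter_upwards [hlow, hup, hT] with τ h1 h2 h3
    obtain ⟨u, hu, hv⟩ := intermediate_value_Icc (show s - 1 ≤ s + 1 by linarith)
      (Complex.continuous_re.comp (Γ τ).continuous_lam).continuousOn ⟨h1.le, h2.le⟩
    exact ⟨u, hu, Complex.ext (by simpa using hv) (by simpa using h3 u (hsT.le.trans hu.1))⟩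
  classical
  -- Any parameter in the interval whose image is `Λ` serves, with `s` as a default value when there
  -- is none. Regularity of `e` comes not from the choice but from its image being fixed, through
  -- `exists_abs_sub_le` with `C = 0`.
  set e : ℂ → ℝ := fun τ => if hτ : ∃ u ∈ Set.Icc (s - 1) (s + 1), (Γ τ).lam u = (Λ : ℂ) then hτ.choose
    else s with he
  have hespec : ∀ᶠ τ in 𝓝 t₀, e τ ∈ Set.Icc (s - 1) (s + 1) ∧ (Γ τ).lam (e τ) = (Λ : ℂ) := by
    filter_upwards [hsol] with τ hτ
    have : e τ = hτ.choose := by rw [he]; exact dif_pos hτ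
    rw [this]
    exact hτ.choose_spec
  have he0 := hespec.self_of_nhds.2
  refine ⟨e, h.exists_abs_sub_le (C := 0) (hespec.mono fun τ hτ => hτ.1) ?_, ?_, ?_, Λ, M + 2, ?_, he0, hKle⟩
  · filter_upwards [hespec] with τ hτ
    rw [hτ.2, he0, sub_self, norm_zero, zero_mul]
  · filter_upwards [hespec] with τ hτ
    rw [hτ.2, he0]
  · filter_upwards [hespec, hT, hsub, hKle] with τ h1 h2 h3 h4 s' hs'
    refine ⟨(h3 hs').2.trans (hsB.trans_le h1.1.1), fun u hu => ?_⟩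
    have h5 : ((Γ τ).lam (e τ)).re ≤ ((Γ τ).lam u).re :=
      ((Γ τ).strictMonoOn_re_lam h2).monotoneOn (hsT.le.trans h1.1.1) (hsT.le.trans (h1.1.1.trans hu)) hu
    rw [h1.2, Complex.ofReal_re] at h5
    have h6 := Complex.re_le_norm ((Γ τ).lam s')
    linarith [h4 s' hs', le_max_right Λ₁ (M + 3)]
  · linarith [le_max_right Λ₁ (M + 3)]

end IsFamilyAt
end CutCurve
end

/-! ### Continuity of `y₀` and of its boundary values in a family. -/

noncomputable section

/-- A tube lemma: joint continuity is required only on the slice over `q₀`, because the families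
here are controlled only at `t₀`. -/
theorem eventually_forall_norm_sub_le {X : Type*} [TopologicalSpace X] {G : X → ℝ → ℂ} {q₀ : X}
    {S : Set ℝ} (hS : IsCompact S) (hc : ∀ r ∈ S, ContinuousAt (fun z : X × ℝ => G z.1 z.2) (q₀, r))
    {η : ℝ} (hη : 0 < η) : ∀ᶠ q in 𝓝 q₀, ∀ r ∈ S, ‖G q r - G q₀ r‖ ≤ η := by
  refine hS.eventually_forall_of_forall_eventually fun r hr => ?_
  have h1 : ContinuousAt (fun z : X × ℝ => G q₀ z.2) (q₀, r) :=
    (hc r hr).comp_of_eq (f := fun z : X × ℝ => (q₀, z.2)) (by fun_prop) rfl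
  have h2 := ((hc r hr).sub h1).norm
  have h3 : ∀ᶠ z in 𝓝 (q₀, r), ‖G z.1 z.2 - G q₀ z.2‖ < η :=
    h2.eventually_lt continuousAt_const (by simpa using hη)
  exact h3.mono fun z hz => hz.le

theorem continuousAt_integral_of_forall_continuousAt {X : Type*} [TopologicalSpace X] {G : X → ℝ → ℂ}
    {q₀ : X} (hc : ∀ r ∈ Set.Icc (0 : ℝ) 1, ContinuousAt (fun z : X × ℝ => G z.1 z.2) (q₀, r))
    (hi : ∀ᶠ q in 𝓝 q₀, IntervalIntegrable (G q) MeasureTheory.volume 0 1) :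
    ContinuousAt (fun q => ∫ r in (0 : ℝ)..1, G q r) q₀ := by
  rw [ContinuousAt, Metric.tendsto_nhds]
  intro ε hε
  filter_upwards [hi, eventually_forall_norm_sub_le isCompact_Icc hc (half_pos hε)] with q h1 h2
  rw [dist_eq_norm, ← intervalIntegral.integral_sub h1 hi.self_of_nhds]
  refine (intervalIntegral.norm_integral_le_of_norm_le_const (C := ε / 2) fun r hr => ?_).trans_lt
    (by simpa using half_lt_self hε)
  rw [Set.uIoc_of_le zero_le_one] at hr
  exact h2 r (Set.Ioc_subset_Icc_self hr)

/-- A continuous function whose square is near `1` stays near the same square root of `1`. -/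
theorem norm_sub_one_le_of_norm_sq_sub_one_le {S : Set ℝ} (hS : IsPreconnected S) {q : ℝ → ℂ} {η : ℝ}
    (hη : η < 1) (hq : ContinuousOn q S) (hsq : ∀ r ∈ S, ‖q r ^ 2 - 1‖ ≤ η) {r₀ : ℝ} (hr₀ : r₀ ∈ S)
    (hpos : 0 < (q r₀).re) {r : ℝ} (hr : r ∈ S) : ‖q r - 1‖ ≤ η := by
  -- If `q r` were purely imaginary, its square would be a nonpositive real, at distance at least
  -- `1` from `1`.
  have hne : ∀ r ∈ S, (q r).re ≠ 0 := by
    intro r hr h0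
    have h1 := (Complex.abs_re_le_norm _).trans (hsq r hr)
    rw [sq, Complex.sub_re, Complex.mul_re, h0, Complex.one_re, abs_le] at h1
    nlinarith [mul_self_nonneg (q r).im]
  have hre : 0 < (q r).re := by
    by_contra! hle
    obtain ⟨u, hu, h0⟩ := hS.intermediate_value hr hr₀ (Complex.continuous_re.comp_continuousOn hq)
      (show (0 : ℝ) ∈ Set.Icc (q r).re (q r₀).re from ⟨hle, hpos.le⟩)
    exact hne u hu h0
  have h1 : 1 ≤ ‖q r + 1‖ := by
    refine le_trans ?_ (Complex.re_le_norm _)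
    rw [Complex.add_re, Complex.one_re]
    linarith
  calc ‖q r - 1‖ ≤ ‖q r - 1‖ * ‖q r + 1‖ := le_mul_of_one_le_right (norm_nonneg _) h1
    _ = ‖q r ^ 2 - 1‖ := by rw [← norm_mul]; congr 1; ring
    _ ≤ η := hsq r hr

namespace CutCurve
variable {m : ℕ} {W : ℂ[X]}

namespace IsFamilyAt

variable {Γ : ℂ → CutCurve m W} {t₀ : ℂ} (h : IsFamilyAt Γ t₀)
include h

theorem continuousAt_lam_comp {X : Type*} [TopologicalSpace X] {q₀ : X} {σ : X → ℂ} {φ : X → ℝ}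
    (hσ : ContinuousAt σ q₀) (hσ0 : σ q₀ = t₀) (hφ : ContinuousAt φ q₀) :
    ContinuousAt (fun q => (Γ (σ q)).lam (φ q)) q₀ :=
  (h.continuousAt_lam (φ q₀)).comp_of_eq (hσ.prodMk hφ) (by simp [hσ0])

theorem continuousAt_deriv_lam_comp {X : Type*} [TopologicalSpace X] {q₀ : X} {σ : X → ℂ} {φ : X → ℝ}
    (hσ : ContinuousAt σ q₀) (hσ0 : σ q₀ = t₀) (hφ : ContinuousAt φ q₀) :
    ContinuousAt (fun q => deriv (Γ (σ q)).lam (φ q)) q₀ :=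
  (h.continuousAt_deriv_lam (φ q₀)).comp_of_eq (hσ.prodMk hφ) (by simp [hσ0])

theorem continuousAt_bp_comp {X : Type*} [TopologicalSpace X] {q₀ : X} {σ : X → ℂ}
    (hσ : ContinuousAt σ q₀) (hσ0 : σ q₀ = t₀) (k : Fin (m + 1) × Bool) :
    ContinuousAt (fun q => (Γ (σ q)).bp k) q₀ :=
  (h.continuousAt_bp k).comp_of_eq hσ hσ0

/-- Affine parametrisation of each cut by `[0, 1]` gives the integrals in the explicit formula a
fixed domain, and their integrands are jointly continuous while `x` stays off the moving cuts. -/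
theorem continuousAt_y₀ {x₀ : ℂ} (hx₀ : x₀ ∉ (Γ t₀).cuts) :
    ContinuousAt (fun q : ℂ × ℂ => (Γ q.1).y₀ q.2) (t₀, x₀) := by
  set φ : Fin (m + 1) → ℂ → ℝ → ℝ := fun i τ r =>
    (Γ τ).sMinus i + ((Γ τ).sPlus i - (Γ τ).sMinus i) * r with hφ
  have hφmem : ∀ i τ, ∀ r ∈ Set.Icc (0 : ℝ) 1, φ i τ r ∈ Set.Icc ((Γ τ).sMinus i) ((Γ τ).sPlus i) := by
    intro i τ r hr
    have := (Γ τ).sMinus_lt_sPlus i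
    constructor
    · simp only [hφ]; nlinarith [hr.1]
    · simp only [hφ]; nlinarith [hr.2]
  have hφc : ∀ i (r : ℝ), ContinuousAt (fun z : (ℂ × ℂ) × ℝ => φ i z.1.1 z.2) ((t₀, x₀), r) := by
    intro i r
    have hσ : ContinuousAt (fun z : (ℂ × ℂ) × ℝ => z.1.1) ((t₀, x₀), r) := by fun_prop
    have h1 := h.continuousAt_bp_comp hσ rfl (i, false)
    have h2 := h.continuousAt_bp_comp hσ rfl (i, true)
    exact h1.add ((h2.sub h1).mul continuousAt_snd)
  have hlamc : ∀ i (r : ℝ), ContinuousAt (fun z : (ℂ × ℂ) × ℝ => (Γ z.1.1).lam (φ i z.1.1 z.2) - z.1.2)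
      ((t₀, x₀), r) := fun i r =>
    (h.continuousAt_lam_comp (by fun_prop) rfl (hφc i r)).sub (by fun_prop)
  have hne0 : ∀ i, ∀ r ∈ Set.Icc (0 : ℝ) 1, (Γ t₀).lam (φ i t₀ r) - x₀ ≠ 0 := fun i r hr =>
    (Γ t₀).lam_sub_ne_zero hx₀ i (hφmem i t₀ r hr)
  have hne : ∀ᶠ q in 𝓝 (t₀, x₀), ∀ i, ∀ r ∈ Set.Icc (0 : ℝ) 1, (Γ q.1).lam (φ i q.1 r) - q.2 ≠ 0 :=
    eventually_all.2 fun i => (isCompact_Icc (a := (0 : ℝ)) (b := 1)).eventually_forall_of_forall_eventually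
      (P := fun (q : ℂ × ℂ) r => (Γ q.1).lam (φ i q.1 r) - q.2 ≠ 0)
      fun r hr => (hlamc i r).eventually_ne (hne0 i r hr)
  have hoff : ∀ᶠ q in 𝓝 (t₀, x₀), q.2 ∉ (Γ q.1).cuts := by
    filter_upwards [hne] with q hq hmem
    obtain ⟨i, s, hs, hsx⟩ := Set.mem_iUnion.1 hmem
    have hlt := sub_pos.2 ((Γ q.1).sMinus_lt_sPlus i)
    refine hq i ((s - (Γ q.1).sMinus i) / ((Γ q.1).sPlus i - (Γ q.1).sMinus i))
      ⟨div_nonneg (by linarith [hs.1]) hlt.le, (div_le_one hlt).2 (by linarith [hs.2])⟩ ?_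
    have : φ i q.1 ((s - (Γ q.1).sMinus i) / ((Γ q.1).sPlus i - (Γ q.1).sMinus i)) = s := by
      simp only [hφ]
      rw [mul_div_cancel₀ _ hlt.ne']
      ring
    rw [this, hsx, sub_self]
  have hint : ∀ i, ContinuousAt (fun q : ℂ × ℂ => ∫ s in (Γ q.1).sMinus i..(Γ q.1).sPlus i,
      deriv (Γ q.1).lam s / ((Γ q.1).lam s - q.2)) (t₀, x₀) := by
    intro i
    have hσ : ContinuousAt (fun z : ℂ × ℂ => z.1) (t₀, x₀) := by fun_prop
    have h1 := h.continuousAt_bp_comp hσ rfl (i, false)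
    have h2 := h.continuousAt_bp_comp hσ rfl (i, true)
    have h3 : ContinuousAt (fun q : ℂ × ℂ => ∫ r in (0 : ℝ)..1,
        deriv (Γ q.1).lam (φ i q.1 r) / ((Γ q.1).lam (φ i q.1 r) - q.2)) (t₀, x₀) := by
      refine continuousAt_integral_of_forall_continuousAt (fun r hr => ?_) ?_
      · exact (h.continuousAt_deriv_lam_comp (by fun_prop) rfl (hφc i r)).div (hlamc i r) (hne0 i r hr)
      · filter_upwards [hoff] with q hq
        refine ContinuousOn.intervalIntegrable ?_
        rw [Set.uIcc_of_le zero_le_one]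
        exact ((Γ q.1).continuousOn_integrand hq i).comp (by fun_prop) (hφmem i q.1)
    refine ((h2.sub h1).smul h3).congr (Eventually.of_forall fun q => ?_)
    have := intervalIntegral.smul_integral_comp_add_mul (a := 0) (b := 1)
      (fun s => deriv (Γ q.1).lam s / ((Γ q.1).lam s - q.2)) ((Γ q.1).sPlus i - (Γ q.1).sMinus i)
      ((Γ q.1).sMinus i)
    rw [mul_zero, add_zero, mul_one, add_sub_cancel] at this
    exact this
  have hprod : ContinuousAt (fun q : ℂ × ℂ => ∏ i, (q.2 - (Γ q.1).lam ((Γ q.1).sMinus i)) *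
      Complex.exp ((∫ s in (Γ q.1).sMinus i..(Γ q.1).sPlus i,
        deriv (Γ q.1).lam s / ((Γ q.1).lam s - q.2)) / 2)) (t₀, x₀) := by
    refine tendsto_finsetProd _ fun i _ => ?_
    have hσ : ContinuousAt (fun z : ℂ × ℂ => z.1) (t₀, x₀) := by fun_prop
    exact (continuousAt_snd.sub (h.continuousAt_lam_comp hσ rfl
      (h.continuousAt_bp_comp hσ rfl (i, false)))).mul ((hint i).div_const 2).cexp
  refine hprod.congr ?_
  filter_upwards [hoff] with q hq
  rw [y₀, Set.indicator_of_mem (show q.2 ∈ (Γ q.1).cutsᶜ from hq)]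

/-- The segments that leave the path on its left side avoid the cuts, uniformly. -/
theorem exists_eventually_offset_notMem_cuts {σ : ℂ → ℝ} (hσ : ContinuousAt σ t₀) :
    ∃ ε₀ : ℝ, 0 < ε₀ ∧ ∀ᶠ τ in 𝓝 t₀, ∀ ε ∈ Set.Ioc (0 : ℝ) ε₀,
      (Γ τ).lam (σ τ) + Complex.I * ε * deriv (Γ τ).lam (σ τ) ∉ (Γ τ).cuts := by
  set s := σ t₀ with hs
  set v := deriv (Γ t₀).lam s with hv
  have hvp : 0 < ‖v‖ := norm_pos_iff.2 ((Γ t₀).deriv_lam_ne_zero s)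
  obtain ⟨δ, hδ, hder⟩ : ∃ δ > 0, ∀ᶠ τ in 𝓝 t₀, ∀ u ∈ Set.Icc (s - δ) (s + δ),
      ‖deriv (Γ τ).lam u - v‖ ≤ ‖v‖ / 8 := by
    have h1 := ((h.continuousAt_deriv_lam s).sub_const v).norm
    have h2 : ∀ᶠ q in 𝓝 (t₀, s), ‖deriv (Γ q.1).lam q.2 - v‖ < ‖v‖ / 8 :=
      h1.eventually_lt continuousAt_const (by simpa [hv] using hvp)
    rw [nhds_prod_eq] at h2
    obtain ⟨pa, ha, pb, hb, hab⟩ := eventually_prod_iff.1 h2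
    obtain ⟨δ, hδ, hball⟩ := Metric.nhds_basis_closedBall.mem_iff.1 hb
    rw [Real.closedBall_eq_Icc] at hball
    exact ⟨δ, hδ, ha.mono fun τ hτ u hu => (hab hτ (hball hu)).le⟩
  obtain ⟨A₀, B₀, -, hAB₀⟩ := (Γ t₀).exists_cutParams_subset_Icc
  set A := min A₀ (s - δ) with hA
  set B := max B₀ (s + δ) with hB
  have hAB : (Γ t₀).cutParams ⊆ Set.Ioo A B := fun u hu =>
    ⟨(min_le_left _ _).trans_lt (hAB₀ hu).1, (hAB₀ hu).2.trans_le (le_max_left _ _)⟩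
  obtain ⟨c, hc, hbi⟩ := exists_mul_abs_sub_le_norm_sub (Γ t₀).contDiff_lam (Γ t₀).deriv_lam_ne_zero
    (Γ t₀).injective_lam A B
  -- The offset is at most `ε₀ * 2 * ‖v‖ = c * δ / 8`. Outside the interval of radius `δ` the old
  -- path is at distance at least `c * δ / 2`, and replacing it by the new one costs at most twice
  -- `c * δ / 8`, so no contact is possible.
  refine ⟨c * δ / (16 * ‖v‖), by positivity, ?_⟩
  have hσm : ∀ᶠ τ in 𝓝 t₀, σ τ ∈ Set.Icc (s - δ / 2) (s + δ / 2) :=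
    hσ.eventually_mem (Icc_mem_nhds (by linarith) (by linarith))
  filter_upwards [hder, h.eventually_cutParams_subset hAB, hσm,
    h.eventually_norm_lam_sub_le A B (show 0 < c * δ / 8 by positivity)] with τ h1 h2 h3 h4 ε hε hmem
  rw [cuts_eq_image] at hmem
  obtain ⟨u, hu, hlu⟩ := hmem
  have hσδ : σ τ ∈ Set.Icc (s - δ) (s + δ) := ⟨by linarith [h3.1], by linarith [h3.2]⟩
  have hw := h1 _ hσδ
  set w := deriv (Γ τ).lam (σ τ) with hwdef
  have hεp := hε.1
  by_cases hud : u ∈ Set.Icc (s - δ) (s + δ)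
  · have h5 : ‖((Γ τ).lam u - u * v) - ((Γ τ).lam (σ τ) - σ τ * v)‖ ≤ ‖v‖ / 8 * ‖u - σ τ‖ := by
      refine (convex_Icc (s - δ) (s + δ)).norm_image_sub_le_of_norm_hasDerivWithin_le
        (f := fun u : ℝ => (Γ τ).lam u - u * v) (f' := fun u => deriv (Γ τ).lam u - v)
        (fun x _ => ?_) h1 hσδ hud
      have h6 := ((Γ τ).hasDerivAt_lam x).sub ((Complex.ofRealCLM.hasDerivAt (x := x)).mul_const v)
      simp only [Complex.ofRealCLM_apply, Complex.ofReal_one, one_mul] at h6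
      exact h6.hasDerivWithinAt
    have e1 : (Complex.I * ε - ((u - σ τ : ℝ) : ℂ)) * v
        = (((Γ τ).lam u - u * v) - ((Γ τ).lam (σ τ) - σ τ * v)) - Complex.I * ε * (w - v) := by
      rw [hlu]; push_cast; ring
    have h7 : ‖Complex.I * ε - ((u - σ τ : ℝ) : ℂ)‖ * ‖v‖
        ≤ ‖v‖ / 8 * |u - σ τ| + ε * (‖v‖ / 8) := by
      rw [← norm_mul, e1]
      refine (norm_sub_le _ _).trans (add_le_add h5 ?_)
      rw [norm_mul, norm_mul, Complex.norm_I, one_mul, Complex.norm_real, Real.norm_of_nonneg hεp.le]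
      exact mul_le_mul_of_nonneg_left hw hεp.le
    have h8 : |u - σ τ| ≤ ‖Complex.I * ε - ((u - σ τ : ℝ) : ℂ)‖ := by
      have := Complex.abs_re_le_norm (Complex.I * ε - ((u - σ τ : ℝ) : ℂ))
      rw [Complex.sub_re, Complex.ofReal_re] at this
      simp only [Complex.mul_re, Complex.I_re, Complex.I_im, Complex.ofReal_im, Complex.ofReal_re,
        zero_mul, mul_zero, sub_zero, zero_sub, abs_neg] at this
      exact this
    have h9 : ε ≤ ‖Complex.I * ε - ((u - σ τ : ℝ) : ℂ)‖ := by
      have := Complex.im_le_norm (Complex.I * ε - ((u - σ τ : ℝ) : ℂ))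
      rw [Complex.sub_im, Complex.ofReal_im] at this
      simp only [Complex.mul_im, Complex.I_re, Complex.I_im, Complex.ofReal_re,
        zero_mul, one_mul, sub_zero, zero_add] at this
      exact this
    -- Inside the interval a contact would bound this norm by an eighth of `|u - σ τ| + ε`, although
    -- both of these are at most the norm and `ε > 0`.
    have h10 : ‖Complex.I * ε - ((u - σ τ : ℝ) : ℂ)‖ ≤ (|u - σ τ| + ε) / 8 := by
      refine le_of_mul_le_mul_right (h7.trans (le_of_eq ?_)) hvp
      ring
    linarith [abs_nonneg (u - σ τ)]
  · have huI := Set.Ioo_subset_Icc_self (h2 hu)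
    have hσI : σ τ ∈ Set.Icc A B :=
      ⟨(min_le_right _ _).trans hσδ.1, hσδ.2.trans (le_max_right _ _)⟩
    have h5 := hbi u huI _ hσI
    have h6 : δ / 2 ≤ |u - σ τ| := by
      rw [Set.mem_Icc, not_and_or, not_le, not_le] at hud
      rcases hud with hud | hud
      · rw [abs_sub_comm]; exact le_trans (by linarith [h3.1]) (le_abs_self _)
      · exact le_trans (by linarith [h3.2]) (le_abs_self _)
    have h7 : ‖(Γ t₀).lam u - (Γ t₀).lam (σ τ)‖ ≤ ‖(Γ τ).lam u - (Γ τ).lam (σ τ)‖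
        + (c * δ / 8 + c * δ / 8) := by
      have e : (Γ t₀).lam u - (Γ t₀).lam (σ τ) = ((Γ τ).lam u - (Γ τ).lam (σ τ))
        - (((Γ τ).lam u - (Γ t₀).lam u) - ((Γ τ).lam (σ τ) - (Γ t₀).lam (σ τ))) := by ring
      rw [e]
      exact (norm_sub_le _ _).trans (add_le_add le_rfl
        ((norm_sub_le _ _).trans (add_le_add (h4 u huI) (h4 _ hσI))))
    have h8 : ‖(Γ τ).lam u - (Γ τ).lam (σ τ)‖ ≤ c * δ / 8 := by
      rw [hlu, add_sub_cancel_left, norm_mul, norm_mul, Complex.norm_I, one_mul, Complex.norm_real,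
        Real.norm_of_nonneg hεp.le]
      have hw2 : ‖w‖ ≤ 2 * ‖v‖ := by
        have := norm_sub_norm_le w v
        linarith
      calc ε * ‖w‖ ≤ c * δ / (16 * ‖v‖) * (2 * ‖v‖) :=
            mul_le_mul hε.2 hw2 (norm_nonneg _) (by positivity)
        _ = c * δ / 8 := by field_simp; ring
    have h9 := mul_le_mul_of_nonneg_left h6 hc.le
    nlinarith

/-- The boundary values `yPlus` at a moving point, not a branch point, vary continuously. -/
theorem eventually_re_yPlus_div_pos {σ : ℂ → ℝ} (hσ : ContinuousAt σ t₀)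
    (hb : σ t₀ ∉ Set.range (Γ t₀).bp) :
    ∀ᶠ τ in 𝓝 t₀, 0 < ((Γ τ).yPlus (σ τ) / (Γ t₀).yPlus (σ t₀)).re := by
  obtain ⟨ε₀, hε₀, hoff⟩ := h.exists_eventually_offset_notMem_cuts hσ
  set z : ℂ → ℝ → ℂ := fun τ ε => (Γ τ).lam (σ τ) + Complex.I * ε * deriv (Γ τ).lam (σ τ) with hz
  have hzc : ∀ ε : ℝ, ContinuousAt (fun p : ℂ × ℝ => z p.1 p.2) (t₀, ε) := by
    intro ε
    have hσ' : ContinuousAt (fun p : ℂ × ℝ => σ p.1) (t₀, ε) := hσ.comp_of_eq continuousAt_fst rfl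
    exact (h.continuousAt_lam_comp continuousAt_fst rfl hσ').add
      (ContinuousAt.mul (by fun_prop) (h.continuousAt_deriv_lam_comp continuousAt_fst rfl hσ'))
  have hP0 : ∀ ε ∈ Set.Icc 0 ε₀, (Γ t₀).P.eval (z t₀ ε) ≠ 0 := by
    intro ε hε
    rcases hε.1.eq_or_lt with rfl | hpos
    · simpa [hz] using (Γ t₀).eval_P_ne_zero hb
    · exact (Γ t₀).eval_P_ne_zero_of_notMem (hoff.self_of_nhds ε ⟨hpos, hε.2⟩)
  have hPc : ∀ ε ∈ Set.Icc 0 ε₀, ContinuousAt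
      (fun p : ℂ × ℝ => (Γ p.1).P.eval (z p.1 p.2) / (Γ t₀).P.eval (z t₀ p.2)) (t₀, ε) := by
    intro ε hε
    refine ContinuousAt.div ?_ ?_ (hP0 ε hε)
    · simp only [eval_P]
      refine tendsto_finsetProd _ fun k _ => ?_
      exact (hzc ε).sub (h.continuousAt_lam_comp continuousAt_fst rfl
        (h.continuousAt_bp_comp continuousAt_fst rfl k))
    · exact (Γ t₀).P.continuous.continuousAt.comp
        ((hzc ε).comp_of_eq (f := fun p : ℂ × ℝ => (t₀, p.2)) (by fun_prop) rfl)
  have hunif := eventually_forall_norm_sub_le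
    (G := fun τ ε => (Γ τ).P.eval (z τ ε) / (Γ t₀).P.eval (z t₀ ε))
    (isCompact_Icc (a := (0 : ℝ)) (b := ε₀)) hPc
    (show (0 : ℝ) < 1 / 2 by norm_num)
  have hε₀m : ε₀ ∈ Set.Ioc 0 ε₀ := ⟨hε₀, le_rfl⟩
  have hyne : ∀ ε ∈ Set.Ioc 0 ε₀, (Γ t₀).y₀ (z t₀ ε) ≠ 0 := fun ε hε =>
    (Γ t₀).y₀_ne_zero (hoff.self_of_nhds ε hε)
  have hend : ∀ᶠ τ in 𝓝 t₀, 0 < ((Γ τ).y₀ (z τ ε₀) / (Γ t₀).y₀ (z t₀ ε₀)).re := by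
    have h1 : ContinuousAt (fun τ => (Γ τ).y₀ (z τ ε₀)) t₀ :=
      (h.continuousAt_y₀ (hoff.self_of_nhds ε₀ hε₀m)).comp_of_eq (f := fun τ => (τ, z τ ε₀))
        (continuousAt_id.prodMk ((hzc ε₀).comp_of_eq (f := fun τ : ℂ => (τ, ε₀)) (by fun_prop) rfl)) rfl
    have h2 := Complex.continuous_re.continuousAt.comp (h1.div_const ((Γ t₀).y₀ (z t₀ ε₀)))
    exact continuousAt_const.eventually_lt h2 (by
      simp only [div_self (hyne ε₀ hε₀m), Complex.one_re, one_pos])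
  have hbτ : ∀ᶠ τ in 𝓝 t₀, σ τ ∉ Set.range (Γ τ).bp := by
    have : ∀ᶠ τ in 𝓝 t₀, ∀ k, (Γ τ).bp k ≠ σ τ := eventually_all.2 fun k =>
      ((h.continuousAt_bp k).ne_iff_eventually_ne hσ).1 fun hk => hb ⟨k, hk⟩
    filter_upwards [this] with τ hτ ⟨k, hk⟩ using hτ k hk
  filter_upwards [hoff, hunif, hend, hbτ] with τ h1 h2 h3 h4
  -- The ratio of the branches is followed along the whole offset segment. Its square stays near
  -- `1`, and at the end `ε₀`, away from the cuts, it is near `1` by continuity of `y₀`. It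
  -- therefore stays near `1` down to the boundary values at `ε = 0`.
  set q : ℝ → ℂ := fun ε => (Γ τ).y₀ (z τ ε) / (Γ t₀).y₀ (z t₀ ε) with hq
  have hzcont : ∀ τ, Continuous (z τ) := fun τ => by simp only [hz]; fun_prop
  have hqc : ContinuousOn q (Set.Ioc 0 ε₀) :=
    ((Γ τ).continuousOn_y₀.comp (hzcont τ).continuousOn h1).div
      ((Γ t₀).continuousOn_y₀.comp (hzcont t₀).continuousOn hoff.self_of_nhds) hyne
  have hqsq : ∀ ε ∈ Set.Ioc 0 ε₀, ‖q ε ^ 2 - 1‖ ≤ 1 / 2 := by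
    intro ε hε
    have := h2 ε (Set.Ioc_subset_Icc_self hε)
    rw [div_self (hP0 ε (Set.Ioc_subset_Icc_self hε))] at this
    rw [hq, div_pow, (Γ τ).y₀_sq' (h1 ε hε), (Γ t₀).y₀_sq' (hoff.self_of_nhds ε hε)]
    exact this
  have hnear : ∀ ε ∈ Set.Ioc 0 ε₀, ‖q ε - 1‖ ≤ 1 / 2 := fun ε hε =>
    norm_sub_one_le_of_norm_sq_sub_one_le isPreconnected_Ioc (by norm_num) hqc hqsq hε₀m h3 hε
  have hlim : Tendsto q (𝓝[>] 0) (𝓝 ((Γ τ).yPlus (σ τ) / (Γ t₀).yPlus (σ t₀))) :=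
    ((Γ τ).tendsto_y₀_offset h4 (by rw [sub_self, norm_zero]; positivity)).div
      ((Γ t₀).tendsto_y₀_offset hb (by rw [sub_self, norm_zero]; positivity)) ((Γ t₀).yPlus_ne_zero hb)
  have hle : ‖(Γ τ).yPlus (σ τ) / (Γ t₀).yPlus (σ t₀) - 1‖ ≤ 1 / 2 := by
    refine le_of_tendsto (hlim.sub_const 1).norm ?_
    filter_upwards [Ioc_mem_nhdsGT hε₀] with ε hε using hnear ε hε
  have := (Complex.abs_re_le_norm _).trans hle
  rw [Complex.sub_re, Complex.one_re, abs_le] at this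
  linarith [this.1]

end IsFamilyAt
end CutCurve
end

/-! ### Derivatives of integrals of `y dz` along a family. -/

noncomputable section

namespace CutCurve
variable {m : ℕ} {W : ℂ[X]}

theorem intervalIntegrable_norm_inv_yPlus (Γ : CutCurve m W) (a b : ℝ) :
    IntervalIntegrable (fun s => ‖Γ.yPlus s‖⁻¹) MeasureTheory.volume a b := by
  obtain ⟨C, hC, hle⟩ := Γ.exists_norm_inv_yPlus_le (min a b) (max a b)
  refine MeasureTheory.IntegrableOn.intervalIntegrable (MeasureTheory.Integrable.mono'
    ((Γ.locallyIntegrable_sing.integrableOn_isCompact isCompact_Icc).const_mul C)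
    (Γ.continuous_yPlus.norm.measurable.inv).aestronglyMeasurable ?_)
  refine (MeasureTheory.ae_restrict_iff' measurableSet_Icc).2 (Eventually.of_forall fun s hs => ?_)
  rw [Real.norm_of_nonneg (inv_nonneg.2 (norm_nonneg _)), ← norm_inv]
  exact hle s hs

namespace IsFamilyAt

variable {Γ : ℂ → CutCurve m W} {t₀ : ℂ} (h : IsFamilyAt Γ t₀)
include h

/-- On a moving piece of path, the ratio of the distances of a moving point to a branch point tends
to `1` uniformly, if the branch point is an end of the piece or not on it. -/
theorem tendsto_ratio {φ : ℂ → ℝ → ℝ} {φ' : ℂ → ℝ} (k : Fin (m + 1) × Bool)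
    (hφ : ∀ τ r, HasDerivAt (φ τ) (φ' τ) r) (hφ'0 : φ' t₀ ≠ 0)
    (hφc : ∀ r, ContinuousAt (fun p : ℂ × ℝ => φ p.1 p.2) (t₀, r)) (hφ'c : ContinuousAt φ' t₀)
    (hφaff : ∀ r r', φ t₀ r - φ t₀ r' = φ' t₀ * (r - r'))
    (hk : (∃ r₁ ∈ ({0, 1} : Set ℝ), ∀ᶠ τ in 𝓝 t₀, (Γ τ).bp k = φ τ r₁) ∨
      ∀ r ∈ Set.Icc (0 : ℝ) 1, (Γ t₀).bp k ≠ φ t₀ r) :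
    Tendsto (fun p : ℂ × ℝ => ((Γ p.1).lam (φ p.1 p.2) - (Γ p.1).lam ((Γ p.1).bp k)) /
      ((Γ t₀).lam (φ t₀ p.2) - (Γ t₀).lam ((Γ t₀).bp k))) (𝓝 t₀ ×ˢ 𝓟 (Set.Ioo 0 1)) (𝓝 1) := by
  rw [Metric.tendsto_nhds]
  intro ε hε
  rw [eventually_prod_principal_iff]
  have hxc : ∀ r, ContinuousAt (fun p : ℂ × ℝ => (Γ p.1).lam (φ p.1 p.2)) (t₀, r) := fun r =>
    h.continuousAt_lam_comp continuousAt_fst rfl (hφc r)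
  rcases hk with ⟨r₁, hr₁', hk⟩ | hk
  · have hr₁ : r₁ ∈ Set.Icc (0 : ℝ) 1 := by rcases hr₁' with rfl | rfl <;> simp
    obtain ⟨c, hc, hbi⟩ : ∃ c > 0, ∀ r ∈ Set.Icc (0 : ℝ) 1, c * |r - r₁| ≤
        ‖(Γ t₀).lam (φ t₀ r) - (Γ t₀).lam (φ t₀ r₁)‖ := by
      have hφ0 : Continuous (φ t₀) := continuous_iff_continuousAt.2 fun r => (hφ t₀ r).continuousAt
      obtain ⟨A, B, hAB⟩ : ∃ A B, φ t₀ '' Set.Icc 0 1 ⊆ Set.Icc A B := by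
        obtain ⟨R, hR⟩ := (isCompact_Icc.image hφ0).isBounded.subset_closedBall 0
        exact ⟨_, _, Real.closedBall_eq_Icc ▸ hR⟩
      obtain ⟨c, hc, hbi⟩ := exists_mul_abs_sub_le_norm_sub (Γ t₀).contDiff_lam
        (Γ t₀).deriv_lam_ne_zero (Γ t₀).injective_lam A B
      refine ⟨c * |φ' t₀|, mul_pos hc (abs_pos.2 hφ'0), fun r hr => ?_⟩
      have := hbi _ (hAB ⟨r, hr, rfl⟩) _ (hAB ⟨r₁, hr₁, rfl⟩)
      rwa [hφaff, abs_mul, ← mul_assoc] at this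
    have hder : ∀ r ∈ Set.Icc (0 : ℝ) 1, ContinuousAt
        (fun p : ℂ × ℝ => (φ' p.1 : ℂ) * deriv (Γ p.1).lam (φ p.1 p.2)) (t₀, r) := fun r _ =>
      (Complex.continuous_ofReal.continuousAt.comp (hφ'c.comp_of_eq continuousAt_fst rfl)).mul
        (h.continuousAt_deriv_lam_comp continuousAt_fst rfl (hφc r))
    -- Numerator and denominator both vanish at the end `r₁`. Their velocities are uniformly close,
    -- so the mean value inequality bounds their difference by `c * (ε / 2) * |r - r₁|`, while the
    -- denominator is at least `c * |r - r₁|`.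
    have hunif := eventually_forall_norm_sub_le
      (G := fun τ r => (φ' τ : ℂ) * deriv (Γ τ).lam (φ τ r)) isCompact_Icc hder
      (show 0 < c * (ε / 2) by positivity)
    filter_upwards [hunif, hk] with τ h1 h2 r hr
    have hrI := Set.Ioo_subset_Icc_self hr
    have hd : ∀ τ u, HasDerivAt (fun u => (Γ τ).lam (φ τ u)) ((φ' τ : ℂ) * deriv (Γ τ).lam (φ τ u)) u := by
      intro τ u
      have := ((Γ τ).hasDerivAt_lam (φ τ u)).scomp u (hφ τ u)
      rwa [Complex.real_smul] at this
    have h3 := (convex_Icc (0 : ℝ) 1).norm_image_sub_le_of_norm_hasDerivWithin_le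
      (f := fun u => (Γ τ).lam (φ τ u) - (Γ t₀).lam (φ t₀ u))
      (fun u _ => ((hd τ u).sub (hd t₀ u)).hasDerivWithinAt) h1 hr₁ hrI
    rw [h2, hk.self_of_nhds, dist_eq_norm]
    have hb := hbi r hrI
    have hrr : r ≠ r₁ := by
      rcases hr₁' with rfl | rfl
      · exact hr.1.ne'
      · exact hr.2.ne
    have hpos : 0 < c * |r - r₁| := mul_pos hc (abs_pos.2 (sub_ne_zero.2 hrr))
    have hnz : (Γ t₀).lam (φ t₀ r) - (Γ t₀).lam (φ t₀ r₁) ≠ 0 := norm_pos_iff.1 (hpos.trans_le hb)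
    rw [div_sub_one hnz, norm_div, div_lt_iff₀ (norm_pos_iff.2 hnz)]
    have e : (Γ τ).lam (φ τ r) - (Γ τ).lam (φ τ r₁) - ((Γ t₀).lam (φ t₀ r) - (Γ t₀).lam (φ t₀ r₁))
      = ((Γ τ).lam (φ τ r) - (Γ t₀).lam (φ t₀ r)) - ((Γ τ).lam (φ τ r₁) - (Γ t₀).lam (φ t₀ r₁)) := by
      ring
    rw [e]
    rw [Real.norm_eq_abs] at h3
    nlinarith
  · have hne : ∀ r ∈ Set.Icc (0 : ℝ) 1, (Γ t₀).lam (φ t₀ r) - (Γ t₀).lam ((Γ t₀).bp k) ≠ 0 :=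
      fun r hr => sub_ne_zero.2 fun he => hk r hr ((Γ t₀).injective_lam he).symm
    have hc : ∀ r ∈ Set.Icc (0 : ℝ) 1, ContinuousAt (fun p : ℂ × ℝ =>
        ((Γ p.1).lam (φ p.1 p.2) - (Γ p.1).lam ((Γ p.1).bp k)) /
          ((Γ t₀).lam (φ t₀ p.2) - (Γ t₀).lam ((Γ t₀).bp k))) (t₀, r) := fun r hr =>
      ((hxc r).sub (h.continuousAt_lam_comp continuousAt_fst rfl
        (h.continuousAt_bp_comp continuousAt_fst rfl k))).div
        (((hxc r).comp_of_eq (f := fun p : ℂ × ℝ => (t₀, p.2)) (by fun_prop) rfl).sub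
          continuousAt_const) (hne r hr)
    have hunif := eventually_forall_norm_sub_le
      (G := fun τ r => ((Γ τ).lam (φ τ r) - (Γ τ).lam ((Γ τ).bp k)) /
        ((Γ t₀).lam (φ t₀ r) - (Γ t₀).lam ((Γ t₀).bp k))) isCompact_Icc hc (half_pos hε)
    filter_upwards [hunif] with τ h1 r hr
    have hrI := Set.Ioo_subset_Icc_self hr
    have := h1 r hrI
    rw [div_self (hne r hrI)] at this
    rw [dist_eq_norm]
    linarith

omit h in
theorem continuousAt_of_abs_sub_le {e : ℂ → ℝ}
    (he : ∃ C, ∀ᶠ τ in 𝓝 t₀, |e τ - e t₀| ≤ C * ‖τ - t₀‖) : ContinuousAt e t₀ := by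
  obtain ⟨C, he⟩ := he
  rw [ContinuousAt, tendsto_iff_norm_sub_tendsto_zero]
  have : Tendsto (fun τ : ℂ => C * ‖τ - t₀‖) (𝓝 t₀) (𝓝 0) := by
    have : ContinuousAt (fun τ : ℂ => C * ‖τ - t₀‖) t₀ := by fun_prop
    simpa [ContinuousAt] using this
  exact squeeze_zero' (Eventually.of_forall fun _ => norm_nonneg _) he this

/-- The derivative along the family of an integral of `g(x) y dx` over a piece of path whose ends are
moving branch points or points with a fixed image. -/
theorem hasDerivAt_integral_mul_dens_P {e₁ e₂ : ℂ → ℝ} {g g' : ℂ → ℂ} {R M : ℝ}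
    (hlt : e₁ t₀ < e₂ t₀)
    (h1 : ∃ C, ∀ᶠ τ in 𝓝 t₀, |e₁ τ - e₁ t₀| ≤ C * ‖τ - t₀‖)
    (h2 : ∃ C, ∀ᶠ τ in 𝓝 t₀, |e₂ τ - e₂ t₀| ≤ C * ‖τ - t₀‖)
    (hb1 : (∃ k, ∀ τ, (Γ τ).bp k = e₁ τ) ∨ ∀ᶠ τ in 𝓝 t₀, (Γ τ).lam (e₁ τ) = (Γ t₀).lam (e₁ t₀))
    (hb2 : (∃ k, ∀ τ, (Γ τ).bp k = e₂ τ) ∨ ∀ᶠ τ in 𝓝 t₀, (Γ τ).lam (e₂ τ) = (Γ t₀).lam (e₂ t₀))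
    (hk : ∀ k, (∀ τ, (Γ τ).bp k = e₁ τ) ∨ (∀ τ, (Γ τ).bp k = e₂ τ) ∨
      (Γ t₀).bp k ∉ Set.Icc (e₁ t₀) (e₂ t₀))
    (hg : ∀ z ∈ Metric.ball 0 R, HasDerivAt g (g' z) z) (hg'c : ContinuousOn g' (Metric.ball 0 R))
    (hgM : ∀ z ∈ Metric.ball 0 R, ‖g z‖ ≤ M) (hg'M : ∀ z ∈ Metric.ball 0 R, ‖g' z‖ ≤ M)
    (hR : ∀ᶠ τ in 𝓝 t₀, ∀ s ∈ Set.Icc (e₁ τ) (e₂ τ), (Γ τ).lam s ∈ Metric.ball (0 : ℂ) R) :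
    HasDerivAt (fun τ => ∫ s in e₁ τ..e₂ τ, g ((Γ τ).lam s) * (Γ τ).dens (Γ τ).P s)
      (1 / 2 * ∫ s in e₁ t₀..e₂ t₀, g ((Γ t₀).lam s) * (Γ t₀).dens (fdot Γ t₀) s) t₀ := by
  have hc1 := continuousAt_of_abs_sub_le h1
  have hc2 := continuousAt_of_abs_sub_le h2
  obtain ⟨C₁, h1⟩ := h1
  obtain ⟨C₂, h2⟩ := h2
  -- Affine change of parameter, so that the moving interval becomes `[0, 1]`.
  set φ : ℂ → ℝ → ℝ := fun τ r => e₁ τ + (e₂ τ - e₁ τ) * r with hφ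
  set φ' : ℂ → ℝ := fun τ => e₂ τ - e₁ τ with hφ'
  have hφd : ∀ τ r, HasDerivAt (φ τ) (φ' τ) r := fun τ r =>
    (((hasDerivAt_id r).const_mul (e₂ τ - e₁ τ)).const_add (e₁ τ)).congr_deriv (mul_one _)
  have hφc : ∀ r, ContinuousAt (fun p : ℂ × ℝ => φ p.1 p.2) (t₀, r) := fun r =>
    have a1 : ContinuousAt (fun p : ℂ × ℝ => e₁ p.1) (t₀, r) := hc1.comp_of_eq continuousAt_fst rfl
    have a2 : ContinuousAt (fun p : ℂ × ℝ => e₂ p.1) (t₀, r) := hc2.comp_of_eq continuousAt_fst rfl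
    a1.add ((a2.sub a1).mul continuousAt_snd)
  have hφ'c : ContinuousAt φ' t₀ := hc2.sub hc1
  have hpos : 0 < φ' t₀ := sub_pos.2 hlt
  have hφmem : ∀ τ, 0 < φ' τ → ∀ r ∈ Set.Icc (0 : ℝ) 1, φ τ r ∈ Set.Icc (e₁ τ) (e₂ τ) := by
    intro τ hτ r hr
    simp only [hφ'] at hτ
    constructor <;> simp only [hφ] <;> nlinarith [hr.1, hr.2]
  have hposτ : ∀ᶠ τ in 𝓝 t₀, 0 < φ' τ := continuousAt_const.eventually_lt hφ'c hpos
  have hφ0 : ∀ τ, φ τ 0 = e₁ τ := fun τ => by simp [hφ]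
  have hφ1 : ∀ τ, φ τ 1 = e₂ τ := fun τ => by simp [hφ]
  have hYne : ∀ r ∈ Set.Ioo (0 : ℝ) 1, φ t₀ r ∉ Set.range (Γ t₀).bp := by
    rintro r hr ⟨k, hkr⟩
    have hr1 : e₁ t₀ < φ t₀ r := by simp only [hφ]; nlinarith [hr.1]
    have hr2 : φ t₀ r < e₂ t₀ := by simp only [hφ]; nlinarith [hr.2]
    rcases hk k with hk | hk | hk
    · linarith [hk t₀]
    · linarith [hk t₀]
    · exact hk (by rw [hkr]; exact ⟨hr1.le, hr2.le⟩)
  set x : ℂ → ℝ → ℂ := fun τ r => (Γ τ).lam (φ τ r) with hx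
  set x' : ℂ → ℝ → ℂ := fun τ r => (φ' τ : ℂ) * deriv (Γ τ).lam (φ τ r) with hx'
  set Y : ℂ → ℝ → ℂ := fun τ r => (Γ τ).yPlus (φ τ r) with hY
  have hφcont : ∀ τ, Continuous (φ τ) := fun τ => by simp only [hφ]; fun_prop
  have hxd : ∀ τ u, HasDerivAt (x τ) (x' τ u) u := by
    intro τ u
    have := ((Γ τ).hasDerivAt_lam (φ τ u)).scomp u (hφd τ u)
    rwa [Complex.real_smul] at this
  -- the displacement is of first order
  obtain ⟨C, hδ⟩ : ∃ C, ∀ᶠ τ in 𝓝 t₀, ∀ r ∈ Set.Icc (0 : ℝ) 1, ‖x τ r - x t₀ r‖ ≤ C * ‖τ - t₀‖ := by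
    obtain ⟨D, hD, hle⟩ := h.exists_norm_lam_sub_le (e₁ t₀ - 1) (e₂ t₀ + 1)
    obtain ⟨L, hL⟩ := (isCompact_Icc (a := e₁ t₀ - 1) (b := e₂ t₀ + 1)).exists_bound_of_continuousOn
      (Γ t₀).continuous_deriv_lam.continuousOn
    have n1 : ∀ᶠ τ in 𝓝 t₀, e₁ t₀ - 1 < e₁ τ := continuousAt_const.eventually_lt hc1 (by linarith)
    have n2 : ∀ᶠ τ in 𝓝 t₀, e₂ τ < e₂ t₀ + 1 := hc2.eventually_lt continuousAt_const (by linarith)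
    refine ⟨D + L * (C₁ + C₂), ?_⟩
    filter_upwards [hle, n1, n2, hposτ, h1, h2] with τ g1 g2 g3 g4 g5 g6 r hr
    have m1 := hφmem τ g4 r hr
    have m2 := hφmem t₀ hpos r hr
    have m1' : φ τ r ∈ Set.Icc (e₁ t₀ - 1) (e₂ t₀ + 1) := ⟨g2.le.trans m1.1, m1.2.trans g3.le⟩
    have m2' : φ t₀ r ∈ Set.Icc (e₁ t₀ - 1) (e₂ t₀ + 1) := ⟨by linarith [m2.1], by linarith [m2.2]⟩
    have b1 := g1 _ m1'
    have b2 := (convex_Icc (e₁ t₀ - 1) (e₂ t₀ + 1)).norm_image_sub_le_of_norm_hasDerivWithin_le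
      (fun u _ => ((Γ t₀).hasDerivAt_lam u).hasDerivWithinAt) hL m2' m1'
    have hL0 : 0 ≤ L := (norm_nonneg _).trans (hL _ m1')
    have b3 : ‖φ τ r - φ t₀ r‖ ≤ (C₁ + C₂) * ‖τ - t₀‖ := by
      have e : φ τ r - φ t₀ r = (1 - r) * (e₁ τ - e₁ t₀) + r * (e₂ τ - e₂ t₀) := by
        simp only [hφ]; ring
      rw [e, Real.norm_eq_abs]
      refine (abs_add_le _ _).trans ?_
      rw [abs_mul, abs_mul, abs_of_nonneg hr.1, abs_of_nonneg (sub_nonneg.2 hr.2), add_mul]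
      refine add_le_add (le_trans ?_ g5) (le_trans ?_ g6)
      · exact mul_le_of_le_one_left (abs_nonneg _) (by linarith [hr.1])
      · exact mul_le_of_le_one_left (abs_nonneg _) hr.2
    have e : x τ r - x t₀ r = ((Γ τ).lam (φ τ r) - (Γ t₀).lam (φ τ r))
      + ((Γ t₀).lam (φ τ r) - (Γ t₀).lam (φ t₀ r)) := by simp only [hx]; ring
    rw [e, add_mul, mul_assoc]
    exact (norm_add_le _ _).trans (add_le_add b1 (b2.trans (mul_le_mul_of_nonneg_left b3 hL0)))
  have hx'η : ∀ η > 0, ∀ᶠ τ in 𝓝 t₀, ∀ r ∈ Set.Icc (0 : ℝ) 1, ‖x' τ r - x' t₀ r‖ ≤ η := fun η hη =>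
    eventually_forall_norm_sub_le (G := x') isCompact_Icc (fun r _ =>
      (Complex.continuous_ofReal.continuousAt.comp (hφ'c.comp_of_eq continuousAt_fst rfl)).mul
        (h.continuousAt_deriv_lam_comp continuousAt_fst rfl (hφc r))) hη
  -- `Y τ / Y t₀` tends to `1` uniformly
  have hratio : Tendsto (fun p : ℂ × ℝ => (Γ p.1).P.eval (x p.1 p.2) / (Γ t₀).P.eval (x t₀ p.2))
      (𝓝 t₀ ×ˢ 𝓟 (Set.Ioo 0 1)) (𝓝 1) := by
    have hprod := tendsto_finsetProd (Finset.univ : Finset (Fin (m + 1) × Bool)) fun k _ =>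
      h.tendsto_ratio (φ := φ) (φ' := φ') k hφd hpos.ne' hφc hφ'c
        (fun r r' => by simp only [hφ, hφ']; ring) (by
          rcases hk k with hk | hk | hk
          · exact Or.inl ⟨0, by simp, Eventually.of_forall fun τ => by rw [hφ0, hk]⟩
          · exact Or.inl ⟨1, by simp, Eventually.of_forall fun τ => by rw [hφ1, hk]⟩
          · exact Or.inr fun r hr he => hk (by rw [he]; exact hφmem t₀ hpos r hr))
    simp only [Finset.prod_const_one] at hprod
    refine hprod.congr fun p => ?_
    rw [Finset.prod_div_distrib, eval_P, eval_P]
  have hmid : (1 / 2 : ℝ) ∈ Set.Ioo (0 : ℝ) 1 := by norm_num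
  -- The squares of the ratios are uniformly near `1` by the product formula for `P`, up to the ends
  -- of the interval. Which square root this is can be read at the midpoint alone, which is not a
  -- branch point.
  have hYc : ∀ η > 0, ∀ᶠ τ in 𝓝 t₀, ∀ r ∈ Set.Ioo (0 : ℝ) 1, ‖Y τ r - Y t₀ r‖ ≤ η * ‖Y t₀ r‖ := by
    intro η hη
    have g1 := Metric.tendsto_nhds.1 hratio (min η (1 / 2)) (lt_min hη (by norm_num))
    rw [eventually_prod_principal_iff] at g1
    have hσ : ContinuousAt (fun τ => φ τ (1 / 2)) t₀ :=
      (hφc (1 / 2)).comp_of_eq (f := fun τ : ℂ => (τ, (1 / 2 : ℝ))) (by fun_prop) rfl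
    filter_upwards [g1, h.eventually_re_yPlus_div_pos hσ (hYne _ hmid)] with τ g2 g3 r hr
    have hYnz : ∀ r ∈ Set.Ioo (0 : ℝ) 1, Y t₀ r ≠ 0 := fun r hr => (Γ t₀).yPlus_ne_zero (hYne r hr)
    have g4 := norm_sub_one_le_of_norm_sq_sub_one_le (q := fun r => Y τ r / Y t₀ r)
      (η := min η (1 / 2)) isPreconnected_Ioo ((min_le_right _ _).trans_lt (by norm_num))
      ((((Γ τ).continuous_yPlus.comp (hφcont τ)).continuousOn).div
        (((Γ t₀).continuous_yPlus.comp (hφcont t₀)).continuousOn) hYnz) (fun r hr => by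
          have := (g2 r hr).le
          rw [dist_eq_norm] at this
          rw [div_pow]
          simp only [hY, yPlus_sq]
          exact this) hmid g3 hr
    rw [div_sub_one (hYnz r hr), norm_div, div_le_iff₀ (norm_pos_iff.2 (hYnz r hr))] at g4
    exact g4.trans (mul_le_mul_of_nonneg_right (min_le_left _ _) (norm_nonneg _))
  have hbdry : ∀ᶠ τ in 𝓝 t₀, ∀ r ∈ ({0, 1} : Set ℝ), (Y τ r = 0 ∧ Y t₀ r = 0) ∨ x τ r = x t₀ r := by
    have key : ∀ {e : ℂ → ℝ}, ((∃ k, ∀ τ, (Γ τ).bp k = e τ) ∨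
        ∀ᶠ τ in 𝓝 t₀, (Γ τ).lam (e τ) = (Γ t₀).lam (e t₀)) → ∀ᶠ τ in 𝓝 t₀,
          ((Γ τ).yPlus (e τ) = 0 ∧ (Γ t₀).yPlus (e t₀) = 0) ∨ (Γ τ).lam (e τ) = (Γ t₀).lam (e t₀) := by
      rintro e (⟨k, hk⟩ | he)
      · exact Eventually.of_forall fun τ => Or.inl ⟨by rw [← hk, yPlus_bp], by rw [← hk, yPlus_bp]⟩
      · exact he.mono fun τ hτ => Or.inr hτ
    filter_upwards [key hb1, key hb2] with τ g1 g2 r hr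
    rcases hr with rfl | rfl
    · simpa only [hY, hx, hφ0] using g1
    · simpa only [hY, hx, hφ1] using g2
  have hint : MeasureTheory.IntegrableOn (fun r => ‖Y t₀ r‖⁻¹) (Set.Ioo 0 1) := by
    have g1 := (Γ t₀).intervalIntegrable_norm_inv_yPlus (e₁ t₀) (e₂ t₀)
    have g2 := (g1.comp_add_left (e₁ t₀)).comp_mul_left (c := φ' t₀)
    rw [sub_self, zero_div, div_self hpos.ne', intervalIntegrable_iff_integrableOn_Ioo_of_le zero_le_one] at g2
    exact g2
  have hmain := hasDerivAt_integral_branch (x := x) (x' := x') (Y := Y) (p := fun τ => (Γ τ).P)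
    (pd := fdot Γ t₀) (n := max (W.derivative ^ 2).natDegree m) zero_lt_one
    (Eventually.of_forall natDegree_P_le) ((natDegree_fdot_le Γ t₀).trans (le_max_right _ _))
    h.hasDerivAt_coeff_P hg hg'c hgM hg'M
    (by filter_upwards [hR, hposτ] with τ g1 g2 r hr using g1 _ (hφmem τ g2 r hr))
    (Eventually.of_forall fun τ r _ => hxd τ r)
    (Eventually.of_forall fun τ => (continuous_const.mul
      ((Γ τ).continuous_deriv_lam.comp (hφcont τ))).continuousOn)
    (Eventually.of_forall fun τ => ((Γ τ).continuous_yPlus.comp (hφcont τ)).continuousOn)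
    (Eventually.of_forall fun τ r _ => (Γ τ).yPlus_sq _)
    (fun r hr => (Γ t₀).yPlus_ne_zero (hYne r hr)) hbdry hδ hx'η hYc hint
  have hsubst : ∀ τ (F : ℝ → ℂ), ∫ s in e₁ τ..e₂ τ, F s = ∫ r in (0 : ℝ)..1, (φ' τ : ℂ) * F (φ τ r) := by
    intro τ F
    have := intervalIntegral.smul_integral_comp_add_mul (a := 0) (b := 1) F (φ' τ) (e₁ τ)
    rw [mul_zero, add_zero, mul_one] at this
    rw [intervalIntegral.integral_const_mul, ← Complex.real_smul]
    simp only [hφ, hφ'] at this ⊢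
    rw [this, add_sub_cancel]
  refine (hmain.congr_of_eventuallyEq (Eventually.of_forall fun τ => ?_)).congr_deriv ?_
  · simp only
    rw [hsubst]
    refine intervalIntegral.integral_congr fun r _ => ?_
    simp only [hx, hx', hY, dens_P]
    ring
  · rw [hsubst, ← intervalIntegral.integral_const_mul]
    refine intervalIntegral.integral_congr fun r _ => ?_
    simp only [hx, hx', hY, dens, div_eq_mul_inv, mul_inv]
    ring

end IsFamilyAt
end CutCurve
end

/-! ### The derivative of the prepotential. -/

noncomputable section

theorem eq_zero_of_sum_Iic_castSucc_eq_zero {m : ℕ} {s : Fin (m + 1) → ℂ}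
    (hs : ∀ i : Fin m, ∑ j ∈ Finset.Iic i.castSucc, s j = 0) (i : Fin m) : s i.castSucc = 0 := by
  induction i using WellFoundedLT.induction with
  | ind i ih =>
    have h1 := hs i
    rw [← Finset.Iio_insert, Finset.sum_insert (by simp)] at h1
    rw [Finset.sum_eq_zero fun j hj => ?_, add_zero] at h1
    · exact h1
    · have hj' : j < i.castSucc := Finset.mem_Iio.1 hj
      have hjm : (j : ℕ) < m := lt_trans (Fin.lt_def.1 hj') i.2
      exact ih ⟨j, hjm⟩ (Fin.lt_def.2 hj')

namespace CutCurve
variable {m : ℕ} {W : ℂ[X]}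

theorem bp_notMem_Icc_cut (Γ : CutCurve m W) {i j : Fin (m + 1)} (hij : j ≠ i) (b : Bool) :
    Γ.bp (j, b) ∉ Set.Icc (Γ.sMinus i) (Γ.sPlus i) := by
  intro hm
  have hj := Γ.sMinus_lt_sPlus j
  rcases lt_or_gt_of_ne hij with hlt | hlt
  · have := Γ.sPlus_lt_sMinus _ _ hlt
    cases b <;> simp only [bp, Set.mem_Icc] at hm <;> linarith [hm.1, hm.2]
  · have := Γ.sPlus_lt_sMinus _ _ hlt
    cases b <;> simp only [bp, Set.mem_Icc] at hm <;> linarith [hm.1, hm.2]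

theorem bp_notMem_Icc_gap (Γ : CutCurve m W) (i : Fin m) (k : Fin (m + 1) × Bool)
    (h1 : k ≠ (i.castSucc, true)) (h2 : k ≠ (i.succ, false)) :
    Γ.bp k ∉ Set.Icc (Γ.sPlus i.castSucc) (Γ.sMinus i.succ) := by
  intro hm
  rcases hm.1.eq_or_lt with he | hlt
  · exact h1 (Γ.bp_injective he.symm)
  rcases hm.2.eq_or_lt with he | hlt'
  · exact h2 (Γ.bp_injective he)
  exact Γ.notMem_cutParams_of_gap ⟨hlt, hlt'⟩ (Γ.bp_mem_cutParams k)

namespace IsFamilyAt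

variable {Γ : ℂ → CutCurve m W} {t₀ : ℂ} (h : IsFamilyAt Γ t₀)
include h

theorem exists_lam_mem_ball {e₁ e₂ : ℂ → ℝ} (h1 : ContinuousAt e₁ t₀) (h2 : ContinuousAt e₂ t₀) :
    ∃ R, ∀ᶠ τ in 𝓝 t₀, ∀ s ∈ Set.Icc (e₁ τ) (e₂ τ), (Γ τ).lam s ∈ Metric.ball (0 : ℂ) R := by
  obtain ⟨M, hM⟩ := (isCompact_Icc (a := e₁ t₀ - 1) (b := e₂ t₀ + 1)).exists_bound_of_continuousOn
    (Γ t₀).continuous_lam.continuousOn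
  have n1 : ∀ᶠ τ in 𝓝 t₀, e₁ t₀ - 1 < e₁ τ := continuousAt_const.eventually_lt h1 (by linarith)
  have n2 : ∀ᶠ τ in 𝓝 t₀, e₂ τ < e₂ t₀ + 1 := h2.eventually_lt continuousAt_const (by linarith)
  refine ⟨M + 2, ?_⟩
  filter_upwards [n1, n2, h.eventually_norm_lam_sub_le (e₁ t₀ - 1) (e₂ t₀ + 1) one_pos]
    with τ g1 g2 g3 s hs
  have hs' : s ∈ Set.Icc (e₁ t₀ - 1) (e₂ t₀ + 1) := ⟨g1.le.trans hs.1, hs.2.trans g2.le⟩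
  rw [mem_ball_zero_iff]
  have := norm_sub_norm_le ((Γ τ).lam s) ((Γ t₀).lam s)
  linarith [hM s hs', g3 s hs']

theorem hasDerivAt_integral_eval_mul_dens_P {e₁ e₂ : ℂ → ℝ} (q : ℂ[X]) (hlt : e₁ t₀ < e₂ t₀)
    (h1 : ∃ C, ∀ᶠ τ in 𝓝 t₀, |e₁ τ - e₁ t₀| ≤ C * ‖τ - t₀‖)
    (h2 : ∃ C, ∀ᶠ τ in 𝓝 t₀, |e₂ τ - e₂ t₀| ≤ C * ‖τ - t₀‖)
    (hb1 : (∃ k, ∀ τ, (Γ τ).bp k = e₁ τ) ∨ ∀ᶠ τ in 𝓝 t₀, (Γ τ).lam (e₁ τ) = (Γ t₀).lam (e₁ t₀))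
    (hb2 : (∃ k, ∀ τ, (Γ τ).bp k = e₂ τ) ∨ ∀ᶠ τ in 𝓝 t₀, (Γ τ).lam (e₂ τ) = (Γ t₀).lam (e₂ t₀))
    (hk : ∀ k, (∀ τ, (Γ τ).bp k = e₁ τ) ∨ (∀ τ, (Γ τ).bp k = e₂ τ) ∨
      (Γ t₀).bp k ∉ Set.Icc (e₁ t₀) (e₂ t₀)) :
    HasDerivAt (fun τ => ∫ s in e₁ τ..e₂ τ, q.eval ((Γ τ).lam s) * (Γ τ).dens (Γ τ).P s)
      (1 / 2 * ∫ s in e₁ t₀..e₂ t₀, q.eval ((Γ t₀).lam s) * (Γ t₀).dens (fdot Γ t₀) s) t₀ := by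
  obtain ⟨R, hR⟩ := h.exists_lam_mem_ball (continuousAt_of_abs_sub_le h1)
    (continuousAt_of_abs_sub_le h2)
  obtain ⟨M, hM⟩ := (isCompact_closedBall (0 : ℂ) R).exists_bound_of_continuousOn
    q.continuous.continuousOn
  obtain ⟨M', hM'⟩ := (isCompact_closedBall (0 : ℂ) R).exists_bound_of_continuousOn
    q.derivative.continuous.continuousOn
  exact h.hasDerivAt_integral_mul_dens_P (M := max M M') hlt h1 h2 hb1 hb2 hk
    (fun z _ => q.hasDerivAt z) q.derivative.continuous.continuousOn
    (fun z hz => (hM z (Metric.ball_subset_closedBall hz)).trans (le_max_left _ _))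
    (fun z hz => (hM' z (Metric.ball_subset_closedBall hz)).trans (le_max_right _ _)) hR

omit h in
theorem cut_ends (i : Fin (m + 1)) (k : Fin (m + 1) × Bool) :
    (∀ τ, (Γ τ).bp k = (Γ τ).sMinus i) ∨ (∀ τ, (Γ τ).bp k = (Γ τ).sPlus i) ∨
      (Γ t₀).bp k ∉ Set.Icc ((Γ t₀).sMinus i) ((Γ t₀).sPlus i) := by
  obtain ⟨j, b⟩ := k
  by_cases hij : j = i
  · subst hij
    cases b
    · exact Or.inl fun _ => rfl
    · exact Or.inr (Or.inl fun _ => rfl)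
  · exact Or.inr (Or.inr ((Γ t₀).bp_notMem_Icc_cut hij b))

theorem hasDerivAt_integral_cut (q : ℂ[X]) (i : Fin (m + 1)) :
    HasDerivAt (fun τ => ∫ s in (Γ τ).sMinus i..(Γ τ).sPlus i,
        q.eval ((Γ τ).lam s) * (Γ τ).dens (Γ τ).P s)
      (1 / 2 * ∫ s in (Γ t₀).sMinus i..(Γ t₀).sPlus i,
        q.eval ((Γ t₀).lam s) * (Γ t₀).dens (fdot Γ t₀) s) t₀ :=
  h.hasDerivAt_integral_eval_mul_dens_P q ((Γ t₀).sMinus_lt_sPlus i)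
    (h.exists_abs_bp_sub_le (i, false)) (h.exists_abs_bp_sub_le (i, true))
    (Or.inl ⟨(i, false), fun _ => rfl⟩) (Or.inl ⟨(i, true), fun _ => rfl⟩) (cut_ends i)

theorem hasDerivAt_integral_cut_dens (i : Fin (m + 1)) :
    HasDerivAt (fun τ => ∫ s in (Γ τ).sMinus i..(Γ τ).sPlus i, (Γ τ).dens (Γ τ).P s)
      (1 / 2 * ∫ s in (Γ t₀).sMinus i..(Γ t₀).sPlus i, (Γ t₀).dens (fdot Γ t₀) s) t₀ := by
  simpa only [eval_one, one_mul] using h.hasDerivAt_integral_cut 1 i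

theorem hasDerivAt_integral_gap_dens (i : Fin m) :
    HasDerivAt (fun τ => ∫ s in (Γ τ).sPlus i.castSucc..(Γ τ).sMinus i.succ, (Γ τ).dens (Γ τ).P s)
      (1 / 2 * ∫ s in (Γ t₀).sPlus i.castSucc..(Γ t₀).sMinus i.succ,
        (Γ t₀).dens (fdot Γ t₀) s) t₀ := by
  have := h.hasDerivAt_integral_eval_mul_dens_P (e₁ := fun τ => (Γ τ).sPlus i.castSucc)
    (e₂ := fun τ => (Γ τ).sMinus i.succ) 1 ((Γ t₀).sPlus_lt_sMinus _ _ Fin.castSucc_lt_succ)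
    (h.exists_abs_bp_sub_le (i.castSucc, true)) (h.exists_abs_bp_sub_le (i.succ, false))
    (Or.inl ⟨(i.castSucc, true), fun _ => rfl⟩) (Or.inl ⟨(i.succ, false), fun _ => rfl⟩) (fun k => by
      by_cases h1 : k = (i.castSucc, true)
      · exact Or.inl fun _ => h1 ▸ rfl
      by_cases h2 : k = (i.succ, false)
      · exact Or.inr (Or.inl fun _ => h2 ▸ rfl)
      exact Or.inr (Or.inr ((Γ t₀).bp_notMem_Icc_gap i k h1 h2)))
  simpa only [eval_one, one_mul] using this

/-- The value on the last cut is reached from a fixed far point `Λ`: it is `V(Λ)` minus the integral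
of `y dz` from the branch point to `Λ`. At `Λ` the potential integrates `log (Λ - z)`, which is
holomorphic near the cuts. The two derivatives recombine through the variation of the potential of
`ḟ dz / y₊`. -/
theorem hasDerivAt_effPot_last (hmonic : W.derivative.Monic) (hdeg : W.derivative.natDegree = m + 1) :
    HasDerivAt (fun τ => (Γ τ).effPot ((Γ τ).sPlus (Fin.last m)))
      (-(2 * Real.pi * Complex.I)⁻¹ *
        (Γ t₀).potential (fdot Γ t₀) ((Γ t₀).sPlus (Fin.last m))) t₀ := by
  have hpi : (Real.pi : ℂ) ≠ 0 := Complex.ofReal_ne_zero.2 Real.pi_ne_zero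
  have hI := Complex.I_ne_zero
  obtain ⟨e, he, helam, hfar, Λ, R, hRΛ, hΛ, hR⟩ := h.exists_far_param
  have hfar0 := hfar.self_of_nhds
  have hseg := h.hasDerivAt_integral_eval_mul_dens_P (e₁ := fun τ => (Γ τ).sPlus (Fin.last m))
    (e₂ := e) 1 hfar0.sPlus_last_lt (h.exists_abs_bp_sub_le (Fin.last m, true)) he
    (Or.inl ⟨(Fin.last m, true), fun _ => rfl⟩) (Or.inr helam) (fun k => by
      by_cases h1 : k = (Fin.last m, true)
      · exact Or.inl fun _ => h1 ▸ rfl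
      refine Or.inr (Or.inr fun hm => ?_)
      have h2 := (Γ t₀).le_sPlus_last ((Γ t₀).bp_mem_cutParams k)
      exact h1 ((Γ t₀).bp_injective (le_antisymm h2 hm.1)))
  simp only [eval_one, one_mul] at hseg
  have hslit : ∀ z ∈ Metric.closedBall (0 : ℂ) R, (Λ : ℂ) - z ∈ Complex.slitPlane := by
    intro z hz
    left
    rw [mem_closedBall_zero_iff] at hz
    rw [Complex.sub_re, Complex.ofReal_re]
    linarith [Complex.re_le_norm z]
  have hgd : ∀ z ∈ Metric.closedBall (0 : ℂ) R,
      HasDerivAt (fun z => Complex.log ((Λ : ℂ) - z)) (-1 / ((Λ : ℂ) - z)) z := fun z hz =>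
    ((hasDerivAt_id z).const_sub (Λ : ℂ)).clog (hslit z hz)
  have hg'c : ContinuousOn (fun z => -1 / ((Λ : ℂ) - z)) (Metric.closedBall 0 R) :=
    continuousOn_const.div (by fun_prop) fun z hz => Complex.slitPlane_ne_zero (hslit z hz)
  obtain ⟨M, hM⟩ := (isCompact_closedBall (0 : ℂ) R).exists_bound_of_continuousOn
    (f := fun z => Complex.log ((Λ : ℂ) - z)) fun z hz => (hgd z hz).continuousAt.continuousWithinAt
  obtain ⟨M', hM'⟩ := (isCompact_closedBall (0 : ℂ) R).exists_bound_of_continuousOn hg'c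
  have hlog : ∀ i, HasDerivAt (fun τ => ∫ s in (Γ τ).sMinus i..(Γ τ).sPlus i,
        Complex.log (Λ - (Γ τ).lam s) * (Γ τ).dens (Γ τ).P s)
      (1 / 2 * ∫ s in (Γ t₀).sMinus i..(Γ t₀).sPlus i,
        Complex.log (Λ - (Γ t₀).lam s) * (Γ t₀).dens (fdot Γ t₀) s) t₀ := fun i =>
    h.hasDerivAt_integral_mul_dens_P (M := max M M') (g := fun z => Complex.log ((Λ : ℂ) - z))
      ((Γ t₀).sMinus_lt_sPlus i)
      (h.exists_abs_bp_sub_le (i, false)) (h.exists_abs_bp_sub_le (i, true))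
      (Or.inl ⟨(i, false), fun _ => rfl⟩) (Or.inl ⟨(i, true), fun _ => rfl⟩) (cut_ends i)
      (fun z hz => hgd z (Metric.ball_subset_closedBall hz)) (hg'c.mono Metric.ball_subset_closedBall)
      (fun z hz => (hM z (Metric.ball_subset_closedBall hz)).trans (le_max_left _ _))
      (fun z hz => (hM' z (Metric.ball_subset_closedBall hz)).trans (le_max_right _ _))
      (hR.mono fun τ hτ s hs => mem_ball_zero_iff.2 (hτ s ((Γ τ).mem_cutParams hs)))
  have hpot : ∀ᶠ τ in 𝓝 t₀, ∀ q, (Γ τ).potential q (e τ) =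
      ∑ i, ∫ s in (Γ τ).sMinus i..(Γ τ).sPlus i, Complex.log (Λ - (Γ τ).lam s) * (Γ τ).dens q s := by
    filter_upwards [hfar, helam, hR] with τ g1 g2 g3 q
    rw [g1.potential_eq q, g2, hΛ]
    refine (Γ τ).integral_cutParams ((Γ τ).integrableOn_mul_dens (Γ τ).measurableSet_cutParams
      subset_rfl (ContinuousOn.clog (continuous_const.sub (Γ τ).continuous_lam).continuousOn
        fun s hs => hslit _ (mem_closedBall_zero_iff.2 (g3 s hs).le)) q)
  have hev : (fun τ => (Γ τ).effPot ((Γ τ).sPlus (Fin.last m))) =ᶠ[𝓝 t₀] fun τ =>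
      W.eval (Λ : ℂ) - (∑ i, ∫ s in (Γ τ).sMinus i..(Γ τ).sPlus i,
        Complex.log (Λ - (Γ τ).lam s) * (Γ τ).dens (Γ τ).P s) / (Real.pi * Complex.I)
        - ∫ s in (Γ τ).sPlus (Fin.last m)..e τ, (Γ τ).dens (Γ τ).P s := by
    filter_upwards [hfar, helam, hpot] with τ g1 g2 g3
    have g4 : (Γ τ).effPot (e τ) = W.eval (Λ : ℂ)
        - (Γ τ).potential (Γ τ).P (e τ) / (Real.pi * Complex.I) := by rw [effPot, g2, hΛ]
    rw [← (Γ τ).effPot_sub_last hmonic hdeg g1.sPlus_last_lt.le, ← g3, g4]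
    ring
  have hD := (((HasDerivAt.fun_sum (u := Finset.univ) fun i _ => hlog i).div_const
    (Real.pi * Complex.I)).const_sub (W.eval (Λ : ℂ))).sub hseg
  refine (hD.congr_of_eventuallyEq hev).congr_deriv ?_
  rw [← Finset.mul_sum, ← hpot.self_of_nhds (fdot Γ t₀)]
  have h3 := (Γ t₀).potential_sub_last (natDegree_fdot_le Γ t₀) hfar0.sPlus_last_lt.le
  have h4 : (Γ t₀).potential (fdot Γ t₀) (e t₀) = (Γ t₀).potential (fdot Γ t₀)
    ((Γ t₀).sPlus (Fin.last m)) - (Real.pi * Complex.I *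
      ∫ u in (Γ t₀).sPlus (Fin.last m)..e t₀, (Γ t₀).dens (fdot Γ t₀) u) := by
    linear_combination h3
  rw [h4]
  field_simp
  ring

/-- Descent from the last cut: crossing a gap changes the effective potential by the integral of `y
dz` and the potential of `ḟ dz / y₊` by `-π I` times the integral of `ḟ dz / y`. The former has half
the integral of `ḟ dz / y` as derivative, so the relation propagates. -/
theorem hasDerivAt_effPot (hmonic : W.derivative.Monic) (hdeg : W.derivative.natDegree = m + 1)
    (i : Fin (m + 1)) :
    HasDerivAt (fun τ => (Γ τ).effPot ((Γ τ).sPlus i))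
      (-(2 * Real.pi * Complex.I)⁻¹ * (Γ t₀).potential (fdot Γ t₀) ((Γ t₀).sPlus i)) t₀ := by
  have hpi : (Real.pi : ℂ) ≠ 0 := Complex.ofReal_ne_zero.2 Real.pi_ne_zero
  have hI := Complex.I_ne_zero
  induction i using Fin.reverseInduction with
  | last => exact h.hasDerivAt_effPot_last hmonic hdeg
  | cast i ih =>
    have e : (fun τ => (Γ τ).effPot ((Γ τ).sPlus i.castSucc)) = fun τ =>
        (Γ τ).effPot ((Γ τ).sPlus i.succ)
          - ∫ s in (Γ τ).sPlus i.castSucc..(Γ τ).sMinus i.succ, (Γ τ).dens (Γ τ).P s := by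
      ext τ
      rw [← (Γ τ).effPot_succ hmonic hdeg]
      ring
    rw [e]
    refine (ih.sub (h.hasDerivAt_integral_gap_dens i)).congr_deriv ?_
    have h3 := (Γ t₀).potential_succ (natDegree_fdot_le Γ t₀) i
    have h4 : (Γ t₀).potential (fdot Γ t₀) ((Γ t₀).sPlus i.castSucc) =
        (Γ t₀).potential (fdot Γ t₀) ((Γ t₀).sPlus i.succ) + (Real.pi * Complex.I *
          ∫ u in (Γ t₀).sPlus i.castSucc..(Γ t₀).sMinus i.succ, (Γ t₀).dens (fdot Γ t₀) u) := by
      linear_combination -h3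
    rw [h4]
    field_simp
    ring

/-- Only the last of the periods `Sᵢ` varies. -/
theorem integral_cut_dens_fdot (i : Fin (m + 1)) :
    ∫ s in (Γ t₀).sMinus i..(Γ t₀).sPlus i, (Γ t₀).dens (fdot Γ t₀) s
      = if i = Fin.last m then 4 * Real.pi * Complex.I else 0 := by
  have hpi : (Real.pi : ℂ) ≠ 0 := Complex.ofReal_ne_zero.2 Real.pi_ne_zero
  have hI := Complex.I_ne_zero
  set d : Fin (m + 1) → ℂ := fun i =>
    ∫ s in (Γ t₀).sMinus i..(Γ t₀).sPlus i, (Γ t₀).dens (fdot Γ t₀) s with hd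
  -- The total mass of `ḟ dz / y₊` is `-π I` times the leading coefficient `-4` of `ḟ`.
  have hsum : ∑ i, d i = 4 * Real.pi * Complex.I := by
    rw [← (Γ t₀).integral_cutParams ((Γ t₀).integrableOn_dens_cutParams _),
      (Γ t₀).integral_dens (natDegree_fdot_le Γ t₀), h.coeff_fdot_eq]
    ring
  have hS : ∀ i, HasDerivAt (fun τ => (Γ τ).S i) ((2 * Real.pi * Complex.I)⁻¹ * (1 / 2 * d i)) t₀ := by
    intro i
    simp only [S_eq]
    exact (h.hasDerivAt_integral_cut_dens i).const_mul _
  have hzero : ∀ i : Fin m, ∑ j ∈ Finset.Iic i.castSucc, d j = 0 := by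
    intro i
    have h1 : HasDerivAt (fun τ => (Γ τ).tildeS i)
        (∑ j ∈ Finset.Iic i.castSucc, (2 * Real.pi * Complex.I)⁻¹ * (1 / 2 * d j)) t₀ :=
      HasDerivAt.fun_sum fun j _ => hS j
    have h2 : HasDerivAt (fun τ => (Γ τ).tildeS i) 0 t₀ :=
      (hasDerivAt_const t₀ ((Γ t₀).tildeS i)).congr_of_eventuallyEq
        (h.tildeS_eq.mono fun τ hτ => hτ i)
    have h3 := h1.unique h2
    rw [← Finset.mul_sum, ← Finset.mul_sum] at h3
    have hne : ((2 * Real.pi * Complex.I)⁻¹ : ℂ) ≠ 0 :=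
      inv_ne_zero (mul_ne_zero (mul_ne_zero two_ne_zero hpi) hI)
    have h4 := (mul_eq_zero.1 h3).resolve_left hne
    exact (mul_eq_zero.1 h4).resolve_left (by norm_num)
  have hcast := eq_zero_of_sum_Iic_castSucc_eq_zero hzero
  change d i = _
  induction i using Fin.lastCases with
  | last =>
    rw [Fin.sum_univ_castSucc, Finset.sum_eq_zero fun i _ => hcast i, zero_add] at hsum
    rw [hsum, if_pos rfl]
  | cast i => rw [hcast i, if_neg (Fin.castSucc_lt_last i).ne]

/-- The derivative of the prepotential in `t` at fixed `S̃` is minus the effective potential on the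
last cut. -/
theorem hasDerivAt_prepotential (hmonic : W.derivative.Monic)
    (hdeg : W.derivative.natDegree = m + 1) :
    HasDerivAt (fun τ => (Γ τ).prepotential)
      (-(Γ t₀).effPot ((Γ t₀).sPlus (Fin.last m))) t₀ := by
  have hpi : (Real.pi : ℂ) ≠ 0 := Complex.ofReal_ne_zero.2 Real.pi_ne_zero
  have hI := Complex.I_ne_zero
  simp only [prepotential_eq _ hmonic hdeg]
  have hD := (HasDerivAt.fun_sum (u := Finset.univ) fun i _ => (h.hasDerivAt_integral_cut W i).add
    ((h.hasDerivAt_effPot hmonic hdeg i).mul (h.hasDerivAt_integral_cut_dens i))).const_mul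
      (-(1 / (4 * Real.pi * Complex.I)) : ℂ)
  refine hD.congr_deriv ?_
  -- With `A` the sum of the integrals of `W ḟ dz / y₊` and `V` the effective potential on the last
  -- cut, symmetry evaluates the sum of the potentials of `ḟ` times the periods of `y₊ dz` as `π I *
  -- (A - 4 π I V)`. Times `-1 / (2 π I)` this cancels `A / 2` and leaves `2 π I V`. The variation
  -- of the last period adds another `2 π I V`, and the prefactor `-1 / (4 π I)` turns the sum into
  -- `-V`.
  have hsymm := (Γ t₀).integral_potential_mul_dens (fdot Γ t₀)
  rw [(Γ t₀).integral_potential_mul_dens_P (natDegree_fdot_le Γ t₀),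
    (Γ t₀).integral_potential_P_mul_dens hmonic hdeg] at hsymm
  have hL : ∑ i, (Γ t₀).effPot ((Γ t₀).sPlus i) *
      ∫ s in (Γ t₀).sMinus i..(Γ t₀).sPlus i, (Γ t₀).dens (fdot Γ t₀) s
      = (Γ t₀).effPot ((Γ t₀).sPlus (Fin.last m)) * (4 * Real.pi * Complex.I) := by
    simp only [h.integral_cut_dens_fdot, mul_ite, mul_zero, Finset.sum_ite_eq', Finset.mem_univ, if_true]
  rw [Finset.sum_sub_distrib, hL] at hsymm
  have e : ∀ i : Fin (m + 1), (1 / 2 * ∫ s in (Γ t₀).sMinus i..(Γ t₀).sPlus i,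
        W.eval ((Γ t₀).lam s) * (Γ t₀).dens (fdot Γ t₀) s)
      + (-(2 * Real.pi * Complex.I)⁻¹ * (Γ t₀).potential (fdot Γ t₀) ((Γ t₀).sPlus i) *
          (∫ s in (Γ t₀).sMinus i..(Γ t₀).sPlus i, (Γ t₀).dens (Γ t₀).P s)
        + (Γ t₀).effPot ((Γ t₀).sPlus i) *
          (1 / 2 * ∫ s in (Γ t₀).sMinus i..(Γ t₀).sPlus i, (Γ t₀).dens (fdot Γ t₀) s))
      = 1 / 2 * (∫ s in (Γ t₀).sMinus i..(Γ t₀).sPlus i,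
        W.eval ((Γ t₀).lam s) * (Γ t₀).dens (fdot Γ t₀) s)
      + (-(2 * Real.pi * Complex.I)⁻¹ * ((Γ t₀).potential (fdot Γ t₀) ((Γ t₀).sPlus i) *
          ∫ s in (Γ t₀).sMinus i..(Γ t₀).sPlus i, (Γ t₀).dens (Γ t₀).P s)
        + 1 / 2 * ((Γ t₀).effPot ((Γ t₀).sPlus i) *
          ∫ s in (Γ t₀).sMinus i..(Γ t₀).sPlus i, (Γ t₀).dens (fdot Γ t₀) s)) := fun i => by ring
  rw [Finset.sum_congr rfl fun i _ => e i, Finset.sum_add_distrib, Finset.sum_add_distrib,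
    ← Finset.mul_sum, ← Finset.mul_sum, ← Finset.mul_sum, hL, hsymm]
  field_simp
  ring

end IsFamilyAt
end CutCurve

/-- Restriction to the complex line of fixed `S̃` through `p`: near `p.1` it stays in the open set
`U`, so local regularity is inherited. -/
theorem IsCoordinateFamily.isFamilyAt {m : ℕ} {W : ℂ[X]} {U : Set (ℂ × (Fin m → ℂ))}
    {Γ : ℂ × (Fin m → ℂ) → CutCurve m W} (h : IsCoordinateFamily U Γ) {p : ℂ × (Fin m → ℂ)}
    (hp : p ∈ U) : CutCurve.IsFamilyAt (fun τ => Γ (τ, p.2)) p.1 := by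
  have hc : Continuous fun τ : ℂ => (τ, p.2) := by fun_prop
  have hU : ∀ᶠ τ in 𝓝 p.1, (τ, p.2) ∈ U :=
    hc.continuousAt.eventually_mem (h.isOpen.mem_nhds hp)
  refine ⟨?_, ?_, fun k => ?_, fun s => ?_, fun i => ?_, fun i => ?_, ?_⟩
  · exact hU.mono fun τ hτ => h.t_eq _ hτ
  · exact hU.mono fun τ hτ i => by rw [h.tildeS_eq _ hτ, h.tildeS_eq _ hU.self_of_nhds]
  · exact ((h.differentiableOn_coeff k).differentiableAt (h.isOpen.mem_nhds hp)).comp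
      (f := fun τ : ℂ => (τ, p.2)) p.1 (by fun_prop)
  · exact ((h.contDiffOn_lam.contDiffAt (x := (p, s)) ((h.isOpen.prod isOpen_univ).mem_nhds
      ⟨hp, Set.mem_univ s⟩)).comp (f := fun q : ℂ × ℝ => ((q.1, p.2), q.2)) (p.1, s) (by fun_prop))
  · exact ((h.continuousOn_sMinus i).continuousAt (h.isOpen.mem_nhds hp)).comp_of_eq
      hc.continuousAt rfl
  · exact ((h.continuousOn_sPlus i).continuousAt (h.isOpen.mem_nhds hp)).comp_of_eq
      hc.continuousAt rfl
  · obtain ⟨T, hT⟩ := h.locally_eventually_real p hp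
    exact ⟨T, hc.continuousAt.eventually hT⟩
end

theorem mainTheorem2 (m : ℕ) (W : ℂ[X])
    (hmonic : W.derivative.Monic) (hdeg : W.derivative.natDegree = m + 1) :
    (∀ (Γ : CutCurve m W) (c : ℝ → ℂ), Γ.IsAlphaHat c →
      1 / (4 * Real.pi * Complex.I) * zetaIntegral (Γ.upperLift c) 0 1 = Γ.t) ∧
    (∀ (U : Set (ℂ × (Fin m → ℂ))) (Γ : ℂ × (Fin m → ℂ) → CutCurve m W),
      IsCoordinateFamily U Γ → ∀ p ∈ U,
      ∃ dF : ℂ, HasDerivAt (fun τ : ℂ => (Γ (τ, p.2)).prepotential) dF p.1 ∧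
        ∃ K Λ₁ : ℝ, 0 < Λ₁ ∧ ∀ Λ₀ ≥ Λ₁,
          ∃ s : ℝ, (Γ p).sPlus (Fin.last m) < s ∧ (Γ p).lam s = (Λ₀ : ℂ) ∧
            ‖1 / 2 * (Γ p).betaHatIntegral s -
                (dF + W.eval (Λ₀ : ℂ) - p.1 * (Real.log (Λ₀ ^ 2) : ℂ))‖ ≤ K / Λ₀) := by
  refine ⟨fun Γ c hc => Γ.zetaIntegral_alphaHat hmonic hdeg hc, fun U Γ h p hp => ?_⟩
  refine ⟨_, (h.isFamilyAt hp).hasDerivAt_prepotential hmonic hdeg, ?_⟩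
  have hbeta := (Γ p).exists_betaHatIntegral_sub_le hmonic hdeg
  rwa [h.t_eq p hp] at hbeta
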